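/- **Setting.** Let $d\in\{2,3\}$, $T>0$, and let $c,b,k,\rho,\kappa,\delta>0$ be constants. Write $x=(x',z)\in\mathbb R^{d-1}\times\mathbb R$. Let $B\subset\mathbb R^{d-1}$ be open and simply connected, let $s_g\ge\frac12$ and $s_\ell>\frac{d+3}{2}$, and let $\ell_0\in H^{s_\ell}(B)$ satisfy $\ell_0>0$ and $\|1/\ell_0\|_{L^\infty(B)}<\infty$. ($H^s(B)$ consists of the restrictions to $B$ of elements of $H^s(\mathbb R^{d-1})$, with the quotient norm; by Sobolev embedding the elements of $H^{s_\ell}(B)$ are restrictions of $C^2$ functions.) Let $\Omega_0\subset\mathbb R^d$ be a bounded domain with $C^{1,1}$ boundary such that $\overline{\Omega_0}=\overline{\Omega_{\rm fix}}\cup\overline{\Omega_{\rm var}}$ with $\Omega_{\rm fix}$ open, $\Omega_{\rm var}=\{(x',z):x'\in B,\ 0<z<\ell_0(x')\}$, $\Omega_{\rm fix}\cap\Omega_{\rm var}=\emptyset$, and such that $\partial\Omega_0$ is the disjoint union of $\Gamma_a$, $\Gamma_{0N}=\{(x',\ell_0(x')):x'\in B\}$ and a relatively open part $\Gamma_{pl}$.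 Let $\nu$ be the outward unit normal of $\Omega_0$, let $\beta_a,\gamma_a$ be smooth and nonnegative on $\Gamma_a$, and let $\Delta_{pl}$ be the Laplace–Beltrami operator on $\Gamma_{pl}$. Functions on $\Gamma_{0N}$ are identified with functions on $B$ via $x'\mapsto(x',\ell_0(x'))$; thus $H^s(\Gamma_{0N})=H^s(B)$, and $H^{-1/2}(\Gamma_{0N})=H^{1/2}(\Gamma_{0N})^*$. **Spaces.** Let $H^2_\diamondsuit(\Gamma_{pl})=\{w\in H^2(\Gamma_{pl}): w=\Delta_{pl}w=0\text{ on }\partial\Gamma_{pl}\}$, understood as the closure in $H^2(\Gamma_{pl})$ of the functions for which both conditions are meaningful ($w\in H^1_0(\Gamma_{pl})$, $\Delta_{pl}w\in H^1_0(\Gamma_{pl})$). Put $W=H^2(0,T;L^2(\Omega_0))\cap H^1(0,T;H^2(\Omega_0))$ and $$U=\{\bar p\in W:\partial_\nu\bar p+\beta_a\bar p_t+\gamma_a\bar p=0\text{ on }\Gamma_a,\ \partial_\nu\bar p=0\text{ on }\Gamma_{pl}\}\times\{\tilde p\in W:\partial_\nu\tilde p+\beta_a\tilde p_t+\gamma_a\tilde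 p=0\text{ on }\Gamma_a,\ \partial_\nu\tilde p=0\text{ on }\Gamma_{0N}\}\times\bigl(H^2(0,T;H^2_\diamondsuit(\Gamma_{pl})^*)\cap L^2(0,T;H^2_\diamondsuit(\Gamma_{pl}))\bigr),$$ $$Z=L^2(0,T;L^2(\Omega_0))^2\times L^2(0,T;H^2_\diamondsuit(\Gamma_{pl}))\times L^2(0,T;H^{-1/2}(\Gamma_{0N}))\times L^2(0,T;L^2(\Gamma_{pl})),$$ $$G=W^{1,\infty}(0,T;H^{s_g}(\Gamma_{0N}))\times H^1(0,T;L^2(\Gamma_{pl}))\times H^{s_\ell}(B),$$ $$G_0=\{(g,h,\ell)\in G: g(0)=g_t(0)=0,\ h(0)=0,\ \mathrm{tr}_{\partial B}\,\ell=0,\ \mathrm{tr}_{\partial B}\,\partial_\nu\ell=0\}$$ (values at $t=0$ are essential limits as $t\downarrow0$; the last two conditions mean $\ell=0$, $\nabla\ell=0$ on $\partial B$). For a fixed base point $(g_*,h_0,\ell_0)\in G$ (for instance $g_*=g_0+tg_1$), let $G_{ad}=(g_*,h_0,\ell_0)+G_0$. **Operator.** For $\ell\in H^{s_\ell}(B)$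 with $\ell>0$, $\|1/\ell\|_{L^\infty(B)}<\infty$ put $r=\ell/\ell_0$. On $\Omega_{\rm var}$ let $1/\omega^0_\ell=r$ and $$\check D^2_\ell\varphi=\Delta_{x'}\varphi-\tfrac{2z}{r}\nabla r\cdot\nabla_{x'}\varphi_z+\tfrac{z^2}{r^2}|\nabla r|^2\varphi_{zz}+\Bigl(\tfrac{2z}{r^2}|\nabla r|^2-\tfrac zr\Delta r\Bigr)\varphi_z+\tfrac1{r^2}\varphi_{zz},$$ the Laplacian of $(x',z)\mapsto\varphi(x',z/r(x'))$ in reference coordinates; elsewhere in $\Omega_0$ let $1/\omega^0_\ell=1$ and $\check D^2_\ell=\Delta$. Let $\omega^1_\ell=\sqrt{1+|\nabla\ell|^2}/\sqrt{1+|\nabla\ell_0|^2}$ and $M_\ell=\begin{pmatrix}I&-\frac zr\nabla r\\0&\frac1r\end{pmatrix}$, and let $n$ denote on $\Gamma_{0N}$ either the normal $\nu_0=(-\nabla\ell_0,1)/\sqrt{1+|\nabla\ell_0|^2}$ of the reference boundary or the normal $(-\nabla\ell,1)/\sqrt{1+|\nabla\ell|^2}$ of the graph of $\ell$ (the same choice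 throughout). For $\vec g=(g,h,\ell)$, $\vec u=(\bar p,\tilde p,w)$ define $$\begin{aligned}\langle A_{PDE}(\vec g,\vec u),(\bar q,\tilde q,v,\mu_N,\mu_{pl})\rangle=\int_0^T\Bigl\{&\int_{\Omega_0}\tfrac1{\omega^0_\ell}\Bigl((\bar p_{tt}-c^2\check D^2_\ell\bar p-b\check D^2_\ell\bar p_t)\bar q\\&+\bigl(\tilde p_{tt}-c^2\check D^2_\ell\tilde p-b\check D^2_\ell\tilde p_t-2k((\bar p+\tilde p)_t)^2-2k(\bar p+\tilde p)(\bar p+\tilde p)_{tt}\bigr)\tilde q\Bigr)dx\\&+\tfrac\rho\kappa\int_{\Gamma_{pl}}\Bigl((\rho w_{tt}-h-\kappa(\bar p_t+\tilde p_t))v+\delta\,\Delta_{pl}w\,\Delta_{pl}v\Bigr)dS\\&+\int_{\Gamma_{0N}}\omega^1_\ell\,(n\cdot M_\ell\nabla\bar p-g)\,\mu_N\,dS+\int_{\Gamma_{pl}}(\partial_\nu\tilde p+\rho w_t)\mu_{pl}\,dS\Bigr\}dt,\end{aligned}$$ where integrals against elements of dual spaces are duality pairings. **Proposition.** At every $(\vec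 g,\vec u)\in G_{ad}\times U$ with $\ell>0$ on $B$ and $\|1/\ell\|_{L^\infty(B)}<\infty$, the formula defines an element $A_{PDE}(\vec g,\vec u)$ of $Z^*$, and $A_{PDE}$ is Fréchet differentiable there as a map $G_{ad}\times U\to Z^*$ (with directions in $G_0\times U$). In particular this holds at every $(\vec g,\vec u)\in G_{ad}\times U$ whose $\ell$ satisfies the closeness condition $$\|\ell-\ell_0\|_{L^\infty(B)}\le\tfrac12\,\|1/\ell_0\|_{L^\infty(B)}^{-1},$$ since this condition implies $\ell>0$ on $B$ and $\|1/\ell\|_{L^\infty(B)}<\infty$. -/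

import Mathlib

open MeasureTheory Set Filter Topology
open scoped ENNReal

noncomputable section

namespace AcousticStructure

/-! ### Euclidean space, partial derivatives, `L²` -/

/-- Euclidean space `ℝⁿ`. -/
abbrev E (n : ℕ) : Type := EuclideanSpace ℝ (Fin n)

/-- The classical partial derivative `∂ᵢ f (x)`. -/
def pd {n : ℕ} (f : E n → ℝ) (i : Fin n) (x : E n) : ℝ :=
  fderiv ℝ f x (EuclideanSpace.single i 1)

/-- Real valued `L²(μ)`. -/
abbrev L2 {n : ℕ} (μ : Measure (E n)) : Type := Lp ℝ 2 μ

/-- Lebesgue measure on `Ω`. -/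
abbrev vol {n : ℕ} (Ω : Set (E n)) : Measure (E n) := volume.restrict Ω

/-- `(x', z) ∈ ℝᵐ × ℝ = ℝᵐ⁺¹`. -/
def pt {m : ℕ} (y : E m) (z : ℝ) : E (m + 1) :=
  WithLp.toLp 2 (Fin.snoc (α := fun _ => ℝ) (fun i => y i) z)

/-- The horizontal part `x'` of `x = (x', z)`. -/
def hor {m : ℕ} (x : E (m + 1)) : E m := WithLp.toLp 2 (fun i => x i.castSucc)

/-- The vertical coordinate `z` of `x = (x', z)`. -/
def ver {m : ℕ} (x : E (m + 1)) : ℝ := x (Fin.last m)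

/-- A smooth compactly supported function times an `L²` function is integrable. -/
theorem integrable_L2_mul {n : ℕ} (Ω : Set (E n)) (u : L2 (vol Ω)) {f : E n → ℝ}
    (hf : Continuous f) (hc : HasCompactSupport f) :
    Integrable (fun x => u x * f x) (vol Ω) :=
  (Lp.memLp u).integrable_mul (q := 2) (hf.memLp_of_hasCompactSupport hc)

theorem pd_continuous {n : ℕ} {f : E n → ℝ} (hf : ContDiff ℝ (⊤ : ℕ∞) f) (i : Fin n) :
    Continuous (pd f i) :=
  (hf.continuous_fderiv (by simp)).clm_apply continuous_const

theorem pd_hasCompactSupport {n : ℕ} {f : E n → ℝ} (hc : HasCompactSupport f) (i : Fin n) :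
    HasCompactSupport (pd f i) :=
  (hc.fderiv (𝕜 := ℝ)).comp_left (g := fun L : E n →L[ℝ] ℝ => L (EuclideanSpace.single i 1))
    (by simp)

theorem pd_add {n : ℕ} {f g : E n → ℝ} (hf : ContDiff ℝ (⊤ : ℕ∞) f) (hg : ContDiff ℝ (⊤ : ℕ∞) g) (i : Fin n)
    (x : E n) : pd (f + g) i x = pd f i x + pd g i x := by
  unfold pd
  rw [fderiv_add (hf.differentiable (by simp) x) (hg.differentiable (by simp) x)]
  rfl

theorem pd_smul {n : ℕ} {f : E n → ℝ} (hf : ContDiff ℝ (⊤ : ℕ∞) f) (c : ℝ) (i : Fin n)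
    (x : E n) : pd (c • f) i x = c * pd f i x := by
  unfold pd
  rw [fderiv_const_smul (hf.differentiable (by simp) x)]
  rfl

/-! ### Sobolev spaces on a domain -/

/-- Pairs `(u, g)` of `L²(Ω)` functions such that `g` is the weak partial derivative `∂ᵢ u`. -/
def weakPartial {n : ℕ} (Ω : Set (E n)) (i : Fin n) :
    Submodule ℝ (L2 (vol Ω) × L2 (vol Ω)) where
  carrier := {q | ∀ φ : E n → ℝ, ContDiff ℝ (⊤ : ℕ∞) φ → HasCompactSupport φ → tsupport φ ⊆ Ω →
    ∫ x in Ω, q.1 x * pd φ i x = - ∫ x in Ω, q.2 x * φ x}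
  zero_mem' := by
    intro φ _ _ _
    have h : ((0 : L2 (vol Ω)) : E n → ℝ) =ᵐ[vol Ω] 0 := Lp.coeFn_zero _ _ _
    have h1 : ∫ x in Ω, (0 : L2 (vol Ω)) x * pd φ i x = 0 :=
      integral_eq_zero_of_ae (by filter_upwards [h] with x hx; rw [hx]; simp)
    have h2 : ∫ x in Ω, (0 : L2 (vol Ω)) x * φ x = 0 :=
      integral_eq_zero_of_ae (by filter_upwards [h] with x hx; rw [hx]; simp)
    simp only [Prod.fst_zero, Prod.snd_zero, h1, h2, neg_zero]
  add_mem' := by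
    intro q r hq hr φ h1 h2 h3
    have e1 : ∫ x in Ω, (q + r).1 x * pd φ i x
        = (∫ x in Ω, q.1 x * pd φ i x) + ∫ x in Ω, r.1 x * pd φ i x := by
      rw [← integral_add
        (integrable_L2_mul Ω q.1 (pd_continuous h1 i) (pd_hasCompactSupport h2 i))
        (integrable_L2_mul Ω r.1 (pd_continuous h1 i) (pd_hasCompactSupport h2 i))]
      refine integral_congr_ae ?_
      filter_upwards [Lp.coeFn_add q.1 r.1] with x hx
      simp only [Prod.fst_add, hx, Pi.add_apply, add_mul]
    have e2 : ∫ x in Ω, (q + r).2 x * φ x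
        = (∫ x in Ω, q.2 x * φ x) + ∫ x in Ω, r.2 x * φ x := by
      rw [← integral_add (integrable_L2_mul Ω q.2 h1.continuous h2)
        (integrable_L2_mul Ω r.2 h1.continuous h2)]
      refine integral_congr_ae ?_
      filter_upwards [Lp.coeFn_add q.2 r.2] with x hx
      simp only [Prod.snd_add, hx, Pi.add_apply, add_mul]
    rw [e1, e2, hq φ h1 h2 h3, hr φ h1 h2 h3, neg_add]
  smul_mem' := by
    intro c q hq φ h1 h2 h3
    have e1 : ∫ x in Ω, (c • q).1 x * pd φ i x = c * ∫ x in Ω, q.1 x * pd φ i x := by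
      rw [← integral_const_mul]
      refine integral_congr_ae ?_
      filter_upwards [Lp.coeFn_smul c q.1] with x hx
      simp only [Prod.smul_fst, hx, Pi.smul_apply, smul_eq_mul, mul_assoc]
    have e2 : ∫ x in Ω, (c • q).2 x * φ x = c * ∫ x in Ω, q.2 x * φ x := by
      rw [← integral_const_mul]
      refine integral_congr_ae ?_
      filter_upwards [Lp.coeFn_smul c q.2] with x hx
      simp only [Prod.smul_snd, hx, Pi.smul_apply, smul_eq_mul, mul_assoc]
    rw [e1, e2, hq φ h1 h2 h3, mul_neg]

/-- `H²(Ω)`: an element is `u` together with its (uniquely determined) weak gradient `Du` and weak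
Hessian `D²u`, all in `L²(Ω)`; the norm is the maximum of the `L²` norms of all the components,
which is equivalent to the usual norm. -/
def H2sub {n : ℕ} (Ω : Set (E n)) :
    Submodule ℝ (L2 (vol Ω) × (Fin n → L2 (vol Ω)) × (Fin n → Fin n → L2 (vol Ω))) where
  carrier := {u | (∀ i, (u.1, u.2.1 i) ∈ weakPartial Ω i) ∧
    ∀ i j, (u.2.1 i, u.2.2 i j) ∈ weakPartial Ω j}
  zero_mem' := ⟨fun i => (weakPartial Ω i).zero_mem, fun _ j => (weakPartial Ω j).zero_mem⟩
  add_mem' := fun {_ _} hu hv => ⟨fun i => (weakPartial Ω i).add_mem (hu.1 i) (hv.1 i),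
    fun i j => (weakPartial Ω j).add_mem (hu.2 i j) (hv.2 i j)⟩
  smul_mem' := fun c _ hu => ⟨fun i => (weakPartial Ω i).smul_mem c (hu.1 i),
    fun i j => (weakPartial Ω j).smul_mem c (hu.2 i j)⟩

/-- `H²(Ω)` as a normed space. -/
def H2 {n : ℕ} (Ω : Set (E n)) : Type := H2sub Ω

instance {n : ℕ} (Ω : Set (E n)) : NormedAddCommGroup (H2 Ω) :=
  inferInstanceAs (NormedAddCommGroup (H2sub Ω))

instance {n : ℕ} (Ω : Set (E n)) : NormedSpace ℝ (H2 Ω) :=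
  inferInstanceAs (NormedSpace ℝ (H2sub Ω))

/-- The inclusion `H²(Ω) → L²(Ω)`. -/
def H2.toL2 {n : ℕ} (Ω : Set (E n)) : H2 Ω →L[ℝ] L2 (vol Ω) :=
  (ContinuousLinearMap.fst ℝ _ _).comp (H2sub Ω).subtypeL

/-- The gradient component `∂ᵢ u` of `u ∈ H²(Ω)`. -/
def H2.grad {n : ℕ} {Ω : Set (E n)} (u : H2 Ω) (i : Fin n) : L2 (vol Ω) := u.1.2.1 i

/-- The Hessian component `∂ⱼ ∂ᵢ u` of `u ∈ H²(Ω)`. -/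
def H2.hess {n : ℕ} {Ω : Set (E n)} (u : H2 Ω) (i j : Fin n) : L2 (vol Ω) := u.1.2.2 i j

/-! ### Boundary: regularity, normal, surface measure, traces -/

/-- The open set `Ω` has a `C^{1,1}` boundary: near every boundary point it is, up to a rigid
motion, the epigraph of a `C¹` function with Lipschitz gradient. -/
def HasC11Boundary {m : ℕ} (Ω : Set (E (m + 1))) : Prop :=
  ∀ x ∈ frontier Ω, ∃ (R : E (m + 1) ≃ₗᵢ[ℝ] E (m + 1)) (r : ℝ) (γ : E m → ℝ),
    0 < r ∧ ContDiff ℝ 1 γ ∧ (∃ K, LipschitzWith K (fderiv ℝ γ)) ∧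
      ∀ y ∈ Metric.ball x r, y ∈ Ω ↔ γ (hor (R y)) < ver (R y)

/-- `n` is the outward unit normal of `Ω` at the boundary point `x`: to first order at `x`, the
set `Ω` is the half space `{y | ⟨y - x, n⟩ < 0}`. -/
def IsOutwardNormal {d : ℕ} (Ω : Set (E d)) (x n : E d) : Prop :=
  ‖n‖ = 1 ∧ ∀ ε > 0, ∃ r > 0, ∀ y ∈ Metric.ball x r,
    (inner ℝ (y - x) n < -ε * ‖y - x‖ → y ∈ Ω) ∧ (ε * ‖y - x‖ < inner ℝ (y - x) n → y ∉ Ω)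

open Classical in
/-- The outward unit normal field `ν` (it exists and is unique on a `C¹` boundary). -/
def normal {d : ℕ} (Ω : Set (E d)) (x : E d) : E d :=
  if h : ∃ n, IsOutwardNormal Ω x n then h.choose else 0

/-- Surface measure on `∂Ω`. -/
def surf {m : ℕ} (Ω : Set (E (m + 1))) : Measure (E (m + 1)) :=
  (Measure.euclideanHausdorffMeasure m : Measure (E (m + 1))).restrict (frontier Ω)

/-- The triples `(u, ∇u, tr u)` coming from smooth functions. -/
def smoothTrace {m : ℕ} (Ω : Set (E (m + 1))) :
    Submodule ℝ (L2 (vol Ω) × (Fin (m + 1) → L2 (vol Ω)) × L2 (surf Ω)) where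
  carrier := {q | ∃ φ : E (m + 1) → ℝ, ContDiff ℝ (⊤ : ℕ∞) φ ∧ HasCompactSupport φ ∧
    q.1 =ᵐ[vol Ω] φ ∧ (∀ i, q.2.1 i =ᵐ[vol Ω] pd φ i) ∧ q.2.2 =ᵐ[surf Ω] φ}
  zero_mem' := by
    refine ⟨0, contDiff_const, HasCompactSupport.zero, Lp.coeFn_zero _ _ _, fun i => ?_,
      Lp.coeFn_zero _ _ _⟩
    refine (Lp.coeFn_zero _ _ _).trans (Eventually.of_forall fun x => ?_)
    simp [pd]
  add_mem' := by
    rintro q r ⟨φ, a1, a2, a3, a4, a5⟩ ⟨ψ, b1, b2, b3, b4, b5⟩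
    refine ⟨φ + ψ, a1.add b1, a2.add b2, (Lp.coeFn_add _ _).trans (a3.add b3), fun i => ?_,
      (Lp.coeFn_add _ _).trans (a5.add b5)⟩
    refine (Lp.coeFn_add _ _).trans (((a4 i).add (b4 i)).trans (Eventually.of_forall fun x => ?_))
    exact (pd_add a1 b1 i x).symm
  smul_mem' := by
    rintro c q ⟨φ, a1, a2, a3, a4, a5⟩
    refine ⟨c • φ, contDiff_const.smul a1, a2.smul_left (f := fun _ => c),
      (Lp.coeFn_smul _ _).trans (a3.const_smul c), fun i => ?_,
      (Lp.coeFn_smul _ _).trans (a5.const_smul c)⟩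
    refine (Lp.coeFn_smul _ _).trans (((a4 i).const_smul c).trans
      (Eventually.of_forall fun x => ?_))
    exact (pd_smul a1 c i x).symm

/-- The graph of the trace operator `H¹(Ω) → L²(∂Ω)`: the closure, in the norm of
`H¹(Ω) × L²(∂Ω)`, of the triples `(u, ∇u, tr u)` with `u` smooth. -/
def traceRel {m : ℕ} (Ω : Set (E (m + 1))) :
    Submodule ℝ (L2 (vol Ω) × (Fin (m + 1) → L2 (vol Ω)) × L2 (surf Ω)) :=
  (smoothTrace Ω).topologicalClosure

/-- `v` is the trace of `u ∈ H²(Ω)` on `∂Ω`. -/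
def HasTrace {m : ℕ} {Ω : Set (E (m + 1))} (u : H2 Ω) (v : L2 (surf Ω)) : Prop :=
  (u.1.1, u.1.2.1, v) ∈ traceRel Ω

/-- `v` is the trace of `∇u` on `∂Ω`, where `u ∈ H²(Ω)`. -/
def HasGradTrace {m : ℕ} {Ω : Set (E (m + 1))} (u : H2 Ω) (v : Fin (m + 1) → L2 (surf Ω)) : Prop :=
  ∀ i, (u.1.2.1 i, u.1.2.2 i, v i) ∈ traceRel Ω

/-- `v` is the normal derivative `∂_ν u` on `∂Ω`, where `u ∈ H²(Ω)`. -/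
def HasNormalDeriv {m : ℕ} {Ω : Set (E (m + 1))} (u : H2 Ω) (v : L2 (surf Ω)) : Prop :=
  ∃ τ, HasGradTrace u τ ∧ v =ᵐ[surf Ω] fun x => ∑ i, normal Ω x i * τ i x

theorem HasTrace.add {m : ℕ} {Ω : Set (E (m + 1))} {u u' : H2 Ω} {v v' : L2 (surf Ω)}
    (h : HasTrace u v) (h' : HasTrace u' v') : HasTrace (u + u') (v + v') :=
  (traceRel Ω).add_mem h h'

theorem HasTrace.smul {m : ℕ} {Ω : Set (E (m + 1))} {u : H2 Ω} {v : L2 (surf Ω)} (c : ℝ)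
    (h : HasTrace u v) : HasTrace (c • u) (c • v) :=
  (traceRel Ω).smul_mem c h

theorem HasTrace.zero {m : ℕ} {Ω : Set (E (m + 1))} : HasTrace (0 : H2 Ω) 0 :=
  (traceRel Ω).zero_mem

theorem HasNormalDeriv.add {m : ℕ} {Ω : Set (E (m + 1))} {u u' : H2 Ω} {v v' : L2 (surf Ω)}
    (h : HasNormalDeriv u v) (h' : HasNormalDeriv u' v') : HasNormalDeriv (u + u') (v + v') := by
  obtain ⟨τ, a, b⟩ := h
  obtain ⟨τ', a', b'⟩ := h'
  refine ⟨τ + τ', fun i => (traceRel Ω).add_mem (a i) (a' i), ?_⟩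
  have hs : ∀ᵐ x ∂surf Ω, ∀ i, (τ i + τ' i) x = τ i x + τ' i x :=
    ae_all_iff.2 fun i => Lp.coeFn_add _ _
  filter_upwards [Lp.coeFn_add v v', b, b', hs] with x h1 h2 h3 h4
  rw [h1, Pi.add_apply, h2, h3, ← Finset.sum_add_distrib]
  exact Finset.sum_congr rfl fun i _ => by rw [Pi.add_apply, h4 i, mul_add]

theorem HasNormalDeriv.smul {m : ℕ} {Ω : Set (E (m + 1))} {u : H2 Ω} {v : L2 (surf Ω)} (c : ℝ)
    (h : HasNormalDeriv u v) : HasNormalDeriv (c • u) (c • v) := by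
  obtain ⟨τ, a, b⟩ := h
  refine ⟨c • τ, fun i => (traceRel Ω).smul_mem c (a i), ?_⟩
  have hs : ∀ᵐ x ∂surf Ω, ∀ i, (c • τ i) x = c * τ i x :=
    ae_all_iff.2 fun i => Lp.coeFn_smul _ _
  filter_upwards [Lp.coeFn_smul c v, b, hs] with x h1 h2 h4
  rw [h1, Pi.smul_apply, h2, smul_eq_mul, Finset.mul_sum]
  exact Finset.sum_congr rfl fun i _ => by rw [Pi.smul_apply, h4 i]; ring

theorem HasNormalDeriv.zero {m : ℕ} {Ω : Set (E (m + 1))} : HasNormalDeriv (0 : H2 Ω) 0 := by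
  refine ⟨0, fun i => (traceRel Ω).zero_mem, ?_⟩
  have hs : ∀ᵐ x ∂surf Ω, ((0 : L2 (surf Ω)) : E (m + 1) → ℝ) x = 0 := Lp.coeFn_zero ℝ 2 (surf Ω)
  filter_upwards [hs] with x h1
  simp only [Pi.zero_apply, h1, mul_zero, Finset.sum_const_zero]

/-- Pairs `(p, p_t)` with `∂_ν p + β p_t + γ p = 0` on `Γ ⊆ ∂Ω`. -/
def absorbing {m : ℕ} (Ω Γ : Set (E (m + 1))) (β γ : E (m + 1) → ℝ) :
    Submodule ℝ (H2 Ω × H2 Ω) where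
  carrier := {q | ∃ n s r : L2 (surf Ω), HasNormalDeriv q.1 n ∧ HasTrace q.2 s ∧ HasTrace q.1 r ∧
    ∀ᵐ x ∂(surf Ω).restrict Γ, n x + β x * s x + γ x * r x = 0}
  zero_mem' := by
    refine ⟨0, 0, 0, HasNormalDeriv.zero, HasTrace.zero, HasTrace.zero, ?_⟩
    have hs : ∀ᵐ x ∂surf Ω, ((0 : L2 (surf Ω)) : E (m + 1) → ℝ) x = 0 :=
      Lp.coeFn_zero ℝ 2 (surf Ω)
    filter_upwards [ae_restrict_of_ae hs] with x h
    simp only [h, mul_zero, add_zero]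
  add_mem' := by
    rintro q q' ⟨n, s, r, a1, a2, a3, a4⟩ ⟨n', s', r', b1, b2, b3, b4⟩
    refine ⟨n + n', s + s', r + r', a1.add b1, a2.add b2, a3.add b3, ?_⟩
    filter_upwards [ae_restrict_of_ae (Lp.coeFn_add n n'), ae_restrict_of_ae (Lp.coeFn_add s s'),
      ae_restrict_of_ae (Lp.coeFn_add r r'), a4, b4] with x h1 h2 h3 h4 h5
    rw [h1, h2, h3]
    simp only [Pi.add_apply]
    linear_combination h4 + h5
  smul_mem' := by
    rintro c q ⟨n, s, r, a1, a2, a3, a4⟩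
    refine ⟨c • n, c • s, c • r, a1.smul c, a2.smul c, a3.smul c, ?_⟩
    filter_upwards [ae_restrict_of_ae (Lp.coeFn_smul c n), ae_restrict_of_ae (Lp.coeFn_smul c s),
      ae_restrict_of_ae (Lp.coeFn_smul c r), a4] with x h1 h2 h3 h4
    rw [h1, h2, h3]
    simp only [Pi.smul_apply, smul_eq_mul]
    linear_combination c * h4

/-! ### Functions of time with values in a Banach space -/

/-- Lebesgue measure on the time interval `(0, T)`. -/
abbrev tim (T : ℝ) : Measure ℝ := volume.restrict (Ioo 0 T)

theorem integrable_smul_time {X : Type*} [NormedAddCommGroup X] [NormedSpace ℝ X] {T : ℝ}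
    {p : ℝ≥0∞} [hp : Fact (1 ≤ p)] (u : Lp X p (tim T)) {f : ℝ → ℝ} (hf : Continuous f)
    (hc : HasCompactSupport f) : Integrable (fun t => f t • u t) (tim T) := by
  obtain ⟨C, hC⟩ := hc.exists_bound_of_continuous hf
  exact ((Lp.memLp u).integrable hp.out).bdd_smul C hf.aestronglyMeasurable
    (Eventually.of_forall hC)

/-- Pairs `(u, v)` in `Lᵖ(0,T;X)` such that `v = u_t` in the weak (distributional) sense. With the
product norm this is the space `W^{1,p}(0,T;X)`. -/
def weakTime (X : Type*) [NormedAddCommGroup X] [NormedSpace ℝ X] (T : ℝ)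
    (p : ℝ≥0∞) [hp : Fact (1 ≤ p)] : Submodule ℝ (Lp X p (tim T) × Lp X p (tim T)) where
  carrier := {q | ∀ φ : ℝ → ℝ, ContDiff ℝ (⊤ : ℕ∞) φ → HasCompactSupport φ → tsupport φ ⊆ Ioo 0 T →
    ∫ t in Ioo 0 T, deriv φ t • q.1 t = - ∫ t in Ioo 0 T, φ t • q.2 t}
  zero_mem' := by
    intro φ _ _ _
    have h : ((0 : Lp X p (tim T)) : ℝ → X) =ᵐ[tim T] 0 := Lp.coeFn_zero _ _ _
    have h1 : ∫ t in Ioo 0 T, deriv φ t • (0 : Lp X p (tim T)) t = 0 :=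
      integral_eq_zero_of_ae (by filter_upwards [h] with x hx; rw [hx]; simp)
    have h2 : ∫ t in Ioo 0 T, φ t • (0 : Lp X p (tim T)) t = 0 :=
      integral_eq_zero_of_ae (by filter_upwards [h] with x hx; rw [hx]; simp)
    simp only [Prod.fst_zero, Prod.snd_zero, h1, h2, neg_zero]
  add_mem' := by
    intro q r hq hr φ h1 h2 h3
    have h1' : Continuous (deriv φ) := h1.continuous_deriv (by simp)
    have e1 : ∫ t in Ioo 0 T, deriv φ t • (q + r).1 t
        = (∫ t in Ioo 0 T, deriv φ t • q.1 t) + ∫ t in Ioo 0 T, deriv φ t • r.1 t := by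
      rw [← integral_add (integrable_smul_time q.1 h1' h2.deriv)
        (integrable_smul_time r.1 h1' h2.deriv)]
      refine integral_congr_ae ?_
      filter_upwards [Lp.coeFn_add q.1 r.1] with x hx
      simp only [Prod.fst_add, hx, Pi.add_apply, smul_add]
    have e2 : ∫ t in Ioo 0 T, φ t • (q + r).2 t
        = (∫ t in Ioo 0 T, φ t • q.2 t) + ∫ t in Ioo 0 T, φ t • r.2 t := by
      rw [← integral_add (integrable_smul_time q.2 h1.continuous h2)
        (integrable_smul_time r.2 h1.continuous h2)]
      refine integral_congr_ae ?_
      filter_upwards [Lp.coeFn_add q.2 r.2] with x hx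
      simp only [Prod.snd_add, hx, Pi.add_apply, smul_add]
    rw [e1, e2, hq φ h1 h2 h3, hr φ h1 h2 h3, neg_add]
  smul_mem' := by
    intro c q hq φ h1 h2 h3
    have e1 : ∫ t in Ioo 0 T, deriv φ t • (c • q).1 t = c • ∫ t in Ioo 0 T, deriv φ t • q.1 t := by
      rw [← integral_smul]
      refine integral_congr_ae ?_
      filter_upwards [Lp.coeFn_smul c q.1] with x hx
      simp only [Prod.smul_fst, hx, Pi.smul_apply]
      rw [smul_comm]
    have e2 : ∫ t in Ioo 0 T, φ t • (c • q).2 t = c • ∫ t in Ioo 0 T, φ t • q.2 t := by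
      rw [← integral_smul]
      refine integral_congr_ae ?_
      filter_upwards [Lp.coeFn_smul c q.2] with x hx
      simp only [Prod.smul_snd, hx, Pi.smul_apply]
      rw [smul_comm]
    rw [e1, e2, hq φ h1 h2 h3, smul_neg]

/-- `u(0) = 0`, in the sense of an essential limit `u(t) → 0` as `t ↓ 0`. For `u` with a continuous
representative this says that the representative vanishes at `0`. -/
def VanishesAtZero {X : Type*} [NormedAddCommGroup X] (T : ℝ) (u : ℝ → X) : Prop :=
  Tendsto u (ae (tim T) ⊓ 𝓝 0) (𝓝 0)

/-- The functions in `Lᵖ(0,T;X)` with `u(0) = 0`. -/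
def vanishing (X : Type*) [NormedAddCommGroup X] [NormedSpace ℝ X] (T : ℝ)
    (p : ℝ≥0∞) [Fact (1 ≤ p)] : Submodule ℝ (Lp X p (tim T)) where
  carrier := {u | VanishesAtZero T u}
  zero_mem' := tendsto_const_nhds.congr' (Filter.EventuallyEq.symm
    ((Lp.coeFn_zero X p (tim T)).filter_mono inf_le_left))
  add_mem' := by
    intro u v hu hv
    have h := Filter.Tendsto.add hu hv
    rw [add_zero] at h
    exact h.congr' (Filter.EventuallyEq.symm ((Lp.coeFn_add u v).filter_mono inf_le_left))
  smul_mem' := by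
    intro c u hu
    have h := Filter.Tendsto.const_smul hu c
    rw [smul_zero] at h
    exact h.congr' (Filter.EventuallyEq.symm ((Lp.coeFn_smul c u).filter_mono inf_le_left))

/-! ### The Sobolev spaces `Hˢ(ℝᵐ)` and `Hˢ(B)` -/

/-- A real `L²` function, viewed as complex valued. -/
def toComplex (m : ℕ) : Lp ℝ 2 (volume : Measure (E m)) →L[ℝ] Lp ℂ 2 (volume : Measure (E m)) :=
  Complex.ofRealCLM.compLpL 2 volume

/-- The real space `Hˢ(ℝᵐ)`, `s ≥ 0`: an element is a real function `u ∈ L²(ℝᵐ)` together with its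
(uniquely determined) Bessel potential `𝓕⁻¹ (1 + |ξ|²)^{s/2} 𝓕 u ∈ L²(ℝᵐ)`. -/
def HsR (m : ℕ) (s : ℝ) :
    Submodule ℝ (Lp ℝ 2 (volume : Measure (E m)) × Lp ℂ 2 (volume : Measure (E m))) where
  carrier := {q | TemperedDistribution.besselPotential (E m) ℂ s
    (Lp.toTemperedDistribution (toComplex m q.1)) = Lp.toTemperedDistribution q.2}
  zero_mem' := by
    simp only [mem_ofPred_eq, ← Lp.toTemperedDistributionCLM_apply, Prod.fst_zero, Prod.snd_zero,
      map_zero]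
  add_mem' := by
    intro q r hq hr
    simp only [mem_ofPred_eq, ← Lp.toTemperedDistributionCLM_apply, Prod.fst_add, Prod.snd_add,
      map_add] at hq hr ⊢
    rw [hq, hr]
  smul_mem' := by
    intro c q hq
    have h1 : toComplex m (c • q.1) = (c : ℂ) • toComplex m q.1 := by
      rw [map_smul]; exact (Complex.coe_smul c _).symm
    have h2 : c • q.2 = (c : ℂ) • q.2 := (Complex.coe_smul c _).symm
    simp only [mem_ofPred_eq, ← Lp.toTemperedDistributionCLM_apply, Prod.smul_fst, Prod.smul_snd]
      at hq ⊢
    rw [h1, h2]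
    simp only [map_smul]
    rw [hq]

/-- The restriction `Hˢ(ℝᵐ) → L²(B)`. -/
def HsR.restrict (m : ℕ) (s : ℝ) (B : Set (E m)) : HsR m s →L[ℝ] L2 (vol B) :=
  (LpToLpRestrictCLM (E m) ℝ ℝ volume 2 B).comp
    ((ContinuousLinearMap.fst ℝ _ _).comp (HsR m s).subtypeL)

/-- The elements of `Hˢ(ℝᵐ)` that vanish on `B`. -/
def HsR.null (m : ℕ) (s : ℝ) (B : Set (E m)) : Submodule ℝ (HsR m s) :=
  LinearMap.ker (HsR.restrict m s B).toLinearMap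

instance (m : ℕ) (s : ℝ) (B : Set (E m)) : IsClosed (HsR.null m s B : Set (HsR m s)) :=
  (HsR.restrict m s B).isClosed_ker

/-- `Hˢ(B)`: restrictions to `B` of elements of `Hˢ(ℝᵐ)`, with the quotient norm
`‖v‖ = inf {‖u‖ : u ∈ Hˢ(ℝᵐ), u = v on B}`. -/
def Hs (m : ℕ) (s : ℝ) (B : Set (E m)) : Type := HsR m s ⧸ HsR.null m s B

instance (m : ℕ) (s : ℝ) (B : Set (E m)) : NormedAddCommGroup (Hs m s B) :=
  inferInstanceAs (NormedAddCommGroup (HsR m s ⧸ HsR.null m s B))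

instance (m : ℕ) (s : ℝ) (B : Set (E m)) : NormedSpace ℝ (Hs m s B) :=
  inferInstanceAs (NormedSpace ℝ (HsR m s ⧸ HsR.null m s B))

/-- The restriction map `Hˢ(ℝᵐ) → Hˢ(B)`. -/
def Hs.mk {m : ℕ} {s : ℝ} {B : Set (E m)} : HsR m s →ₗ[ℝ] Hs m s B :=
  (HsR.null m s B).mkQ

/-- The function `f` represents `v ∈ Hˢ(B)`, i.e. `v = f` almost everywhere on `B`. -/
def Represents {m : ℕ} {s : ℝ} {B : Set (E m)} (v : Hs m s B) (f : E m → ℝ) : Prop :=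
  ∃ u : HsR m s, Hs.mk u = v ∧ f =ᵐ[vol B] u.1.1

open Classical in
/-- A `C²` representative of `v ∈ Hˢ(B)`; it exists for `s > m/2 + 2`, and its values and
derivatives on the open set `B` are uniquely determined. -/
def Hs.fn {m : ℕ} {s : ℝ} {B : Set (E m)} (v : Hs m s B) : E m → ℝ :=
  if h : ∃ f, ContDiff ℝ 2 f ∧ Represents v f then h.choose else 0

/-- The elements of `Hˢ(B)` whose trace and whose normal derivative vanish on `∂B`. Where the
function vanishes on `∂B`, its tangential derivatives there vanish too, so that a vanishing normal
derivative means a vanishing gradient. -/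
def zeroTraces (m : ℕ) (s : ℝ) (B : Set (E m)) : Submodule ℝ (Hs m s B) where
  carrier := {v | ∃ f : E m → ℝ, ContDiff ℝ 1 f ∧ Represents v f ∧
    ∀ x ∈ frontier B, f x = 0 ∧ fderiv ℝ f x = 0}
  zero_mem' := by
    refine ⟨0, contDiff_const, ⟨0, map_zero _, ?_⟩, fun x _ => by simp⟩
    exact (ae_restrict_of_ae (μ := volume) (s := B) (Lp.coeFn_zero ℝ 2 volume)).mono fun x hx => hx.symm
  add_mem' := by
    rintro v w ⟨f, f1, ⟨u, u1, u2⟩, f3⟩ ⟨g, g1, ⟨r, r1, r2⟩, g3⟩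
    refine ⟨f + g, f1.add g1, ⟨u + r, by rw [map_add, u1, r1], ?_⟩,
      fun x hx => ⟨by simp [(f3 x hx).1, (g3 x hx).1], ?_⟩⟩
    · exact (u2.add r2).trans ((ae_restrict_of_ae (Lp.coeFn_add u.1.1 r.1.1)).mono fun x hx => hx.symm)
    · rw [fderiv_add (f1.differentiable (by simp) x) (g1.differentiable (by simp) x),
        (f3 x hx).2, (g3 x hx).2, add_zero]
  smul_mem' := by
    rintro c v ⟨f, f1, ⟨u, u1, u2⟩, f3⟩
    refine ⟨c • f, contDiff_const.smul f1, ⟨c • u, by rw [map_smul, u1], ?_⟩,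
      fun x hx => ⟨by simp [(f3 x hx).1], ?_⟩⟩
    · exact (u2.const_smul c).trans ((ae_restrict_of_ae (Lp.coeFn_smul c u.1.1)).mono fun x hx => hx.symm)
    · rw [fderiv_const_smul (f1.differentiable (by simp) x), (f3 x hx).2, smul_zero]

/-! ### Sobolev spaces on the plate `Γ ⊆ ∂Ω` -/

/-- `L²(Γ)` with respect to surface measure, `Γ ⊆ ∂Ω`. -/
abbrev L2s {m : ℕ} (Ω Γ : Set (E (m + 1))) : Type := L2 ((surf Ω).restrict Γ)

/-- The tangential gradient `∇φ - (ν · ∇φ) ν` (`i`-th component) on `∂Ω`. -/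
def tgrad {m : ℕ} (Ω : Set (E (m + 1))) (φ : E (m + 1) → ℝ) (i : Fin (m + 1))
    (x : E (m + 1)) : ℝ :=
  pd φ i x - (∑ j, normal Ω x j * pd φ j x) * normal Ω x i

/-- Pairs `(φ, ∇_Γ φ)` on `Γ`, for smooth `φ` with `supp φ ∩ ∂Ω ⊆ K`. -/
def smoothSurf {m : ℕ} (Ω Γ K : Set (E (m + 1))) :
    Submodule ℝ (L2s Ω Γ × (Fin (m + 1) → L2s Ω Γ)) where
  carrier := {q | ∃ φ : E (m + 1) → ℝ, ContDiff ℝ (⊤ : ℕ∞) φ ∧ HasCompactSupport φ ∧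
    tsupport φ ∩ frontier Ω ⊆ K ∧
    q.1 =ᵐ[(surf Ω).restrict Γ] φ ∧ ∀ i, q.2 i =ᵐ[(surf Ω).restrict Γ] tgrad Ω φ i}
  zero_mem' := by
    refine ⟨0, contDiff_const, HasCompactSupport.zero, ?_, Lp.coeFn_zero _ _ _, fun i => ?_⟩
    · have : tsupport (0 : E (m + 1) → ℝ) = ∅ := by simp
      simp [this]
    · refine (Lp.coeFn_zero _ _ _).trans (Eventually.of_forall fun x => ?_)
      simp [tgrad, pd]
  add_mem' := by
    rintro q r ⟨φ, a1, a2, a3, a4, a5⟩ ⟨ψ, b1, b2, b3, b4, b5⟩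
    refine ⟨φ + ψ, a1.add b1, a2.add b2, ?_, (Lp.coeFn_add _ _).trans (a4.add b4), fun i => ?_⟩
    · rintro x ⟨hx, hx'⟩
      rcases tsupport_add φ ψ hx with h | h
      · exact a3 ⟨h, hx'⟩
      · exact b3 ⟨h, hx'⟩
    · refine (Lp.coeFn_add _ _).trans (((a5 i).add (b5 i)).trans
        (Eventually.of_forall fun x => ?_))
      simp only [tgrad, pd_add a1 b1, mul_add, Finset.sum_add_distrib, Pi.add_apply]
      ring
  smul_mem' := by
    rintro c q ⟨φ, a1, a2, a3, a4, a5⟩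
    refine ⟨c • φ, contDiff_const.smul a1, a2.smul_left (f := fun _ => c), ?_,
      (Lp.coeFn_smul _ _).trans (a4.const_smul c), fun i => ?_⟩
    · exact (inter_subset_inter_left _ (tsupport_smul_subset_right (fun _ => c) φ)).trans a3
    · refine (Lp.coeFn_smul _ _).trans (((a5 i).const_smul c).trans
        (Eventually.of_forall fun x => ?_))
      simp only [tgrad, pd_smul a1, Pi.smul_apply, smul_eq_mul, mul_left_comm _ c,
        ← Finset.mul_sum]
      ring

/-- `H¹(Γ)` as the space of pairs `(w, ∇_Γ w)`: the closure of the restrictions of smooth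
functions. -/
def H1s {m : ℕ} (Ω Γ : Set (E (m + 1))) : Submodule ℝ (L2s Ω Γ × (Fin (m + 1) → L2s Ω Γ)) :=
  (smoothSurf Ω Γ univ).topologicalClosure

/-- `H¹₀(Γ)`, the functions in `H¹(Γ)` vanishing on the relative boundary `∂Γ`: the closure of the
restrictions of smooth functions supported in `Γ`. -/
def H10s {m : ℕ} (Ω Γ : Set (E (m + 1))) : Submodule ℝ (L2s Ω Γ × (Fin (m + 1) → L2s Ω Γ)) :=
  (smoothSurf Ω Γ Γ).topologicalClosure

/-- `H²(Γ)`: functions `w` whose tangential derivatives `Dᵢ w` (the Euclidean components of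
`∇_Γ w`) lie in `H¹(Γ)`, together with `Dᵢ w` and `Dⱼ Dᵢ w`. -/
def H2s {m : ℕ} (Ω Γ : Set (E (m + 1))) :
    Submodule ℝ (L2s Ω Γ × (Fin (m + 1) → L2s Ω Γ) × (Fin (m + 1) → Fin (m + 1) → L2s Ω Γ)) where
  carrier := {w | (w.1, w.2.1) ∈ H1s Ω Γ ∧ ∀ i, (w.2.1 i, w.2.2 i) ∈ H1s Ω Γ}
  zero_mem' := ⟨(H1s Ω Γ).zero_mem, fun _ => (H1s Ω Γ).zero_mem⟩
  add_mem' := fun {_ _} hu hv =>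
    ⟨(H1s Ω Γ).add_mem hu.1 hv.1, fun i => (H1s Ω Γ).add_mem (hu.2 i) (hv.2 i)⟩
  smul_mem' := fun c _ hu =>
    ⟨(H1s Ω Γ).smul_mem c hu.1, fun i => (H1s Ω Γ).smul_mem c (hu.2 i)⟩

/-- The Laplace-Beltrami operator `Δ_Γ w = ∑ᵢ Dᵢ Dᵢ w` on `H²(Γ)`. -/
def lapBeltrami {m : ℕ} {Ω Γ : Set (E (m + 1))} : H2s Ω Γ →ₗ[ℝ] L2s Ω Γ where
  toFun w := ∑ i, w.1.2.2 i i
  map_add' _ _ := by simp [Finset.sum_add_distrib]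
  map_smul' _ _ := by simp [Finset.smul_sum]

/-- The `w ∈ H²(Γ)` with `w = 0` and `Δ_Γ w = 0` on `∂Γ`, the second condition being meaningful
since `Δ_Γ w` is required to be an `H¹` function. -/
def hingedCore {m : ℕ} (Ω Γ : Set (E (m + 1))) : Submodule ℝ (H2s Ω Γ) where
  carrier := {w | (w.1.1, w.1.2.1) ∈ H10s Ω Γ ∧ ∃ K, (lapBeltrami w, K) ∈ H10s Ω Γ}
  zero_mem' := ⟨(H10s Ω Γ).zero_mem, 0, by rw [map_zero]; exact (H10s Ω Γ).zero_mem⟩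
  add_mem' := by
    rintro v w ⟨h1, K, h2⟩ ⟨h3, K', h4⟩
    exact ⟨(H10s Ω Γ).add_mem h1 h3, K + K', by
      rw [map_add]; exact (H10s Ω Γ).add_mem h2 h4⟩
  smul_mem' := by
    rintro c v ⟨h1, K, h2⟩
    exact ⟨(H10s Ω Γ).smul_mem c h1, c • K, by
      rw [map_smul]; exact (H10s Ω Γ).smul_mem c h2⟩

/-- `H²_◇(Γ) = {w ∈ H²(Γ) : w = Δ_Γ w = 0 on ∂Γ}`. As `Δ_Γ w` has no trace for a general
`w ∈ H²(Γ)`, this is the closure in `H²(Γ)` of the functions for which both conditions make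
sense. -/
def H2hinged {m : ℕ} (Ω Γ : Set (E (m + 1))) : Submodule ℝ (H2s Ω Γ) :=
  (hingedCore Ω Γ).topologicalClosure

/-- `H²_◇(Γ)` as a normed space. -/
def Hd {m : ℕ} (Ω Γ : Set (E (m + 1))) : Type := H2hinged Ω Γ

instance {m : ℕ} (Ω Γ : Set (E (m + 1))) : NormedAddCommGroup (Hd Ω Γ) :=
  inferInstanceAs (NormedAddCommGroup (H2hinged Ω Γ))

instance {m : ℕ} (Ω Γ : Set (E (m + 1))) : NormedSpace ℝ (Hd Ω Γ) :=
  inferInstanceAs (NormedSpace ℝ (H2hinged Ω Γ))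

/-- The dual space `H²_◇(Γ)*`. -/
abbrev HdDual {m : ℕ} (Ω Γ : Set (E (m + 1))) : Type := Hd Ω Γ →L[ℝ] ℝ

/-- The inclusion `H²_◇(Γ) → L²(Γ)`. -/
def Hd.toL2 {m : ℕ} (Ω Γ : Set (E (m + 1))) : Hd Ω Γ →L[ℝ] L2s Ω Γ :=
  (ContinuousLinearMap.fst ℝ _ _).comp ((H2s Ω Γ).subtypeL.comp (H2hinged Ω Γ).subtypeL)

/-- The embedding `L²(Γ) → H²_◇(Γ)*`, `f ↦ (v ↦ ∫_Γ f v dS)`. -/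
def L2s.toDual {m : ℕ} (Ω Γ : Set (E (m + 1))) : L2s Ω Γ →L[ℝ] HdDual Ω Γ :=
  ((ContinuousLinearMap.compL ℝ (Hd Ω Γ) (L2s Ω Γ) ℝ).flip (Hd.toL2 Ω Γ)).comp (innerSL ℝ)

/-! ### State, control and test spaces -/

/-- Almost every time slice of `(p, p_t)` lies in `S`. -/
def sliceWise {X Y : Type*} [NormedAddCommGroup X] [NormedSpace ℝ X] [NormedAddCommGroup Y]
    [NormedSpace ℝ Y] {T : ℝ} (S : Submodule ℝ (X × X)) :
    Submodule ℝ (Lp X 2 (tim T) × Lp X 2 (tim T) × Y) where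
  carrier := {q | ∀ᵐ t ∂tim T, (q.1 t, q.2.1 t) ∈ S}
  zero_mem' := by
    filter_upwards [Lp.coeFn_zero X 2 (tim T)] with t h
    simp only [Prod.fst_zero, Prod.snd_zero, h, Pi.zero_apply]
    exact S.zero_mem
  add_mem' := by
    intro q r hq hr
    filter_upwards [hq, hr, Lp.coeFn_add q.1 r.1, Lp.coeFn_add q.2.1 r.2.1] with t h1 h2 h3 h4
    simp only [Prod.fst_add, Prod.snd_add, h3, h4, Pi.add_apply]
    exact S.add_mem h1 h2
  smul_mem' := by
    intro c q hq
    filter_upwards [hq, Lp.coeFn_smul c q.1, Lp.coeFn_smul c q.2.1] with t h1 h3 h4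
    simp only [Prod.smul_fst, Prod.smul_snd, h3, h4, Pi.smul_apply]
    exact S.smul_mem c h1

/-- For `ι : X → Y`, the space `{u : u, u_t ∈ L²(0,T;X), u_tt ∈ L²(0,T;Y)}` of triples
`(u, u_t, u_tt)`. -/
def timeSpaceA {X Y : Type*} [NormedAddCommGroup X] [NormedSpace ℝ X] [NormedAddCommGroup Y]
    [NormedSpace ℝ Y] (ι : X →L[ℝ] Y) (T : ℝ) :
    Submodule ℝ (Lp X 2 (tim T) × Lp X 2 (tim T) × Lp Y 2 (tim T)) where
  carrier := {q |
    (ι.compLpL 2 (tim T) q.1, ι.compLpL 2 (tim T) q.2.1) ∈ weakTime Y T 2 ∧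
    (ι.compLpL 2 (tim T) q.2.1, q.2.2) ∈ weakTime Y T 2}
  zero_mem' := by
    simp only [mem_ofPred_eq, Prod.fst_zero, Prod.snd_zero, map_zero]
    exact ⟨Submodule.zero_mem _, Submodule.zero_mem _⟩
  add_mem' := by
    intro q r hq hr
    simp only [mem_ofPred_eq, Prod.fst_add, Prod.snd_add, map_add]
    exact ⟨Submodule.add_mem _ hq.1 hr.1, Submodule.add_mem _ hq.2 hr.2⟩
  smul_mem' := by
    intro c q hq
    simp only [mem_ofPred_eq, Prod.smul_fst, Prod.smul_snd, map_smul]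
    exact ⟨Submodule.smul_mem _ c hq.1, Submodule.smul_mem _ c hq.2⟩

/-- For `ι : X → Y`, the space `{u : u ∈ L²(0,T;X), u_t, u_tt ∈ L²(0,T;Y)}` of triples
`(u, u_t, u_tt)`. -/
def timeSpaceB {X Y : Type*} [NormedAddCommGroup X] [NormedSpace ℝ X] [NormedAddCommGroup Y]
    [NormedSpace ℝ Y] (ι : X →L[ℝ] Y) (T : ℝ) :
    Submodule ℝ (Lp X 2 (tim T) × Lp Y 2 (tim T) × Lp Y 2 (tim T)) where
  carrier := {q |
    (ι.compLpL 2 (tim T) q.1, q.2.1) ∈ weakTime Y T 2 ∧ (q.2.1, q.2.2) ∈ weakTime Y T 2}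
  zero_mem' := by
    simp only [mem_ofPred_eq, Prod.fst_zero, Prod.snd_zero, map_zero]
    exact ⟨Submodule.zero_mem _, Submodule.zero_mem _⟩
  add_mem' := by
    intro q r hq hr
    simp only [mem_ofPred_eq, Prod.fst_add, Prod.snd_add, map_add]
    exact ⟨Submodule.add_mem _ hq.1 hr.1, Submodule.add_mem _ hq.2 hr.2⟩
  smul_mem' := by
    intro c q hq
    simp only [mem_ofPred_eq, Prod.smul_fst, Prod.smul_snd, map_smul]
    exact ⟨Submodule.smul_mem _ c hq.1, Submodule.smul_mem _ c hq.2⟩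

/-- `H²(0,T;L²(Ω)) ∩ H¹(0,T;H²(Ω))`, as the space of triples `(p, p_t, p_tt)`. -/
def waveSpace {m : ℕ} (Ω : Set (E (m + 1))) (T : ℝ) :
    Submodule ℝ (Lp (H2 Ω) 2 (tim T) × Lp (H2 Ω) 2 (tim T) × Lp (L2 (vol Ω)) 2 (tim T)) :=
  timeSpaceA (H2.toL2 Ω) T

/-- Wave functions with `∂_ν p + β p_t + γ p = 0` on `Γa` and `∂_ν p = 0` on `Γ`. -/
def pressureSpace {m : ℕ} (Ω Γa Γ : Set (E (m + 1))) (β γ : E (m + 1) → ℝ) (T : ℝ) :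
    Submodule ℝ (Lp (H2 Ω) 2 (tim T) × Lp (H2 Ω) 2 (tim T) × Lp (L2 (vol Ω)) 2 (tim T)) :=
  waveSpace Ω T ⊓ sliceWise (absorbing Ω Γa β γ) ⊓ sliceWise (absorbing Ω Γ 0 0)

/-- `H²(0,T;H²_◇(Γ)*) ∩ L²(0,T;H²_◇(Γ))`, as the space of triples `(w, w_t, w_tt)`, where `w` is
identified with the functional `v ↦ ∫_Γ w v dS`. -/
def plateSpace {m : ℕ} (Ω Γ : Set (E (m + 1))) (T : ℝ) :
    Submodule ℝ (Lp (Hd Ω Γ) 2 (tim T) × Lp (HdDual Ω Γ) 2 (tim T) ×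
      Lp (HdDual Ω Γ) 2 (tim T)) :=
  timeSpaceB ((L2s.toDual Ω Γ).comp (Hd.toL2 Ω Γ)) T

/-- The part `{(x', z) : x' ∈ B, 0 < z < ℓ(x')}` of the domain under the graph of `ℓ`. -/
def underGraph {m : ℕ} (B : Set (E m)) (l : E m → ℝ) : Set (E (m + 1)) :=
  {x | hor x ∈ B ∧ 0 < ver x ∧ ver x < l (hor x)}

/-- The graph `{(x', ℓ(x')) : x' ∈ B}`. -/
def graphOver {m : ℕ} (B : Set (E m)) (l : E m → ℝ) : Set (E (m + 1)) :=
  (fun y => pt y (l y)) '' B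

/-- The data of the problem in dimension `d = m + 1`. Functions on `Γ_0N = {(x', ℓ₀(x'))}` are
identified with functions of `x' ∈ B`; in particular `Hˢ(Γ_0N)` is `Hˢ(B)`. -/
structure Problem (m : ℕ) where
  /-- reference domain `Ω₀` -/
  Ω : Set (E (m + 1))
  /-- fixed part of the domain -/
  Ωfix : Set (E (m + 1))
  /-- absorbing boundary part -/
  Γa : Set (E (m + 1))
  /-- plate -/
  Γpl : Set (E (m + 1))
  /-- parameter domain of the variable boundary part -/
  B : Set (E m)
  /-- final time -/
  T : ℝ
  /-- speed of sound -/
  c : ℝ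
  /-- damping parameter -/
  b : ℝ
  /-- nonlinearity parameter -/
  k : ℝ
  ρ : ℝ
  κ : ℝ
  δ : ℝ
  /-- coefficient of `p_t` in the absorbing boundary condition -/
  βa : E (m + 1) → ℝ
  /-- coefficient of `p` in the absorbing boundary condition -/
  γa : E (m + 1) → ℝ
  sg : ℝ
  sl : ℝ
  /-- the control `g_*` at the base point of the affine space `G_ad` -/
  g0 : weakTime (Hs m sg B) T ∞
  /-- the control `h₀` at the base point of the affine space `G_ad` -/
  h0 : weakTime (L2s Ω Γpl) T 2
  /-- the reference shape `ℓ₀` -/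
  l0 : Hs m sl B

namespace Problem

variable {m : ℕ}

/-- The reference Neumann boundary `Γ_0N`. -/
def ΓN (P : Problem m) : Set (E (m + 1)) := graphOver P.B P.l0.fn

/-- `ℓ > 0` on `B` and `‖1/ℓ‖_{L^∞(B)} < ∞`. -/
def Nondegenerate (P : Problem m) (l : Hs m P.sl P.B) : Prop :=
  (∀ y ∈ P.B, 0 < l.fn y) ∧ eLpNorm (fun y => 1 / l.fn y) ∞ (vol P.B) < ∞

/-- `‖ℓ - ℓ₀‖_{L^∞(B)} ≤ ½ ‖1/ℓ₀‖_{L^∞(B)}⁻¹`. -/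
def Close (P : Problem m) (l : Hs m P.sl P.B) : Prop :=
  eLpNorm (fun y => l.fn y - P.l0.fn y) ∞ (vol P.B) ≤
    2⁻¹ * (eLpNorm (fun y => 1 / P.l0.fn y) ∞ (vol P.B))⁻¹

/-- The standing assumptions. -/
structure Assumptions (P : Problem m) : Prop where
  isOpen_Ω : IsOpen P.Ω
  isConnected_Ω : IsConnected P.Ω
  isBounded_Ω : Bornology.IsBounded P.Ω
  c11 : HasC11Boundary P.Ω
  isOpen_B : IsOpen P.B
  simplyConnected_B : IsSimplyConnected P.B
  isOpen_fix : IsOpen P.Ωfix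
  disjoint_fix : Disjoint P.Ωfix (underGraph P.B P.l0.fn)
  closure_eq : closure P.Ω = closure P.Ωfix ∪ closure (underGraph P.B P.l0.fn)
  frontier_eq : frontier P.Ω = P.Γa ∪ P.ΓN ∪ P.Γpl
  disjoint_a_N : Disjoint P.Γa P.ΓN
  disjoint_a_pl : Disjoint P.Γa P.Γpl
  disjoint_N_pl : Disjoint P.ΓN P.Γpl
  relOpen_pl : ∃ O : Set (E (m + 1)), IsOpen O ∧ P.Γpl = O ∩ frontier P.Ω
  T_pos : 0 < P.T
  c_pos : 0 < P.c
  b_pos : 0 < P.b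
  k_pos : 0 < P.k
  ρ_pos : 0 < P.ρ
  κ_pos : 0 < P.κ
  δ_pos : 0 < P.δ
  smooth_βa : ContDiff ℝ (⊤ : ℕ∞) P.βa
  smooth_γa : ContDiff ℝ (⊤ : ℕ∞) P.γa
  βa_nonneg : ∀ x ∈ P.Γa, 0 ≤ P.βa x
  γa_nonneg : ∀ x ∈ P.Γa, 0 ≤ P.γa x
  sg_ge : 1 / 2 ≤ P.sg
  sl_gt : ((m + 1 : ℕ) + 3 : ℝ) / 2 < P.sl
  nondegenerate : P.Nondegenerate P.l0

/-- The control space `G = W^{1,∞}(0,T;H^{s_g}(Γ_0N)) × H¹(0,T;L²(Γ_pl)) × H^{s_ℓ}(B)`. -/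
abbrev G (P : Problem m) : Type :=
  weakTime (Hs m P.sg P.B) P.T ∞ × weakTime (L2s P.Ω P.Γpl) P.T 2 × Hs m P.sl P.B

/-- The space of directions `G₀`: `g(0) = g_t(0) = 0`, `h(0) = 0`, and `ℓ` has vanishing trace and
normal derivative on `∂B`. -/
def G0 (P : Problem m) : Submodule ℝ P.G where
  carrier := {x | x.1.1.1 ∈ vanishing (Hs m P.sg P.B) P.T ∞ ∧
    x.1.1.2 ∈ vanishing (Hs m P.sg P.B) P.T ∞ ∧
    x.2.1.1.1 ∈ vanishing (L2s P.Ω P.Γpl) P.T 2 ∧ x.2.2 ∈ zeroTraces m P.sl P.B}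
  zero_mem' := ⟨Submodule.zero_mem _, Submodule.zero_mem _, Submodule.zero_mem _,
    Submodule.zero_mem _⟩
  add_mem' := fun {_ _} h h' => ⟨Submodule.add_mem _ h.1 h'.1, Submodule.add_mem _ h.2.1 h'.2.1,
    Submodule.add_mem _ h.2.2.1 h'.2.2.1, Submodule.add_mem _ h.2.2.2 h'.2.2.2⟩
  smul_mem' := fun c _ h => ⟨Submodule.smul_mem _ c h.1, Submodule.smul_mem _ c h.2.1,
    Submodule.smul_mem _ c h.2.2.1, Submodule.smul_mem _ c h.2.2.2⟩

/-- The base point of the affine space `G_ad`. -/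
def base (P : Problem m) : P.G := (P.g0, P.h0, P.l0)

/-- The parametrization `G₀ → G_ad = base + G₀` of the affine space of admissible controls. -/
def control (P : Problem m) (x : P.G0) : P.G := P.base + x

/-- The state space `U(Ω₀)`, with elements `(p̄, p̃, w)`. -/
abbrev U (P : Problem m) : Type :=
  pressureSpace P.Ω P.Γa P.Γpl P.βa P.γa P.T × pressureSpace P.Ω P.Γa P.ΓN P.βa P.γa P.T ×
    plateSpace P.Ω P.Γpl P.T

/-- The test space `Z(Ω₀) = L²(L²(Ω₀))² × L²(H²_◇(Γ_pl)) × L²(H^{-1/2}(Γ_0N)) × L²(L²(Γ_pl))`, where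
`H^{-1/2}(Γ_0N)` is the dual of `H^{1/2}(Γ_0N)`. -/
abbrev Z (P : Problem m) : Type :=
  Lp (L2 (vol P.Ω)) 2 (tim P.T) × Lp (L2 (vol P.Ω)) 2 (tim P.T) ×
    Lp (Hd P.Ω P.Γpl) 2 (tim P.T) × Lp (Hs m (1 / 2) P.B →L[ℝ] ℝ) 2 (tim P.T) ×
    Lp (L2s P.Ω P.Γpl) 2 (tim P.T)

/-! ### The transformed differential operators -/

/-- The ratio `r = ℓ/ℓ₀` as a function on `B`. -/
def ratio (P : Problem m) (l : Hs m P.sl P.B) (y : E m) : ℝ := l.fn y / P.l0.fn y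

open Classical in
/-- The volume weight `1/ω⁰_ℓ`: `ℓ/ℓ₀` on the variable part, `1` elsewhere. -/
def invω0 (P : Problem m) (l : Hs m P.sl P.B) (x : E (m + 1)) : ℝ :=
  if x ∈ underGraph P.B P.l0.fn then P.ratio l (hor x) else 1

/-- The surface weight `ω¹_ℓ = √(|∇ℓ|² + 1) / √(|∇ℓ₀|² + 1)`. -/
def ω1 (P : Problem m) (l : Hs m P.sl P.B) (y : E m) : ℝ :=
  √((∑ i, pd l.fn i y ^ 2) + 1) / √((∑ i, pd P.l0.fn i y ^ 2) + 1)

open Classical in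
/-- The transformed Laplacian `Ď²_ℓ u`: the Laplacian of `(x', z) ↦ u (x', z / r(x'))`,
`r = ℓ/ℓ₀`, at the point with reference coordinates `x` in the variable part; the Laplacian of `u`
elsewhere. -/
def lap (P : Problem m) (l : Hs m P.sl P.B) (u : H2 P.Ω) (x : E (m + 1)) : ℝ :=
  let r := P.ratio l
  let y := hor x
  let z := ver x
  let e : Fin (m + 1) := Fin.last m
  if x ∈ underGraph P.B P.l0.fn then
    (∑ i : Fin m, u.hess i.castSucc i.castSucc x)
      - 2 * (z / r y) * (∑ i : Fin m, pd r i y * u.hess i.castSucc e x)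
      + (z / r y) ^ 2 * (∑ i : Fin m, pd r i y ^ 2) * u.hess e e x
      + (2 * z / r y ^ 2 * (∑ i : Fin m, pd r i y ^ 2)
          - z / r y * (∑ i : Fin m, pd (pd r i) i y)) * u.grad e x
      + (1 / r y) ^ 2 * u.hess e e x
  else ∑ i, u.hess i i x

/-- `M_ℓ τ` at the point `(x', ℓ₀(x'))` of `Γ_0N`, for a vector `τ` (the gradient in reference
coordinates). -/
def Mmul (P : Problem m) (l : Hs m P.sl P.B) (y : E m) (τ : Fin (m + 1) → ℝ) : Fin (m + 1) → ℝ :=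
  Fin.snoc (α := fun _ => ℝ)
    (fun i : Fin m => τ i.castSucc
      - 1 / P.ratio l y * P.l0.fn y * pd (P.ratio l) i y * τ (Fin.last m))
    (1 / P.ratio l y * τ (Fin.last m))

/-- The upward unit normal `(-∇f, 1) / √(|∇f|² + 1)` of the graph of `f`. -/
def graphNormal (f : E m → ℝ) (y : E m) : Fin (m + 1) → ℝ :=
  Fin.snoc (α := fun _ => ℝ)
    (fun i : Fin m => -pd f i y / √((∑ j, pd f j y ^ 2) + 1)) (1 / √((∑ j, pd f j y ^ 2) + 1))

/-- Which normal vector is used in the Neumann condition on `Γ_0N`: the normal `ν₀` of the reference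
boundary, or the normal of the deformed boundary `Γ_N(ℓ)` transported to `Γ_0N`. -/
inductive NormalChoice where
  | reference
  | deformed

/-- The normal vector used in the Neumann condition, at the point over `y ∈ B`. -/
def neumannNormal (P : Problem m) : NormalChoice → Hs m P.sl P.B → E m → Fin (m + 1) → ℝ
  | .reference, _ => graphNormal P.l0.fn
  | .deformed, l => graphNormal l.fn

/-- `L : Z → ℝ` is the functional `A_PDE(g, u)`. The fields spell out
`⟨L, (q̄, q̃, v, μ_N, μ_pl)⟩`
`= ∫_0^T { ∫_{Ω₀} (1/ω⁰_ℓ) [(p̄_tt - c² Ď²_ℓ p̄ - b Ď²_ℓ p̄_t) q̄`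
`  + (p̃_tt - c² Ď²_ℓ p̃ - b Ď²_ℓ p̃_t - 2k ((p̄+p̃)_t)² - 2k (p̄+p̃) (p̄+p̃)_tt) q̃] dx`
`  + (ρ/κ) ∫_{Γ_pl} [(ρ w_tt - h - κ (p̄_t + p̃_t)) v + δ Δ_pl w Δ_pl v] dS`
`  + ∫_{Γ_0N} ω¹_ℓ (n · M_ℓ ∇p̄ - g) μ_N dS + ∫_{Γ_pl} (∂_ν p̃ + ρ w_t) μ_pl dS } dt`,
naming each factor that multiplies a test function and stating in which space it lies, so that every
integral and duality pairing is well defined. -/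
def IsAPDE (P : Problem m) (nc : NormalChoice) (g : P.G) (u : P.U) (L : P.Z →L[ℝ] ℝ) : Prop :=
  let l : Hs m P.sl P.B := g.2.2
  let gN := g.1.1.1
  let h := g.2.1.1.1
  let p := u.1.1.1
  let p' := u.1.1.2.1
  let p'' := u.1.1.2.2
  let q := u.2.1.1.1
  let q' := u.2.1.1.2.1
  let q'' := u.2.1.1.2.2
  let w := u.2.2.1.1
  let w' := u.2.2.1.2.1
  let w'' := u.2.2.1.2.2
  ∃ (r₁ r₂ : Lp (L2 (vol P.Ω)) 2 (tim P.T)) (trp wt dn : Lp (L2s P.Ω P.Γpl) 2 (tim P.T))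
    (rN : Lp (Hs m (1 / 2) P.B) 2 (tim P.T)),
    -- the interior factors
    (∀ᵐ t ∂tim P.T, ∀ᵐ x ∂vol P.Ω, r₁ t x =
      P.invω0 l x * (p'' t x - P.c ^ 2 * P.lap l (p t) x - P.b * P.lap l (p' t) x)) ∧
    (∀ᵐ t ∂tim P.T, ∀ᵐ x ∂vol P.Ω, r₂ t x =
      P.invω0 l x * (q'' t x - P.c ^ 2 * P.lap l (q t) x - P.b * P.lap l (q' t) x
        - 2 * P.k * (H2.toL2 P.Ω (p' t) x + H2.toL2 P.Ω (q' t) x) ^ 2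
        - 2 * P.k * (H2.toL2 P.Ω (p t) x + H2.toL2 P.Ω (q t) x) * (p'' t x + q'' t x))) ∧
    -- `trp` is the trace of `p̄_t + p̃_t` on the plate
    (∀ᵐ t ∂tim P.T, ∃ v, HasTrace (p' t + q' t) v ∧ trp t =ᵐ[(surf P.Ω).restrict P.Γpl] v) ∧
    -- `wt` is `w_t`, as an element of `L²(0,T;L²(Γ_pl))`
    (∀ᵐ t ∂tim P.T, w' t = L2s.toDual P.Ω P.Γpl (wt t)) ∧
    -- `dn` is the normal derivative of `p̃` on the plate
    (∀ᵐ t ∂tim P.T, ∃ v, HasNormalDeriv (q t) v ∧ dn t =ᵐ[(surf P.Ω).restrict P.Γpl] v) ∧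
    -- `rN` is the factor of `μ_N` on the Neumann boundary
    (∀ᵐ t ∂tim P.T, ∃ (τ : Fin (m + 1) → L2 (surf P.Ω)) (f : E m → ℝ),
      HasGradTrace (p t) τ ∧ Represents (gN t) f ∧
      Represents (rN t) (fun y => P.ω1 l y *
        ((∑ i, P.neumannNormal nc l y i * P.Mmul l y (fun j => τ j (pt y (P.l0.fn y))) i)
          - f y))) ∧
    ∀ z : P.Z, L z = ∫ t in Ioo 0 P.T,
      ((∫ x in P.Ω, (r₁ t x * z.1 t x + r₂ t x * z.2.1 t x))
        + P.ρ / P.κ * (P.ρ * w'' t (z.2.2.1 t)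
            - inner ℝ (h t + P.κ • trp t) (Hd.toL2 P.Ω P.Γpl (z.2.2.1 t))
            + P.δ * inner ℝ (lapBeltrami (w t).1) (lapBeltrami (z.2.2.1 t).1))
        + z.2.2.2.1 t (rN t)
        + inner ℝ (dn t + P.ρ • wt t) (z.2.2.2.2 t))

end Problem

end AcousticStructure

end

noncomputable section

namespace AcousticStructure

open ContinuousLinearMap (fst snd lsmul opNorm_le_bound)
open ENNReal (ofReal ofReal_mul ofReal_le_ofReal mul_ne_top ofReal_pow ofReal_add ofReal_one ofReal_ne_top toReal_mono toReal_mul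
  add_ne_top sum_ne_top continuous_ofReal rpow_ne_top_of_nonneg ofReal_le_ofReal_iff ofReal_ofNat)
open Finset (sum_le_sum mul_sum sum_mul sum_congr sum_nonneg abs_sum_le_sum_abs sum_const card_univ)
open Metric (ball closedBall)
open Real (norm_eq_abs norm_of_nonneg enorm_eq_ofReal dist_eq rpow_add rpow_neg cos)
open Bornology (IsBounded)

variable {m n : ℕ} {s T : ℝ} {B : Set (E m)} {Ω : Set (E (m + 1))} {P : Problem m} {γ : E m → ℝ}
  {X Y Z V W : Type*} [NormedAddCommGroup X] [NormedSpace ℝ X] [NormedAddCommGroup Y] [NormedSpace ℝ Y]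
  [NormedAddCommGroup Z] [NormedSpace ℝ Z]
  [NormedAddCommGroup V] [NormedSpace ℝ V] [NormedAddCommGroup W] [NormedSpace ℝ W]

/-! ### Approximation by integral operators -/

theorem sq_lintegral_mul_le {α : Type*} [MeasurableSpace α] {μ : Measure α} {k f : α → ℝ≥0∞}
    (hk : AEMeasurable k μ) (hf : AEMeasurable f μ) :
    (∫⁻ a, k a * f a ∂μ) ^ 2 ≤ (∫⁻ a, k a ∂μ) * ∫⁻ a, k a * f a ^ 2 ∂μ := by
  have hsq : ∀ x : ℝ≥0∞, (x ^ (1 / 2 : ℝ)) ^ (2 : ℕ) = x := fun x => by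
    rw [← ENNReal.rpow_natCast, ← ENNReal.rpow_mul]; norm_num
  have h := ENNReal.lintegral_mul_le_Lp_mul_Lq μ (p := 2) (q := 2) Real.HolderConjugate.two_two
    (f := fun a => k a ^ (1 / 2 : ℝ)) (g := fun a => k a ^ (1 / 2 : ℝ) * f a)
    (hk.pow_const _) ((hk.pow_const _).mul hf)
  have e1 : ∀ a, ((fun a => k a ^ (1 / 2 : ℝ)) * fun a => k a ^ (1 / 2 : ℝ) * f a) a
      = k a * f a := fun a => by
    simp only [Pi.mul_apply]
    rw [← mul_assoc, ← sq, hsq]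
  have e2 : ∀ a, (k a ^ (1 / 2 : ℝ)) ^ (2 : ℝ) = k a := fun a => by rw [ENNReal.rpow_two, hsq]
  have e3 : ∀ a, (k a ^ (1 / 2 : ℝ) * f a) ^ (2 : ℝ) = k a * f a ^ 2 := fun a => by
    rw [ENNReal.rpow_two, mul_pow, hsq]
  simp only [e1, e2, e3] at h
  calc _ ≤ ((∫⁻ a, k a ∂μ) ^ (1 / 2 : ℝ) * (∫⁻ a, k a * f a ^ 2 ∂μ) ^ (1 / 2 : ℝ)) ^ 2 := by
        gcongr
    _ = _ := by rw [mul_pow, hsq, hsq]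

section Kernel

variable {F : Type*} [NormedAddCommGroup F] [ProperSpace F] [MeasurableSpace F] [BorelSpace F] {ν : Measure F} [SFinite ν]

/-- Schur's test. -/
theorem lintegral_enorm_kernel_sq_le {k : F → F → ℝ} (hk : Continuous (Function.uncurry k))
    (h0 : ∀ t s, 0 ≤ k t s) {S : Set F} (hS : MeasurableSet S)
    (h1 : ∀ t ∈ S, ∫⁻ s, ofReal (k t s) ∂ν ≤ 1) {C : ℝ≥0∞}
    (h2 : ∀ s, ∫⁻ t in S, ofReal (k t s) ∂ν ≤ C) {w : F → X}
    (hw : AEStronglyMeasurable w ν) :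
    ∫⁻ t in S, ‖∫ s, k t s • w s ∂ν‖ₑ ^ 2 ∂ν ≤ C * ∫⁻ s, ‖w s‖ₑ ^ 2 ∂ν := by
  have hkt : ∀ t, Measurable (fun s => ofReal (k t s)) := fun t =>
    (continuous_ofReal.comp (hk.comp (Continuous.prodMk_right t))).measurable
  calc ∫⁻ t in S, ‖∫ s, k t s • w s ∂ν‖ₑ ^ 2 ∂ν
      ≤ ∫⁻ t in S, ∫⁻ s, ofReal (k t s) * ‖w s‖ₑ ^ 2 ∂ν ∂ν := by
        refine setLIntegral_mono' hS fun t ht => ?_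
        calc ‖∫ s, k t s • w s ∂ν‖ₑ ^ 2 ≤ (∫⁻ s, ofReal (k t s) * ‖w s‖ₑ ∂ν) ^ 2 := by
              gcongr
              refine (enorm_integral_le_lintegral_enorm _).trans (le_of_eq ?_)
              refine lintegral_congr fun s => ?_
              rw [enorm_smul, enorm_eq_ofReal (h0 t s)]
          _ ≤ _ := sq_lintegral_mul_le (hkt t).aemeasurable hw.enorm
          _ ≤ 1 * _ := by gcongr; exact h1 t ht
          _ = _ := one_mul _
    _ = ∫⁻ s, ∫⁻ t in S, ofReal (k t s) * ‖w s‖ₑ ^ 2 ∂ν ∂ν := by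
        refine lintegral_lintegral_swap ?_
        have a1 : AEMeasurable (fun p : F × F => ofReal (k p.1 p.2))
            ((ν.restrict S).prod ν) := (continuous_ofReal.comp hk).measurable.aemeasurable
        have a2 : AEMeasurable (fun p : F × F => ‖w p.2‖ₑ ^ 2) ((ν.restrict S).prod ν) :=
          (hw.enorm.pow_const 2).comp_snd
        exact a1.mul a2
    _ = ∫⁻ s, (∫⁻ t in S, ofReal (k t s) ∂ν) * ‖w s‖ₑ ^ 2 ∂ν := by
        refine lintegral_congr fun s => ?_
        refine lintegral_mul_const _ ?_
        exact (continuous_ofReal.comp (hk.comp (Continuous.prodMk_left s))).measurable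
    _ ≤ ∫⁻ s, C * ‖w s‖ₑ ^ 2 ∂ν := lintegral_mono fun s => by gcongr; exact h2 s
    _ = _ := lintegral_const_mul'' _ (hw.enorm.pow_const 2)

theorem eLpNorm_two_sq {α Y : Type*} [NormedAddCommGroup Y] [MeasurableSpace α] (μ : Measure α) (f : α → Y) :
    eLpNorm f 2 μ ^ 2 = ∫⁻ a, ‖f a‖ₑ ^ 2 ∂μ := by
  rw [eLpNorm_eq_lintegral_rpow_enorm_toReal (by norm_num) (by norm_num)]
  simp only [ENNReal.toReal_ofNat, ENNReal.rpow_two]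
  rw [← ENNReal.rpow_natCast, ← ENNReal.rpow_mul]
  norm_num

theorem eLpNorm_kernel_le {k : F → F → ℝ} (hk : Continuous (Function.uncurry k))
    (h0 : ∀ t s, 0 ≤ k t s) {S : Set F} (hS : MeasurableSet S)
    (h1 : ∀ t ∈ S, ∫⁻ s, ofReal (k t s) ∂ν ≤ 1) {C : ℝ≥0∞}
    (h2 : ∀ s, ∫⁻ t in S, ofReal (k t s) ∂ν ≤ C) {w : F → X}
    (hw : AEStronglyMeasurable w ν) :
    eLpNorm (fun t => ∫ s, k t s • w s ∂ν) 2 (ν.restrict S) ≤ C ^ (1 / 2 : ℝ) * eLpNorm w 2 ν := by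
  have h := lintegral_enorm_kernel_sq_le hk h0 hS h1 h2 hw
  rw [← eLpNorm_two_sq, ← eLpNorm_two_sq] at h
  have h' := ENNReal.rpow_le_rpow h (z := 1 / 2) (by norm_num)
  rw [ENNReal.mul_rpow_of_nonneg _ _ (by norm_num)] at h'
  have hsq : ∀ x : ℝ≥0∞, (x ^ (2 : ℕ)) ^ (1 / 2 : ℝ) = x := fun x => by
    rw [← ENNReal.rpow_natCast, ← ENNReal.rpow_mul]; norm_num
  rwa [hsq, hsq] at h'

theorem aestronglyMeasurable_kernel {k : F → F → ℝ} (hk : Continuous (Function.uncurry k))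
    {μ : Measure F} [SFinite μ] {w : F → X} (hw : AEStronglyMeasurable w ν) :
    AEStronglyMeasurable (fun t => ∫ s, k t s • w s ∂ν) μ := by
  refine AEStronglyMeasurable.integral_prod_right' (μ := μ) (ν := ν)
    (f := fun p : F × F => k p.1 p.2 • w p.2) ?_
  exact hk.aestronglyMeasurable.smul hw.comp_snd

theorem integrable_kernel_smul {F : Type*} [TopologicalSpace F] [MeasurableSpace F]
    [OpensMeasurableSpace F] {ν : Measure F} [IsFiniteMeasureOnCompacts ν] {k : F → ℝ}
    (hc : Continuous k) (hcs : HasCompactSupport k) {w : F → X} (hw : MemLp w 2 ν) :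
    Integrable (fun s => k s • w s) ν :=
  memLp_one_iff_integrable.1 (hw.smul (hc.memLp_of_hasCompactSupport (p := 2) hcs))

theorem tendsto_kernel [CompleteSpace X] [ν.Regular] {k : ℕ → F → F → ℝ}
    (hk : ∀ n, Continuous (Function.uncurry (k n))) (h0 : ∀ n t s, 0 ≤ k n t s) {S : Set F}
    (hS : MeasurableSet S) (hνS : ν S ≠ ∞)
    (h1 : ∀ n, ∀ t ∈ S, ∫⁻ s, ofReal (k n t s) ∂ν = 1) {C : ℝ≥0∞} (hC : C ≠ ∞)
    (h2 : ∀ n s, ∫⁻ t in S, ofReal (k n t s) ∂ν ≤ C)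
    (hcs : ∀ n t, HasCompactSupport (k n t)) {r : ℕ → ℝ}
    (hr : ∀ n, ∀ t ∈ S, ∀ s, r n ≤ dist t s → k n t s = 0) (hr0 : Tendsto r atTop (𝓝 0)) {w : F → X}
    (hw : MemLp w 2 ν) :
    Tendsto (fun n => eLpNorm (fun t => ∫ s, k n t s • w s ∂ν - w t) 2 (ν.restrict S))
      atTop (𝓝 0) := by
  rw [ENNReal.tendsto_atTop_zero]
  intro ε hε
  -- choose the accuracies
  obtain ⟨η, hη0, hη⟩ : ∃ η : ℝ≥0∞, η ≠ 0 ∧ C ^ (1 / 2 : ℝ) * η + η ≤ ε / 2 := by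
    have hcont : Tendsto (fun η : ℝ≥0∞ => C ^ (1 / 2 : ℝ) * η + η) (𝓝 0) (𝓝 0) := by
      have h := (ENNReal.Tendsto.const_mul (a := C ^ (1 / 2 : ℝ)) (tendsto_id (α := ℝ≥0∞) (x := 𝓝 0))
        (Or.inr (rpow_ne_top_of_nonneg (by norm_num) hC))).add (tendsto_id (x := 𝓝 0))
      simpa using h
    have hev := hcont.eventually (Iic_mem_nhds (ENNReal.half_pos hε.ne'))
    have hev2 : ∀ᶠ η : ℝ≥0∞ in 𝓝[>] 0, C ^ (1 / 2 : ℝ) * η + η ≤ ε / 2 ∧ 0 < η :=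
      (hev.filter_mono nhdsWithin_le_nhds).and self_mem_nhdsWithin
    obtain ⟨η, a, b⟩ := hev2.exists
    exact ⟨η, b.ne', a⟩
  obtain ⟨g, hgs, hgw, hgc, hgm⟩ := hw.exists_hasCompactSupport_eLpNorm_sub_le (by norm_num) hη0
  obtain ⟨δ, hδ0, hδ⟩ : ∃ δ : ℝ, 0 < δ ∧ ofReal δ * ν S ^ (1 / 2 : ℝ) ≤ ε / 2 := by
    have hcont : Tendsto (fun δ : ℝ => ofReal δ * ν S ^ (1 / 2 : ℝ)) (𝓝 0) (𝓝 0) := by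
      have h := ENNReal.Tendsto.mul_const (b := ν S ^ (1 / 2 : ℝ))
        (continuous_ofReal.tendsto 0)
        (Or.inr (rpow_ne_top_of_nonneg (by norm_num) hνS))
      simpa using h
    have hev := hcont.eventually (Iic_mem_nhds (ENNReal.half_pos hε.ne'))
    have hev2 : ∀ᶠ δ : ℝ in 𝓝[>] 0, _ ∧ 0 < δ :=
      (hev.filter_mono nhdsWithin_le_nhds).and self_mem_nhdsWithin
    obtain ⟨δ, a, b⟩ := hev2.exists
    exact ⟨δ, b, a⟩
  have huc : UniformContinuous g := hgc.uniformContinuous_of_tendsto_cocompact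
    (x := 0) (by simpa using hgs.is_zero_at_infty)
  obtain ⟨ρ, hρ0, hρ⟩ := Metric.uniformContinuous_iff.1 huc δ hδ0
  have hev := hr0.eventually (Iio_mem_nhds hρ0)
  obtain ⟨N, hN⟩ := eventually_atTop.1 hev
  refine ⟨N, fun n hn => ?_⟩
  have hwg : MemLp (w - g) 2 ν := hw.sub hgm
  have i1 := fun t => integrable_kernel_smul (k := k n t) ((hk n).comp (Continuous.prodMk_right t))
    (hcs n t) hwg
  have i2 := fun t => integrable_kernel_smul (k := k n t) ((hk n).comp (Continuous.prodMk_right t))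
    (hcs n t) hgm
  have i3 := fun t => integrable_kernel_smul (k := k n t) ((hk n).comp (Continuous.prodMk_right t))
    (hcs n t) hw
  have hsplit : (fun t => ∫ s, k n t s • w s ∂ν - w t) =
      (fun t => ∫ s, k n t s • (w - g) s ∂ν) + ((fun t => ∫ s, k n t s • g s ∂ν - g t)
        + fun t => (g - w) t) := by
    funext t
    have : ∫ s, k n t s • (w - g) s ∂ν = ∫ s, k n t s • w s ∂ν - ∫ s, k n t s • g s ∂ν := by
      rw [← integral_sub (i3 t) (i2 t)]
      simp only [Pi.sub_apply, smul_sub]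
    simp only [Pi.add_apply]
    rw [this, Pi.sub_apply]
    abel
  have m1 : AEStronglyMeasurable (fun t => ∫ s, k n t s • (w - g) s ∂ν) (ν.restrict S) :=
    aestronglyMeasurable_kernel (hk n) hwg.1
  have m2 : AEStronglyMeasurable (fun t => ∫ s, k n t s • g s ∂ν - g t) (ν.restrict S) :=
    (aestronglyMeasurable_kernel (hk n) hgm.1).sub hgc.aestronglyMeasurable
  have m3 : AEStronglyMeasurable (fun t => (g - w) t) (ν.restrict S) := (hgm.1.sub hw.1).restrict
  have b1 : eLpNorm (fun t => ∫ s, k n t s • (w - g) s ∂ν) 2 (ν.restrict S)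
      ≤ C ^ (1 / 2 : ℝ) * η :=
    (eLpNorm_kernel_le (hk n) (h0 n) hS (fun t ht => (h1 n t ht).le) (h2 n) hwg.1).trans
      (by gcongr)
  have b3 : eLpNorm (fun t => (g - w) t) 2 (ν.restrict S) ≤ η := by
    refine (eLpNorm_mono_measure _ Measure.restrict_le_self).trans ?_
    have : eLpNorm (fun t => (g - w) t) 2 ν = eLpNorm (w - g) 2 ν := eLpNorm_sub_comm g w 2 ν
    rw [this]
    exact hgw
  have b2 : eLpNorm (fun t => ∫ s, k n t s • g s ∂ν - g t) 2 (ν.restrict S)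
      ≤ ofReal δ * ν S ^ (1 / 2 : ℝ) := by
    have hpt : ∀ᵐ t ∂ν.restrict S, ‖∫ s, k n t s • g s ∂ν - g t‖ ≤ δ := by
      filter_upwards [ae_restrict_mem hS] with t ht
      have hint : Integrable (k n t) ν := by
        refine ⟨((hk n).comp (Continuous.prodMk_right t)).aestronglyMeasurable, ?_⟩
        have : ∫⁻ s, ‖k n t s‖ₑ ∂ν = 1 := by
          rw [← h1 n t ht]
          exact lintegral_congr fun s => enorm_eq_ofReal (h0 n t s)
        rw [HasFiniteIntegral, this]; exact ENNReal.one_lt_top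
      have hone : ∫ s, k n t s ∂ν = 1 := by
        rw [integral_eq_lintegral_of_nonneg_ae (.of_forall (h0 n t)) hint.1, h1 n t ht]
        rfl
      have e : ∫ s, k n t s • g s ∂ν - g t = ∫ s, k n t s • (g s - g t) ∂ν := by
        simp only [smul_sub]
        rw [integral_sub (i2 t) (hint.smul_const _), integral_smul_const, hone, one_smul]
      rw [e]
      calc _ ≤ ∫ s, k n t s * δ ∂ν := by
            refine norm_integral_le_of_norm_le (hint.mul_const _) (.of_forall fun s => ?_)
            rw [norm_smul, norm_of_nonneg (h0 n t s)]
            rcases lt_or_ge (dist t s) (r n) with h | h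
            · refine mul_le_mul_of_nonneg_left ?_ (h0 n t s)
              rw [← dist_eq_norm, dist_comm]
              exact (hρ (h.trans (hN n hn))).le
            · rw [hr n t ht s h]; simp
        _ = δ := by rw [integral_mul_const, hone, one_mul]
    refine (eLpNorm_le_of_ae_bound hpt).trans (le_of_eq ?_)
    rw [Measure.restrict_apply_univ, mul_comm]
    norm_num
  rw [hsplit]
  calc _ ≤ _ := eLpNorm_add_le m1 (m2.add m3) (by norm_num)
    _ ≤ C ^ (1 / 2 : ℝ) * η + (ofReal δ * ν S ^ (1 / 2 : ℝ) + η) := by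
        gcongr
        exact (eLpNorm_add_le m2 m3 (by norm_num)).trans (by gcongr)
    _ = (C ^ (1 / 2 : ℝ) * η + η) + ofReal δ * ν S ^ (1 / 2 : ℝ) := by ring
    _ ≤ ε / 2 + ε / 2 := by gcongr
    _ = ε := ENNReal.add_halves ε

end Kernel

/-! ### An interpolation estimate for intermediate time derivatives -/

theorem integral_comp_div_sixteen_le (hT : 0 < T) {g : ℝ → ℝ} (hg : Continuous g)
    (h0 : ∀ t, 0 ≤ g t) : ∫ t in (0 : ℝ)..T, g (t / 16) ≤ 16 * ∫ t in (0 : ℝ)..T, g t := by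
  rw [intervalIntegral.integral_comp_div g (by norm_num)]
  rw [smul_eq_mul, zero_div]
  refine mul_le_mul_of_nonneg_left ?_ (by norm_num)
  refine intervalIntegral.integral_mono_interval le_rfl (by positivity) (by linarith)
    (.of_forall h0) (hg.intervalIntegrable _ _)

theorem integral_comp_div_sixteen_add_le (hT : 0 < T) {g : ℝ → ℝ} (hg : Continuous g)
    (h0 : ∀ t, 0 ≤ g t) :
    ∫ t in (0 : ℝ)..T, g (t / 16 + 15 / 16 * T) ≤ 16 * ∫ t in (0 : ℝ)..T, g t := by
  rw [intervalIntegral.integral_comp_div_add g (by norm_num)]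
  rw [smul_eq_mul, zero_div]
  refine mul_le_mul_of_nonneg_left ?_ (by norm_num)
  refine intervalIntegral.integral_mono_interval (by positivity) (by linarith) (by linarith)
    (.of_forall h0) (hg.intervalIntegrable _ _)

theorem intermediate_pointwise {a b c n m K r : ℝ}
    (h : a ^ 2 ≤ K + a / 16 * b + a / 16 * c + r⁻¹ * a * n + r⁻¹ * a * m) :
    a ^ 2 / 2 ≤ K + (b ^ 2 + c ^ 2) / 128 + 2 * r⁻¹ ^ 2 * (n ^ 2 + m ^ 2) := by
  nlinarith [sq_nonneg (a - b / 4), sq_nonneg (a - c / 4), sq_nonneg (a - 4 * (r⁻¹ * n)),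
    sq_nonneg (a - 4 * (r⁻¹ * m))]

theorem integral_sq_deriv_le {H : Type*}
    [NormedAddCommGroup H] [InnerProductSpace ℝ H] (ι : V →L[ℝ] H) (hT : 0 < T)
    {u u1 u2 : ℝ → V} {W : ℝ → V →L[ℝ] ℝ}
    (hu : ∀ t, HasDerivAt u (u1 t) t) (hu1 : ∀ t, HasDerivAt u1 (u2 t) t) (hu2 : Continuous u2)
    (hW : ∀ t ∈ Icc 0 T, ∀ v, inner ℝ (ι (u2 t)) (ι v) = W t v) (hWc : Continuous W) :
    ∫ t in (0 : ℝ)..T, ‖ι (u1 t)‖ ^ 2 ≤ 2 * (∫ t in (0 : ℝ)..T, ‖W t‖ ^ 2)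
      + (200 + 256 * ‖ι‖ ^ 2 / T ^ 2) * ∫ t in (0 : ℝ)..T, ‖u t‖ ^ 2 := by
  have cu : Continuous u := continuous_iff_continuousAt.2 fun t => (hu t).continuousAt
  have cu1 : Continuous u1 := continuous_iff_continuousAt.2 fun t => (hu1 t).continuousAt
  set v : ℝ → V := fun t => u t - (1 - t / T) • u (t / 16) - (t / T) • u (t / 16 + 15 / 16 * T)
    with hv
  set v1 : ℝ → V := fun t => u1 t - ((1 - t / T) • ((1 / 16 : ℝ) • u1 (t / 16)) + (-(1 / T)) • u (t / 16))
    - ((t / T) • ((1 / 16 : ℝ) • u1 (t / 16 + 15 / 16 * T)) + (1 / T) • u (t / 16 + 15 / 16 * T)) with hv1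
  have dv : ∀ t, HasDerivAt v (v1 t) t := by
    intro t
    have d1 : HasDerivAt (fun t : ℝ => t / 16) (1 / 16) t := (hasDerivAt_id t).div_const 16
    have d2 : HasDerivAt (fun t : ℝ => t / 16 + 15 / 16 * T) (1 / 16) t := d1.add_const _
    have d3 : HasDerivAt (fun t : ℝ => t / T) (1 / T) t := (hasDerivAt_id t).div_const T
    have d4 : HasDerivAt (fun t : ℝ => 1 - t / T) (-(1 / T)) t := d3.const_sub 1
    exact ((hu t).sub (d4.smul ((hu _).scomp t d1))).sub (d3.smul ((hu _).scomp t d2))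
  have cv : Continuous v := continuous_iff_continuousAt.2 fun t => (dv t).continuousAt
  have cv1 : Continuous v1 := by simp only [hv1]; fun_prop
  have v0 : v 0 = 0 := by simp [hv]
  have vT : v T = 0 := by
    have : T / 16 + 15 / 16 * T = T := by ring
    simp [hv, this, hT.ne']
  have parts : ∫ t in (0 : ℝ)..T, inner ℝ (ι (u1 t)) (ι (v1 t))
      = - ∫ t in (0 : ℝ)..T, inner ℝ (ι (u2 t)) (ι (v t)) := by
    have hd : ∀ t ∈ uIcc 0 T, HasDerivAt (fun t => inner ℝ (ι (u1 t)) (ι (v t)))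
        (inner ℝ (ι (u1 t)) (ι (v1 t)) + inner ℝ (ι (u2 t)) (ι (v t))) t := fun t _ =>
      HasDerivAt.inner ℝ (ι.hasFDerivAt.comp_hasDerivAt t (hu1 t))
        (ι.hasFDerivAt.comp_hasDerivAt t (dv t))
    have c1 : Continuous fun t => (inner ℝ (ι (u1 t)) (ι (v1 t)) : ℝ) := by fun_prop
    have c2 : Continuous fun t => (inner ℝ (ι (u2 t)) (ι (v t)) : ℝ) := by fun_prop
    have h := intervalIntegral.integral_eq_sub_of_hasDerivAt hd
      ((c1.add c2).intervalIntegrable _ _)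
    rw [intervalIntegral.integral_add (c1.intervalIntegrable _ _) (c2.intervalIntegrable _ _), v0,
      vT] at h
    simp only [map_zero, inner_zero_right, sub_zero] at h
    linarith
  have pw : ∀ t ∈ Icc 0 T, ‖ι (u1 t)‖ ^ 2 / 2 ≤ inner ℝ (ι (u1 t)) (ι (v1 t))
      + (‖ι (u1 (t / 16))‖ ^ 2 + ‖ι (u1 (t / 16 + 15 / 16 * T))‖ ^ 2) / 128
      + 2 * T⁻¹ ^ 2 * (‖ι (u (t / 16))‖ ^ 2 + ‖ι (u (t / 16 + 15 / 16 * T))‖ ^ 2) := by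
    intro t ht
    refine intermediate_pointwise ?_
    have e : ι (v1 t) = ι (u1 t) - ((1 - t / T) * (1 / 16)) • ι (u1 (t / 16))
        + T⁻¹ • ι (u (t / 16)) - ((t / T) * (1 / 16)) • ι (u1 (t / 16 + 15 / 16 * T))
        - T⁻¹ • ι (u (t / 16 + 15 / 16 * T)) := by
      simp only [hv1, map_sub, map_add, map_neg, map_smul, one_div, neg_smul, smul_smul]
      abel
    have t0 : 0 ≤ t / T := div_nonneg ht.1 hT.le
    have t1 : t / T ≤ 1 := (div_le_one hT).2 ht.2
    rw [e]
    simp only [inner_sub_right, inner_add_right, inner_smul_right, real_inner_self_eq_norm_sq]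
    set x := ι (u1 t)
    have key : ∀ y : H, ∀ c : ℝ, 0 ≤ c → ∀ d, c ≤ d → c * inner ℝ x y ≤ d * (‖x‖ * ‖y‖) := by
      intro y c hc d hd
      calc c * inner ℝ x y ≤ c * (‖x‖ * ‖y‖) :=
            mul_le_mul_of_nonneg_left (real_inner_le_norm x y) hc
        _ ≤ _ := by gcongr
    have key2 : ∀ y : H, ∀ c : ℝ, 0 ≤ c → - (c * inner ℝ x y) ≤ c * (‖x‖ * ‖y‖) := by
      intro y c hc
      have := (abs_le.1 (abs_real_inner_le_norm x y)).1
      nlinarith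
    have k1 := key (ι (u1 (t / 16))) ((1 - t / T) * (1 / 16)) (by nlinarith) (1 / 16) (by nlinarith)
    have k2 := key (ι (u1 (t / 16 + 15 / 16 * T))) ((t / T) * (1 / 16)) (by nlinarith) (1 / 16) (by nlinarith)
    have k3 := key2 (ι (u (t / 16))) T⁻¹ (by positivity)
    have k4 := key (ι (u (t / 16 + 15 / 16 * T))) T⁻¹ (by positivity) T⁻¹ le_rfl
    linarith
  have pv : ∀ t, ‖v t‖ ^ 2 ≤ 3 * ‖u t‖ ^ 2 + (3 * (1 - t / T) ^ 2) * ‖u (t / 16)‖ ^ 2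
      + (3 * (t / T) ^ 2) * ‖u (t / 16 + 15 / 16 * T)‖ ^ 2 := by
    intro t
    have h : ‖v t‖ ≤ ‖u t‖ + |1 - t / T| * ‖u (t / 16)‖ + |t / T| * ‖u (t / 16 + 15 / 16 * T)‖ := by
      have h1 := norm_sub_le (u t - (1 - t / T) • u (t / 16)) ((t / T) • u (t / 16 + 15 / 16 * T))
      have h2 := norm_sub_le (u t) ((1 - t / T) • u (t / 16))
      rw [norm_smul, norm_eq_abs] at h1 h2
      linarith
    have h' : ‖v t‖ ^ 2 ≤ (‖u t‖ + |1 - t / T| * ‖u (t / 16)‖ + |t / T| * ‖u (t / 16 + 15 / 16 * T)‖) ^ 2 := by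
      gcongr
    rw [← sq_abs (1 - t / T), ← sq_abs (t / T)]
    nlinarith [sq_nonneg (‖u t‖ - |1 - t / T| * ‖u (t / 16)‖),
      sq_nonneg (‖u t‖ - |t / T| * ‖u (t / 16 + 15 / 16 * T)‖),
      sq_nonneg (|1 - t / T| * ‖u (t / 16)‖ - |t / T| * ‖u (t / 16 + 15 / 16 * T)‖)]
  have pw2 : ∀ t ∈ Icc 0 T, - inner ℝ (ι (u2 t)) (ι (v t)) ≤ ‖W t‖ ^ 2 / 2
      + 3 / 2 * (‖u t‖ ^ 2 + ‖u (t / 16)‖ ^ 2 + ‖u (t / 16 + 15 / 16 * T)‖ ^ 2) := by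
    intro t ht
    rw [hW t ht]
    have h1 : -(W t (v t)) ≤ ‖W t‖ * ‖v t‖ := (neg_le_abs _).trans ((W t).le_opNorm (v t))
    have t0 : 0 ≤ t / T := div_nonneg ht.1 hT.le
    have t1 : t / T ≤ 1 := (div_le_one hT).2 ht.2
    have h2 := pv t
    have h3 : (3 * (1 - t / T) ^ 2) * ‖u (t / 16)‖ ^ 2 ≤ 3 * ‖u (t / 16)‖ ^ 2 := by
      gcongr; nlinarith
    have h4 : (3 * (t / T) ^ 2) * ‖u (t / 16 + 15 / 16 * T)‖ ^ 2 ≤ 3 * ‖u (t / 16 + 15 / 16 * T)‖ ^ 2 := by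
      gcongr; nlinarith
    nlinarith [sq_nonneg (‖W t‖ - ‖v t‖)]
  -- integrate
  have cx : Continuous fun t => ‖ι (u1 t)‖ ^ 2 := by fun_prop
  have cx0 : Continuous fun t => ‖ι (u1 (t / 16))‖ ^ 2 := by fun_prop
  have cx1 : Continuous fun t => ‖ι (u1 (t / 16 + 15 / 16 * T))‖ ^ 2 := by fun_prop
  have cn : Continuous fun t => ‖ι (u t)‖ ^ 2 := by fun_prop
  have cn0 : Continuous fun t => ‖ι (u (t / 16))‖ ^ 2 := by fun_prop
  have cn1 : Continuous fun t => ‖ι (u (t / 16 + 15 / 16 * T))‖ ^ 2 := by fun_prop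
  have cm : Continuous fun t => ‖u t‖ ^ 2 := by fun_prop
  have cm0 : Continuous fun t => ‖u (t / 16)‖ ^ 2 := by fun_prop
  have cm1 : Continuous fun t => ‖u (t / 16 + 15 / 16 * T)‖ ^ 2 := by fun_prop
  have cW : Continuous fun t => ‖W t‖ ^ 2 := by fun_prop
  have ci : Continuous fun t => (inner ℝ (ι (u1 t)) (ι (v1 t)) : ℝ) := by fun_prop
  have ci2 : Continuous fun t => (inner ℝ (ι (u2 t)) (ι (v t)) : ℝ) := by fun_prop
  have ii : ∀ {f : ℝ → ℝ}, Continuous f → IntervalIntegrable f volume 0 T :=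
    fun h => h.intervalIntegrable _ _
  have I1 := intervalIntegral.integral_mono_on (μ := volume) hT.le (ii (cx.div_const 2))
    (ii ((ci.add ((cx0.add cx1).div_const 128)).add
      ((cn0.add cn1).const_mul (2 * T⁻¹ ^ 2)))) pw
  have I2 := intervalIntegral.integral_mono_on (μ := volume) hT.le (ii ci2.neg)
    (ii ((cW.div_const 2).add (((cm.add cm0).add cm1).const_mul (3 / 2)))) pw2
  simp only [Pi.add_apply, Pi.neg_apply] at I1 I2
  rw [intervalIntegral.integral_add, intervalIntegral.integral_add,
    intervalIntegral.integral_div, intervalIntegral.integral_div,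
    intervalIntegral.integral_const_mul, intervalIntegral.integral_add,
    intervalIntegral.integral_add, parts] at I1
  rotate_left
  all_goals try exact ii (by fun_prop)
  rw [intervalIntegral.integral_add, intervalIntegral.integral_div,
    intervalIntegral.integral_const_mul, intervalIntegral.integral_add,
    intervalIntegral.integral_add, intervalIntegral.integral_neg] at I2
  rotate_left
  all_goals try exact ii (by fun_prop)
  have b0 := integral_comp_div_sixteen_le hT cx (fun _ => by positivity)
  have b1 := integral_comp_div_sixteen_add_le hT cx (fun _ => by positivity)
  have b2 := integral_comp_div_sixteen_le hT cn (fun _ => by positivity)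
  have b3 := integral_comp_div_sixteen_add_le hT cn (fun _ => by positivity)
  have b4 := integral_comp_div_sixteen_le hT cm (fun _ => by positivity)
  have b5 := integral_comp_div_sixteen_add_le hT cm (fun _ => by positivity)
  have b6 : ∫ t in (0 : ℝ)..T, ‖ι (u t)‖ ^ 2 ≤ ‖ι‖ ^ 2 * ∫ t in (0 : ℝ)..T, ‖u t‖ ^ 2 := by
    rw [← intervalIntegral.integral_const_mul]
    refine intervalIntegral.integral_mono_on hT.le (ii cn) (ii (cm.const_mul _)) fun t _ => ?_
    rw [← mul_pow]
    gcongr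
    exact ι.le_opNorm _
  set I := ∫ t in (0 : ℝ)..T, ‖ι (u1 t)‖ ^ 2
  set M := ∫ t in (0 : ℝ)..T, ‖u t‖ ^ 2
  set N := ∫ t in (0 : ℝ)..T, ‖ι (u t)‖ ^ 2
  set Q := ∫ t in (0 : ℝ)..T, ‖W t‖ ^ 2
  have hM : 0 ≤ M := intervalIntegral.integral_nonneg hT.le fun t _ => by positivity
  have f1 : 2 * T⁻¹ ^ 2 * ((∫ t in (0 : ℝ)..T, ‖ι (u (t / 16))‖ ^ 2)
      + ∫ t in (0 : ℝ)..T, ‖ι (u (t / 16 + 15 / 16 * T))‖ ^ 2) ≤ 2 * T⁻¹ ^ 2 * (32 * (‖ι‖ ^ 2 * M)) := by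
    gcongr
    linarith
  have f2 : 2 * T⁻¹ ^ 2 * (32 * (‖ι‖ ^ 2 * M)) = 64 * ‖ι‖ ^ 2 / T ^ 2 * M := by
    field_simp
    ring
  have f3 : (200 + 256 * ‖ι‖ ^ 2 / T ^ 2) * M = 200 * M + 4 * (64 * ‖ι‖ ^ 2 / T ^ 2 * M) := by ring
  rw [f3]
  linarith

/-! ### Smoothing in time on a bounded interval -/

/-- A bump function supported in `(0, 1)`. -/
def unitBump : ContDiffBump (1 / 2 : ℝ) := ⟨1 / 8, 1 / 4, by norm_num, by norm_num⟩

/-- A mollifier supported in `(-a, 0)`. -/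
def backKernel (a x : ℝ) : ℝ := a⁻¹ * unitBump.normed volume (-x / a)

theorem contDiff_backKernel (a : ℝ) : ContDiff ℝ (⊤ : ℕ∞) (backKernel a) :=
  contDiff_const.mul (unitBump.contDiff_normed.comp (contDiff_neg.div_const a))

theorem backKernel_nonneg {a : ℝ} (ha : 0 < a) (x : ℝ) : 0 ≤ backKernel a x :=
  mul_nonneg (inv_nonneg.2 ha.le) (unitBump.nonneg_normed _)

theorem mem_of_backKernel_ne_zero {a : ℝ} (ha : 0 < a) {x : ℝ} (hx : backKernel a x ≠ 0) :
    x ∈ Icc (-(3 / 4) * a) (-(1 / 4) * a) := by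
  have h : -x / a ∈ Function.support (unitBump.normed (volume : Measure ℝ)) := by
    intro h
    exact hx (by rw [backKernel, h, mul_zero])
  rw [unitBump.support_normed_eq, Real.ball_eq_Ioo] at h
  have h1 : 1 / 4 < -x / a := by
    have := h.1; simp only [unitBump] at this; linarith
  have h2 : -x / a < 3 / 4 := by
    have := h.2; simp only [unitBump] at this; linarith
  rw [lt_div_iff₀ ha] at h1
  rw [div_lt_iff₀ ha] at h2
  constructor <;> linarith

theorem tsupport_backKernel {a : ℝ} (ha : 0 < a) :
    tsupport (backKernel a) ⊆ Icc (-(3 / 4) * a) (-(1 / 4) * a) :=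
  closure_minimal (fun _ hx => mem_of_backKernel_ne_zero ha hx) isClosed_Icc

theorem hasCompactSupport_backKernel {a : ℝ} (ha : 0 < a) : HasCompactSupport (backKernel a) :=
  isCompact_Icc.of_isClosed_subset (isClosed_tsupport _) (tsupport_backKernel ha)

theorem integral_backKernel {a : ℝ} (ha : 0 < a) : ∫ x, backKernel a x = 1 := by
  have h : ∀ x, backKernel a x = a⁻¹ * unitBump.normed volume (x * (-a)⁻¹) := fun x => by
    have : -x / a = x * (-a)⁻¹ := by rw [inv_neg, div_eq_mul_inv, neg_mul, mul_neg]
    rw [backKernel, this]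
  simp only [h]
  rw [integral_const_mul, Measure.integral_comp_mul_right, unitBump.integral_normed]
  rw [inv_inv, abs_neg, abs_of_pos ha, smul_eq_mul, mul_one, inv_mul_cancel₀ ha.ne']

theorem lintegral_backKernel_comp {a r : ℝ} (ha : 0 < a) (hr : r ≠ 0) (b : ℝ) :
    ∫⁻ x, ofReal (backKernel a (r * x + b)) = ofReal |r⁻¹| := by
  have hint : Integrable (backKernel a) :=
    (contDiff_backKernel a).continuous.integrable_of_hasCompactSupport (hasCompactSupport_backKernel ha)
  rw [← ofReal_integral_eq_lintegral_ofReal]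
  · have := Measure.integral_comp_mul_left (fun y => backKernel a (y + b)) r
    rw [integral_add_right_eq_self (fun y => backKernel a y), integral_backKernel ha] at this
    rw [this]; simp
  · exact (hint.comp_add_right b).comp_mul_left' hr
  · exact Eventually.of_forall fun x => backKernel_nonneg ha _

section

variable {T : ℝ}

/-- The convolution over `(0, T)`. -/
def timeConv (T : ℝ) (k : ℝ → ℝ) (w : ℝ → X) (x : ℝ) : X := ∫ s in Ioo 0 T, k (x - s) • w s

theorem integrable_timeConv {k : ℝ → ℝ} (hk : Continuous k) (hc : HasCompactSupport k) {w : ℝ → X}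
    (hw : Integrable w (tim T)) (x : ℝ) : Integrable (fun s => k (x - s) • w s) (tim T) := by
  obtain ⟨C, hC⟩ := hc.exists_bound_of_continuous hk
  exact hw.bdd_smul C (hk.comp (continuous_const.sub continuous_id)).aestronglyMeasurable
    (.of_forall fun s => hC _)

theorem hasDerivAt_timeConv {k : ℝ → ℝ} (hk : ContDiff ℝ (⊤ : ℕ∞) k) (hc : HasCompactSupport k)
    {w : ℝ → X} (hw : Integrable w (tim T)) (x : ℝ) :
    HasDerivAt (timeConv T k w) (timeConv T (deriv k) w x) x := by
  have hdc : Continuous (deriv k) := hk.continuous_deriv (by simp)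
  obtain ⟨C, hC⟩ := (hc.deriv).exists_bound_of_continuous hdc
  refine (hasDerivAt_integral_of_dominated_loc_of_deriv_le (bound := fun s => C * ‖w s‖)
    (F := fun x s => k (x - s) • w s) (F' := fun x s => deriv k (x - s) • w s) (s := univ)
    univ_mem ?_ (integrable_timeConv hk.continuous hc hw x) ?_ ?_ (hw.norm.const_mul C) ?_).2
  · exact Eventually.of_forall fun y => (integrable_timeConv hk.continuous hc hw y).1
  · exact (integrable_timeConv hdc hc.deriv hw x).1
  · refine Eventually.of_forall fun s y _ => ?_
    rw [norm_smul]
    exact mul_le_mul_of_nonneg_right (hC _) (norm_nonneg _)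
  · refine Eventually.of_forall fun s y _ => ?_
    have h1 : HasDerivAt (fun y => k (y - s)) (deriv k (y - s)) y := by
      have := ((hk.differentiable (by simp)) (y - s)).hasDerivAt
      exact this.comp_sub_const y s
    exact h1.smul_const (w s)

theorem continuous_timeConv {k : ℝ → ℝ} (hk : ContDiff ℝ (⊤ : ℕ∞) k) (hc : HasCompactSupport k)
    {w : ℝ → X} (hw : Integrable w (tim T)) : Continuous (timeConv T k w) :=
  continuous_iff_continuousAt.2 fun x => (hasDerivAt_timeConv hk hc hw x).continuousAt

/-- The scales `1 / (n + 2)`. -/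
def scale (n : ℕ) : ℝ := 1 / ((n : ℝ) + 2)

theorem scale_pos (n : ℕ) : 0 < scale n := by unfold scale; positivity

theorem scale_le (n : ℕ) : scale n ≤ 1 / 2 := by
  unfold scale
  exact one_div_le_one_div_of_le (by norm_num) (by linarith [(Nat.cast_nonneg n : (0 : ℝ) ≤ n)])

theorem tendsto_scale : Tendsto scale atTop (𝓝 0) := by
  unfold scale
  have h : Tendsto (fun n : ℕ => (n : ℝ) + 2) atTop atTop :=
    tendsto_atTop_add_const_right _ _ tendsto_natCast_atTop_atTop
  simp only [one_div]
  exact h.inv_tendsto_atTop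

/-- The smoothing operators on `(0, T)`. -/
def smooth (T : ℝ) (n : ℕ) (w : ℝ → X) (t : ℝ) : X :=
  timeConv T (backKernel (scale n * T)) w ((1 - scale n) * t)

theorem ioo_of_backKernel_ne_zero (hT : 0 < T) {t s : ℝ} (ht : t ∈ Icc 0 T)
    (h : (1 - scale n) * t - s ∈ Icc (-(3 / 4) * (scale n * T)) (-(1 / 4) * (scale n * T))) :
    s ∈ Ioo 0 T := by
  have h1 := h.1
  have h2 := h.2
  have e0 := scale_pos n
  have e1 := scale_le n
  have p := mul_pos e0 hT
  constructor
  · have : 0 ≤ (1 - scale n) * t := mul_nonneg (by linarith) ht.1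
    linarith
  · have : (1 - scale n) * t ≤ (1 - scale n) * T := mul_le_mul_of_nonneg_left ht.2 (by linarith)
    nlinarith

theorem lintegral_smooth_kernel (hT : 0 < T) {t : ℝ} (ht : t ∈ Icc 0 T) :
    ∫⁻ s in Ioo 0 T, ofReal (backKernel (scale n * T) ((1 - scale n) * t - s)) = 1 := by
  have hp := mul_pos (scale_pos n) hT
  have h := lintegral_backKernel_comp hp (r := -1) (by norm_num) ((1 - scale n) * t)
  have e : ∀ x, (-1 : ℝ) * x + (1 - scale n) * t = (1 - scale n) * t - x := fun x => by ring
  simp only [e] at h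
  rw [← lintegral_indicator measurableSet_Ioo]
  simp only [inv_neg, inv_one, abs_neg, abs_one, ofReal_one] at h
  rw [← h]
  refine lintegral_congr fun s => ?_
  by_cases hs : s ∈ Ioo 0 T
  · rw [indicator_of_mem hs]
  · rw [indicator_of_notMem hs]
    by_contra hne
    refine hs (ioo_of_backKernel_ne_zero hT ht (mem_of_backKernel_ne_zero hp fun h0 => hne ?_))
    rw [h0, ENNReal.ofReal_zero]

theorem lintegral_smooth_kernel_le (hT : 0 < T) (n : ℕ) (s : ℝ) :
    ∫⁻ t in Ioo 0 T, ofReal (backKernel (scale n * T) ((1 - scale n) * t - s)) ∂tim T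
      ≤ 2 := by
  have hp := mul_pos (scale_pos n) hT
  have e1 := scale_le n
  calc _ ≤ ∫⁻ t, ofReal (backKernel (scale n * T) ((1 - scale n) * t - s)) :=
        lintegral_mono' (Measure.restrict_le_self.trans Measure.restrict_le_self) le_rfl
    _ = ofReal |(1 - scale n)⁻¹| :=
        lintegral_backKernel_comp hp (by linarith : (0 : ℝ) < 1 - scale n).ne' (-s)
    _ ≤ 2 := by
        rw [abs_of_nonneg (inv_nonneg.2 (by linarith))]
        have : (1 - scale n)⁻¹ ≤ 2 := by rw [inv_le_comm₀ (by linarith) (by norm_num)]; linarith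
        calc _ ≤ ofReal 2 := ofReal_le_ofReal this
          _ = 2 := by norm_num

theorem continuous_smooth_kernel (n : ℕ) : Continuous (Function.uncurry fun t s : ℝ =>
    backKernel (scale n * T) ((1 - scale n) * t - s)) :=
  (contDiff_backKernel _).continuous.comp (by fun_prop)

theorem eLpNorm_smooth_le (hT : 0 < T) (n : ℕ) {w : ℝ → X} (hw : AEStronglyMeasurable w (tim T)) :
    eLpNorm (smooth T n w) 2 (tim T) ≤ 2 ^ (1 / 2 : ℝ) * eLpNorm w 2 (tim T) := by
  have h := eLpNorm_kernel_le (ν := tim T) (S := Ioo 0 T) (C := 2) (continuous_smooth_kernel (T := T) n)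
    (fun t s => backKernel_nonneg (mul_pos (scale_pos n) hT) _) measurableSet_Ioo
    (fun t ht => (lintegral_smooth_kernel hT (Ioo_subset_Icc_self ht)).le)
    (lintegral_smooth_kernel_le hT n) hw
  rwa [Measure.restrict_restrict measurableSet_Ioo, inter_self] at h

theorem tendsto_smooth [CompleteSpace X] (hT : 0 < T) {w : ℝ → X} (hw : MemLp w 2 (tim T)) :
    Tendsto (fun n => eLpNorm (fun t => smooth T n w t - w t) 2 (tim T)) atTop (𝓝 0) := by
  have h := tendsto_kernel (ν := tim T) (S := Ioo 0 T) (C := 2)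
    (k := fun n t s => backKernel (scale n * T) ((1 - scale n) * t - s))
    (r := fun n => 2 * (scale n * T)) (fun n => continuous_smooth_kernel (T := T) n)
    (fun n t s => backKernel_nonneg (mul_pos (scale_pos n) hT) _) measurableSet_Ioo
    (measure_ne_top _ _)
    (fun n t ht => lintegral_smooth_kernel hT (Ioo_subset_Icc_self ht)) (by norm_num)
    (lintegral_smooth_kernel_le hT) ?_ ?_ ?_ hw
  · rwa [Measure.restrict_restrict measurableSet_Ioo, inter_self] at h
  · intro n t
    exact (hasCompactSupport_backKernel (mul_pos (scale_pos n) hT)).comp_homeomorph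
      (Homeomorph.subLeft ((1 - scale n) * t))
  · intro n t ht s hr
    by_contra hne
    have hm := mem_of_backKernel_ne_zero (mul_pos (scale_pos n) hT) hne
    have e0 := scale_pos n
    have p := mul_pos e0 hT
    have q1 : scale n * t ≤ scale n * T := mul_le_mul_of_nonneg_left ht.2.le e0.le
    have q2 : 0 ≤ scale n * t := mul_nonneg e0.le ht.1.le
    have : dist t s < 2 * (scale n * T) := by
      rw [dist_eq, abs_lt]
      constructor
      · linarith [hm.1]
      · linarith [hm.2]
    exact absurd hr (not_le.2 this)
  · have := (tendsto_scale.mul_const T).const_mul 2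
    simpa using this

theorem timeConv_deriv_of_weakTime (hT : 0 < T) {q : Lp X 2 (tim T) × Lp X 2 (tim T)}
    (hq : q ∈ weakTime X T 2) (n : ℕ) {t : ℝ} (ht : t ∈ Icc 0 T) :
    timeConv T (deriv (backKernel (scale n * T))) q.1 ((1 - scale n) * t) = smooth T n q.2 t := by
  have hp := mul_pos (scale_pos n) hT
  set k := backKernel (scale n * T) with hk
  have h := hq (fun s => k ((1 - scale n) * t - s))
    ((contDiff_backKernel _).comp (contDiff_const.sub contDiff_id))
    ((hasCompactSupport_backKernel hp).comp_homeomorph (Homeomorph.subLeft ((1 - scale n) * t))) ?_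
  · have e : ∀ s, deriv (fun s => k ((1 - scale n) * t - s)) s = - deriv k ((1 - scale n) * t - s) :=
      fun s => by rw [deriv_comp_const_sub]
    simp only [e, neg_smul, integral_neg, neg_inj] at h
    exact h
  · intro s hs
    have := tsupport_comp_subset_preimage k (f := fun s => (1 - scale n) * t - s)
      (by fun_prop) hs
    exact ioo_of_backKernel_ne_zero hT ht (tsupport_backKernel hp this)

theorem continuous_smooth (hT : 0 < T) (n : ℕ) {w : ℝ → X} (hw : Integrable w (tim T)) :
    Continuous (smooth T n w) := (continuous_timeConv (contDiff_backKernel _)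
    (hasCompactSupport_backKernel (mul_pos (scale_pos n) hT)) hw).comp (continuous_const.mul continuous_id)

theorem hasDerivAt_smooth (hT : 0 < T) (n : ℕ) {w : ℝ → X} (hw : Integrable w (tim T)) (t : ℝ) :
    HasDerivAt (smooth T n w) ((1 - scale n) •
      timeConv T (deriv (backKernel (scale n * T))) w ((1 - scale n) * t)) t := by
  have h := hasDerivAt_timeConv (T := T) (contDiff_backKernel _)
    (hasCompactSupport_backKernel (mul_pos (scale_pos n) hT)) hw ((1 - scale n) * t)
  have h2 : HasDerivAt (fun t : ℝ => (1 - scale n) * t) (1 - scale n) t := by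
    simpa using (hasDerivAt_id t).const_mul (1 - scale n)
  exact h.scomp t h2

theorem integrable_of_Lp {X : Type*} [NormedAddCommGroup X] {p : ℝ≥0∞} [hp : Fact (1 ≤ p)] (w : Lp X p (tim T)) :
    Integrable w (tim T) := (Lp.memLp w).integrable hp.out

/-! ### `H¹(0,T;X) ⊆ L^∞(0,T;X)` -/

theorem enorm_le_of_hasDerivAt [CompleteSpace X] {u u1 : ℝ → X} (hu : ∀ t, HasDerivAt u (u1 t) t)
    (hu1 : Continuous u1) {t : ℝ} (ht : t ∈ Ioo 0 T) :
    ofReal T * ‖u t‖ₑ ≤ eLpNorm u 1 (tim T) + ofReal T * eLpNorm u1 1 (tim T) := by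
  have cu : Continuous u := continuous_iff_continuousAt.2 fun t => (hu t).continuousAt
  simp only [eLpNorm_one_eq_lintegral_enorm]
  have h : ∀ s ∈ Ioo 0 T, ‖u t‖ₑ ≤ ‖u s‖ₑ + ∫⁻ r in Ioo 0 T, ‖u1 r‖ₑ := by
    intro s hs
    have e : u t = u s + ∫ r in s..t, u1 r := by
      rw [intervalIntegral.integral_eq_sub_of_hasDerivAt (fun r _ => hu r)
        (hu1.intervalIntegrable _ _)]
      abel
    rw [e]
    refine (enorm_add_le _ _).trans ?_
    gcongr
    have : ‖∫ r in s..t, u1 r‖ₑ = ‖∫ r in uIoc s t, u1 r‖ₑ := by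
      rw [enorm_eq_iff_norm_eq, intervalIntegral.norm_intervalIntegral_eq]
    rw [this]
    refine (enorm_integral_le_lintegral_enorm _).trans (lintegral_mono_set ?_)
    intro r hr
    rcases le_total s t with hst | hst
    · rw [uIoc_of_le hst] at hr
      exact ⟨hs.1.trans hr.1, hr.2.trans_lt ht.2⟩
    · rw [uIoc_of_ge hst] at hr
      exact ⟨ht.1.trans hr.1, hr.2.trans_lt hs.2⟩
  have h2 := setLIntegral_mono' (μ := volume) measurableSet_Ioo h
  rw [lintegral_add_right _ measurable_const, setLIntegral_const, setLIntegral_const,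
    Real.volume_Ioo, sub_zero] at h2
  rw [mul_comm, mul_comm (ofReal T)]
  exact h2

theorem exists_eLpNorm_top_le [CompleteSpace X] (hT : 0 < T) : ∃ C : ℝ≥0∞, C ≠ ∞ ∧
    ∀ q ∈ weakTime X T 2, eLpNorm q.1 ∞ (tim T) ≤ C * ‖q‖ₑ := by
  set M : ℝ≥0∞ := tim T univ ^ (1 / 2 : ℝ) with hM
  have hMt : M ≠ ∞ := rpow_ne_top_of_nonneg (by norm_num) (measure_ne_top _ _)
  have hT0 : ofReal T ≠ 0 := by simpa using hT
  refine ⟨(ofReal T)⁻¹ * (2 ^ (1 / 2 : ℝ) * M + ofReal T * (2 ^ (1 / 2 : ℝ) * M)),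
    ?_, fun q hq => ?_⟩
  · refine mul_ne_top (ENNReal.inv_ne_top.2 hT0) (add_ne_top.2
      ⟨mul_ne_top (by simp) hMt, mul_ne_top (by simp)
        (mul_ne_top (by simp) hMt)⟩)
  have i1 := integrable_of_Lp q.1
  have i2 := integrable_of_Lp q.2
  have key : ∀ n, ∀ t ∈ Ioo 0 T, ‖smooth T n q.1 t‖ₑ ≤ (ofReal T)⁻¹ *
      (2 ^ (1 / 2 : ℝ) * M + ofReal T * (2 ^ (1 / 2 : ℝ) * M)) * ‖q‖ₑ := by
    intro n t ht
    have hc : Continuous fun t => (1 - scale n) •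
        timeConv T (deriv (backKernel (scale n * T))) q.1 ((1 - scale n) * t) := by
      have hc := continuous_timeConv (contDiff_infty_iff_deriv.1 (contDiff_backKernel _)).2
        (hasCompactSupport_backKernel (mul_pos (scale_pos n) hT)).deriv i1
      exact (hc.comp (continuous_const.mul continuous_id)).const_smul _
    have h := enorm_le_of_hasDerivAt (hasDerivAt_smooth hT n i1) hc ht
    have hh : ∀ w : Lp X 2 (tim T), ‖w‖ₑ ≤ ‖q‖ₑ → eLpNorm (smooth T n w) 1 (tim T)
        ≤ 2 ^ (1 / 2 : ℝ) * M * ‖q‖ₑ := by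
      intro w hwq
      have iw := integrable_of_Lp w
      have e1 := eLpNorm_le_eLpNorm_mul_rpow_measure_univ (μ := tim T) (p := 1) (q := 2)
        (by norm_num) (f := smooth T n w) (continuous_smooth hT n iw).aestronglyMeasurable
      have e2 := eLpNorm_smooth_le hT n iw.1
      rw [← Lp.enorm_def] at e2
      calc _ ≤ _ := e1
        _ = eLpNorm (smooth T n w) 2 (tim T) * M := by norm_num [hM]
        _ ≤ (2 ^ (1 / 2 : ℝ) * ‖q‖ₑ) * M := by gcongr; exact e2.trans (by gcongr)
        _ = _ := by ring
    have n1 : ‖q.1‖ₑ ≤ ‖q‖ₑ := by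
      rw [← ofReal_norm, ← ofReal_norm]; exact ofReal_le_ofReal (norm_fst_le q)
    have n2 : ‖q.2‖ₑ ≤ ‖q‖ₑ := by
      rw [← ofReal_norm, ← ofReal_norm]; exact ofReal_le_ofReal (norm_snd_le q)
    have b2 : eLpNorm (fun t => (1 - scale n) •
        timeConv T (deriv (backKernel (scale n * T))) q.1 ((1 - scale n) * t)) 1 (tim T)
        ≤ 2 ^ (1 / 2 : ℝ) * M * ‖q‖ₑ := by
      refine le_trans ?_ (hh q.2 n2)
      refine eLpNorm_mono_ae ?_
      filter_upwards [ae_restrict_mem measurableSet_Ioo] with t ht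
      rw [timeConv_deriv_of_weakTime hT hq n (Ioo_subset_Icc_self ht), norm_smul]
      have e0 := scale_pos n
      have e1 := scale_le n
      rw [norm_of_nonneg (by linarith)]
      exact mul_le_of_le_one_left (norm_nonneg _) (by linarith)
    have h' : ofReal T * ‖smooth T n q.1 t‖ₑ
        ≤ (2 ^ (1 / 2 : ℝ) * M + ofReal T * (2 ^ (1 / 2 : ℝ) * M)) * ‖q‖ₑ := by
      refine h.trans ?_
      rw [add_mul, mul_assoc (ofReal T)]
      exact add_le_add (hh q.1 n1) (mul_le_mul_right b2 _)
    calc ‖smooth T n q.1 t‖ₑ = (ofReal T)⁻¹ * (ofReal T * ‖smooth T n q.1 t‖ₑ) := by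
          rw [← mul_assoc, ENNReal.inv_mul_cancel hT0 ofReal_ne_top, one_mul]
      _ ≤ _ := by rw [mul_assoc]; gcongr
  have hlim := tendsto_smooth hT (Lp.memLp q.1)
  obtain ⟨ns, -, hns⟩ := (tendstoInMeasure_of_tendsto_eLpNorm (p := 2) (by norm_num)
    (fun n => (continuous_smooth hT n i1).aestronglyMeasurable) (Lp.memLp q.1).1
    hlim).exists_seq_tendsto_ae
  refine (eLpNorm_exponent_top (f := (q.1 : ℝ → X)) (μ := tim T)).trans_le
    (eLpNormEssSup_le_of_ae_enorm_bound ?_)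
  filter_upwards [hns, ae_restrict_mem measurableSet_Ioo] with t h1 h2
  exact le_of_tendsto ((continuous_enorm.tendsto _).comp h1)
    (.of_forall fun i => key (ns i) t h2)

/-- The embedding `H¹(0,T;X) → L^∞(0,T;X)`. -/
theorem exists_embedding_top [CompleteSpace X] (hT : 0 < T) :
    ∃ L : weakTime X T 2 →L[ℝ] Lp X ∞ (tim T), ∀ q, L q =ᵐ[tim T] q.1.1 := by
  obtain ⟨C, hC, h⟩ := exists_eLpNorm_top_le (X := X) hT
  have hm : ∀ q : weakTime X T 2, MemLp q.1.1 ∞ (tim T) := fun q =>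
    ⟨(Lp.memLp q.1.1).1, (h q.1 q.2).trans_lt
      (ENNReal.mul_lt_top hC.lt_top enorm_lt_top)⟩
  let L0 : weakTime X T 2 →ₗ[ℝ] Lp X ∞ (tim T) :=
    { toFun := fun q => (hm q).toLp _
      map_add' := fun q r => by
        rw [← MemLp.toLp_add]
        exact MemLp.toLp_congr _ _ (Lp.coeFn_add q.1.1 r.1.1)
      map_smul' := fun c q => by
        rw [RingHom.id_apply, ← MemLp.toLp_const_smul]
        exact MemLp.toLp_congr _ _ (Lp.coeFn_smul c q.1.1) }
  refine ⟨L0.mkContinuous C.toReal fun q => ?_, fun q => (hm q).coeFn_toLp⟩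
  have := h q.1 q.2
  change ‖(hm q).toLp _‖ ≤ _
  rw [Lp.norm_toLp]
  calc _ ≤ (C * ‖q.1‖ₑ).toReal := toReal_mono (mul_ne_top hC enorm_ne_top) this
    _ = _ := by rw [toReal_mul, toReal_enorm]; rfl

end

/-! ### The first time derivative of a plate function -/

section

variable {X : Type*} [NormedAddCommGroup X] {T : ℝ}

theorem memLp_of_continuous {f : ℝ → X} (hf : Continuous f) (p : ℝ≥0∞) : MemLp f p (tim T) := by
  obtain ⟨C, hC⟩ := (isCompact_Icc (a := (0 : ℝ)) (b := T)).exists_bound_of_continuousOn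
    hf.continuousOn
  refine MemLp.of_bound hf.aestronglyMeasurable C ?_
  filter_upwards [ae_restrict_mem measurableSet_Ioo] with t ht
  exact hC t (Ioo_subset_Icc_self ht)

/-- A continuous function as an element of `L²(0,T;X)`. -/
def contLp (T : ℝ) (f : ℝ → X) (hf : Continuous f) : Lp X 2 (tim T) :=
  (memLp_of_continuous hf 2).toLp f

theorem coeFn_contLp {f : ℝ → X} (hf : Continuous f) : contLp T f hf =ᵐ[tim T] f :=
  MemLp.coeFn_toLp _

theorem norm_sq_Lp_two {α : Type*} [MeasurableSpace α] {μ : Measure α} (f : Lp X 2 μ) :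
    ‖f‖ ^ 2 = ∫ t, ‖f t‖ ^ 2 ∂μ := by
  have h := eLpNorm_two_sq μ (f : α → X)
  rw [← Lp.enorm_def] at h
  have hm : AEStronglyMeasurable (fun t => ‖f t‖ ^ 2) μ := (Lp.aestronglyMeasurable f).norm.pow 2
  rw [integral_eq_lintegral_of_nonneg_ae (.of_forall fun t => by positivity) hm]
  have e : ∀ t, ofReal (‖f t‖ ^ 2) = ‖f t‖ₑ ^ 2 := fun t => by
    rw [ofReal_pow (norm_nonneg _), ofReal_norm]
  simp only [e]
  rw [← h, ENNReal.toReal_pow, toReal_enorm]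

theorem norm_sq_contLp (hT : 0 < T) {f : ℝ → X} (hf : Continuous f) :
    ‖contLp T f hf‖ ^ 2 = ∫ t in (0 : ℝ)..T, ‖f t‖ ^ 2 := by
  rw [norm_sq_Lp_two, intervalIntegral.integral_of_le hT.le, integral_Ioc_eq_integral_Ioo]
  refine integral_congr_ae ?_
  filter_upwards [coeFn_contLp (T := T) hf] with t ht
  rw [ht]

variable [NormedSpace ℝ X]

theorem tendsto_contLp_smooth [CompleteSpace X] (hT : 0 < T) (w : Lp X 2 (tim T)) :
    Tendsto (fun n => contLp T (smooth T n w) (continuous_smooth hT n (integrable_of_Lp w)))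
      atTop (𝓝 w) := by
  rw [tendsto_iff_edist_tendsto_0]
  refine (tendsto_smooth hT (Lp.memLp w)).congr fun n => ?_
  rw [Lp.edist_def]
  refine eLpNorm_congr_ae ?_
  filter_upwards [coeFn_contLp (T := T) (continuous_smooth hT n (integrable_of_Lp w))] with t ht
  simp only [Pi.sub_apply, ht]

theorem timeConv_add {k : ℝ → ℝ} (hk : Continuous k) (hc : HasCompactSupport k)
    (w w' : Lp X 2 (tim T)) (x : ℝ) :
    timeConv T k (w + w' : Lp X 2 (tim T)) x = timeConv T k w x + timeConv T k w' x := by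
  unfold timeConv
  rw [← integral_add (integrable_timeConv hk hc (integrable_of_Lp w) x)
    (integrable_timeConv hk hc (integrable_of_Lp w') x)]
  refine integral_congr_ae ?_
  filter_upwards [Lp.coeFn_add w w'] with s hs
  rw [hs, Pi.add_apply, smul_add]

theorem timeConv_smul {k : ℝ → ℝ} (c : ℝ) (w : Lp X 2 (tim T)) (x : ℝ) :
    timeConv T k (c • w : Lp X 2 (tim T)) x = c • timeConv T k w x := by
  unfold timeConv
  rw [← integral_smul]
  refine integral_congr_ae ?_
  filter_upwards [Lp.coeFn_smul c w] with s hs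
  rw [hs, Pi.smul_apply, smul_comm]

theorem timeConv_compLp [CompleteSpace X] [CompleteSpace Y] {k : ℝ → ℝ}
    (hk : Continuous k) (hc : HasCompactSupport k) (A : X →L[ℝ] Y) (w : Lp X 2 (tim T)) (x : ℝ) :
    timeConv T k (A.compLpL 2 (tim T) w) x = A (timeConv T k w x) := by
  unfold timeConv
  rw [← A.integral_comp_comm (integrable_timeConv hk hc (integrable_of_Lp w) x)]
  refine integral_congr_ae ?_
  filter_upwards [A.coeFn_compLpL w] with s hs
  rw [hs, map_smul]

end

section

variable {H : Type*}
  [NormedAddCommGroup H] [InnerProductSpace ℝ H] (ι : V →L[ℝ] H) {T : ℝ}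

/-- The derivative kernel at scale `n`. -/
def derivKernel (T : ℝ) (n : ℕ) : ℝ → ℝ := deriv (backKernel (scale n * T))

theorem contDiff_derivKernel (T : ℝ) (n : ℕ) : ContDiff ℝ (⊤ : ℕ∞) (derivKernel T n) :=
  (contDiff_infty_iff_deriv.1 (contDiff_backKernel _)).2

theorem hasCompactSupport_derivKernel (hT : 0 < T) (n : ℕ) : HasCompactSupport (derivKernel T n) :=
  (hasCompactSupport_backKernel (mul_pos (scale_pos n) hT)).deriv

/-- The time derivative of the smoothed function. -/
def smoothDeriv (T : ℝ) (n : ℕ) (w : ℝ → V) (t : ℝ) : V :=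
  (1 - scale n) • timeConv T (derivKernel T n) w ((1 - scale n) * t)

/-- The second time derivative of the smoothed function. -/
def smoothDeriv2 (T : ℝ) (n : ℕ) (w : ℝ → V) (t : ℝ) : V :=
  (1 - scale n) • (1 - scale n) • timeConv T (deriv (derivKernel T n)) w ((1 - scale n) * t)

theorem hasDerivAt_smoothDeriv (hT : 0 < T) (n : ℕ) {w : ℝ → V} (hw : Integrable w (tim T)) (t : ℝ) :
    HasDerivAt (smoothDeriv T n w) (smoothDeriv2 T n w t) t := by
  have h := hasDerivAt_timeConv (T := T) (contDiff_derivKernel T n)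
    (hasCompactSupport_derivKernel hT n) hw ((1 - scale n) * t)
  have h2 : HasDerivAt (fun t : ℝ => (1 - scale n) * t) (1 - scale n) t := by
    simpa using (hasDerivAt_id t).const_mul (1 - scale n)
  exact (h.scomp t h2).const_smul _

theorem continuous_smoothDeriv (hT : 0 < T) (n : ℕ) {w : ℝ → V} (hw : Integrable w (tim T)) :
    Continuous (smoothDeriv T n w) :=
  continuous_iff_continuousAt.2 fun t => (hasDerivAt_smoothDeriv hT n hw t).continuousAt

theorem continuous_smoothDeriv2 (hT : 0 < T) (n : ℕ) {w : ℝ → V} (hw : Integrable w (tim T)) :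
    Continuous (smoothDeriv2 T n w) := by
  have hc := continuous_timeConv (contDiff_infty_iff_deriv.1 (contDiff_derivKernel T n)).2
    (hasCompactSupport_derivKernel hT n).deriv hw
  exact ((hc.comp (continuous_const.mul continuous_id)).const_smul _).const_smul _

/-- The functional `v ↦ ⟨h, ι v⟩`. -/
def dualMap : H →L[ℝ] V →L[ℝ] ℝ := ((ContinuousLinearMap.compL ℝ V H ℝ).flip ι).comp (innerSL ℝ)

theorem dualMap_apply (h : H) (v : V) : dualMap ι h v = inner ℝ h (ι v) := rfl

variable {ι}

theorem dual_smoothDeriv [CompleteSpace V] (hT : 0 < T) (n : ℕ) {q : Lp V 2 (tim T) × Lp (V →L[ℝ] ℝ) 2 (tim T) ×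
      Lp (V →L[ℝ] ℝ) 2 (tim T)} (hq : q ∈ timeSpaceB ((dualMap ι).comp ι) T) {t : ℝ}
    (ht : t ∈ Icc 0 T) :
    dualMap ι (ι (smoothDeriv T n q.1 t)) = (1 - scale n) • smooth T n q.2.1 t := by
  have h := timeConv_deriv_of_weakTime hT hq.1 n ht
  have h' := timeConv_compLp ((contDiff_derivKernel T n).continuous)
    (hasCompactSupport_derivKernel hT n) ((dualMap ι).comp ι) q.1 ((1 - scale n) * t)
  have h2 : smooth T n q.2.1 t = dualMap ι (ι (timeConv T (derivKernel T n) q.1 ((1 - scale n) * t))) :=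
    h.symm.trans h'
  rw [h2, smoothDeriv, map_smul, map_smul]

theorem dual_smoothDeriv2 [CompleteSpace V] (hT : 0 < T) (n : ℕ) {q : Lp V 2 (tim T) × Lp (V →L[ℝ] ℝ) 2 (tim T) ×
      Lp (V →L[ℝ] ℝ) 2 (tim T)} (hq : q ∈ timeSpaceB ((dualMap ι).comp ι) T) {t : ℝ}
    (ht : t ∈ Ioo 0 T) : dualMap ι (ι (smoothDeriv2 T n q.1 t)) =
      ((1 - scale n) * (1 - scale n)) • smooth T n q.2.2 t := by
  have h1 : HasDerivAt (fun t => dualMap ι (ι (smoothDeriv T n q.1 t)))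
      (dualMap ι (ι (smoothDeriv2 T n q.1 t))) t :=
    (dualMap ι).hasFDerivAt.comp_hasDerivAt t (ι.hasFDerivAt.comp_hasDerivAt t
      (hasDerivAt_smoothDeriv hT n (integrable_of_Lp q.1) t))
  have h2 := (hasDerivAt_smooth hT n (integrable_of_Lp q.2.1) t).const_smul (1 - scale n)
  have h3 : (fun t => dualMap ι (ι (smoothDeriv T n q.1 t))) =ᶠ[𝓝 t]
      fun t => (1 - scale n) • smooth T n q.2.1 t := by
    filter_upwards [isOpen_Ioo.mem_nhds ht] with s hs
    exact dual_smoothDeriv hT n hq (Ioo_subset_Icc_self hs)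
  have h4 := h1.unique (h2.congr_of_eventuallyEq h3)
  rw [h4, timeConv_deriv_of_weakTime hT hq.2 n (Ioo_subset_Icc_self ht), smul_smul]

theorem eq_on_Icc_of_eq_on_Ioo {Y : Type*} [TopologicalSpace Y] [T2Space Y] (hT : 0 < T) {f g : ℝ → Y}
    (hf : Continuous f) (hg : Continuous g) (h : ∀ t ∈ Ioo 0 T, f t = g t) :
    ∀ t ∈ Icc 0 T, f t = g t := by
  rw [← closure_Ioo hT.ne]
  exact fun t ht => EqOn.closure (fun s hs => h s hs) hf hg ht

theorem smoothDeriv_add (hT : 0 < T) (n : ℕ) (w w' : Lp V 2 (tim T)) (t : ℝ) :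
    smoothDeriv T n (w + w' : Lp V 2 (tim T)) t = smoothDeriv T n w t + smoothDeriv T n w' t := by
  unfold smoothDeriv
  rw [timeConv_add (contDiff_derivKernel T n).continuous (hasCompactSupport_derivKernel hT n),
    smul_add]

theorem smoothDeriv_smul (n : ℕ) (c : ℝ) (w : Lp V 2 (tim T)) (t : ℝ) :
    smoothDeriv T n (c • w : Lp V 2 (tim T)) t = c • smoothDeriv T n w t := by
  unfold smoothDeriv
  rw [timeConv_smul, smul_comm]

variable (ι) in
/-- The map `w ↦ ι (w_n)_t`, with `w_n` the smoothed function. -/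
def smoothDerivL (hT : 0 < T) (n : ℕ) : Lp V 2 (tim T) →ₗ[ℝ] Lp H 2 (tim T) where
  toFun w := contLp T (fun t => ι (smoothDeriv T n w t))
    (ι.continuous.comp (continuous_smoothDeriv hT n (integrable_of_Lp w)))
  map_add' w w' := by
    unfold contLp
    rw [← MemLp.toLp_add]
    refine MemLp.toLp_congr _ _ (.of_forall fun t => ?_)
    simp only [smoothDeriv_add hT, Pi.add_apply, map_add]
  map_smul' c w := by
    unfold contLp
    rw [RingHom.id_apply, ← MemLp.toLp_const_smul]
    refine MemLp.toLp_congr _ _ (.of_forall fun t => ?_)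
    simp only [smoothDeriv_smul, Pi.smul_apply, map_smul]

theorem exists_clm_of_tendsto {S : Type*} [SeminormedAddCommGroup S] [NormedSpace ℝ S] [CompleteSpace Y] (R : ℕ → S →ₗ[ℝ] Y)
    (hR : ∀ q, CauchySeq fun n => R n q) (B : ℝ)
    (hB : ∀ q D, Tendsto (fun n => R n q) atTop (𝓝 D) → ‖D‖ ≤ B * ‖q‖) :
    ∃ D : S →L[ℝ] Y, ∀ q, Tendsto (fun n => R n q) atTop (𝓝 (D q)) := by
  choose D hD using fun q => cauchySeq_tendsto_of_complete (hR q)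
  exact ⟨(linearMapOfTendsto D R (tendsto_pi_nhds.2 hD)).mkContinuous B fun q => hB q _ (hD q), hD⟩

set_option maxHeartbeats 1000000 in
/-- If `w ∈ L²(0,T;V)` and `w_tt ∈ L²(0,T;V*)`, then `w_t ∈ L²(0,T;H)`. -/
theorem exists_intermediate [CompleteSpace V] [CompleteSpace H] (hT : 0 < T) (ι : V →L[ℝ] H) :
    ∃ D : timeSpaceB ((dualMap ι).comp ι) T →L[ℝ] Lp H 2 (tim T),
      ∀ q, ∀ᵐ t ∂tim T, q.1.2.1 t = dualMap ι (D q t) := by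
  let S := timeSpaceB ((dualMap ι).comp ι) T
  let pr : S →ₗ[ℝ] Lp V 2 (tim T) := (LinearMap.fst ℝ _ _).comp S.subtype
  let R : ℕ → S →ₗ[ℝ] Lp H 2 (tim T) := fun n => (smoothDerivL ι hT n).comp pr
  have cT : ∀ n (q : S), Continuous fun t => ι (smoothDeriv T n q.1.1 t) := fun n q =>
    ι.continuous.comp (continuous_smoothDeriv hT n (integrable_of_Lp q.1.1))
  let a : ℕ → S → Lp V 2 (tim T) := fun n q =>
    contLp T (smooth T n q.1.1) (continuous_smooth hT n (integrable_of_Lp q.1.1))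
  have cb : ∀ n (q : S), Continuous fun t => ((1 - scale n) * (1 - scale n)) • smooth T n q.1.2.2 t :=
    fun n q => by
      have h := continuous_smooth hT n (integrable_of_Lp q.1.2.2)
      exact Continuous.smul (f := fun _ => (1 - scale n) * (1 - scale n)) continuous_const h
  let b : ℕ → S → Lp (V →L[ℝ] ℝ) 2 (tim T) := fun n q => contLp T _ (cb n q)
  have hsc : Tendsto (fun n => 1 - scale n) atTop (𝓝 1) := by simpa using tendsto_scale.const_sub 1
  have ha : ∀ q, Tendsto (fun n => a n q) atTop (𝓝 q.1.1) := fun q => tendsto_contLp_smooth hT q.1.1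
  have hb : ∀ q, Tendsto (fun n => b n q) atTop (𝓝 q.1.2.2) := fun q => by
    have h := (hsc.mul hsc).smul (tendsto_contLp_smooth hT q.1.2.2)
    rw [one_mul, one_smul] at h
    refine h.congr fun n => ?_
    exact (MemLp.toLp_const_smul _ (memLp_of_continuous
      (continuous_smooth hT n (integrable_of_Lp q.1.2.2)) 2)).symm
  set C := 200 + 256 * ‖ι‖ ^ 2 / T ^ 2 with hC
  have est1 : ∀ n q, ‖R n q‖ ^ 2 ≤ 2 * ‖b n q‖ ^ 2 + C * ‖a n q‖ ^ 2 := by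
    intro n q
    have iq := integrable_of_Lp q.1.1
    have h := integral_sq_deriv_le ι hT (hasDerivAt_smooth hT n iq) (hasDerivAt_smoothDeriv hT n iq)
      (continuous_smoothDeriv2 hT n iq)
      (W := fun t => ((1 - scale n) * (1 - scale n)) • smooth T n q.1.2.2 t) ?_ (cb n q)
    · change ‖contLp T _ (cT n q)‖ ^ 2 ≤ 2 * ‖contLp T _ (cb n q)‖ ^ 2 + C * ‖contLp T _ _‖ ^ 2
      rw [norm_sq_contLp hT, norm_sq_contLp hT, norm_sq_contLp hT]
      exact h
    · intro t ht v
      rw [← dualMap_apply]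
      exact DFunLike.congr_fun (eq_on_Icc_of_eq_on_Ioo hT
        ((dualMap ι).continuous.comp (ι.continuous.comp (continuous_smoothDeriv2 hT n iq)))
        (cb n q) (fun s hs => dual_smoothDeriv2 hT n q.2 hs) t ht) v
  have est2 : ∀ n m q, ‖R n q - R m q‖ ^ 2 ≤ 2 * ‖b n q - b m q‖ ^ 2 + C * ‖a n q - a m q‖ ^ 2 := by
    intro n m q
    have iq := integrable_of_Lp q.1.1
    have h := integral_sq_deriv_le ι hT
      (fun t => (hasDerivAt_smooth hT n iq t).sub (hasDerivAt_smooth hT m iq t))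
      (fun t => (hasDerivAt_smoothDeriv hT n iq t).sub (hasDerivAt_smoothDeriv hT m iq t))
      ((continuous_smoothDeriv2 hT n iq).sub (continuous_smoothDeriv2 hT m iq))
      (W := fun t => ((1 - scale n) * (1 - scale n)) • smooth T n q.1.2.2 t
        - ((1 - scale m) * (1 - scale m)) • smooth T m q.1.2.2 t) ?_ ((cb n q).sub (cb m q))
    · have e1 : R n q - R m q = contLp T (fun t => ι (smoothDeriv T n q.1.1 t - smoothDeriv T m q.1.1 t))
          (ι.continuous.comp ((continuous_smoothDeriv hT n iq).sub (continuous_smoothDeriv hT m iq))) := by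
        refine (MemLp.toLp_sub (memLp_of_continuous (cT n q) 2)
          (memLp_of_continuous (cT m q) 2)).symm.trans ?_
        refine MemLp.toLp_congr _ _ (.of_forall fun t => ?_)
        simp only [Pi.sub_apply, map_sub]
      have e2 : a n q - a m q = contLp T (fun t => smooth T n q.1.1 t - smooth T m q.1.1 t)
          ((continuous_smooth hT n iq).sub (continuous_smooth hT m iq)) := (MemLp.toLp_sub _ _).symm
      have e3 : b n q - b m q = contLp T (fun t => ((1 - scale n) * (1 - scale n)) • smooth T n q.1.2.2 t
          - ((1 - scale m) * (1 - scale m)) • smooth T m q.1.2.2 t) ((cb n q).sub (cb m q)) :=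
        (MemLp.toLp_sub _ _).symm
      rw [e1, e2, e3, norm_sq_contLp hT, norm_sq_contLp hT, norm_sq_contLp hT]
      exact h
    · intro t ht v
      rw [← dualMap_apply]
      refine DFunLike.congr_fun (eq_on_Icc_of_eq_on_Ioo hT
        ((dualMap ι).continuous.comp (ι.continuous.comp
          ((continuous_smoothDeriv2 hT n iq).sub (continuous_smoothDeriv2 hT m iq))))
        ((cb n q).sub (cb m q)) (fun s hs => ?_) t ht) v
      simp only [Function.comp, Pi.sub_apply, map_sub]
      rw [dual_smoothDeriv2 hT n q.2 hs, dual_smoothDeriv2 hT m q.2 hs]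
  have hC0 : 0 ≤ C := by positivity
  have hcau : ∀ q, CauchySeq fun n => R n q := by
    intro q
    have h1 : Tendsto (fun p : ℕ × ℕ => 2 * ‖b p.1 q - b p.2 q‖ ^ 2 + C * ‖a p.1 q - a p.2 q‖ ^ 2)
        atTop (𝓝 0) := by
      have hb' := cauchySeq_iff_tendsto_dist_atTop_0.1 (hb q).cauchySeq
      have ha' := cauchySeq_iff_tendsto_dist_atTop_0.1 (ha q).cauchySeq
      simp only [dist_eq_norm] at hb' ha'
      simpa using ((hb'.pow 2).const_mul 2).add ((ha'.pow 2).const_mul C)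
    rw [cauchySeq_iff_tendsto_dist_atTop_0]
    have h2 : Tendsto (fun p : ℕ × ℕ => ‖R p.1 q - R p.2 q‖ ^ 2) atTop (𝓝 0) :=
      squeeze_zero (fun _ => by positivity) (fun p => est2 p.1 p.2 q) h1
    have h3 := h2.sqrt
    simpa [Real.sqrt_sq, dist_eq_norm] using h3
  obtain ⟨D, hD⟩ := exists_clm_of_tendsto R hcau (√(2 + C)) fun q D hD => by
    have h1 : ‖D‖ ^ 2 ≤ 2 * ‖q.1.2.2‖ ^ 2 + C * ‖q.1.1‖ ^ 2 :=
      le_of_tendsto_of_tendsto' (hD.norm.pow 2)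
        ((((hb q).norm.pow 2).const_mul 2).add (((ha q).norm.pow 2).const_mul C)) fun n => est1 n q
    have n1 : ‖q.1.1‖ ≤ ‖q‖ := norm_fst_le q.1
    have n2 : ‖q.1.2.2‖ ≤ ‖q‖ := (norm_snd_le q.1.2).trans (norm_snd_le q.1)
    refine le_of_sq_le_sq ?_ (by positivity)
    rw [mul_pow, Real.sq_sqrt (by positivity)]
    calc _ ≤ _ := h1
      _ ≤ 2 * ‖q‖ ^ 2 + C * ‖q‖ ^ 2 := by gcongr
      _ = _ := by ring
  refine ⟨D, fun q => ?_⟩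
  have l1 : Tendsto (fun n => (dualMap ι).compLpL 2 (tim T) (R n q)) atTop
      (𝓝 ((dualMap ι).compLpL 2 (tim T) (D q))) :=
    (((dualMap ι).compLpL 2 (tim T)).continuous.tendsto _).comp (hD q)
  have l2 : Tendsto (fun n => (dualMap ι).compLpL 2 (tim T) (R n q)) atTop (𝓝 q.1.2.1) := by
    have h := hsc.smul (tendsto_contLp_smooth hT q.1.2.1)
    rw [one_smul] at h
    refine h.congr fun n => ?_
    refine Lp.ext ?_
    filter_upwards [Lp.coeFn_smul (1 - scale n) (contLp T (smooth T n q.1.2.1)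
        (continuous_smooth hT n (integrable_of_Lp q.1.2.1))),
      coeFn_contLp (T := T) (continuous_smooth hT n (integrable_of_Lp q.1.2.1)),
      (dualMap ι).coeFn_compLpL (R n q), coeFn_contLp (T := T) (cT n q),
      ae_restrict_mem measurableSet_Ioo] with t h1 h2 h3 h4 h5
    rw [h1, Pi.smul_apply, h2, h3]
    rw [← dual_smoothDeriv hT n q.2 (Ioo_subset_Icc_self h5)]
    exact congrArg (dualMap ι) h4.symm
  have := tendsto_nhds_unique l2 l1
  filter_upwards [(dualMap ι).coeFn_compLpL (p := 2) (μ := tim T) (D q)] with t ht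
  rw [this, ht]

end

/-! ### Charts and cones -/

section

@[simp] theorem hor_pt (y : E m) (z : ℝ) : hor (pt y z) = y := by ext i; simp [hor, pt]

@[simp] theorem ver_pt (y : E m) (z : ℝ) : ver (pt y z) = z := by simp [ver, pt]

@[simp] theorem pt_hor_ver (x : E (m + 1)) : pt (hor x) (ver x) = x := by
  ext i
  refine Fin.lastCases ?_ (fun j => ?_) i <;> simp [hor, ver, pt]

theorem hor_add (x y : E (m + 1)) : hor (x + y) = hor x + hor y := by ext i; simp [hor]
theorem ver_add (x y : E (m + 1)) : ver (x + y) = ver x + ver y := by simp [ver]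
theorem hor_sub (x y : E (m + 1)) : hor (x - y) = hor x - hor y := by ext i; simp [hor]
theorem ver_sub (x y : E (m + 1)) : ver (x - y) = ver x - ver y := by simp [ver]
theorem hor_smul (c : ℝ) (x : E (m + 1)) : hor (c • x) = c • hor x := by ext i; simp [hor]
theorem ver_smul (c : ℝ) (x : E (m + 1)) : ver (c • x) = c * ver x := by simp [ver]
theorem pt_sub (y y' : E m) (z z' : ℝ) : pt y z - pt y' z' = pt (y - y') (z - z') := by
  ext i
  refine Fin.lastCases ?_ (fun j => ?_) i <;> simp [pt]

theorem norm_sq_eq_hor_ver (x : E (m + 1)) : ‖x‖ ^ 2 = ‖hor x‖ ^ 2 + ver x ^ 2 := by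
  rw [EuclideanSpace.norm_sq_eq, EuclideanSpace.norm_sq_eq, Fin.sum_univ_castSucc]
  simp [hor, ver]

theorem norm_hor_le (x : E (m + 1)) : ‖hor x‖ ≤ ‖x‖ := by
  refine le_of_sq_le_sq ?_ (norm_nonneg _)
  rw [norm_sq_eq_hor_ver]; nlinarith [sq_nonneg (ver x)]

theorem abs_ver_le (x : E (m + 1)) : |ver x| ≤ ‖x‖ := by
  refine le_of_sq_le_sq ?_ (norm_nonneg _)
  rw [norm_sq_eq_hor_ver, sq_abs]; nlinarith [sq_nonneg ‖hor x‖]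

theorem norm_pt_le (y : E m) (z : ℝ) : ‖pt y z‖ ≤ ‖y‖ + |z| := by
  refine le_of_sq_le_sq ?_ (by positivity)
  rw [norm_sq_eq_hor_ver, hor_pt, ver_pt]
  nlinarith [norm_nonneg y, abs_nonneg z, sq_abs z]

theorem lipschitz_hor : LipschitzWith 1 (hor : E (m + 1) → E m) :=
  LipschitzWith.of_dist_le_mul fun x y => by
    rw [dist_eq_norm, dist_eq_norm, ← hor_sub, NNReal.coe_one, one_mul]; exact norm_hor_le _

theorem lipschitz_ver : LipschitzWith 1 (ver : E (m + 1) → ℝ) :=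
  LipschitzWith.of_dist_le_mul fun x y => by
    rw [dist_eq_norm, dist_eq_norm, ← ver_sub, NNReal.coe_one, one_mul]; exact abs_ver_le _

@[fun_prop] theorem continuous_hor : Continuous (hor : E (m + 1) → E m) := lipschitz_hor.continuous
@[fun_prop] theorem continuous_ver : Continuous (ver : E (m + 1) → ℝ) := lipschitz_ver.continuous

theorem continuous_pt : Continuous (fun q : E m × ℝ => pt q.1 q.2) := by
  refine (PiLp.continuous_toLp 2 _).comp (continuous_pi fun i => ?_)
  refine Fin.lastCases ?_ (fun j => ?_) i
  · simp only [Fin.snoc_last]; exact continuous_snd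
  · simp only [Fin.snoc_castSucc]; exact (PiLp.continuous_apply 2 _ j).comp continuous_fst

/-- Near `x`, the set `Ω` is the rotated epigraph of the Lipschitz function `γ`. -/
structure IsLipChart (Ω : Set (E (m + 1))) (x : E (m + 1)) (R : E (m + 1) ≃ₗᵢ[ℝ] E (m + 1))
    (γ : E m → ℝ) (L : NNReal) (r : ℝ) : Prop where
  pos : 0 < r
  lip : LipschitzWith L γ
  mem_iff : ∀ y ∈ ball x r, y ∈ Ω ↔ γ (hor (R y)) < ver (R y)

theorem HasC11Boundary.exists_lipChart (h : HasC11Boundary Ω)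
    {x : E (m + 1)} (hx : x ∈ frontier Ω) : ∃ R γ L r, IsLipChart Ω x R γ L r := by
  obtain ⟨R, r, γ, hr, hγ, -, hy⟩ := h x hx
  obtain ⟨L, t, ht, hL⟩ := hγ.locallyLipschitz (hor (R x))
  obtain ⟨g, hg, hgt⟩ := hL.extend_real
  obtain ⟨s, hs, hst⟩ := Metric.mem_nhds_iff.1 ht
  refine ⟨R, g, L, min r s, lt_min hr hs, hg, fun y hyx => ?_⟩
  have h1 : y ∈ ball x r := Metric.ball_subset_ball (min_le_left _ _) hyx
  have h2 : hor (R y) ∈ t := by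
    refine hst ?_
    rw [Metric.mem_ball, dist_eq_norm, ← hor_sub, ← map_sub]
    refine (norm_hor_le _).trans_lt ?_
    rw [R.norm_map, ← dist_eq_norm]
    exact lt_of_lt_of_le hyx (min_le_right _ _)
  rw [hy y h1, hgt h2]

theorem IsLipChart.ver_eq (hΩ : IsOpen Ω) {x : E (m + 1)} {R γ L r}
    (h : IsLipChart Ω x R γ L r) {y : E (m + 1)} (hy : y ∈ ball x r) (hf : y ∈ frontier Ω) :
    ver (R y) = γ (hor (R y)) := by
  rw [hΩ.frontier_eq] at hf
  refine le_antisymm (not_lt.1 fun hlt => hf.2 ((h.mem_iff y hy).2 hlt)) (not_lt.1 fun hlt => ?_)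
  have ho : IsOpen {y | ver (R y) < γ (hor (R y))} := isOpen_lt (continuous_ver.comp R.continuous)
      (h.lip.continuous.comp (continuous_hor.comp R.continuous))
  obtain ⟨w, hw1, hw2⟩ := mem_closure_iff.1 hf.1 _ (ho.inter Metric.isOpen_ball) ⟨hlt, hy⟩
  exact lt_asymm hw1.1 ((h.mem_iff w hw1.2).1 hw2)

/-- The points of `Ω` near `x` are vertices of cones in the direction `e` contained in `Ω`. -/
structure IsCone (Ω : Set (E n)) (x e : E n) (a r h : ℝ) : Prop where
  a_pos : 0 < a
  r_pos : 0 < r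
  h_pos : 0 < h
  mem : ∀ y ∈ Ω, y ∈ ball x r → ∀ s ∈ Ioo 0 h, ∀ θ ∈ closedBall e a, y + s • θ ∈ Ω

theorem IsLipChart.exists_cone {x : E (m + 1)} {R γ L r}
    (h : IsLipChart Ω x R γ L r) : ∃ e a r' h', IsCone Ω x e a r' h' := by
  have hL : (0 : ℝ) ≤ L := L.2
  refine ⟨R.symm (pt 0 1), 1 / (2 * (1 + L)), r / 2, r / 4, by positivity, half_pos h.pos,
    by linarith [h.pos], fun y hy hyx s hs θ hθ => ?_⟩
  set a : ℝ := 1 / (2 * (1 + L)) with ha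
  have ha0 : 0 < a := by positivity
  have ha1 : a ≤ 1 / 2 := by rw [ha]; apply one_div_le_one_div_of_le (by norm_num); linarith
  have hLa : L * a < 1 - a := by
    have : a * (2 * (1 + L)) = 1 := by rw [ha]; field_simp
    nlinarith
  have hr := h.pos
  have hd : ‖R θ - pt 0 1‖ ≤ a := by
    have : R θ - pt 0 1 = R (θ - R.symm (pt 0 1)) := by simp
    rw [this, R.norm_map, ← dist_eq_norm]; exact hθ
  have h1 : ‖hor (R θ)‖ ≤ a := by
    have := (norm_hor_le _).trans hd
    rwa [hor_sub, hor_pt, sub_zero] at this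
  have h2 : 1 - a ≤ ver (R θ) := by
    have := (abs_ver_le _).trans hd
    rw [ver_sub, ver_pt, abs_le] at this
    linarith
  have h3 : ‖θ‖ ≤ 2 := by
    have h5 : ‖R θ‖ ≤ ‖R θ - pt 0 1‖ + ‖(pt 0 1 : E (m + 1))‖ := norm_le_norm_sub_add _ _
    have h4 : ‖(pt 0 1 : E (m + 1))‖ ≤ ‖(0 : E m)‖ + |1| := norm_pt_le (0 : E m) 1
    rw [norm_zero, abs_one] at h4
    rw [R.norm_map θ] at h5
    linarith
  have hy1 : y ∈ ball x r := Metric.ball_subset_ball (by linarith) hyx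
  have hb : y + s • θ ∈ ball x r := by
    rw [Metric.mem_ball, dist_eq_norm]
    have e : y + s • θ - x = (y - x) + s • θ := by abel
    rw [e]
    refine (norm_add_le _ _).trans_lt ?_
    rw [norm_smul, norm_of_nonneg hs.1.le, ← dist_eq_norm]
    have : s * ‖θ‖ ≤ r / 4 * 2 := mul_le_mul hs.2.le h3 (norm_nonneg _) (by linarith)
    have := Metric.mem_ball.1 hyx
    linarith
  rw [h.mem_iff _ hb, map_add, map_smul, hor_add, ver_add, hor_smul, ver_smul]
  have hlt := (h.mem_iff y hy1).1 hy
  have hl := h.lip.dist_le_mul (hor (R y) + s • hor (R θ)) (hor (R y))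
  rw [dist_eq_norm, dist_eq_norm, add_sub_cancel_left, norm_smul, norm_of_nonneg hs.1.le,
    norm_eq_abs] at hl
  have := (abs_le.1 hl).2
  have q1 : L * (s * ‖hor (R θ)‖) ≤ L * (s * a) := by gcongr; exact hs.1.le
  have q2 : s * (1 - a) ≤ s * ver (R θ) := mul_le_mul_of_nonneg_left h2 hs.1.le
  have q3 : s * (L * a) < s * (1 - a) := mul_lt_mul_of_pos_left hLa hs.1
  linarith

theorem exists_cone_of_mem {Ω : Set (E n)} (hΩ : IsOpen Ω) {x : E n} (hx : x ∈ Ω) :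
    ∃ e a r h, IsCone Ω x e a r h := by
  obtain ⟨r, hr, hsub⟩ := Metric.isOpen_iff.1 hΩ x hx
  refine ⟨0, 1, r / 2, r / 2, one_pos, half_pos hr, half_pos hr, fun y _ hyx s hs θ hθ => hsub ?_⟩
  rw [Metric.mem_ball, dist_eq_norm]
  have e : y + s • θ - x = (y - x) + s • θ := by abel
  rw [e]
  refine (norm_add_le _ _).trans_lt ?_
  rw [norm_smul, norm_of_nonneg hs.1.le, ← dist_eq_norm]
  have h1 : ‖θ‖ ≤ 1 := by simpa using hθ
  have : s * ‖θ‖ ≤ s * 1 := mul_le_mul_of_nonneg_left h1 hs.1.le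
  have := Metric.mem_ball.1 hyx
  linarith [hs.2]

/-- Every point of `closure Ω` has a neighbourhood with the cone property. -/
def HasCones (Ω : Set (E n)) : Prop := ∀ x ∈ closure Ω, ∃ e a r h, IsCone Ω x e a r h

theorem HasC11Boundary.hasCones (h : HasC11Boundary Ω) (hΩ : IsOpen Ω) :
    HasCones Ω := by
  intro x hx
  by_cases hxo : x ∈ Ω
  · exact exists_cone_of_mem hΩ hxo
  · obtain ⟨R, γ, L, r, hc⟩ := h.exists_lipChart (by rw [hΩ.frontier_eq]; exact ⟨hx, hxo⟩)
    exact hc.exists_cone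

end

/-- A smooth partition of unity on a compact set, subordinate to balls of prescribed radii. -/
theorem exists_partition {K : Set (E n)} (hK : IsCompact K) (r : E n → ℝ)
    (hr : ∀ x ∈ K, 0 < r x) : ∃ (N : ℕ) (c : Fin N → E n) (χ : Fin N → E n → ℝ), (∀ k, c k ∈ K) ∧
      (∀ k, ContDiff ℝ (⊤ : ℕ∞) (χ k)) ∧ (∀ k, HasCompactSupport (χ k)) ∧
      (∀ k, tsupport (χ k) ⊆ ball (c k) (r (c k))) ∧ ∀ x ∈ K, ∑ k, χ k x = 1 := by
  obtain ⟨t, ht⟩ := hK.elim_nhds_subcover' (fun x _ => ball x (r x / 4))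
    fun x hx => Metric.ball_mem_nhds x (by linarith [hr x hx])
  let e := t.equivFin.symm
  have hpos : ∀ x : K, 0 < r x := fun x => hr x x.2
  let f : Fin t.card → E n → ℝ := fun k =>
    (⟨r (e k).1 / 4, r (e k).1 / 2, by linarith [hpos (e k).1], by linarith [hpos (e k).1]⟩ :
      ContDiffBump ((e k).1 : E n))
  have hf : ∀ k, ContDiff ℝ (⊤ : ℕ∞) (f k) := fun k => ContDiffBump.contDiff _
  have hts : ∀ k, tsupport (fun x => f k x * ∏ j with j < k, (1 - f j x)) ⊆ tsupport (f k) :=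
    fun k => closure_mono fun x hx h0 => hx (by
      have : f k x = 0 := h0
      simp [this])
  have hball : ∀ k, tsupport (f k) = closedBall ((e k).1 : E n) (r (e k).1 / 2) := fun k =>
    ContDiffBump.tsupport_eq _
  refine ⟨t.card, fun k => (e k).1, fun k x => f k x * ∏ j with j < k, (1 - f j x),
    fun k => (e k).1.2, fun k => ?_, fun k => ?_, fun k => ?_, fun x hx => ?_⟩
  · exact (hf k).mul (contDiff_prod fun j _ => contDiff_const.sub (hf j))
  · refine (isCompact_closedBall ((e k).1 : E n) (r (e k).1 / 2)).of_isClosed_subset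
      (isClosed_tsupport _) ((hts k).trans (hball k).subset)
  · refine (hts k).trans ?_
    rw [hball]
    exact Metric.closedBall_subset_ball (by linarith [hpos (e k).1])
  · have h := Finset.prod_one_sub_ordered Finset.univ (fun k => f k x)
    have h2 : ∏ k, (1 - f k x) = 0 := by
      obtain ⟨y, hy⟩ := mem_iUnion.1 (ht hx)
      obtain ⟨hyt, hxy⟩ := mem_iUnion.1 hy
      refine Finset.prod_eq_zero (i := e.symm ⟨y, hyt⟩) (Finset.mem_univ _) ?_
      rw [sub_eq_zero]
      refine (ContDiffBump.one_of_mem_closedBall _ ?_).symm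
      simp only [e.apply_symm_apply]
      exact Metric.ball_subset_closedBall hxy
    rw [h2] at h
    linarith

/-! ### Density of smooth functions -/

section

/-- A mollifier supported in the cone of directions `-ball e a`, at scale `ε`. -/
def dirKernel {e : E n} (b : ContDiffBump e) (ε : ℝ) (w : E n) : ℝ :=
  (ε ^ n)⁻¹ * b.normed volume ((-ε⁻¹) • w)

variable {e : E n} (b : ContDiffBump e)

theorem contDiff_dirKernel (ε : ℝ) : ContDiff ℝ (⊤ : ℕ∞) (dirKernel b ε) :=
  contDiff_const.mul (b.contDiff_normed.comp (contDiff_const_smul _))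

theorem dirKernel_nonneg {ε : ℝ} (hε : 0 < ε) (w : E n) : 0 ≤ dirKernel b ε w :=
  mul_nonneg (by positivity) (b.nonneg_normed _)

theorem mem_ball_of_dirKernel_ne_zero {ε : ℝ} {w : E n} (hw : dirKernel b ε w ≠ 0) :
    (-ε⁻¹) • w ∈ ball e b.rOut := by
  rw [← b.support_normed_eq (μ := (volume : Measure (E n)))]
  exact right_ne_zero_of_mul hw

theorem mem_closedBall_of_mem_tsupport {ε : ℝ} {w : E n} (hw : w ∈ tsupport (dirKernel b ε)) :
    (-ε⁻¹) • w ∈ closedBall e b.rOut := by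
  have hcl : IsClosed ((fun w : E n => (-ε⁻¹) • w) ⁻¹' closedBall e b.rOut) :=
    Metric.isClosed_closedBall.preimage (by fun_prop)
  have hsub : Function.support (dirKernel b ε) ⊆
      (fun w : E n => (-ε⁻¹) • w) ⁻¹' closedBall e b.rOut := fun v hv =>
    mem_preimage.2 (Metric.ball_subset_closedBall (mem_ball_of_dirKernel_ne_zero b hv))
  exact mem_preimage.1 (closure_minimal hsub hcl hw)

theorem norm_le_of_mem_tsupport {ε : ℝ} (hε : 0 < ε) {w : E n} (hw : w ∈ tsupport (dirKernel b ε)) :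
    ‖w‖ ≤ ε * (‖e‖ + b.rOut) := by
  have h : (-ε⁻¹) • w ∈ closedBall e b.rOut := mem_closedBall_of_mem_tsupport b hw
  have h1 : ‖(-ε⁻¹) • w‖ ≤ ‖e‖ + b.rOut := by
    have := norm_le_norm_add_norm_sub' ((-ε⁻¹) • w) e
    rw [mem_closedBall_iff_norm] at h
    linarith
  rw [norm_smul, norm_neg, norm_inv, norm_of_nonneg hε.le, inv_mul_le_iff₀ hε] at h1
  exact h1

theorem hasCompactSupport_dirKernel {ε : ℝ} (hε : 0 < ε) : HasCompactSupport (dirKernel b ε) :=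
  (isCompact_closedBall (0 : E n) (ε * (‖e‖ + b.rOut))).of_isClosed_subset (isClosed_tsupport _)
    fun _ hw => by rw [mem_closedBall_zero_iff]; exact norm_le_of_mem_tsupport b hε hw

theorem integral_dirKernel {ε : ℝ} (hε : 0 < ε) : ∫ w, dirKernel b ε w = 1 := by
  simp only [dirKernel]
  rw [integral_const_mul, Measure.integral_comp_smul, b.integral_normed, finrank_euclideanSpace,
    Fintype.card_fin, smul_eq_mul, mul_one, abs_inv, abs_pow, abs_neg, abs_inv, abs_of_pos hε,
    inv_pow, inv_inv, inv_mul_cancel₀ (pow_pos hε n).ne']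

theorem lintegral_dirKernel {ε : ℝ} (hε : 0 < ε) : ∫⁻ w, ofReal (dirKernel b ε w) = 1 := by
  rw [← ofReal_integral_eq_lintegral_ofReal _ (.of_forall (dirKernel_nonneg b hε)),
    integral_dirKernel b hε, ofReal_one]
  exact (contDiff_dirKernel b ε).continuous.integrable_of_hasCompactSupport
    (hasCompactSupport_dirKernel b hε)

/-- Convolution of a function with a kernel. -/
def mollify (f k : E n → ℝ) : E n → ℝ := convolution f k (lsmul ℝ ℝ) volume

theorem mollify_apply (f k : E n → ℝ) (x : E n) : mollify f k x = ∫ y, f y * k (x - y) := rfl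

theorem pd_mollify {f k : E n → ℝ} (hf : LocallyIntegrable f volume) (hk : ContDiff ℝ (⊤ : ℕ∞) k)
    (hc : HasCompactSupport k) (i : Fin n) (x : E n) :
    pd (mollify f k) i x = ∫ y, f y * pd k i (x - y) := by
  have h := hc.hasFDerivAt_convolution_right (lsmul ℝ ℝ) hf
    (hk.of_le (by simp)) x
  rw [pd, mollify, h.fderiv, convolution_precompR_apply (lsmul ℝ ℝ) hf (hc.fderiv ℝ)
      (hk.continuous_fderiv (by simp))]
  rfl

theorem tendsto_mollify {Ω : Set (E n)} (hΩ : MeasurableSet Ω) (hfin : volume Ω ≠ ∞) {ε : ℕ → ℝ}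
    (hε : ∀ j, 0 < ε j) (hε0 : Tendsto ε atTop (𝓝 0)) {f : E n → ℝ} (hf : MemLp f 2 volume) :
    Tendsto (fun j => eLpNorm (mollify f (dirKernel b (ε j)) - f) 2 (vol Ω)) atTop (𝓝 0) := by
  have h := tendsto_kernel (ν := (volume : Measure (E n))) (S := Ω) (C := 1)
    (k := fun j t s => dirKernel b (ε j) (t - s))
    (r := fun j => ε j * (‖e‖ + b.rOut) + ε j)
    (fun j => (contDiff_dirKernel b (ε j)).continuous.comp (continuous_fst.sub continuous_snd))
    (fun j t s => dirKernel_nonneg b (hε j) _) hΩ hfin ?_ ENNReal.one_ne_top ?_ ?_ ?_ ?_ hf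
  · refine h.congr fun j => eLpNorm_congr_ae (.of_forall fun t => ?_)
    simp only [Pi.sub_apply, mollify_apply, smul_eq_mul, mul_comm]
  · intro j t _
    rw [lintegral_sub_left_eq_self (fun s => ofReal (dirKernel b (ε j) s))]
    exact lintegral_dirKernel b (hε j)
  · intro j s
    refine (lintegral_mono' Measure.restrict_le_self le_rfl).trans ?_
    rw [lintegral_sub_right_eq_self (fun s => ofReal (dirKernel b (ε j) s))]
    exact (lintegral_dirKernel b (hε j)).le
  · intro j t
    exact (hasCompactSupport_dirKernel b (hε j)).comp_homeomorph (Homeomorph.subLeft t)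
  · intro j t _ s hr
    by_contra hne
    have := norm_le_of_mem_tsupport b (hε j) (subset_tsupport _ hne)
    rw [← dist_eq_norm] at this
    linarith [hε j]
  · have := (hε0.mul_const (‖e‖ + b.rOut)).add hε0
    simpa using this

end

section

variable {Ω : Set (E n)}

/-- The extension by zero of `χ u`. -/
def cutExt (Ω : Set (E n)) (χ : E n → ℝ) (u : L2 (vol Ω)) : E n → ℝ :=
  Ω.indicator fun y => χ y * u y

theorem memLp_cutExt (hΩ : MeasurableSet Ω) {χ : E n → ℝ} (hχ : Continuous χ)
    (hc : HasCompactSupport χ) (u : L2 (vol Ω)) : MemLp (cutExt Ω χ u) 2 volume := by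
  rw [cutExt, memLp_indicator_iff_restrict hΩ]
  obtain ⟨C, hC⟩ := hc.exists_bound_of_continuous hχ
  refine (Lp.memLp u).of_le_mul (c := C) (hχ.aestronglyMeasurable.mul (Lp.aestronglyMeasurable u))
    (.of_forall fun x => ?_)
  rw [norm_mul]
  exact mul_le_mul_of_nonneg_right (hC x) (norm_nonneg _)

theorem locallyIntegrable_cutExt (hΩ : MeasurableSet Ω) {χ : E n → ℝ} (hχ : Continuous χ)
    (hc : HasCompactSupport χ) (u : L2 (vol Ω)) : LocallyIntegrable (cutExt Ω χ u) volume :=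
  (memLp_cutExt hΩ hχ hc u).locallyIntegrable (by norm_num)

theorem integral_cutExt_mul (hΩ : MeasurableSet Ω) (χ : E n → ℝ) (u : L2 (vol Ω)) (f : E n → ℝ) :
    ∫ y, cutExt Ω χ u y * f y = ∫ y in Ω, u y * (χ y * f y) := by
  rw [← integral_indicator hΩ]
  refine integral_congr_ae (.of_forall fun y => ?_)
  by_cases hy : y ∈ Ω
  · simp only [cutExt, indicator_of_mem hy]; ring
  · simp only [cutExt, indicator_of_notMem hy, zero_mul]

theorem pd_mollify_cutExt (hΩ : IsOpen Ω) {i : Fin n} {u g : L2 (vol Ω)}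
    (hu : (u, g) ∈ weakPartial Ω i) {χ k : E n → ℝ} (hχ : ContDiff ℝ (⊤ : ℕ∞) χ)
    (hχc : HasCompactSupport χ) (hk : ContDiff ℝ (⊤ : ℕ∞) k) (hkc : HasCompactSupport k) {x : E n}
    (hx : ∀ y ∈ tsupport χ, x - y ∈ tsupport k → y ∈ Ω) : pd (mollify (cutExt Ω χ u) k) i x =
      mollify (cutExt Ω χ g) k x + mollify (cutExt Ω (pd χ i) u) k x := by
  have hm := hΩ.measurableSet
  have hk' : ContDiff ℝ (⊤ : ℕ∞) fun y => k (x - y) := hk.comp (contDiff_const.sub contDiff_id)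
  have hφ : ContDiff ℝ (⊤ : ℕ∞) fun y => χ y * k (x - y) := hχ.mul hk'
  have hpk : ∀ y, pd (fun y => k (x - y)) i y = - pd k i (x - y) := fun y => by
    have h := ((hk.differentiable (by simp) (x - y)).hasFDerivAt.comp y
      ((hasFDerivAt_id y).const_sub x)).fderiv
    have h' : fderiv ℝ (fun y => k (x - y)) y = _ := h
    rw [pd, h']
    simp [pd]
  have hpφ : ∀ y, pd (fun y => χ y * k (x - y)) i y
      = pd χ i y * k (x - y) - χ y * pd k i (x - y) := fun y => by
    have h1 := fderiv_fun_mul (hχ.differentiable (by simp) y) (hk'.differentiable (by simp) y)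
    have h2 := hpk y
    unfold pd at h2 ⊢
    rw [h1]
    simp only [add_apply, smul_apply, smul_eq_mul, h2]
    ring
  have hcpd : Continuous fun y => pd k i (x - y) :=
    (pd_continuous hk i).comp (continuous_const.sub continuous_id)
  have h := hu (fun y => χ y * k (x - y)) hφ (hχc.mul_right) (fun y hy => by
    refine hx y (tsupport_mul_subset_left hy) ?_
    have h1 : y ∈ tsupport fun y => k (x - y) := tsupport_mul_subset_right hy
    exact tsupport_comp_subset_preimage k (f := fun y => x - y) (by fun_prop) h1)
  simp only [hpφ, mul_sub] at h
  have hs : ∫ y in Ω, (u y * (pd χ i y * k (x - y)) - u y * (χ y * pd k i (x - y))) =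
      (∫ y in Ω, u y * (pd χ i y * k (x - y))) - ∫ y in Ω, u y * (χ y * pd k i (x - y)) :=
    integral_sub (integrable_L2_mul Ω u ((pd_continuous hχ i).mul hk'.continuous)
      ((pd_hasCompactSupport hχc i).mul_right))
    (integrable_L2_mul Ω u (hχ.continuous.mul hcpd) hχc.mul_right)
  rw [hs] at h
  rw [pd_mollify (locallyIntegrable_cutExt hm hχ.continuous hχc u) hk hkc, mollify_apply,
    mollify_apply, integral_cutExt_mul hm, integral_cutExt_mul hm, integral_cutExt_mul hm]
  linarith

/-- A finite family of cutoff functions and mollifiers adapted to `Ω`. -/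
structure Mollifiers (Ω : Set (E n)) where
  N : ℕ
  χ : Fin N → E n → ℝ
  κ : ℕ → Fin N → E n → ℝ
  χ_smooth : ∀ k, ContDiff ℝ (⊤ : ℕ∞) (χ k)
  χ_supp : ∀ k, HasCompactSupport (χ k)
  χ_sum : ∀ x ∈ Ω, ∑ k, χ k x = 1
  κ_smooth : ∀ j k, ContDiff ℝ (⊤ : ℕ∞) (κ j k)
  κ_supp : ∀ j k, HasCompactSupport (κ j k)
  mem : ∀ j k, ∀ x ∈ Ω, ∀ y ∈ tsupport (χ k), x - y ∈ tsupport (κ j k) → y ∈ Ω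
  tendsto : ∀ k (f : E n → ℝ), MemLp f 2 volume →
    Tendsto (fun j => eLpNorm (mollify f (κ j k) - f) 2 (vol Ω)) atTop (𝓝 0)

theorem HasCones.nonempty_mollifiers (h : HasCones Ω) (hΩ : IsOpen Ω) (hb : IsBounded Ω) :
    Nonempty (Mollifiers Ω) := by
  choose! e a r ρ hc using h
  obtain ⟨N, c, χ, hcK, hχ, hχc, hχs, hχ1⟩ := exists_partition hb.isCompact_closure
    (fun x => r x / 2) fun x hx => half_pos (hc x hx).r_pos
  have hck := fun k => hc (c k) (hcK k)
  let b : ∀ k, ContDiffBump (e (c k)) := fun k =>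
    ⟨a (c k) / 2, a (c k), half_pos (hck k).a_pos, half_lt_self (hck k).a_pos⟩
  let s : Fin N → ℝ := fun k => min (ρ (c k)) (r (c k) / (2 * (‖e (c k)‖ + a (c k))))
  have hs : ∀ k, 0 < s k := fun k => by
    have := (hck k).a_pos
    have := (hck k).r_pos
    exact lt_min (hck k).h_pos (by positivity)
  have hε : ∀ k j, 0 < s k * scale j := fun k j => mul_pos (hs k) (scale_pos j)
  refine ⟨⟨N, χ, fun j k => dirKernel (b k) (s k * scale j), hχ, hχc,
    fun x hx => hχ1 x (subset_closure hx), fun j k => contDiff_dirKernel _ _,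
    fun j k => hasCompactSupport_dirKernel _ (hε k j), fun j k x hx y hy hxy => ?_,
    fun k f hf => ?_⟩⟩
  · set ε := s k * scale j with hεd
    have e0 := scale_pos j
    have e1 := scale_le j
    have hsc : scale j < 1 := by linarith
    have hεs : ε < s k := mul_lt_of_lt_one_right (hs k) hsc
    have hn := norm_le_of_mem_tsupport (b k) (hε k j) hxy
    have hθ := mem_closedBall_of_mem_tsupport (b k) hxy
    have hpos : 0 < ‖e (c k)‖ + a (c k) := by
      have := (hck k).a_pos
      positivity
    have hyb := hχs k hy
    have hxb : x ∈ ball (c k) (r (c k)) := by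
      rw [Metric.mem_ball] at hyb ⊢
      have h1 : dist x y ≤ s k * (‖e (c k)‖ + a (c k)) := by
        rw [dist_eq_norm]
        exact hn.trans (mul_le_mul_of_nonneg_right hεs.le hpos.le)
      have h2 : s k * (‖e (c k)‖ + a (c k)) ≤ r (c k) / 2 := by
        have : s k ≤ r (c k) / (2 * (‖e (c k)‖ + a (c k))) := min_le_right _ _
        rw [le_div_iff₀ (by positivity)] at this
        linarith
      have := dist_triangle x y (c k)
      linarith
    have := (hck k).mem x hx hxb ε ⟨hε k j, hεs.trans_le (min_le_left _ _)⟩ _ hθ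
    rw [smul_smul, mul_neg, mul_inv_cancel₀ (hε k j).ne', neg_smul, one_smul] at this
    simpa using this
  · refine tendsto_mollify (b k) hΩ.measurableSet hb.measure_lt_top.ne (hε k) ?_ hf
    simpa using tendsto_scale.const_mul (s k)

namespace Mollifiers

variable (M : Mollifiers Ω)

/-- The mollified function. -/
def J (j : ℕ) (η : Fin M.N → E n → ℝ) (u : L2 (vol Ω)) : E n → ℝ :=
  fun x => ∑ k, mollify (cutExt Ω (η k) u) (M.κ j k) x

/-- Families of smooth functions supported in the supports of the cutoff functions. -/
def Adapted (η : Fin M.N → E n → ℝ) : Prop :=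
  ∀ k, ContDiff ℝ (⊤ : ℕ∞) (η k) ∧ tsupport (η k) ⊆ tsupport (M.χ k)

theorem adapted_χ : M.Adapted M.χ := fun k => ⟨M.χ_smooth k, Subset.rfl⟩

theorem contDiff_pd {f : E n → ℝ} (hf : ContDiff ℝ (⊤ : ℕ∞) f) (i : Fin n) :
    ContDiff ℝ (⊤ : ℕ∞) (pd f i) :=
  (hf.fderiv_right (m := (⊤ : ℕ∞)) (by simp)).clm_apply contDiff_const

theorem tsupport_pd_subset (f : E n → ℝ) (i : Fin n) : tsupport (pd f i) ⊆ tsupport f :=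
  closure_minimal (fun x hx => support_fderiv_subset ℝ (f := f) fun h => hx (by
    unfold pd; rw [h]; rfl)) (isClosed_tsupport _)

variable {M}

theorem Adapted.deriv {η : Fin M.N → E n → ℝ} (h : M.Adapted η) (i : Fin n) :
    M.Adapted fun k => pd (η k) i :=
  fun k => ⟨contDiff_pd (h k).1 i, (tsupport_pd_subset _ i).trans (h k).2⟩

theorem Adapted.hasCompactSupport {η : Fin M.N → E n → ℝ} (h : M.Adapted η) (k : Fin M.N) :
    HasCompactSupport (η k) := (M.χ_supp k).of_isClosed_subset (isClosed_tsupport _) (h k).2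

theorem contDiff_J (hΩ : MeasurableSet Ω) (j : ℕ) {η : Fin M.N → E n → ℝ} (h : M.Adapted η)
    (u : L2 (vol Ω)) : ContDiff ℝ (⊤ : ℕ∞) (M.J j η u) :=
  ContDiff.sum fun k _ => (M.κ_supp j k).contDiff_convolution_right _
    (locallyIntegrable_cutExt hΩ (h k).1.continuous (h.hasCompactSupport k) u) (M.κ_smooth j k)

theorem hasCompactSupport_J (j : ℕ) {η : Fin M.N → E n → ℝ} (h : M.Adapted η)
    (u : L2 (vol Ω)) : HasCompactSupport (M.J j η u) := by
  have hk : ∀ k, HasCompactSupport (mollify (cutExt Ω (η k) u) (M.κ j k)) := fun k => by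
    refine HasCompactSupport.convolution _ ?_ (M.κ_supp j k)
    refine (h.hasCompactSupport k).mono fun x hx hx0 => hx ?_
    have hx0 : η k x = 0 := hx0
    simp only [cutExt, indicator_apply_eq_zero, hx0, zero_mul, implies_true]
  have : M.J j η u = ∑ k, mollify (cutExt Ω (η k) u) (M.κ j k) := by funext x; simp [J]
  rw [this]
  exact Finset.sum_induction _ (fun f => HasCompactSupport f) (fun _ _ ha hb => ha.add hb)
    HasCompactSupport.zero fun k _ => hk k

theorem pd_J (hΩ : IsOpen Ω) (j : ℕ) {η : Fin M.N → E n → ℝ} (h : M.Adapted η) {i : Fin n}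
    {u g : L2 (vol Ω)} (hu : (u, g) ∈ weakPartial Ω i) {x : E n} (hx : x ∈ Ω) :
    pd (M.J j η u) i x = M.J j η g x + M.J j (fun k => pd (η k) i) u x := by
  have hd : ∀ k, DifferentiableAt ℝ (mollify (cutExt Ω (η k) u) (M.κ j k)) x := fun k =>
    ((M.κ_supp j k).contDiff_convolution_right _ (locallyIntegrable_cutExt hΩ.measurableSet
      (h k).1.continuous (h.hasCompactSupport k) u) (M.κ_smooth j k)).differentiable (by simp) x
  have e : pd (M.J j η u) i x = ∑ k, pd (mollify (cutExt Ω (η k) u) (M.κ j k)) i x := by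
    unfold pd J
    rw [fderiv_fun_sum fun k _ => hd k]
    simp
  rw [e]
  unfold J
  rw [← Finset.sum_add_distrib]
  exact sum_congr rfl fun k _ => pd_mollify_cutExt hΩ hu (h k).1 (h.hasCompactSupport k)
    (M.κ_smooth j k) (M.κ_supp j k) fun y hy hxy => M.mem j k x hx y ((h k).2 hy) hxy

theorem tendsto_J (hΩ : IsOpen Ω) {η : Fin M.N → E n → ℝ} (h : M.Adapted η) {c : ℝ}
    (hc : ∀ x ∈ Ω, ∑ k, η k x = c) (u : L2 (vol Ω)) :
    Tendsto (fun j => eLpNorm (fun x => M.J j η u x - c * u x) 2 (vol Ω)) atTop (𝓝 0) := by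
  have hml : ∀ k, MemLp (cutExt Ω (η k) u) 2 volume := fun k =>
    memLp_cutExt hΩ.measurableSet (h k).1.continuous (h.hasCompactSupport k) u
  have hsum : Tendsto (fun j => ∑ k, eLpNorm (mollify (cutExt Ω (η k) u) (M.κ j k)
      - cutExt Ω (η k) u) 2 (vol Ω)) atTop (𝓝 0) := by
    have := tendsto_finsetSum Finset.univ fun k _ => M.tendsto k _ (hml k)
    simpa using this
  refine tendsto_of_tendsto_of_tendsto_of_le_of_le tendsto_const_nhds hsum
    (fun _ => zero_le) fun j => ?_
  have e : (fun x => M.J j η u x - c * u x) =ᵐ[vol Ω]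
      ∑ k, (mollify (cutExt Ω (η k) u) (M.κ j k) - cutExt Ω (η k) u) := by
    filter_upwards [ae_restrict_mem hΩ.measurableSet] with x hx
    simp only [Finset.sum_apply, Pi.sub_apply, Finset.sum_sub_distrib, J, cutExt,
      indicator_of_mem hx, ← sum_mul, hc x hx]
  rw [eLpNorm_congr_ae e]
  refine eLpNorm_sum_le (fun k _ => ?_) (by norm_num)
  refine AEStronglyMeasurable.sub ?_ (hml k).1.restrict
  exact ((M.κ_supp j k).contDiff_convolution_right (n := 0) _ (locallyIntegrable_cutExt
    hΩ.measurableSet (h k).1.continuous (h.hasCompactSupport k) u)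
    ((M.κ_smooth j k).of_le (by simp))).continuous.aestronglyMeasurable

theorem sum_pd_eq_zero (hΩ : IsOpen Ω) {η : Fin M.N → E n → ℝ} (h : M.Adapted η) {c : ℝ}
    (hc : ∀ x ∈ Ω, ∑ k, η k x = c) (i : Fin n) : ∀ x ∈ Ω, ∑ k, pd (η k) i x = 0 := by
  intro x hx
  have e : pd (fun x => ∑ k, η k x) i x = ∑ k, pd (η k) i x := by
    unfold pd
    rw [fderiv_fun_sum fun k _ => (h k).1.differentiable (by simp) x]
    simp
  rw [← e]
  have : (fun x => ∑ k, η k x) =ᶠ[𝓝 x] fun _ => c := by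
    filter_upwards [hΩ.mem_nhds hx] with y hy using hc y hy
  unfold pd
  rw [this.fderiv_eq]
  simp

theorem tendsto_J_one (hΩ : IsOpen Ω) (u : L2 (vol Ω)) :
    Tendsto (fun j => eLpNorm (M.J j M.χ u - (u : E n → ℝ)) 2 (vol Ω)) atTop (𝓝 0) := by
  have := tendsto_J hΩ M.adapted_χ M.χ_sum u
  simp only [one_mul] at this
  exact this

theorem tendsto_J_zero (hΩ : IsOpen Ω) {η : Fin M.N → E n → ℝ} (h : M.Adapted η)
    (hc : ∀ x ∈ Ω, ∑ k, η k x = 0) (u : L2 (vol Ω)) :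
    Tendsto (fun j => eLpNorm (M.J j η u) 2 (vol Ω)) atTop (𝓝 0) := by
  have := tendsto_J hΩ h hc u
  simp only [zero_mul, sub_zero] at this
  exact this

theorem aesm_J (hΩ : IsOpen Ω) (j : ℕ) {η : Fin M.N → E n → ℝ} (h : M.Adapted η) (u : L2 (vol Ω)) :
    AEStronglyMeasurable (M.J j η u) (vol Ω) :=
  (contDiff_J hΩ.measurableSet j h u).continuous.aestronglyMeasurable

theorem pd_J_ae (hΩ : IsOpen Ω) (j : ℕ) {η : Fin M.N → E n → ℝ} (h : M.Adapted η) {i : Fin n}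
    {u g : L2 (vol Ω)} (hu : (u, g) ∈ weakPartial Ω i) : pd (M.J j η u) i =ᵐ[vol Ω]
      M.J j η g + M.J j (fun k => pd (η k) i) u := by
  filter_upwards [ae_restrict_mem hΩ.measurableSet] with x hx using pd_J hΩ j h hu hx

theorem tendsto_pd_J (hΩ : IsOpen Ω) {i : Fin n} {u g : L2 (vol Ω)} (hu : (u, g) ∈ weakPartial Ω i) :
    Tendsto (fun j => eLpNorm (pd (M.J j M.χ u) i - (g : E n → ℝ)) 2 (vol Ω)) atTop (𝓝 0) := by
  have h1 := tendsto_J_one (M := M) hΩ g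
  have h2 := tendsto_J_zero hΩ (M.adapted_χ.deriv i) (sum_pd_eq_zero hΩ M.adapted_χ M.χ_sum i) u
  have h3 := h1.add h2
  rw [add_zero] at h3
  refine tendsto_of_tendsto_of_tendsto_of_le_of_le tendsto_const_nhds h3 (fun _ => zero_le)
    fun j => ?_
  have e : pd (M.J j M.χ u) i - (g : E n → ℝ) =ᵐ[vol Ω]
      (M.J j M.χ g - (g : E n → ℝ)) + M.J j (fun k => pd (M.χ k) i) u := by
    filter_upwards [pd_J_ae hΩ j M.adapted_χ hu] with x hx
    simp only [Pi.sub_apply, Pi.add_apply, hx]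
    ring
  rw [eLpNorm_congr_ae e]
  exact eLpNorm_add_le ((aesm_J hΩ j M.adapted_χ g).sub (Lp.aestronglyMeasurable g))
    (aesm_J hΩ j (M.adapted_χ.deriv i) u) (by norm_num)

theorem tendsto_pd_pd_J (hΩ : IsOpen Ω) {i i' : Fin n} {u g g' v : L2 (vol Ω)}
    (hu : (u, g) ∈ weakPartial Ω i) (hu' : (u, g') ∈ weakPartial Ω i')
    (hg : (g, v) ∈ weakPartial Ω i') :
    Tendsto (fun j => eLpNorm (pd (pd (M.J j M.χ u) i) i' - (v : E n → ℝ)) 2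
      (vol Ω)) atTop (𝓝 0) := by
  have hs := sum_pd_eq_zero hΩ M.adapted_χ M.χ_sum
  have h1 := tendsto_J_one (M := M) hΩ v
  have h2 := tendsto_J_zero hΩ (M.adapted_χ.deriv i') (hs i') g
  have h3 := tendsto_J_zero hΩ (M.adapted_χ.deriv i) (hs i) g'
  have h4 := tendsto_J_zero hΩ ((M.adapted_χ.deriv i).deriv i')
    (sum_pd_eq_zero hΩ (M.adapted_χ.deriv i) (hs i) i') u
  have h := (h1.add h2).add (h3.add h4)
  simp only [add_zero] at h
  refine tendsto_of_tendsto_of_tendsto_of_le_of_le tendsto_const_nhds h (fun _ => zero_le)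
    fun j => ?_
  have e : pd (pd (M.J j M.χ u) i) i' - (v : E n → ℝ) =ᵐ[vol Ω]
      ((M.J j M.χ v - (v : E n → ℝ)) + M.J j (fun k => pd (M.χ k) i') g) +
      (M.J j (fun k => pd (M.χ k) i) g' + M.J j (fun k => pd (pd (M.χ k) i) i') u) := by
    filter_upwards [ae_restrict_mem hΩ.measurableSet] with x hx
    have e1 : pd (M.J j M.χ u) i =ᶠ[𝓝 x]
        M.J j M.χ g + M.J j (fun k => pd (M.χ k) i) u := by
      filter_upwards [hΩ.mem_nhds hx] with y hy using pd_J hΩ j M.adapted_χ hu hy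
    have e2 : pd (pd (M.J j M.χ u) i) i' x =
        pd (M.J j M.χ g + M.J j (fun k => pd (M.χ k) i) u) i' x := by
      rw [pd, e1.fderiv_eq]
      rfl
    rw [pd_add (contDiff_J hΩ.measurableSet j M.adapted_χ g)
      (contDiff_J hΩ.measurableSet j (M.adapted_χ.deriv i) u), pd_J hΩ j M.adapted_χ hg hx,
      pd_J hΩ j (M.adapted_χ.deriv i) hu' hx] at e2
    simp only [Pi.sub_apply, Pi.add_apply, e2]
    ring
  rw [eLpNorm_congr_ae e]
  have m1 := (aesm_J hΩ j M.adapted_χ v).sub (Lp.aestronglyMeasurable v)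
  have m2 := aesm_J hΩ j (M.adapted_χ.deriv i') g
  have m3 := aesm_J hΩ j (M.adapted_χ.deriv i) g'
  have m4 := aesm_J hΩ j ((M.adapted_χ.deriv i).deriv i') u
  refine (eLpNorm_add_le (m1.add m2) (m3.add m4) (by norm_num)).trans ?_
  gcongr
  · exact eLpNorm_add_le m1 m2 (by norm_num)
  · exact eLpNorm_add_le m3 m4 (by norm_num)

end Mollifiers

end

/-! ### The embedding `H²(Ω) → L^∞(Ω)` -/

section

theorem fderiv_apply_eq_sum (f : E n → ℝ) (x v : E n) : fderiv ℝ f x v = ∑ i, v i * pd f i x := by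
  have hv : v = ∑ i, v i • EuclideanSpace.single i (1 : ℝ) := by
    ext j
    simp [Finset.sum_apply, Pi.single_apply]
  conv_lhs => rw [hv]
  simp [pd]

theorem hasDerivAt_line {f : E n → ℝ} (hf : Differentiable ℝ f) (x θ : E n) (s : ℝ) :
    HasDerivAt (fun s : ℝ => f (x + s • θ)) (∑ i, θ i * pd f i (x + s • θ)) s := by
  have h1 : HasDerivAt (fun s : ℝ => x + s • θ) θ s := by
    simpa using ((hasDerivAt_id s).smul_const θ).const_add x
  have h2 := (hf (x + s • θ)).hasFDerivAt.comp_hasDerivAt s h1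
  rwa [fderiv_apply_eq_sum] at h2

theorem abs_apply_le_norm (θ : E n) (i : Fin n) : |θ i| ≤ ‖θ‖ := by
  simpa using PiLp.norm_apply_le θ i

theorem abs_le_integral_mul {G G' G'' F : ℝ → ℝ} {h K : ℝ} (hh : 0 < h)
    (h1 : ∀ s, HasDerivAt G (G' s) s) (h2 : ∀ s, HasDerivAt G' (G'' s) s) (hc : Continuous G'')
    (hF : Continuous F) (b0 : ∀ s, |G s| ≤ F s) (b1 : ∀ s, |G' s| ≤ K * F s)
    (b2 : ∀ s, |G'' s| ≤ K ^ 2 * F s) :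
    |G 0| ≤ (2 / h ^ 2 + 4 * K / h + K ^ 2) * ∫ s in (0 : ℝ)..h, s * F s := by
  have c0 : Continuous G := continuous_iff_continuousAt.2 fun s => (h1 s).continuousAt
  have c1 : Continuous G' := continuous_iff_continuousAt.2 fun s => (h2 s).continuousAt
  have hne := hh.ne'
  have hη : ∀ s, HasDerivAt (fun s => 1 - s / h) (-(1 / h)) s := fun s => by
    simpa using ((hasDerivAt_id s).div_const h).const_sub 1
  have hV : ∀ s, HasDerivAt (fun s => s * (-2 / h * (1 - s / h) * G s + (1 - s / h) ^ 2 * G' s)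
      - (1 - s / h) ^ 2 * G s)
      (s * (2 / h ^ 2 * G s - 4 / h * (1 - s / h) * G' s + (1 - s / h) ^ 2 * G'' s)) s := fun s => by
    have := ((hasDerivAt_id s).mul ((((hη s).const_mul (-2 / h)).mul (h1 s)).add
      (((hη s).pow 2).mul (h2 s)))).sub (((hη s).pow 2).mul (h1 s))
    refine this.congr_deriv ?_
    simp only [Pi.mul_apply, Pi.add_apply, Pi.pow_apply, id]
    push_cast
    field_simp
    ring
  have hi := intervalIntegral.integral_eq_sub_of_hasDerivAt (a := 0) (b := h) (fun s _ => hV s)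
    (Continuous.intervalIntegrable (by fun_prop) _ _)
  have hG : G 0 = ∫ s in (0 : ℝ)..h,
      s * (2 / h ^ 2 * G s - 4 / h * (1 - s / h) * G' s + (1 - s / h) ^ 2 * G'' s) := by
    rw [hi]
    simp [div_self hne]
  rw [hG, ← intervalIntegral.integral_const_mul, ← norm_eq_abs]
  refine intervalIntegral.norm_integral_le_of_norm_le hh.le ?_
    (Continuous.intervalIntegrable (by fun_prop) _ _)
  refine Eventually.of_forall fun s hs => ?_
  have hs0 : 0 < s := hs.1
  have e0 : 0 ≤ 1 - s / h := by rw [sub_nonneg, div_le_one hh]; exact hs.2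
  have e1 : 1 - s / h ≤ 1 := by linarith [div_pos hs0 hh]
  have e2 : (1 - s / h) ^ 2 ≤ 1 := pow_le_one₀ e0 e1
  rw [norm_eq_abs, abs_mul, abs_of_pos hs0]
  have t1 : |2 / h ^ 2 * G s| ≤ 2 / h ^ 2 * F s := by
    rw [abs_mul, abs_of_pos (by positivity)]
    exact mul_le_mul_of_nonneg_left (b0 s) (by positivity)
  have t2 : |4 / h * (1 - s / h) * G' s| ≤ 4 / h * (K * F s) := by
    rw [abs_mul, abs_mul, abs_of_pos (by positivity : 0 < 4 / h), abs_of_nonneg e0, mul_assoc]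
    refine mul_le_mul_of_nonneg_left ?_ (by positivity)
    exact (mul_le_of_le_one_left (abs_nonneg _) e1).trans (b1 s)
  have t3 : |(1 - s / h) ^ 2 * G'' s| ≤ K ^ 2 * F s := by
    rw [abs_mul, abs_of_nonneg (by positivity : 0 ≤ (1 - s / h) ^ 2)]
    exact (mul_le_of_le_one_left (abs_nonneg _) e2).trans (b2 s)
  have t := (abs_add_le (2 / h ^ 2 * G s - 4 / h * (1 - s / h) * G' s) ((1 - s / h) ^ 2 * G'' s)).trans
    (add_le_add ((abs_sub _ _).trans (add_le_add t1 t2)) t3)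
  calc s * _ ≤ s * (2 / h ^ 2 * F s + 4 / h * (K * F s) + K ^ 2 * F s) :=
        mul_le_mul_of_nonneg_left t hs0.le
    _ = _ := by ring

/-- The sum of the absolute values of all derivatives of order at most two. -/
def derivSum (f : E n → ℝ) (x : E n) : ℝ := |f x| + ∑ i, |pd f i x| + ∑ i, ∑ j, |pd (pd f i) j x|

theorem continuous_derivSum {f : E n → ℝ} (hf : ContDiff ℝ (⊤ : ℕ∞) f) : Continuous (derivSum f) := by
  have h1 : ∀ i, Continuous (pd f i) := pd_continuous hf
  have h2 : ∀ i j, Continuous (pd (pd f i) j) := fun i j =>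
    pd_continuous (Mollifiers.contDiff_pd hf i) j
  have h0 := hf.continuous
  unfold derivSum
  fun_prop

theorem derivSum_nonneg (f : E n → ℝ) (x : E n) : 0 ≤ derivSum f x := by unfold derivSum; positivity

theorem abs_le_integral_line {f : E n → ℝ} (hf : ContDiff ℝ (⊤ : ℕ∞) f) (x : E n) {θ : E n}
    {h K : ℝ} (hh : 0 < h) (hθ : ‖θ‖ ≤ K) :
    |f x| ≤ (2 / h ^ 2 + 4 * K / h + K ^ 2) * ∫ s in (0 : ℝ)..h, s * derivSum f (x + s • θ) := by
  have hθi : ∀ i, |θ i| ≤ K := fun i => (abs_apply_le_norm θ i).trans hθ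
  have hK : 0 ≤ K := (norm_nonneg _).trans hθ
  have hl : Continuous fun s : ℝ => x + s • θ := by fun_prop
  have hpp : ∀ i j, Continuous fun s : ℝ => pd (pd f i) j (x + s • θ) := fun i j =>
    (pd_continuous (Mollifiers.contDiff_pd hf i) j).comp hl
  have h := abs_le_integral_mul (G := fun s => f (x + s • θ))
    (G' := fun s => ∑ i, θ i * pd f i (x + s • θ))
    (G'' := fun s => ∑ i, θ i * ∑ j, θ j * pd (pd f i) j (x + s • θ))
    (F := fun s => derivSum f (x + s • θ)) (K := K) hh
    (fun s => hasDerivAt_line (hf.differentiable (by simp)) x θ s)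
    (fun s => HasDerivAt.fun_sum fun i _ => (hasDerivAt_line
      ((Mollifiers.contDiff_pd hf i).differentiable (by simp)) x θ s).const_mul (θ i))
    (by fun_prop) ((continuous_derivSum hf).comp hl) (fun s => ?_) (fun s => ?_) (fun s => ?_)
  · simpa using h
  · unfold derivSum
    have : 0 ≤ ∑ i, |pd f i (x + s • θ)| := by positivity
    have : 0 ≤ ∑ i, ∑ j, |pd (pd f i) j (x + s • θ)| := by positivity
    linarith
  · refine (abs_sum_le_sum_abs _ _).trans ?_
    have : ∑ i, |θ i * pd f i (x + s • θ)| ≤ K * ∑ i, |pd f i (x + s • θ)| := by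
      rw [mul_sum]
      refine sum_le_sum fun i _ => ?_
      rw [abs_mul]
      exact mul_le_mul_of_nonneg_right (hθi i) (abs_nonneg _)
    refine this.trans (mul_le_mul_of_nonneg_left ?_ hK)
    unfold derivSum
    have : 0 ≤ ∑ i, ∑ j, |pd (pd f i) j (x + s • θ)| := by positivity
    linarith [abs_nonneg (f (x + s • θ))]
  · refine (abs_sum_le_sum_abs _ _).trans ?_
    have : ∑ i, |θ i * ∑ j, θ j * pd (pd f i) j (x + s • θ)|
        ≤ K ^ 2 * ∑ i, ∑ j, |pd (pd f i) j (x + s • θ)| := by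
      rw [mul_sum]
      refine sum_le_sum fun i _ => ?_
      rw [abs_mul, pow_two, mul_assoc]
      refine mul_le_mul (hθi i) ?_ (abs_nonneg _) hK
      refine (abs_sum_le_sum_abs _ _).trans ?_
      rw [mul_sum]
      refine sum_le_sum fun j _ => ?_
      rw [abs_mul]
      exact mul_le_mul_of_nonneg_right (hθi j) (abs_nonneg _)
    refine this.trans (mul_le_mul_of_nonneg_left ?_ (by positivity))
    unfold derivSum
    have : 0 ≤ ∑ i, |pd f i (x + s • θ)| := by positivity
    linarith [abs_nonneg (f (x + s • θ))]

theorem lintegral_comp_line_le {D Ω : Set (E n)} (hΩ : MeasurableSet Ω) (hD : MeasurableSet D)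
    {x : E n} (hs : 0 < s)
    (hm : ∀ θ ∈ D, x + s • θ ∈ Ω) {f : E n → ℝ≥0∞} (hf : Measurable f) :
    ∫⁻ θ in D, f (x + s • θ) ≤ ofReal ((s ^ n)⁻¹) * ∫⁻ y in Ω, f y := by
  have hg : Measurable (Ω.indicator f) := hf.indicator hΩ
  calc ∫⁻ θ in D, f (x + s • θ) = ∫⁻ θ in D, Ω.indicator f (x + s • θ) :=
        setLIntegral_congr_fun hD fun θ hθ => by rw [indicator_of_mem (hm θ hθ)]
    _ ≤ ∫⁻ θ, Ω.indicator f (x + s • θ) := setLIntegral_le_lintegral _ _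
    _ = ∫⁻ θ, (fun y => Ω.indicator f (x + y)) θ ∂(Measure.map (s • ·) volume) := by
        exact (lintegral_map (f := fun y => Ω.indicator f (x + y))
          (hg.comp (measurable_const_add x)) (measurable_const_smul s)).symm
    _ = ofReal ((s ^ n)⁻¹) * ∫⁻ y, Ω.indicator f (x + y) := by
        rw [Measure.map_addHaar_smul _ hs.ne', lintegral_smul_measure, finrank_euclideanSpace,
          Fintype.card_fin, abs_of_pos (by positivity), smul_eq_mul]
    _ = _ := by rw [lintegral_add_left_eq_self (fun y => Ω.indicator f y), lintegral_indicator hΩ]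

theorem lintegral_rpow_lt_top {h : ℝ} (hh : 0 < h) (hn : n ≤ 3) :
    ∫⁻ s in Ioo 0 h, ofReal (s * (Real.sqrt (s ^ n))⁻¹) < ∞ := by
  have hi : IntegrableOn (fun s : ℝ => s ^ (1 - (n : ℝ) / 2)) (Ioo 0 h) := by
    have : (-1 : ℝ) < 1 - (n : ℝ) / 2 := by
      have : (n : ℝ) ≤ 3 := by exact_mod_cast hn
      linarith
    exact (intervalIntegral.integrableOn_Ioo_rpow_iff hh).2 this
  refine lt_of_eq_of_lt ?_ hi.lintegral_lt_top
  refine setLIntegral_congr_fun measurableSet_Ioo fun s hs => ?_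
  have hs0 : 0 < s := hs.1
  rw [Real.rpow_sub hs0, Real.rpow_one, Real.sqrt_eq_rpow, ← Real.rpow_natCast, ← Real.rpow_mul hs0.le,
    mul_one_div]
  rfl

end

theorem ofReal_abs_le_of_isCone (hn : n ≤ 3) {Ω : Set (E n)} (hΩ : MeasurableSet Ω)
    {c e : E n} {a r h : ℝ} (hc : IsCone Ω c e a r h) :
    ∃ C : ℝ≥0∞, C ≠ ∞ ∧ ∀ f : E n → ℝ, ContDiff ℝ (⊤ : ℕ∞) f → ∀ x ∈ Ω ∩ ball c r,
      ‖f x‖ₑ ≤ C * eLpNorm (derivSum f) 2 (vol Ω) := by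
  set D := closedBall e a with hD
  have hDm : MeasurableSet D := measurableSet_closedBall
  have hD0 : volume D ≠ 0 := (Metric.measure_closedBall_pos _ _ hc.a_pos).ne'
  have hDt : volume D ≠ ∞ := measure_closedBall_lt_top.ne
  set K := ‖e‖ + a
  set C1 := 2 / h ^ 2 + 4 * K / h + K ^ 2
  have hh := hc.h_pos
  have ha := hc.a_pos
  have hC1 : 0 ≤ C1 := by positivity
  set I := ∫⁻ s in Ioo 0 h, ofReal (s * (Real.sqrt (s ^ n))⁻¹) with hI
  have hIt : I < ∞ := lintegral_rpow_lt_top hh hn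
  refine ⟨(volume D)⁻¹ * (ofReal C1 * (volume D ^ (1 / 2 : ℝ) * I)), ?_, ?_⟩
  · refine mul_ne_top (ENNReal.inv_ne_top.2 hD0) (mul_ne_top ofReal_ne_top
      (mul_ne_top (rpow_ne_top_of_nonneg (by norm_num) hDt) hIt.ne))
  intro f hf x hx
  set F : E n → ℝ≥0∞ := fun y => ofReal (derivSum f y) with hF
  have hFc : Continuous F := continuous_ofReal.comp (continuous_derivSum hf)
  have hFm : Measurable F := hFc.measurable
  have hN : eLpNorm (derivSum f) 2 (vol Ω) = (∫⁻ y in Ω, F y ^ 2) ^ (1 / 2 : ℝ) := by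
    rw [eLpNorm_eq_lintegral_rpow_enorm_toReal (by norm_num) (by norm_num)]
    simp [hF, enorm_eq_ofReal (derivSum_nonneg f _)]
  have hKθ : ∀ θ ∈ D, ‖θ‖ ≤ K := fun θ hθ => by
    have := norm_le_norm_add_norm_sub' θ e
    rw [hD, mem_closedBall_iff_norm] at hθ
    linarith
  have key : ∀ θ ∈ D, ‖f x‖ₑ ≤
      ofReal C1 * ∫⁻ s in Ioo 0 h, ofReal s * F (x + s • θ) := fun θ hθ => by
    have h1 := abs_le_integral_line hf x hh (hKθ θ hθ)
    have hcs : Continuous fun s : ℝ => s * derivSum f (x + s • θ) :=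
      continuous_id.mul ((continuous_derivSum hf).comp (by fun_prop))
    rw [intervalIntegral.integral_of_le hh.le, integral_Ioc_eq_integral_Ioo] at h1
    rw [Real.enorm_eq_ofReal_abs]
    refine (ofReal_le_ofReal h1).trans_eq ?_
    rw [ofReal_mul hC1, ofReal_integral_eq_lintegral_ofReal]
    · congr 1
      refine setLIntegral_congr_fun measurableSet_Ioo fun s hs => ?_
      simp only [hF]
      rw [ofReal_mul hs.1.le]
    · exact (hcs.integrableOn_Icc (a := 0) (b := h)).mono_set Ioo_subset_Icc_self
    · filter_upwards [ae_restrict_mem measurableSet_Ioo] with s hs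
      exact mul_nonneg hs.1.le (derivSum_nonneg f _)
  have inner : ∀ s ∈ Ioo 0 h, ∫⁻ θ in D, F (x + s • θ) ≤
      volume D ^ (1 / 2 : ℝ) * ofReal ((Real.sqrt (s ^ n))⁻¹) *
        eLpNorm (derivSum f) 2 (vol Ω) := fun s hs => by
    have hs0 : 0 < s := hs.1
    have h1 := ENNReal.lintegral_mul_le_Lp_mul_Lq (volume.restrict D) Real.HolderConjugate.two_two
      (f := fun _ => 1) (g := fun θ => F (x + s • θ)) aemeasurable_const
      (hFm.comp (by fun_prop : Measurable fun θ : E n => x + s • θ)).aemeasurable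
    have h2 := lintegral_comp_line_le hΩ hDm hs0 (fun θ hθ => hc.mem x hx.1 hx.2 s hs θ hθ)
      (hFm.pow_const 2)
    simp only [Pi.mul_apply, one_mul, lintegral_const, Measure.restrict_apply_univ,
      ENNReal.rpow_two, one_pow] at h1
    refine h1.trans ?_
    rw [mul_assoc]
    refine mul_le_mul_right ((ENNReal.rpow_le_rpow h2 (by norm_num)).trans_eq ?_) _
    rw [ENNReal.mul_rpow_of_nonneg _ _ (by norm_num), hN]
    congr 1
    have hsn : 0 ≤ s ^ n := by positivity
    rw [ENNReal.ofReal_rpow_of_nonneg (inv_nonneg.2 hsn) (by norm_num), Real.sqrt_eq_rpow,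
      Real.inv_rpow hsn]
  have hme : Measurable fun p : E n × ℝ => ofReal p.2 * F (x + p.2 • p.1) :=
    (by fun_prop : Measurable fun p : E n × ℝ => ofReal p.2).mul
      (hFm.comp (by fun_prop : Measurable fun p : E n × ℝ => x + p.2 • p.1))
  have hfin : volume D * ‖f x‖ₑ ≤
      ofReal C1 * (volume D ^ (1 / 2 : ℝ) * I) * eLpNorm (derivSum f) 2 (vol Ω) := by
    calc volume D * ‖f x‖ₑ = ∫⁻ θ in D, ‖f x‖ₑ := by
          rw [lintegral_const, Measure.restrict_apply_univ, mul_comm]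
      _ ≤ ∫⁻ θ in D, ofReal C1 * ∫⁻ s in Ioo 0 h, ofReal s * F (x + s • θ) :=
          setLIntegral_mono' hDm key
      _ = ofReal C1 * ∫⁻ θ in D, ∫⁻ s in Ioo 0 h, ofReal s * F (x + s • θ) :=
          lintegral_const_mul _ hme.lintegral_prod_right'
      _ = ofReal C1 * ∫⁻ s in Ioo 0 h, ∫⁻ θ in D, ofReal s * F (x + s • θ) := by
          rw [lintegral_lintegral_swap hme.aemeasurable]
      _ ≤ ofReal C1 * ∫⁻ s in Ioo 0 h, volume D ^ (1 / 2 : ℝ) *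
            ofReal (s * (Real.sqrt (s ^ n))⁻¹) * eLpNorm (derivSum f) 2 (vol Ω) := by
          refine mul_le_mul_right (setLIntegral_mono' measurableSet_Ioo fun s hs => ?_) _
          have hms : Measurable fun θ => F (x + s • θ) :=
            hFm.comp (by fun_prop : Measurable fun θ : E n => x + s • θ)
          rw [lintegral_const_mul _ hms, ofReal_mul hs.1.le]
          refine (mul_le_mul_right (inner s hs) _).trans_eq ?_
          ring
      _ = _ := by
          rw [lintegral_mul_const _ (by fun_prop), lintegral_const_mul _ (by fun_prop), ← hI]
          ring
  calc ‖f x‖ₑ = (volume D)⁻¹ * (volume D * ‖f x‖ₑ) := by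
        rw [← mul_assoc, ENNReal.inv_mul_cancel hD0 hDt, one_mul]
    _ ≤ _ := by rw [mul_assoc]; exact mul_le_mul_right hfin _

theorem HasCones.ofReal_abs_le (hn : n ≤ 3) {Ω : Set (E n)} (hc : HasCones Ω)
    (hΩ : MeasurableSet Ω) (hb : IsBounded Ω) :
    ∃ C : ℝ≥0∞, C ≠ ∞ ∧ ∀ f : E n → ℝ, ContDiff ℝ (⊤ : ℕ∞) f → ∀ x ∈ Ω,
      ‖f x‖ₑ ≤ C * eLpNorm (derivSum f) 2 (vol Ω) := by
  have h : ∀ x ∈ closure Ω, ∃ r > 0, ∃ C : ℝ≥0∞, C ≠ ∞ ∧ ∀ f : E n → ℝ, ContDiff ℝ (⊤ : ℕ∞) f →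
      ∀ y ∈ Ω ∩ ball x r, ‖f y‖ₑ ≤ C * eLpNorm (derivSum f) 2 (vol Ω) := fun x hx => by
    obtain ⟨e, a, r, h, hcone⟩ := hc x hx
    exact ⟨r, hcone.r_pos, ofReal_abs_le_of_isCone hn hΩ hcone⟩
  choose! r hr C hC hCf using h
  obtain ⟨t, ht, hcov⟩ := hb.isCompact_closure.elim_nhds_subcover (fun x => ball x (r x))
    fun x hx => Metric.ball_mem_nhds x (hr x hx)
  refine ⟨∑ x ∈ t, C x, sum_ne_top.2 fun x hx => hC x (ht x hx), fun f hf y hy => ?_⟩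
  obtain ⟨x, hxt, hyx⟩ := mem_iUnion₂.1 (hcov (subset_closure hy))
  refine (hCf x (ht x hxt) f hf y ⟨hy, hyx⟩).trans ?_
  gcongr
  exact Finset.single_le_sum (f := C) (fun _ _ => zero_le) hxt

theorem eLpNorm_derivSum_le {μ : Measure (E n)} {f : E n → ℝ} (hf : ContDiff ℝ (⊤ : ℕ∞) f) :
    eLpNorm (derivSum f) 2 μ ≤ eLpNorm f 2 μ + ∑ i, eLpNorm (pd f i) 2 μ
      + ∑ i, ∑ j, eLpNorm (pd (pd f i) j) 2 μ := by
  have m0 : AEStronglyMeasurable (fun x => |f x|) μ := hf.continuous.abs.aestronglyMeasurable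
  have m1 : ∀ i, AEStronglyMeasurable (fun x => |pd f i x|) μ := fun i =>
    (pd_continuous hf i).abs.aestronglyMeasurable
  have m2 : ∀ i j, AEStronglyMeasurable (fun x => |pd (pd f i) j x|) μ := fun i j =>
    (pd_continuous (Mollifiers.contDiff_pd hf i) j).abs.aestronglyMeasurable
  have hab : ∀ g : E n → ℝ, eLpNorm (fun x => |g x|) 2 μ = eLpNorm g 2 μ := fun g => eLpNorm_norm g
  have e : derivSum f = (fun x => |f x|) + (∑ i, fun x => |pd f i x|)
      + ∑ i, ∑ j, fun x => |pd (pd f i) j x| := by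
    funext x
    simp [derivSum]
  have s1 : AEStronglyMeasurable (∑ i, fun x => |pd f i x|) μ :=
    Finset.aestronglyMeasurable_sum _ fun i _ => m1 i
  have s2 : ∀ i, AEStronglyMeasurable (∑ j, fun x => |pd (pd f i) j x|) μ := fun i =>
    Finset.aestronglyMeasurable_sum _ fun j _ => m2 i j
  rw [e]
  refine (eLpNorm_add_le (m0.add s1) (Finset.aestronglyMeasurable_sum _ fun i _ => s2 i)
    (by norm_num)).trans (add_le_add ((eLpNorm_add_le m0 s1 (by norm_num)).trans
    (add_le_add (hab f).le ?_)) ?_)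
  · refine (eLpNorm_sum_le (fun i _ => m1 i) (by norm_num)).trans_eq ?_
    simp only [hab]
  · refine (eLpNorm_sum_le (fun i _ => s2 i) (by norm_num)).trans (sum_le_sum fun i _ => ?_)
    refine (eLpNorm_sum_le (fun j _ => m2 i j) (by norm_num)).trans_eq ?_
    simp only [hab]

section

variable {Ω : Set (E n)}

theorem tendsto_eLpNorm_of_sub {μ : Measure (E n)} {f : ℕ → E n → ℝ} {g : E n → ℝ}
    (hf : ∀ j, AEStronglyMeasurable (f j) μ) (hg : MemLp g 2 μ)
    (h : Tendsto (fun j => eLpNorm (f j - g) 2 μ) atTop (𝓝 0)) :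
    Tendsto (fun j => eLpNorm (f j) 2 μ) atTop (𝓝 (eLpNorm g 2 μ)) := by
  have h1 : ∀ j, eLpNorm (f j) 2 μ ≤ eLpNorm (f j - g) 2 μ + eLpNorm g 2 μ := fun j => by
    have := eLpNorm_add_le ((hf j).sub hg.1) hg.1 (p := 2) (by norm_num)
    rwa [sub_add_cancel] at this
  have h2 : ∀ j, eLpNorm g 2 μ - eLpNorm (f j - g) 2 μ ≤ eLpNorm (f j) 2 μ := fun j => by
    have := eLpNorm_sub_le (hf j) ((hf j).sub hg.1) (p := 2) (by norm_num)
    rw [sub_sub_cancel] at this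
    exact tsub_le_iff_right.2 this
  refine tendsto_of_tendsto_of_tendsto_of_le_of_le ?_ ?_ h2 h1
  · simpa using ENNReal.Tendsto.sub (tendsto_const_nhds (x := eLpNorm g 2 μ)) h
      (Or.inl hg.eLpNorm_ne_top)
  · simpa using h.add_const (eLpNorm g 2 μ)

/-- The sum of the `L²` norms of the components of `u ∈ H²(Ω)`. -/
def H2.sumNorm (u : H2 Ω) : ℝ≥0∞ := eLpNorm u.1.1 2 (vol Ω) + ∑ i, eLpNorm (u.grad i) 2 (vol Ω)
    + ∑ i, ∑ j, eLpNorm (u.hess i j) 2 (vol Ω)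

theorem H2.sumNorm_le (u : H2 Ω) : u.sumNorm ≤ ofReal ((1 + n + n ^ 2) * ‖u‖) := by
  have h0 : eLpNorm u.1.1 2 (vol Ω) ≤ ofReal ‖u‖ := by
    rw [← Lp.enorm_def, ← ofReal_norm]
    exact ofReal_le_ofReal (norm_fst_le u.1)
  have h1 : ∀ i, eLpNorm (u.grad i) 2 (vol Ω) ≤ ofReal ‖u‖ := fun i => by
    rw [← Lp.enorm_def, ← ofReal_norm]
    exact ofReal_le_ofReal ((norm_le_pi_norm _ i).trans
      ((norm_fst_le u.1.2).trans (norm_snd_le u.1)))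
  have h2 : ∀ i j, eLpNorm (u.hess i j) 2 (vol Ω) ≤ ofReal ‖u‖ := fun i j => by
    rw [← Lp.enorm_def, ← ofReal_norm]
    exact ofReal_le_ofReal ((norm_le_pi_norm _ j).trans ((norm_le_pi_norm _ i).trans
      ((norm_snd_le u.1.2).trans (norm_snd_le u.1))))
  have hs : u.sumNorm ≤ ofReal ‖u‖ + ∑ i : Fin n, ofReal ‖u‖
      + ∑ i : Fin n, ∑ j : Fin n, ofReal ‖u‖ :=
    add_le_add (add_le_add h0 (sum_le_sum fun i _ => h1 i))
      (sum_le_sum fun i _ => sum_le_sum fun j _ => h2 i j)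
  refine hs.trans_eq ?_
  simp only [sum_const, card_univ, Fintype.card_fin, nsmul_eq_mul]
  rw [ofReal_mul (by positivity), ofReal_add (by positivity) (by positivity),
    ofReal_add (by positivity) (by positivity), ofReal_pow (by positivity)]
  simp only [ofReal_one, ENNReal.ofReal_natCast]
  ring

theorem Mollifiers.tendsto_sum (M : Mollifiers Ω) (hΩ : IsOpen Ω) (u : H2 Ω) :
    Tendsto (fun j => eLpNorm (M.J j M.χ u.1.1) 2 (vol Ω)
      + ∑ i, eLpNorm (pd (M.J j M.χ u.1.1) i) 2 (vol Ω)
      + ∑ i, ∑ i', eLpNorm (pd (pd (M.J j M.χ u.1.1) i) i') 2 (vol Ω))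
      atTop (𝓝 u.sumNorm) := by
  have hs := fun j => contDiff_J hΩ.measurableSet j M.adapted_χ u.1.1
  refine (Tendsto.add ?_ (tendsto_finsetSum _ fun i _ => ?_)).add
    (tendsto_finsetSum _ fun i _ => tendsto_finsetSum _ fun i' _ => ?_)
  · exact tendsto_eLpNorm_of_sub (fun j => (hs j).continuous.aestronglyMeasurable) (Lp.memLp _)
      (tendsto_J_one hΩ u.1.1)
  · exact tendsto_eLpNorm_of_sub (fun j => (pd_continuous (hs j) i).aestronglyMeasurable)
      (Lp.memLp _) (tendsto_pd_J hΩ (u.2.1 i))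
  · exact tendsto_eLpNorm_of_sub
      (fun j => (pd_continuous (contDiff_pd (hs j) i) i').aestronglyMeasurable)
      (Lp.memLp _) (tendsto_pd_pd_J hΩ (u.2.1 i) (u.2.1 i') (u.2.2 i i'))

theorem H2.exists_ae_bound (hn : n ≤ 3) (hc : HasCones Ω) (hΩ : IsOpen Ω)
    (hb : IsBounded Ω) : ∃ C : ℝ, 0 ≤ C ∧ ∀ u : H2 Ω, ∀ᵐ x ∂vol Ω, ‖H2.toL2 Ω u x‖ ≤ C * ‖u‖ := by
  obtain ⟨C, hC, hCf⟩ := hc.ofReal_abs_le hn hΩ.measurableSet hb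
  obtain ⟨M⟩ := hc.nonempty_mollifiers hΩ hb
  refine ⟨C.toReal * (1 + n + n ^ 2), by positivity, fun u => ?_⟩
  have hs := fun j => Mollifiers.contDiff_J hΩ.measurableSet j M.adapted_χ u.1.1
  have hm := tendstoInMeasure_of_tendsto_eLpNorm (p := 2) (μ := vol Ω) (by norm_num)
    (f := fun j => M.J j M.χ u.1.1) (g := u.1.1)
    (fun j => (hs j).continuous.aestronglyMeasurable) (Lp.memLp u.1.1).1
    (Mollifiers.tendsto_J_one (M := M) hΩ u.1.1)
  obtain ⟨ns, hns, hae⟩ := hm.exists_seq_tendsto_ae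
  filter_upwards [hae, ae_restrict_mem hΩ.measurableSet] with x hx hxΩ
  have h1 : Tendsto (fun j => ‖M.J (ns j) M.χ u.1.1 x‖ₑ) atTop (𝓝 ‖u.1.1 x‖ₑ) := hx.enorm
  have h2 := ENNReal.Tendsto.const_mul (a := C) ((M.tendsto_sum hΩ u).comp hns.tendsto_atTop)
    (Or.inr hC)
  have h3 : ‖u.1.1 x‖ₑ ≤ C * u.sumNorm := le_of_tendsto_of_tendsto' h1 h2 fun j =>
    (hCf _ (hs (ns j)) x hxΩ).trans (mul_le_mul_right (eLpNorm_derivSum_le (hs (ns j))) _)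
  have h4 := h3.trans (mul_le_mul_right u.sumNorm_le C)
  rw [← ENNReal.ofReal_toReal hC, ← ofReal_mul ENNReal.toReal_nonneg, ← ofReal_norm,
    ofReal_le_ofReal_iff (by positivity)] at h4
  calc ‖H2.toL2 Ω u x‖ = ‖u.1.1 x‖ := rfl
    _ ≤ _ := h4
    _ = _ := by ring

theorem norm_top_le_of_ae_bound {α X : Type*} [MeasurableSpace α] {μ : Measure α}
    [NormedAddCommGroup X] {f : Lp X ∞ μ} {C : ℝ} (hC : 0 ≤ C) (h : ∀ᵐ x ∂μ, ‖f x‖ ≤ C) :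
    ‖f‖ ≤ C := by
  rw [Lp.norm_def, eLpNorm_exponent_top]
  exact ENNReal.toReal_le_of_le_ofReal hC (eLpNormEssSup_le_of_ae_bound h)

/-- The embedding `H²(Ω) → L^∞(Ω)` in dimension at most three. -/
theorem H2.exists_toLinfty (hn : n ≤ 3) (hc : HasCones Ω) (hΩ : IsOpen Ω)
    (hb : IsBounded Ω) : ∃ L : H2 Ω →L[ℝ] Lp ℝ ∞ (vol Ω), ∀ u, L u =ᵐ[vol Ω] H2.toL2 Ω u := by
  obtain ⟨C, hC, h⟩ := H2.exists_ae_bound hn hc hΩ hb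
  have hm : ∀ u : H2 Ω, MemLp (H2.toL2 Ω u) ∞ (vol Ω) := fun u =>
    memLp_top_of_bound (Lp.memLp _).1 _ (h u)
  refine ⟨LinearMap.mkContinuous
    { toFun := fun u => (hm u).toLp _
      map_add' := fun u v => ?_
      map_smul' := fun c u => ?_ } C fun u => ?_, fun u => (hm u).coeFn_toLp⟩
  · rw [← MemLp.toLp_add]
    refine MemLp.toLp_congr _ _ ?_
    rw [map_add]
    exact Lp.coeFn_add _ _
  · rw [RingHom.id_apply, ← MemLp.toLp_const_smul]
    refine MemLp.toLp_congr _ _ ?_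
    rw [map_smul]
    exact Lp.coeFn_smul _ _
  · refine norm_top_le_of_ae_bound (by positivity) ?_
    filter_upwards [(hm u).coeFn_toLp, h u] with x h1 h2
    exact (congrArg norm h1).trans_le h2

end

/-! ### The unit normal field -/

section

theorem IsOutwardNormal.unique {d : ℕ} {Ω : Set (E d)} {x n n' : E d} (h : IsOutwardNormal Ω x n)
    (h' : IsOutwardNormal Ω x n') : n = n' := by
  by_contra hne
  set v := n' - n with hv
  have hv0 : 0 < ‖v‖ := norm_pos_iff.2 (sub_ne_zero.2 (Ne.symm hne))
  have e1 : inner ℝ v n = inner ℝ n' n - 1 := by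
    rw [hv, inner_sub_left, real_inner_self_eq_norm_sq, h.1, one_pow]
  have e2 : inner ℝ v n' = 1 - inner ℝ n' n := by
    rw [hv, inner_sub_left, real_inner_self_eq_norm_sq, h'.1, one_pow, real_inner_comm]
  have e3 : ‖v‖ ^ 2 = 2 * (1 - inner ℝ n' n) := by
    rw [← real_inner_self_eq_norm_sq]
    nth_rewrite 2 [hv]
    rw [inner_sub_right, e1, e2]
    ring
  set a : ℝ := 1 - inner ℝ n' n
  have ha : 0 < a := by nlinarith
  obtain ⟨r, hr, H⟩ := h.2 (a / (2 * ‖v‖)) (by positivity)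
  obtain ⟨r', hr', H'⟩ := h'.2 (a / (2 * ‖v‖)) (by positivity)
  set s := min r r' / (2 * ‖v‖)
  have hs : 0 < s := by have := lt_min hr hr'; positivity
  have hsv : s * ‖v‖ < min r r' := by
    have := lt_min hr hr'
    have : s * ‖v‖ = min r r' / 2 := by simp only [s]; field_simp
    linarith
  have hd : dist (x + s • v) x < min r r' := by
    rw [dist_eq_norm, add_sub_cancel_left, norm_smul, norm_of_nonneg hs.le]
    exact hsv
  have k1 := (H (x + s • v) (lt_of_lt_of_le hd (min_le_left _ _))).1
  have k2 := (H' (x + s • v) (lt_of_lt_of_le hd (min_le_right _ _))).2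
  rw [add_sub_cancel_left, real_inner_smul_left, norm_smul, norm_of_nonneg hs.le] at k1 k2
  have e4 : a / (2 * ‖v‖) * (s * ‖v‖) = s * a / 2 := by field_simp
  have hsa : 0 < s * a := by positivity
  refine k2 ?_ (k1 ?_)
  · rw [e4, e2]; linarith
  · rw [neg_mul, e4, e1, show inner ℝ n' n - 1 = -a by simp only [a]; ring]; linarith

theorem IsOutwardNormal.normal_eq {d : ℕ} {Ω : Set (E d)} {x n : E d} (h : IsOutwardNormal Ω x n) :
    normal Ω x = n := by
  have hex : ∃ n, IsOutwardNormal Ω x n := ⟨n, h⟩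
  rw [normal, dif_pos hex]
  exact hex.choose_spec.unique h

theorem norm_normal_le {d : ℕ} (Ω : Set (E d)) (x : E d) : ‖normal Ω x‖ ≤ 1 := by
  unfold normal
  split_ifs with h
  · exact h.choose_spec.1.le
  · simp

theorem ver_eq_of_mem_frontier (hΩ : IsOpen Ω) {x : E (m + 1)}
    {R : E (m + 1) ≃ₗᵢ[ℝ] E (m + 1)} {r : ℝ} (hγ : Continuous γ)
    (h : ∀ y ∈ ball x r, y ∈ Ω ↔ γ (hor (R y)) < ver (R y)) {y : E (m + 1)}
    (hy : y ∈ ball x r) (hf : y ∈ frontier Ω) : ver (R y) = γ (hor (R y)) := by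
  rw [hΩ.frontier_eq] at hf
  refine le_antisymm (not_lt.1 fun hlt => hf.2 ((h y hy).2 hlt)) (not_lt.1 fun hlt => ?_)
  have ho : IsOpen {y | ver (R y) < γ (hor (R y))} := isOpen_lt (continuous_ver.comp R.continuous)
      (hγ.comp (continuous_hor.comp R.continuous))
  obtain ⟨w, hw1, hw2⟩ := mem_closure_iff.1 hf.1 _ (ho.inter Metric.isOpen_ball) ⟨hlt, hy⟩
  exact lt_asymm hw1.1 ((h w hw1.2).1 hw2)

theorem inner_pt (x : E (m + 1)) (y : E m) (z : ℝ) :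
    inner ℝ x (pt y z) = inner ℝ (hor x) y + ver x * z := by
  simp only [PiLp.inner_apply, Fin.sum_univ_castSucc]
  simp [hor, ver, pt, mul_comm]

/-- The outward normal of the epigraph of `γ`, at a point over `y`, before normalization. -/
def conormal (γ : E m → ℝ) (y : E m) : E (m + 1) := pt (WithLp.toLp 2 fun i => pd γ i y) (-1)

theorem inner_conormal (γ : E m → ℝ) (y : E m) (x : E (m + 1)) :
    inner ℝ x (conormal γ y) = fderiv ℝ γ y (hor x) - ver x := by
  rw [conormal, inner_pt, fderiv_apply_eq_sum, PiLp.inner_apply]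
  simp [mul_comm, sub_eq_add_neg]

theorem norm_conormal_pos (γ : E m → ℝ) (y : E m) : 0 < ‖conormal γ y‖ := by
  have := norm_sq_eq_hor_ver (conormal γ y)
  rw [conormal, ver_pt] at this
  refine norm_pos_iff.2 fun h => ?_
  rw [← conormal, h, norm_zero] at this
  nlinarith [sq_nonneg ‖hor (conormal γ y)‖, sq_nonneg ‖hor (pt (WithLp.toLp 2 fun i => pd γ i y) (-1))‖]

theorem continuous_conormal (hγ : ContDiff ℝ 1 γ) : Continuous (conormal γ) := by
  have h : ∀ i, Continuous fun y => pd γ i y := fun i =>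
    (hγ.continuous_fderiv (by simp)).clm_apply continuous_const
  refine continuous_pt.comp₂ ?_ continuous_const
  exact (PiLp.continuous_toLp 2 _).comp (continuous_pi h)

theorem isOutwardNormal_of_chart (hΩ : IsOpen Ω) {x : E (m + 1)}
    {R : E (m + 1) ≃ₗᵢ[ℝ] E (m + 1)} {r : ℝ} (hγ : ContDiff ℝ 1 γ)
    (h : ∀ y ∈ ball x r, y ∈ Ω ↔ γ (hor (R y)) < ver (R y)) {p : E (m + 1)}
    (hp : p ∈ ball x r) (hf : p ∈ frontier Ω) : IsOutwardNormal Ω p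
      (R.symm (‖conormal γ (hor (R p))‖⁻¹ • conormal γ (hor (R p)))) := by
  set y := hor (R p) with hy
  set c := ‖conormal γ y‖ with hc
  have hc0 : 0 < c := norm_conormal_pos γ y
  refine ⟨?_, fun ε hε => ?_⟩
  · rw [R.symm.norm_map, norm_smul, norm_inv, norm_norm, inv_mul_cancel₀ hc0.ne']
  have hin : ∀ q, inner ℝ (q - p) (R.symm (c⁻¹ • conormal γ y))
      = c⁻¹ * (fderiv ℝ γ y (hor (R q) - y) - (ver (R q) - γ y)) := fun q => by
    rw [← R.inner_map_map, R.apply_symm_apply, real_inner_smul_right, inner_conormal, map_sub,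
      hor_sub, ver_sub, ver_eq_of_mem_frontier hΩ hγ.continuous h hp hf]
  have hd := (hγ.differentiable (by simp) y).hasFDerivAt.isLittleO
  have hd2 := hd.def (mul_pos hε hc0)
  have hcont : Tendsto (fun q => hor (R q)) (𝓝 p) (𝓝 y) :=
    (continuous_hor.comp R.continuous).continuousAt
  obtain ⟨δ, hδ, hb⟩ := Metric.eventually_nhds_iff_ball.1
    ((hcont.eventually hd2).and (Metric.isOpen_ball.mem_nhds hp))
  refine ⟨δ, hδ, fun q hq => ?_⟩
  obtain ⟨b1, b2⟩ := hb q hq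
  have b3 : ‖hor (R q) - y‖ ≤ ‖q - p‖ := by
    rw [hy, ← hor_sub, ← map_sub]
    exact (norm_hor_le _).trans (R.norm_map _).le
  have b4 : |γ (hor (R q)) - γ y - fderiv ℝ γ y (hor (R q) - y)| ≤ c * (ε * ‖q - p‖) := by
    refine b1.trans ?_
    calc _ ≤ ε * c * ‖q - p‖ := by gcongr
      _ = _ := by ring
  rw [abs_le] at b4
  rw [hin, h q b2]
  constructor
  · intro hlt
    rw [inv_mul_lt_iff₀ hc0] at hlt
    linarith
  · intro hlt
    rw [lt_inv_mul_iff₀ hc0] at hlt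
    linarith

theorem continuousOn_normal (h : HasC11Boundary Ω) (hΩ : IsOpen Ω) :
    ContinuousOn (normal Ω) (frontier Ω) := by
  intro x hx
  obtain ⟨R, r, γ, hr, hγ, -, hy⟩ := h x hx
  have hc : Continuous fun p : E (m + 1) =>
      R.symm (‖conormal γ (hor (R p))‖⁻¹ • conormal γ (hor (R p))) := by
    have h1 : Continuous fun p : E (m + 1) => conormal γ (hor (R p)) :=
      (continuous_conormal hγ).comp (continuous_hor.comp R.continuous)
    exact R.symm.continuous.comp
      ((h1.norm.inv₀ fun p => (norm_conormal_pos γ _).ne').smul h1)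
  refine hc.continuousWithinAt.congr_of_eventuallyEq ?_ ?_
  · filter_upwards [self_mem_nhdsWithin, mem_nhdsWithin_of_mem_nhds (Metric.ball_mem_nhds x hr)]
      with p hp hpb
    exact (isOutwardNormal_of_chart hΩ hγ hy hpb hp).normal_eq
  · exact (isOutwardNormal_of_chart hΩ hγ hy (Metric.mem_ball_self hr) hx).normal_eq

theorem aestronglyMeasurable_normal (h : HasC11Boundary Ω) (hΩ : IsOpen Ω)
    (i : Fin (m + 1)) : AEStronglyMeasurable (fun x => normal Ω x i) (surf Ω) := by
  have h1 := (continuousOn_normal h hΩ).aestronglyMeasurable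
    (μ := (Measure.euclideanHausdorffMeasure m : Measure (E (m + 1)))) isClosed_frontier.measurableSet
  exact (EuclideanSpace.proj (𝕜 := ℝ) i).continuous.comp_aestronglyMeasurable h1

/-! ### Volume and surface measure in graph coordinates -/

theorem measurePreserving_pt :
    MeasurePreserving (fun q : E m × ℝ => pt q.1 q.2) (volume.prod volume) volume := by
  have h1 := (volume_preserving_piFinSuccAbove (fun _ : Fin (m + 1) => ℝ) (Fin.last m)).symm
  have h2 := (MeasurePreserving.id (volume : Measure ℝ)).prod (PiLp.volume_preserving_ofLp (Fin m))
  have h3 := (PiLp.volume_preserving_toLp (Fin (m + 1))).comp (h1.comp h2)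
  have h4 := h3.comp (Measure.measurePreserving_swap (μ := (volume : Measure (E m)))
    (ν := (volume : Measure ℝ)))
  have h5 : (fun q : E m × ℝ => pt q.1 q.2) = (WithLp.toLp 2 ∘
      ⇑(MeasurableEquiv.piFinSuccAbove (fun _ : Fin (m + 1) => ℝ) (Fin.last m)).symm ∘
        Prod.map id WithLp.ofLp) ∘ Prod.swap := by
    funext q
    simp only [pt, Function.comp_apply, MeasurableEquiv.piFinSuccAbove_symm_apply,
      Fin.insertNthEquiv, Prod.swap, Prod.map, Fin.insertNth_last', Equiv.coe_fn_mk, id]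
  rw [h5]
  exact h4

/-- The point at height `s` above the point of the graph of `γ` over `y`, in the frame `R`. -/
def overGraph (R : E (m + 1) ≃ₗᵢ[ℝ] E (m + 1)) (γ : E m → ℝ) (q : E m × ℝ) : E (m + 1) :=
  R.symm (pt q.1 (γ q.1 + q.2))

theorem measurePreserving_overGraph (R : E (m + 1) ≃ₗᵢ[ℝ] E (m + 1))
    (hγ : Continuous γ) : MeasurePreserving (overGraph R γ) (volume.prod volume) volume := by
  have h1 : MeasurePreserving (fun q : E m × ℝ => (q.1, γ q.1 + q.2)) (volume.prod volume)
      (volume.prod volume) :=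
    MeasurePreserving.skew_product (g := fun y s => γ y + s) (MeasurePreserving.id _)
      (by simp only [Function.uncurry_def]; fun_prop)
      (.of_forall fun y => (measurePreserving_add_left volume (γ y)).map_eq)
  exact R.symm.measurePreserving.comp (measurePreserving_pt.comp h1)

theorem continuous_overGraph (R : E (m + 1) ≃ₗᵢ[ℝ] E (m + 1)) (hγ : Continuous γ) :
    Continuous (overGraph R γ) := R.symm.continuous.comp (continuous_pt.comp₂ continuous_fst
    ((hγ.comp continuous_fst).add continuous_snd))

theorem lintegral_overGraph (R : E (m + 1) ≃ₗᵢ[ℝ] E (m + 1)) (hγ : Continuous γ)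
    {f : E (m + 1) → ℝ≥0∞} (hf : Measurable f) :
    ∫⁻ y, ∫⁻ s, f (overGraph R γ (y, s)) = ∫⁻ x, f x := by
  rw [← (measurePreserving_overGraph R hγ).lintegral_comp hf]
  exact (lintegral_prod _
    (hf.comp (continuous_overGraph R hγ).measurable).aemeasurable).symm

theorem lipschitz_overGraph (R : E (m + 1) ≃ₗᵢ[ℝ] E (m + 1)) {L : NNReal}
    (hγ : LipschitzWith L γ) : LipschitzWith (1 + L) fun y => overGraph R γ (y, 0) := by
  refine LipschitzWith.of_dist_le_mul fun y y' => ?_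
  rw [overGraph, overGraph, R.symm.dist_map, dist_eq_norm, pt_sub]
  refine (norm_pt_le _ _).trans ?_
  have := hγ.dist_le_mul y y'
  rw [dist_eq] at this
  simp only [add_zero]
  rw [dist_eq_norm] at this ⊢
  push_cast
  linarith

theorem euclideanHausdorffMeasure_image_le {X Y : Type*} [MetricSpace X] [MeasurableSpace X]
    [BorelSpace X] [MetricSpace Y] [MeasurableSpace Y] [BorelSpace Y] {K : NNReal} {f : X → Y}
    (hf : LipschitzWith K f) (m : ℕ) (s : Set X) :
    (Measure.euclideanHausdorffMeasure m : Measure Y) (f '' s) ≤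
      (K : ℝ≥0∞) ^ m * (Measure.euclideanHausdorffMeasure m : Measure X) s := by
  have h := hf.hausdorffMeasure_image_le (Nat.cast_nonneg m) s
  rw [ENNReal.rpow_natCast] at h
  rw [Measure.euclideanHausdorffMeasure_def, Measure.euclideanHausdorffMeasure_def,
    Measure.smul_apply, Measure.smul_apply, ENNReal.smul_def, ENNReal.smul_def, smul_eq_mul,
    smul_eq_mul, mul_left_comm]
  exact mul_le_mul_right h _

theorem IsLipChart.surf_restrict_le (hΩ : IsOpen Ω) {x : E (m + 1)} {R γ L r}
    (h : IsLipChart Ω x R γ L r) : (surf Ω).restrict (ball x r) ≤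
      ((1 + L : NNReal) : ℝ≥0∞) ^ m • volume.map fun y => overGraph R γ (y, 0) := by
  refine Measure.le_iff.2 fun A hA => ?_
  have hc : Continuous fun y : E m => overGraph R γ (y, 0) := (lipschitz_overGraph R h.lip).continuous
  rw [surf, Measure.restrict_apply hA, Measure.restrict_apply (hA.inter measurableSet_ball),
    Measure.smul_apply, Measure.map_apply hc.measurable hA, smul_eq_mul,
    ← EuclideanSpace.euclideanHausdorffMeasure_eq_volume]
  refine (measure_mono ?_).trans (euclideanHausdorffMeasure_image_le
    (lipschitz_overGraph R h.lip) m _)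
  rintro p ⟨⟨hpA, hpb⟩, hpf⟩
  have hp : overGraph R γ (hor (R p), 0) = p := by
    rw [overGraph, add_zero, ← h.ver_eq hΩ hpb hpf, pt_hor_ver, R.symm_apply_apply]
  exact ⟨hor (R p), by rw [mem_preimage, hp]; exact hpA, hp⟩

theorem isFiniteMeasure_surf (h : HasC11Boundary Ω) (hΩ : IsOpen Ω)
    (hb : IsBounded Ω) : IsFiniteMeasure (surf Ω) := by
  have hK : IsCompact (frontier Ω) := hb.isCompact_closure.of_isClosed_subset isClosed_frontier
    frontier_subset_closure
  have hx : ∀ x ∈ frontier Ω, ∃ t ∈ 𝓝[frontier Ω] x, (surf Ω) t < ∞ := fun x hx => by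
    obtain ⟨R, γ, L, r, hch⟩ := h.exists_lipChart hx
    refine ⟨ball x r, mem_nhdsWithin_of_mem_nhds (Metric.ball_mem_nhds x hch.pos), ?_⟩
    have h1 := (hch.surf_restrict_le hΩ) (ball x r)
    have hc : Continuous fun y : E m => overGraph R γ (y, 0) :=
      (lipschitz_overGraph R hch.lip).continuous
    rw [Measure.restrict_apply_self, Measure.smul_apply, Measure.map_apply hc.measurable
      measurableSet_ball, smul_eq_mul] at h1
    refine h1.trans_lt (ENNReal.mul_lt_top (ENNReal.pow_lt_top ENNReal.coe_lt_top) ?_)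
    refine (measure_mono fun y hy => ?_).trans_lt (measure_ball_lt_top (x := hor (R x)) (r := r))
    rw [mem_preimage, Metric.mem_ball] at hy
    rw [Metric.mem_ball]
    refine lt_of_le_of_lt ?_ hy
    rw [dist_eq_norm, dist_eq_norm, ← R.norm_map, map_sub, overGraph, R.apply_symm_apply]
    refine le_trans (le_of_eq ?_) (norm_hor_le _)
    rw [hor_sub, hor_pt]
  have := hK.measure_lt_top_of_nhdsWithin hx
  refine ⟨?_⟩
  rw [surf, Measure.restrict_apply_univ]
  rwa [surf, Measure.restrict_apply_self] at this

/-- The map `y ↦ (y, f y)`. -/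
def graphMap (f : E m → ℝ) (y : E m) : E (m + 1) := pt y (f y)

theorem continuous_graphMap {f : E m → ℝ} (hf : Continuous f) : Continuous (graphMap f) :=
  continuous_pt.comp₂ continuous_id hf

theorem map_graphMap_le_surf {f : E m → ℝ}
    (hf : Continuous f) (hB : graphOver B f ⊆ frontier Ω) : (vol B).map (graphMap f) ≤ surf Ω := by
  refine Measure.le_iff.2 fun A hA => ?_
  have hm := (continuous_graphMap hf).measurable
  rw [Measure.map_apply hm hA, vol, Measure.restrict_apply (hm hA), surf, Measure.restrict_apply hA,
    ← EuclideanSpace.euclideanHausdorffMeasure_eq_volume]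
  have h := euclideanHausdorffMeasure_image_le (lipschitz_hor (m := m)) m (A ∩ frontier Ω)
  rw [ENNReal.coe_one, one_pow, one_mul] at h
  refine (measure_mono ?_).trans h
  rintro y ⟨hy, hyB⟩
  exact ⟨graphMap f y, ⟨hy, hB ⟨y, hyB, rfl⟩⟩, hor_pt _ _⟩

end

/-! ### Lipschitz functions with a continuous bound for their pointwise Lipschitz constant -/

section

/-- `F` is Lipschitz, and its pointwise Lipschitz constant is bounded by the continuous
function `G`. -/
structure HasUpperGrad (F G : E n → ℝ) : Prop where
  lip : ∃ K, LipschitzWith K F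
  cont : Continuous G
  nonneg : ∀ p, 0 ≤ G p
  bound : ∀ p c, G p < c → ∀ᶠ q in 𝓝 p, |F q - F p| ≤ c * ‖q - p‖

theorem HasUpperGrad.zero : HasUpperGrad (0 : E n → ℝ) 0 where
  lip := ⟨0, LipschitzWith.const 0⟩
  cont := continuous_const
  nonneg _ := le_rfl
  bound p c hc := Eventually.of_forall fun q => by
    simpa using mul_nonneg (le_of_lt hc) (norm_nonneg (q - p))

theorem HasUpperGrad.add {F G F' G' : E n → ℝ} (h : HasUpperGrad F G) (h' : HasUpperGrad F' G') :
    HasUpperGrad (F + F') (G + G') where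
  lip := by
    obtain ⟨K, hK⟩ := h.lip
    obtain ⟨K', hK'⟩ := h'.lip
    exact ⟨K + K', hK.add hK'⟩
  cont := h.cont.add h'.cont
  nonneg p := add_nonneg (h.nonneg p) (h'.nonneg p)
  bound p c hc := by
    simp only [Pi.add_apply] at hc
    filter_upwards [h.bound p (G p + (c - (G p + G' p)) / 2) (by linarith),
      h'.bound p (G' p + (c - (G p + G' p)) / 2) (by linarith)] with q h1 h2
    simp only [Pi.add_apply]
    calc |F q + F' q - (F p + F' p)| = |(F q - F p) + (F' q - F' p)| := by ring_nf
      _ ≤ |F q - F p| + |F' q - F' p| := abs_add_le _ _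
      _ ≤ _ := add_le_add h1 h2
      _ = _ := by ring

theorem HasUpperGrad.sum {ι : Type*} (s : Finset ι) {F G : ι → E n → ℝ}
    (h : ∀ k, HasUpperGrad (F k) (G k)) : HasUpperGrad (∑ k ∈ s, F k) (∑ k ∈ s, G k) := by
  classical
  induction s using Finset.induction_on with
  | empty => simpa using HasUpperGrad.zero
  | insert a s ha ih => rw [Finset.sum_insert ha, Finset.sum_insert ha]; exact (h a).add ih

theorem HasUpperGrad.of_contDiff {f : E n → ℝ} (hf : ContDiff ℝ (⊤ : ℕ∞) f)
    (hc : HasCompactSupport f) : HasUpperGrad f fun p => ‖fderiv ℝ f p‖ where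
  lip := ContDiff.lipschitzWith_of_hasCompactSupport hc hf (by simp)
  cont := (hf.continuous_fderiv (by simp)).norm
  nonneg _ := norm_nonneg _
  bound p c hpc := by
    have h := (hf.differentiable (by simp) p).hasFDerivAt.isLittleO.def (sub_pos.2 hpc)
    filter_upwards [h] with q hq
    have h1 := (fderiv ℝ f p).le_opNorm (q - p)
    have h2 := abs_sub_abs_le_abs_sub (f q - f p) (fderiv ℝ f p (q - p))
    rw [norm_eq_abs] at hq h1
    linarith

theorem HasUpperGrad.comp {F G : E n → ℝ} (h : HasUpperGrad F G) {Φ : E n → E n} {K : NNReal}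
    (hΦ : LipschitzWith K Φ) : HasUpperGrad (F ∘ Φ) fun p => K * G (Φ p) where
  lip := by
    obtain ⟨K', hK'⟩ := h.lip
    exact ⟨_, hK'.comp hΦ⟩
  cont := continuous_const.mul (h.cont.comp hΦ.continuous)
  nonneg p := mul_nonneg K.2 (h.nonneg _)
  bound p c hpc := by
    have hK : (0 : ℝ) ≤ K := K.2
    set c' := G (Φ p) + (c - K * G (Φ p)) / (K + 1) with hc'
    have h1 : G (Φ p) < c' := by
      have : 0 < (c - K * G (Φ p)) / (K + 1) := div_pos (sub_pos.2 hpc) (by positivity)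
      linarith
    have h2 : K * c' ≤ c := by
      have e : K * c' = c - (c - K * G (Φ p)) / (K + 1) := by rw [hc']; field_simp; ring
      have : 0 < (c - K * G (Φ p)) / (K + 1) := div_pos (sub_pos.2 hpc) (by positivity)
      linarith
    filter_upwards [(hΦ.continuous.tendsto p).eventually (h.bound (Φ p) c' h1)] with q hq
    have h3 := hΦ.dist_le_mul q p
    rw [dist_eq_norm, dist_eq_norm] at h3
    have h4 : 0 ≤ c' := (h.nonneg _).trans h1.le
    calc |F (Φ q) - F (Φ p)| ≤ c' * ‖Φ q - Φ p‖ := hq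
      _ ≤ c' * (K * ‖q - p‖) := by gcongr
      _ = K * c' * ‖q - p‖ := by ring
      _ ≤ c * ‖q - p‖ := by gcongr

theorem HasUpperGrad.line_le {F G : E n → ℝ} (h : HasUpperGrad F G) (p : E n) {v : E n}
    (hv : ‖v‖ ≤ 1) (hs : 0 ≤ s) :
    ‖F (p + s • v) - F p‖ₑ ≤ ∫⁻ t in Ioo 0 s, ofReal (G (p + t • v)) := by
  obtain ⟨K, hK⟩ := h.lip
  have hline : LipschitzWith 1 fun t : ℝ => p + t • v := LipschitzWith.of_dist_le_mul fun t t' => by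
    rw [dist_add_left, dist_eq_norm, ← sub_smul, norm_smul, NNReal.coe_one, one_mul, dist_eq_norm]
    exact mul_le_of_le_one_right (norm_nonneg _) hv
  have hac := ((hK.comp hline).lipschitzOnWith (s := uIcc 0 s)).absolutelyContinuousOnInterval
  have hi := hac.integral_deriv_eq_sub
  simp only [Function.comp_apply, zero_smul, add_zero] at hi
  rw [← hi]
  have hd : ∀ t, ‖deriv (F ∘ fun t : ℝ => p + t • v) t‖ ≤ G (p + t • v) := fun t => by
    refine le_of_forall_gt_imp_ge_of_dense fun c hc => ?_
    refine norm_deriv_le_of_lip' ((h.nonneg _).trans hc.le) ?_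
    filter_upwards [(hline.continuous.tendsto t).eventually (h.bound _ c hc)] with r hr
    refine hr.trans ?_
    have := hline.dist_le_mul r t
    rw [dist_eq_norm, dist_eq_norm, NNReal.coe_one, one_mul] at this
    exact mul_le_mul_of_nonneg_left this ((h.nonneg _).trans hc.le)
  have hcl : Continuous fun t : ℝ => G (p + t • v) := h.cont.comp hline.continuous
  have hb : ‖∫ t in (0 : ℝ)..s, deriv (F ∘ fun t : ℝ => p + t • v) t‖ ≤
      ∫ t in (0 : ℝ)..s, G (p + t • v) :=
    intervalIntegral.norm_integral_le_of_norm_le hs (.of_forall fun t _ => hd t)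
      (hcl.intervalIntegrable _ _)
  rw [← ofReal_norm]
  refine (ofReal_le_ofReal hb).trans_eq ?_
  rw [intervalIntegral.integral_of_le hs, integral_Ioc_eq_integral_Ioo,
    ofReal_integral_eq_lintegral_ofReal]
  · exact (hcl.integrableOn_Icc (a := 0) (b := s)).mono_set Ioo_subset_Icc_self
  · exact Eventually.of_forall fun t => h.nonneg _

theorem HasUpperGrad.continuous {F G : E n → ℝ} (h : HasUpperGrad F G) : Continuous F :=
  h.lip.choose_spec.continuous

end

/-! ### Restriction to hyperplanes and graphs -/

theorem add_sq_le_two_mul (a b : ℝ≥0∞) : (a + b) ^ 2 ≤ 2 * (a ^ 2 + b ^ 2) := by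
  have h := ENNReal.rpow_add_le_mul_rpow_add_rpow a b (p := 2) (by norm_num)
  norm_num at h
  exact_mod_cast h

theorem lintegral_sq_le_mul {f : ℝ → ℝ≥0∞} (hf : Measurable f) :
    (∫⁻ t in Ioo 0 s, f t) ^ 2 ≤ ofReal s * ∫⁻ t in Ioo 0 s, f t ^ 2 := by
  have h := sq_lintegral_mul_le (μ := volume.restrict (Ioo 0 s)) (k := fun _ => 1)
    aemeasurable_const hf.aemeasurable
  simpa using h

theorem lintegral_rpow_neg_half (hs : 0 < s) :
    ∫⁻ z in Ioo 0 s, ofReal (z ^ (-(1 / 2) : ℝ)) = ofReal (2 * s ^ (1 / 2 : ℝ)) := by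
  have hi : IntegrableOn (fun z : ℝ => z ^ (-(1 / 2) : ℝ)) (Ioo 0 s) :=
    (intervalIntegral.integrableOn_Ioo_rpow_iff hs).2 (by norm_num)
  rw [← ofReal_integral_eq_lintegral_ofReal hi, ← integral_Ioc_eq_integral_Ioo,
    ← intervalIntegral.integral_of_le hs.le, integral_rpow (Or.inl (by norm_num))]
  · congr 1
    norm_num
    ring
  · filter_upwards [ae_restrict_mem measurableSet_Ioo] with z hz
    exact Real.rpow_nonneg hz.1.le _

theorem lintegral_rpow_neg_three_half {z : ℝ} (hz : 0 < z) :
    ∫⁻ s in Ioi z, ofReal (s ^ (-(3 / 2) : ℝ)) = ofReal (2 * z ^ (-(1 / 2) : ℝ)) := by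
  have hi : IntegrableOn (fun z : ℝ => z ^ (-(3 / 2) : ℝ)) (Ioi z) :=
    integrableOn_Ioi_rpow_of_lt (by norm_num) hz
  rw [← ofReal_integral_eq_lintegral_ofReal hi, integral_Ioi_rpow_of_lt (by norm_num) hz]
  · congr 1
    norm_num
    ring
  · filter_upwards [ae_restrict_mem measurableSet_Ioi] with s hs
    exact Real.rpow_nonneg (hz.trans hs).le _

/-- Hardy's inequality. -/
theorem lintegral_hardy_le {g : ℝ → ℝ≥0∞} (hg : Measurable g) :
    ∫⁻ s in Ioi 0, ofReal ((s ^ 2)⁻¹) * (∫⁻ z in Ioo 0 s, g z) ^ 2 ≤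
      4 * ∫⁻ z in Ioi 0, g z ^ 2 := by
  set w : ℝ → ℝ≥0∞ := fun z => ofReal (z ^ (1 / 2 : ℝ)) * g z ^ 2 with hw
  have hwm : Measurable w := by fun_prop
  have h1 : ∀ s ∈ Ioi (0 : ℝ), ofReal ((s ^ 2)⁻¹) * (∫⁻ z in Ioo 0 s, g z) ^ 2 ≤
      ∫⁻ z in Ioi 0, (Iio s).indicator (fun z => ofReal (2 * s ^ (-(3 / 2) : ℝ)) * w z) z := by
    intro s hs
    have hs : 0 < s := hs
    have h2 := sq_lintegral_mul_le (μ := volume.restrict (Ioo 0 s))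
      (k := fun z => ofReal (z ^ (-(1 / 2) : ℝ)))
      (f := fun z => ofReal (z ^ (1 / 2 : ℝ)) * g z) (by fun_prop) (by fun_prop)
    have e1 : ∫⁻ z in Ioo 0 s, ofReal (z ^ (-(1 / 2) : ℝ)) *
        (ofReal (z ^ (1 / 2 : ℝ)) * g z) = ∫⁻ z in Ioo 0 s, g z := by
      refine setLIntegral_congr_fun measurableSet_Ioo fun z hz => ?_
      have hz : 0 < z := hz.1
      rw [← mul_assoc, ← ofReal_mul (by positivity), ← rpow_add hz]
      norm_num
    have e2 : ∫⁻ z in Ioo 0 s, ofReal (z ^ (-(1 / 2) : ℝ)) *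
        (ofReal (z ^ (1 / 2 : ℝ)) * g z) ^ 2 = ∫⁻ z in Ioo 0 s, w z := by
      refine setLIntegral_congr_fun measurableSet_Ioo fun z hz => ?_
      have hz : 0 < z := hz.1
      simp only [hw]
      rw [mul_pow, ← mul_assoc, ← ofReal_pow (by positivity),
        ← ofReal_mul (by positivity), ← Real.rpow_natCast, ← Real.rpow_mul hz.le, ← rpow_add hz]
      norm_num
    rw [e1, e2, lintegral_rpow_neg_half hs] at h2
    rw [lintegral_indicator measurableSet_Iio, Measure.restrict_restrict measurableSet_Iio,
      Iio_inter_Ioi, lintegral_const_mul _ hwm]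
    refine (mul_le_mul_right h2 _).trans_eq ?_
    rw [← mul_assoc, ← ofReal_mul (by positivity)]
    congr 2
    rw [mul_left_comm]
    congr 1
    rw [← Real.rpow_natCast, ← rpow_neg hs.le, ← rpow_add hs]
    norm_num
  refine (setLIntegral_mono' measurableSet_Ioi h1).trans ?_
  have hm : Measurable fun p : ℝ × ℝ =>
      (Iio p.1).indicator (fun z => ofReal (2 * p.1 ^ (-(3 / 2) : ℝ)) * w z) p.2 := by
    have : (fun p : ℝ × ℝ =>
        (Iio p.1).indicator (fun z => ofReal (2 * p.1 ^ (-(3 / 2) : ℝ)) * w z) p.2) =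
        {p : ℝ × ℝ | p.2 < p.1}.indicator fun p => ofReal (2 * p.1 ^ (-(3 / 2) : ℝ)) * w p.2 := by
      funext p
      simp [indicator_apply]
    rw [this]
    exact Measurable.indicator (by fun_prop) (measurableSet_lt measurable_snd measurable_fst)
  rw [lintegral_lintegral_swap hm.aemeasurable, ← lintegral_const_mul _ (by fun_prop)]
  refine (setLIntegral_mono' measurableSet_Ioi fun z hz => ?_)
  have hz : 0 < z := hz
  have e3 : ∀ s, (Iio s).indicator (fun z => ofReal (2 * s ^ (-(3 / 2) : ℝ)) * w z) z =
      (Ioi z).indicator (fun s => w z * 2 * ofReal (s ^ (-(3 / 2) : ℝ))) s := fun s => by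
    simp only [indicator_apply, mem_Iio, mem_Ioi]
    split_ifs
    · rw [ofReal_mul (by norm_num), ofReal_ofNat]; ring
    · rfl
  simp only [e3]
  rw [lintegral_indicator measurableSet_Ioi, Measure.restrict_restrict measurableSet_Ioi,
    Ioi_inter_Ioi, max_eq_left hz.le, lintegral_const_mul _ (by fun_prop),
    lintegral_rpow_neg_three_half hz]
  refine le_of_eq ?_
  simp only [hw]
  rw [ofReal_mul (by norm_num), ofReal_ofNat]
  have e4 : ofReal (z ^ (1 / 2 : ℝ)) * ofReal (z ^ (-(1 / 2) : ℝ)) = 1 := by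
    rw [← ofReal_mul (by positivity), ← rpow_add hz]
    norm_num
  calc _ = (ofReal (z ^ (1 / 2 : ℝ)) * ofReal (z ^ (-(1 / 2) : ℝ))) * (2 * 2) * g z ^ 2 := by
        ring
    _ = _ := by rw [e4]; norm_num

section

theorem pt_zero_one_norm : ‖(pt 0 1 : E (m + 1))‖ = 1 := by
  have := norm_sq_eq_hor_ver (pt (0 : E m) 1)
  rw [hor_pt, ver_pt] at this
  simp only [norm_zero] at this
  nlinarith [norm_nonneg (pt (0 : E m) 1)]

theorem pt_add_smul (y : E m) (z s : ℝ) : pt y z + s • pt 0 1 = pt y (z + s) := by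
  ext i
  refine Fin.lastCases ?_ (fun j => ?_) i <;> simp [pt]

theorem pt_add_smul_hor (y v : E m) (z s : ℝ) : pt y z + s • pt v 0 = pt (y + s • v) z := by
  ext i
  refine Fin.lastCases ?_ (fun j => ?_) i <;> simp [pt]

theorem HasUpperGrad.lintegral_graph_le {F G : E (m + 1) → ℝ} (h : HasUpperGrad F G)
    (R : E (m + 1) ≃ₗᵢ[ℝ] E (m + 1)) (hγ : Continuous γ) :
    ∫⁻ y, ‖F (overGraph R γ (y, 0))‖ₑ ^ 2 ≤ 2 * (∫⁻ x, ‖F x‖ₑ ^ 2) + 2 * ∫⁻ x, ‖G x‖ₑ ^ 2 := by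
  have hFm : Measurable fun x => ‖F x‖ₑ ^ 2 := h.continuous.enorm.measurable.pow_const 2
  have hGm : Measurable fun x => ‖G x‖ₑ ^ 2 := h.cont.enorm.measurable.pow_const 2
  have hog := (continuous_overGraph R hγ).measurable
  have hv : ‖R.symm (pt 0 1)‖ ≤ 1 := by rw [R.symm.norm_map, pt_zero_one_norm]
  have hl : ∀ y s, overGraph R γ (y, 0) + s • R.symm (pt 0 1) = overGraph R γ (y, s) := fun y s => by
    rw [overGraph, overGraph, ← map_smul, ← map_add, pt_add_smul, add_zero]
  have key : ∀ y, ‖F (overGraph R γ (y, 0))‖ₑ ^ 2 ≤ 2 * (∫⁻ s, ‖F (overGraph R γ (y, s))‖ₑ ^ 2)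
      + 2 * ∫⁻ s, ‖G (overGraph R γ (y, s))‖ₑ ^ 2 := fun y => by
    have hsm : Measurable fun s : ℝ => overGraph R γ (y, s) := hog.comp measurable_prodMk_left
    have h1 : ∀ s ∈ Ioo (0 : ℝ) 1, ‖F (overGraph R γ (y, 0))‖ₑ ^ 2 ≤
        2 * ‖F (overGraph R γ (y, s))‖ₑ ^ 2 + 2 * ∫⁻ t in Ioo (0 : ℝ) 1, ‖G (overGraph R γ (y, t))‖ₑ ^ 2 := by
      intro s hs
      have h2 := h.line_le (overGraph R γ (y, 0)) hv hs.1.le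
      simp only [hl] at h2
      have h3 : ‖F (overGraph R γ (y, 0))‖ₑ ≤ ‖F (overGraph R γ (y, s))‖ₑ +
          ∫⁻ t in Ioo 0 s, ofReal (G (overGraph R γ (y, t))) := by
        refine le_trans ?_ (add_le_add_right h2 _)
        have := enorm_sub_le (a := F (overGraph R γ (y, s)))
          (b := F (overGraph R γ (y, s)) - F (overGraph R γ (y, 0)))
        rwa [sub_sub_cancel] at this
      have h4 : (∫⁻ t in Ioo 0 s, ofReal (G (overGraph R γ (y, t)))) ^ 2 ≤
          ∫⁻ t in Ioo (0 : ℝ) 1, ‖G (overGraph R γ (y, t))‖ₑ ^ 2 := by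
        refine (lintegral_sq_le_mul
          (ENNReal.measurable_ofReal.comp (h.cont.measurable.comp hsm))).trans ?_
        refine (mul_le_of_le_one_left' (by simpa using hs.2.le)).trans ?_
        refine (lintegral_mono_set (Ioo_subset_Ioo_right hs.2.le)).trans_eq ?_
        simp only [Function.comp_apply, enorm_eq_ofReal (h.nonneg _)]
      calc _ ≤ _ := pow_le_pow_left' h3 2
        _ ≤ _ := add_sq_le_two_mul _ _
        _ ≤ _ := by rw [mul_add]; gcongr
    calc ‖F (overGraph R γ (y, 0))‖ₑ ^ 2 = ∫⁻ s in Ioo (0 : ℝ) 1, ‖F (overGraph R γ (y, 0))‖ₑ ^ 2 := by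
          simp
      _ ≤ ∫⁻ s in Ioo (0 : ℝ) 1, (2 * ‖F (overGraph R γ (y, s))‖ₑ ^ 2 +
            2 * ∫⁻ t in Ioo (0 : ℝ) 1, ‖G (overGraph R γ (y, t))‖ₑ ^ 2) :=
          setLIntegral_mono' measurableSet_Ioo h1
      _ = 2 * (∫⁻ s in Ioo (0 : ℝ) 1, ‖F (overGraph R γ (y, s))‖ₑ ^ 2) +
            2 * ∫⁻ t in Ioo (0 : ℝ) 1, ‖G (overGraph R γ (y, t))‖ₑ ^ 2 := by
          have hm : Measurable fun s => ‖F (overGraph R γ (y, s))‖ₑ ^ 2 := hFm.comp hsm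
          rw [lintegral_add_right _ measurable_const, lintegral_const_mul _ hm]
          simp
      _ ≤ _ := by gcongr <;> exact Measure.restrict_le_self
  refine (lintegral_mono key).trans_eq ?_
  have m1 : Measurable fun y => ∫⁻ s, ‖F (overGraph R γ (y, s))‖ₑ ^ 2 :=
    (hFm.comp hog).lintegral_prod_right'
  have m2 : Measurable fun y => ∫⁻ s, ‖G (overGraph R γ (y, s))‖ₑ ^ 2 :=
    (hGm.comp hog).lintegral_prod_right'
  rw [lintegral_add_left (m1.const_mul 2), lintegral_const_mul _ m1, lintegral_const_mul _ m2,
    lintegral_overGraph R hγ hFm, lintegral_overGraph R hγ hGm]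

theorem lintegral_pt {f : E (m + 1) → ℝ≥0∞} (hf : Measurable f) :
    ∫⁻ y, ∫⁻ z, f (pt y z) = ∫⁻ x, f x := by
  have h := lintegral_overGraph (LinearIsometryEquiv.refl ℝ (E (m + 1)))
    (γ := fun _ => 0) continuous_const hf
  have e : ∀ q : E m × ℝ, overGraph (LinearIsometryEquiv.refl ℝ (E (m + 1))) (fun _ => 0) q =
      pt q.1 q.2 := fun q => by
    rw [overGraph, zero_add]
    rfl
  simpa only [e] using h

/-- The Gagliardo seminorm, in the direction `v`, of the restriction to a hyperplane. -/
theorem HasUpperGrad.lintegral_gagliardo_le {F G : E (m + 1) → ℝ} (h : HasUpperGrad F G)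
    {v : E m} (hv : ‖v‖ ≤ 1) : ∫⁻ s in Ioi 0, ofReal ((s ^ 2)⁻¹) *
      ∫⁻ y, ‖F (pt (y + s • v) 0) - F (pt y 0)‖ₑ ^ 2 ≤ 34 * ∫⁻ x, ‖G x‖ₑ ^ 2 := by
  set g : E (m + 1) → ℝ≥0∞ := fun x => ofReal (G x) with hg
  have hgG : ∀ x, ‖G x‖ₑ = g x := fun x => enorm_eq_ofReal (h.nonneg x)
  have hgm : Measurable g := ENNReal.measurable_ofReal.comp h.cont.measurable
  have hpt : Measurable fun q : E m × ℝ => pt q.1 q.2 := measurePreserving_pt.measurable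
  have hgp : ∀ y, Measurable fun z => g (pt y z) := fun y =>
    hgm.comp (hpt.comp measurable_prodMk_left)
  set A : E m → ℝ → ℝ≥0∞ := fun y s => ∫⁻ z in Ioo 0 s, g (pt y z) with hA
  have hv' : ‖(pt v 0 : E (m + 1))‖ ≤ 1 := by
    refine (norm_pt_le _ _).trans ?_
    simpa using hv
  have key : ∀ s ∈ Ioi (0 : ℝ), ∀ y, ‖F (pt (y + s • v) 0) - F (pt y 0)‖ₑ ^ 2 ≤
      4 * A y s ^ 2 + 4 * A (y + s • v) s ^ 2 +
        2 * (ofReal s * ∫⁻ t in Ioo 0 s, g (pt (y + t • v) s) ^ 2) := by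
    intro s hs y
    have hs : 0 < s := hs
    have h1 := h.line_le (pt y 0) pt_zero_one_norm.le hs.le
    have h2 := h.line_le (pt (y + s • v) 0) pt_zero_one_norm.le hs.le
    have h3 := h.line_le (pt y s) hv' hs.le
    simp only [pt_add_smul, pt_add_smul_hor, zero_add] at h1 h2 h3
    have h4 : ‖F (pt (y + s • v) 0) - F (pt y 0)‖ₑ ≤ (A y s + A (y + s • v) s) +
        ∫⁻ t in Ioo 0 s, g (pt (y + t • v) s) := by
      have e : F (pt (y + s • v) 0) - F (pt y 0) = ((F (pt y s) - F (pt y 0)) -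
          (F (pt (y + s • v) s) - F (pt (y + s • v) 0))) + (F (pt (y + s • v) s) - F (pt y s)) := by
        ring
      rw [e]
      exact (enorm_add_le _ _).trans (add_le_add (enorm_sub_le.trans (add_le_add h1 h2)) h3)
    have hm3 : Measurable fun t : ℝ => g (pt (y + t • v) s) :=
      hgm.comp (hpt.comp (by fun_prop : Measurable fun t : ℝ => (y + t • v, s)))
    calc _ ≤ _ := pow_le_pow_left' h4 2
      _ ≤ _ := add_sq_le_two_mul _ _
      _ ≤ 2 * (2 * (A y s ^ 2 + A (y + s • v) s ^ 2) +
          ofReal s * ∫⁻ t in Ioo 0 s, g (pt (y + t • v) s) ^ 2) := by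
          gcongr
          · exact add_sq_le_two_mul _ _
          · exact lintegral_sq_le_mul hm3
      _ = _ := by ring
  have hAm : Measurable fun q : E m × ℝ => A q.1 q.2 := by
    have : ∀ q : E m × ℝ, A q.1 q.2 = ∫⁻ z, (Ioo 0 q.2).indicator (fun z => g (pt q.1 z)) z :=
      fun q => (lintegral_indicator measurableSet_Ioo _).symm
    simp only [this]
    have hm : Measurable fun w : (E m × ℝ) × ℝ =>
        {w : (E m × ℝ) × ℝ | 0 < w.2 ∧ w.2 < w.1.2}.indicator (fun w => g (pt w.1.1 w.2)) w :=
      (hgm.comp (hpt.comp (by fun_prop : Measurable fun w : (E m × ℝ) × ℝ => (w.1.1, w.2)))).indicator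
        ((measurableSet_lt measurable_const measurable_snd).inter
          (measurableSet_lt measurable_snd (measurable_snd.comp measurable_fst)))
    exact hm.lintegral_prod_right'
  have hAy : ∀ s, Measurable fun y => A y s := fun s => hAm.comp measurable_prodMk_right
  have hM : ∀ s ∈ Ioi (0 : ℝ), ∫⁻ y, ofReal s * ∫⁻ t in Ioo 0 s, g (pt (y + t • v) s) ^ 2 =
      ofReal (s ^ 2) * ∫⁻ y, g (pt y s) ^ 2 := by
    intro s hs
    have hs : 0 < s := hs
    have hm : Measurable fun q : E m × ℝ => g (pt (q.1 + q.2 • v) s) ^ 2 :=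
      (hgm.comp (hpt.comp (by fun_prop : Measurable fun q : E m × ℝ => (q.1 + q.2 • v, s)))).pow_const 2
    rw [lintegral_const_mul _ hm.lintegral_prod_right', lintegral_lintegral_swap hm.aemeasurable]
    have e : ∀ t : ℝ, ∫⁻ y, g (pt (y + t • v) s) ^ 2 = ∫⁻ y, g (pt y s) ^ 2 := fun t =>
      lintegral_add_right_eq_self (fun y => g (pt y s) ^ 2) (t • v)
    simp only [e]
    rw [lintegral_const, Measure.restrict_apply_univ, Real.volume_Ioo, sub_zero, sq, ofReal_mul
      hs.le]
    ring
  have hA2 : ∀ s : ℝ, ∫⁻ y, A (y + s • v) s ^ 2 = ∫⁻ y, A y s ^ 2 := fun s =>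
    lintegral_add_right_eq_self (fun y => A y s ^ 2) (s • v)
  have step : ∀ s ∈ Ioi (0 : ℝ), ofReal ((s ^ 2)⁻¹) *
      ∫⁻ y, ‖F (pt (y + s • v) 0) - F (pt y 0)‖ₑ ^ 2 ≤
      8 * (∫⁻ y, ofReal ((s ^ 2)⁻¹) * A y s ^ 2) + 2 * ∫⁻ y, g (pt y s) ^ 2 := by
    intro s hs
    have hs0 : (0 : ℝ) < s := hs
    refine (mul_le_mul_right (lintegral_mono (key s hs)) _).trans_eq ?_
    have m1 : Measurable fun y => 4 * A y s ^ 2 := ((hAy s).pow_const 2).const_mul 4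
    have m2 : Measurable fun y => 4 * A (y + s • v) s ^ 2 :=
      (((hAy s).comp (measurable_add_const (s • v))).pow_const 2).const_mul 4
    have m3 : Measurable fun y => A (y + s • v) s ^ 2 :=
      ((hAy s).comp (measurable_add_const (s • v))).pow_const 2
    have m4 : Measurable fun y => ofReal s * ∫⁻ t in Ioo 0 s, g (pt (y + t • v) s) ^ 2 := by
      have hm : Measurable fun q : E m × ℝ => g (pt (q.1 + q.2 • v) s) ^ 2 :=
        (hgm.comp (hpt.comp (by fun_prop : Measurable fun q : E m × ℝ => (q.1 + q.2 • v, s)))).pow_const 2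
      exact hm.lintegral_prod_right'.const_mul _
    have m12 : Measurable fun y => 4 * A y s ^ 2 + 4 * A (y + s • v) s ^ 2 := m1.add m2
    rw [lintegral_add_left m12, lintegral_add_left m1, lintegral_const_mul _ ((hAy s).pow_const 2),
      lintegral_const_mul _ m3, lintegral_const_mul _ m4, hM s hs, hA2,
      lintegral_const_mul _ ((hAy s).pow_const 2)]
    have e1 : ofReal ((s ^ 2)⁻¹) * ofReal (s ^ 2) = 1 := by
      rw [← ofReal_mul (by positivity), inv_mul_cancel₀ (by positivity), ofReal_one]
    set a := ofReal ((s ^ 2)⁻¹)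
    calc _ = 8 * (a * ∫⁻ y, A y s ^ 2) + 2 * ((a * ofReal (s ^ 2)) * ∫⁻ y, g (pt y s) ^ 2) := by
          ring
      _ = _ := by rw [e1, one_mul]
  refine (setLIntegral_mono' measurableSet_Ioi step).trans ?_
  have mA : Measurable fun q : ℝ × E m => ofReal ((q.1 ^ 2)⁻¹) * A q.2 q.1 ^ 2 :=
    (by fun_prop : Measurable fun q : ℝ × E m => ofReal ((q.1 ^ 2)⁻¹)).mul
      ((hAm.comp measurable_swap).pow_const 2)
  have mg : Measurable fun q : ℝ × E m => g (pt q.2 q.1) ^ 2 :=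
    (hgm.comp (hpt.comp measurable_swap)).pow_const 2
  rw [lintegral_add_left (mA.lintegral_prod_right'.const_mul 8),
    lintegral_const_mul _ mA.lintegral_prod_right', lintegral_const_mul _ mg.lintegral_prod_right',
    lintegral_lintegral_swap mA.aemeasurable,
    lintegral_lintegral_swap (f := fun (s : ℝ) (y : E m) => g (pt y s) ^ 2) mg.aemeasurable]
  have b1 : ∫⁻ y, ∫⁻ s in Ioi (0 : ℝ), ofReal ((s ^ 2)⁻¹) * A y s ^ 2 ≤ 4 * ∫⁻ x, ‖G x‖ₑ ^ 2 := by
    have mz : Measurable fun y => ∫⁻ z, g (pt y z) ^ 2 :=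
      ((hgm.comp hpt).pow_const 2).lintegral_prod_right'
    simp only [hgG]
    rw [← lintegral_pt (hgm.pow_const 2), ← lintegral_const_mul _ mz]
    refine lintegral_mono fun y => (lintegral_hardy_le (hgp y)).trans ?_
    gcongr
    exact Measure.restrict_le_self
  have b2 : ∫⁻ y, ∫⁻ s in Ioi (0 : ℝ), g (pt y s) ^ 2 ≤ ∫⁻ x, ‖G x‖ₑ ^ 2 := by
    simp only [hgG]
    rw [← lintegral_pt (hgm.pow_const 2)]
    exact lintegral_mono fun y => lintegral_mono' Measure.restrict_le_self le_rfl
  calc _ ≤ 8 * (4 * ∫⁻ x, ‖G x‖ₑ ^ 2) + 2 * ∫⁻ x, ‖G x‖ₑ ^ 2 := by gcongr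
    _ = _ := by ring

end

/-! ### Extension across the boundary -/

section

/-- A Lipschitz map folding a neighbourhood of `closure Ω` into `closure Ω`, for functions
supported in `ball c ρ`. -/
structure IsFold (Ω : Set (E n)) (c : E n) (ρ : ℝ) (K : NNReal) (Φ : E n → E n) : Prop where
  pos : 0 < ρ
  lip : LipschitzWith K Φ
  eq : ∀ p ∈ closure Ω, (p ∈ ball c ρ ∨ Φ p ∈ ball c ρ) → Φ p = p
  lint : ∀ h : E n → ℝ≥0∞, Measurable h → (∀ x ∉ ball c ρ, h x = 0) →
    ∫⁻ p, h (Φ p) ≤ 2 * ∫⁻ x in Ω, h x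

theorem isFold_id {Ω : Set (E n)} (hΩ : IsOpen Ω) {c : E n} (hc : c ∈ Ω) :
    ∃ ρ, IsFold Ω c ρ 1 id := by
  obtain ⟨ρ, hρ, hb⟩ := Metric.isOpen_iff.1 hΩ c hc
  refine ⟨ρ, hρ, LipschitzWith.id, fun _ _ _ => rfl, fun h hm h0 => ?_⟩
  have : ∫⁻ p, h p = ∫⁻ p in Ω, h p := by
    refine (setLIntegral_eq_of_support_subset (μ := volume) fun x hx => ?_).symm
    by_contra hxΩ
    exact hx (h0 x fun hxb => hxΩ (hb hxb))
  simp only [id, this]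
  exact le_mul_of_one_le_left' (by norm_num)

/-- The reflection of the hypograph of `γ` into the epigraph. -/
def foldMap (R : E (m + 1) ≃ₗᵢ[ℝ] E (m + 1)) (γ : E m → ℝ) (p : E (m + 1)) : E (m + 1) :=
  overGraph R γ (hor (R p), |ver (R p) - γ (hor (R p))|)

theorem foldMap_overGraph (R : E (m + 1) ≃ₗᵢ[ℝ] E (m + 1)) (γ : E m → ℝ) (q : E m × ℝ) :
    foldMap R γ (overGraph R γ q) = overGraph R γ (q.1, |q.2|) := by
  simp [foldMap, overGraph]

theorem foldMap_eq {R : E (m + 1) ≃ₗᵢ[ℝ] E (m + 1)} {p : E (m + 1)}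
    (h : γ (hor (R p)) ≤ ver (R p)) : foldMap R γ p = p := by
  rw [foldMap, overGraph, abs_of_nonneg (sub_nonneg.2 h), add_sub_cancel, pt_hor_ver,
    R.symm_apply_apply]

theorem lipschitz_foldMap (R : E (m + 1) ≃ₗᵢ[ℝ] E (m + 1)) {L : NNReal}
    (hγ : LipschitzWith L γ) : LipschitzWith (2 + 2 * L) (foldMap R γ) := by
  refine LipschitzWith.of_dist_le_mul fun p q => ?_
  rw [foldMap, foldMap, overGraph, overGraph, R.symm.dist_map, dist_eq_norm, pt_sub]
  refine (norm_pt_le _ _).trans ?_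
  have h1 := hγ.dist_le_mul (hor (R p)) (hor (R q))
  have h2 : ‖hor (R p) - hor (R q)‖ ≤ dist p q := by
    rw [← hor_sub, ← map_sub, dist_eq_norm]; exact (norm_hor_le _).trans (R.norm_map _).le
  have h3 : |ver (R p) - ver (R q)| ≤ dist p q := by
    rw [← ver_sub, ← map_sub, dist_eq_norm]; exact (abs_ver_le _).trans (R.norm_map _).le
  rw [dist_eq, dist_eq_norm] at h1
  have h4 : (L : ℝ) * ‖hor (R p) - hor (R q)‖ ≤ L * dist p q := by gcongr
  simp only
  set a := γ (hor (R p))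
  set a' := γ (hor (R q))
  have h5 : |a + |ver (R p) - a| - (a' + |ver (R q) - a'|)| ≤
      |a - a'| + (|ver (R p) - ver (R q)| + |a - a'|) := by
    have e1 : a + |ver (R p) - a| - (a' + |ver (R q) - a'|) =
        (a - a') + (|ver (R p) - a| - |ver (R q) - a'|) := by ring
    rw [e1]
    refine (abs_add_le _ _).trans (add_le_add le_rfl ((abs_abs_sub_abs_le _ _).trans ?_))
    have e2 : ver (R p) - a - (ver (R q) - a') = (ver (R p) - ver (R q)) - (a - a') := by ring
    rw [e2]
    exact abs_sub _ _
  push_cast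
  linarith

theorem IsLipChart.isFold (hΩ : IsOpen Ω) {c : E (m + 1)}
    (hc : c ∈ frontier Ω) {R γ L r} (h : IsLipChart Ω c R γ L r) :
    IsFold Ω c (r / (3 + 2 * L)) (2 + 2 * L) (foldMap R γ) := by
  have hL : (0 : ℝ) ≤ L := L.2
  have hr := h.pos
  have hρ : r / (3 + 2 * L) * (3 + 2 * L) = r := by field_simp
  have hρ0 : 0 < r / (3 + 2 * L) := by positivity
  set ρ := r / (3 + 2 * L)
  have hρr : ρ ≤ r := by nlinarith
  have hcl : ∀ p ∈ closure Ω, p ∈ ball c r → γ (hor (R p)) ≤ ver (R p) := fun p hp hb => by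
    rcases (closure_eq_self_union_frontier Ω ▸ hp : p ∈ Ω ∪ frontier Ω) with h1 | h1
    · exact ((h.mem_iff p hb).1 h1).le
    · exact (h.ver_eq hΩ hb h1).ge
  refine ⟨hρ0, lipschitz_foldMap R h.lip, fun p hp hor' => ?_, fun f hf h0 => ?_⟩
  · by_contra hne
    have hlt : ver (R p) < γ (hor (R p)) := not_le.1 fun hle => hne (foldMap_eq hle)
    have hpr : p ∉ ball c r := fun hb => not_le.2 hlt (hcl p hp hb)
    rcases hor' with hb | hb
    · exact hpr (Metric.ball_subset_ball hρr hb)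
    · set s := γ (hor (R p)) - ver (R p) with hs
      have hs0 : 0 < s := sub_pos.2 hlt
      have e1 : foldMap R γ p = overGraph R γ (hor (R p), s) := by
        rw [foldMap, abs_of_neg (sub_neg.2 hlt), neg_sub]
      have e2 : p = overGraph R γ (hor (R p), -s) := by rw [overGraph]; simp [hs]
      have e3 : dist (foldMap R γ p) p = 2 * s := by
        rw [e1]
        nth_rewrite 2 [e2]
        rw [overGraph, overGraph, R.symm.dist_map, dist_eq_norm, pt_sub]
        simp only [sub_self]
        have : (pt 0 (γ (hor (R p)) + s - (γ (hor (R p)) + -s)) : E (m + 1)) =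
            (2 * s) • pt 0 1 := by
          ext i
          refine Fin.lastCases ?_ (fun j => ?_) i <;> simp [pt]
          ring
        rw [this, norm_smul, pt_zero_one_norm, mul_one, norm_of_nonneg (by positivity)]
      have hd : ‖R (foldMap R γ p) - R c‖ < ρ := by
        rw [← map_sub, R.norm_map, ← dist_eq_norm]; exact hb
      have k1 : ‖hor (R p) - hor (R c)‖ < ρ := by
        refine lt_of_le_of_lt ?_ hd
        refine le_trans (le_of_eq ?_) (norm_hor_le _)
        rw [hor_sub, e1, overGraph, R.apply_symm_apply, hor_pt]
      have k2 : |γ (hor (R p)) + s - γ (hor (R c))| < ρ := by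
        refine lt_of_le_of_lt ?_ hd
        refine le_trans (le_of_eq ?_) (abs_ver_le _)
        rw [ver_sub, e1, overGraph, R.apply_symm_apply, ver_pt,
          h.ver_eq hΩ (Metric.mem_ball_self hr) hc]
      have k3 := h.lip.dist_le_mul (hor (R p)) (hor (R c))
      rw [dist_eq, dist_eq_norm] at k3
      have k4 : (L : ℝ) * ‖hor (R p) - hor (R c)‖ ≤ L * ρ := by gcongr
      have k5 : s < (1 + L) * ρ := by
        have := (abs_lt.1 k2).2
        have := (abs_le.1 (k3.trans k4)).1
        linarith
      apply hpr
      rw [Metric.mem_ball] at hb ⊢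
      have := dist_triangle p (foldMap R γ p) c
      rw [dist_comm p (foldMap R γ p), e3] at this
      nlinarith
  · set k : E m × ℝ → ℝ≥0∞ := fun q => Ω.indicator f (overGraph R γ q) with hk
    have hog := (continuous_overGraph R h.lip.continuous).measurable
    have hΩm := hΩ.measurableSet
    have hkm : Measurable k := (hf.indicator hΩm).comp hog
    have hfold : Measurable (foldMap R γ) := (lipschitz_foldMap R h.lip).continuous.measurable
    have hpos : ∀ y, ∀ s : ℝ, 0 < s → f (overGraph R γ (y, s)) ≤ k (y, s) := fun y s hs => by
      by_cases hb : overGraph R γ (y, s) ∈ ball c ρ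
      · have : overGraph R γ (y, s) ∈ Ω := by
          rw [h.mem_iff _ (Metric.ball_subset_ball hρr hb), overGraph, R.apply_symm_apply, hor_pt,
            ver_pt]
          linarith
        simp only [hk, indicator_of_mem this, le_refl]
      · rw [h0 _ hb]; exact zero_le
    have hky : ∀ y, Measurable fun s => k (y, s) := fun y => hkm.comp measurable_prodMk_left
    have key : ∀ y, ∫⁻ s, f (overGraph R γ (y, |s|)) ≤ 2 * ∫⁻ s, k (y, s) := fun y => by
      have hae : ∀ᵐ s : ℝ, f (overGraph R γ (y, |s|)) ≤ k (y, s) + k (y, -s) := by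
        filter_upwards [compl_mem_ae_iff.2 (measure_singleton (0 : ℝ))] with s hs
        rcases lt_or_gt_of_ne (show s ≠ 0 from hs) with h1 | h1
        · rw [abs_of_neg h1]
          exact (hpos y (-s) (neg_pos.2 h1)).trans le_add_self
        · rw [abs_of_pos h1]
          exact (hpos y s h1).trans le_self_add
      refine (lintegral_mono_ae hae).trans_eq ?_
      have hn : ∫⁻ s : ℝ, k (y, -s) = ∫⁻ s, k (y, s) :=
        (Measure.measurePreserving_neg (volume : Measure ℝ)).lintegral_comp (hky y)
      rw [lintegral_add_left (hky y), hn, two_mul]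
    calc ∫⁻ p, f (foldMap R γ p) = ∫⁻ y, ∫⁻ s, f (foldMap R γ (overGraph R γ (y, s))) :=
          (lintegral_overGraph R h.lip.continuous (hf.comp hfold)).symm
      _ ≤ ∫⁻ y, 2 * ∫⁻ s, k (y, s) := lintegral_mono fun y => by
          simp only [foldMap_overGraph]
          exact key y
      _ = 2 * ∫⁻ x in Ω, f x := by
          rw [lintegral_const_mul _ hkm.lintegral_prod_right', ← lintegral_indicator hΩm,
            ← lintegral_overGraph R h.lip.continuous (hf.indicator hΩm)]

theorem IsFold.eLpNorm_comp_le {Ω : Set (E n)} {c : E n} {ρ : ℝ} {K : NNReal} {Φ : E n → E n}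
    (h : IsFold Ω c ρ K Φ) {f : E n → ℝ} (hf : Measurable f)
    (h0 : ∀ x ∉ ball c ρ, f x = 0) :
    eLpNorm (fun x => f (Φ x)) 2 volume ≤ 2 * eLpNorm f 2 (vol Ω) := by
  have h1 := h.lint (fun x => ‖f x‖ₑ ^ 2) (hf.enorm.pow_const 2) fun x hx => by simp [h0 x hx]
  have e1 := eLpNorm_two_sq (volume : Measure (E n)) (fun x => f (Φ x))
  have e2 := eLpNorm_two_sq (vol Ω) f
  have h2 : eLpNorm (fun x => f (Φ x)) 2 volume ^ 2 ≤ (2 * eLpNorm f 2 (vol Ω)) ^ 2 := by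
    rw [e1, mul_pow, e2]
    refine h1.trans ?_
    gcongr
    norm_num
  exact (ENNReal.pow_right_strictMono two_ne_zero).le_iff_le.1 h2

/-- The sum of the `L²(Ω)` norms of a smooth function and its first derivatives. -/
def sobolevNorm (Ω : Set (E n)) (f : E n → ℝ) : ℝ≥0∞ :=
  eLpNorm f 2 (vol Ω) + ∑ i, eLpNorm (pd f i) 2 (vol Ω)

theorem norm_fderiv_le_sum (f : E n → ℝ) (x : E n) : ‖fderiv ℝ f x‖ ≤ ∑ i, |pd f i x| := by
  refine opNorm_le_bound _ (by positivity) fun v => ?_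
  rw [fderiv_apply_eq_sum, sum_mul]
  refine (abs_sum_le_sum_abs _ _).trans (sum_le_sum fun i _ => ?_)
  rw [abs_mul, mul_comm]
  exact mul_le_mul_of_nonneg_left (abs_apply_le_norm v i) (abs_nonneg _)

theorem eLpNorm_fderiv_le (Ω : Set (E n)) {f : E n → ℝ} (hf : ContDiff ℝ (⊤ : ℕ∞) f) :
    eLpNorm (fun x => ‖fderiv ℝ f x‖) 2 (vol Ω) ≤ ∑ i, eLpNorm (pd f i) 2 (vol Ω) := by
  have h1 : eLpNorm (fun x => ‖fderiv ℝ f x‖) 2 (vol Ω) ≤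
      eLpNorm (∑ i, fun x => |pd f i x|) 2 (vol Ω) := by
    refine eLpNorm_mono_real fun x => ?_
    rw [norm_norm, Finset.sum_apply]
    exact norm_fderiv_le_sum f x
  refine h1.trans ((eLpNorm_sum_le (fun i _ => (pd_continuous hf i).abs.aestronglyMeasurable)
    (by norm_num)).trans_eq ?_)
  exact sum_congr rfl fun i _ => eLpNorm_norm (pd f i)

theorem exists_cutoff_bound (Ω : Set (E n)) {χ : E n → ℝ} (hχ : ContDiff ℝ (⊤ : ℕ∞) χ)
    (hc : HasCompactSupport χ) : ∃ M : ℝ≥0∞, M ≠ ∞ ∧ ∀ f : E n → ℝ, ContDiff ℝ (⊤ : ℕ∞) f →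
      eLpNorm (fun x => χ x * f x) 2 (vol Ω) ≤ M * sobolevNorm Ω f ∧
      eLpNorm (fun x => ‖fderiv ℝ (fun x => χ x * f x) x‖) 2 (vol Ω) ≤ M * sobolevNorm Ω f := by
  obtain ⟨C, hC⟩ := hc.exists_bound_of_continuous hχ.continuous
  obtain ⟨D, hD⟩ := (hc.fderiv ℝ).exists_bound_of_continuous (hχ.continuous_fderiv (by simp))
  have hC0 : 0 ≤ C := (norm_nonneg _).trans (hC 0)
  have hD0 : 0 ≤ D := (norm_nonneg _).trans (hD 0)
  refine ⟨ofReal (C + D), ofReal_ne_top, fun f hf => ⟨?_, ?_⟩⟩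
  · refine (eLpNorm_le_mul_eLpNorm_of_ae_le_mul (c := C + D) (g := f)
      (.of_forall fun x => ?_) 2).trans ?_
    · rw [norm_mul]
      exact mul_le_mul_of_nonneg_right ((hC x).trans (by linarith)) (norm_nonneg _)
    · exact mul_le_mul_right le_self_add _
  · have e : ∀ x, ‖fderiv ℝ (fun x => χ x * f x) x‖ ≤ (C + D) * (|f x| + ‖fderiv ℝ f x‖) := fun x => by
      rw [fderiv_fun_mul (hχ.differentiable (by simp) x) (hf.differentiable (by simp) x)]
      refine (norm_add_le _ _).trans ?_
      rw [norm_smul, norm_smul]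
      have := mul_le_mul_of_nonneg_right (hC x) (norm_nonneg (fderiv ℝ f x))
      have := mul_le_mul_of_nonneg_left (hD x) (norm_nonneg (f x))
      have := mul_nonneg hC0 (abs_nonneg (f x))
      have := mul_nonneg hD0 (norm_nonneg (fderiv ℝ f x))
      rw [norm_eq_abs (f x)] at *
      linarith
    have h1 : eLpNorm (fun x => ‖fderiv ℝ (fun x => χ x * f x) x‖) 2 (vol Ω) ≤
        ofReal (C + D) * eLpNorm (fun x => |f x| + ‖fderiv ℝ f x‖) 2 (vol Ω) := by
      refine eLpNorm_le_mul_eLpNorm_of_ae_le_mul (.of_forall fun x => ?_) 2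
      rw [norm_norm]
      refine (e x).trans (le_of_eq ?_)
      rw [norm_of_nonneg (by positivity)]
    refine h1.trans (mul_le_mul_right ((eLpNorm_add_le hf.continuous.abs.aestronglyMeasurable
      (hf.continuous_fderiv (by simp)).norm.aestronglyMeasurable (by norm_num)).trans ?_) _)
    exact add_le_add (eLpNorm_norm f).le (eLpNorm_fderiv_le Ω hf)

theorem exists_extension (h : HasC11Boundary Ω) (hΩ : IsOpen Ω)
    (hb : IsBounded Ω) : ∃ C : ℝ≥0∞, C ≠ ∞ ∧ ∀ f : E (m + 1) → ℝ, ContDiff ℝ (⊤ : ℕ∞) f →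
      ∃ F G, HasUpperGrad F G ∧ (∀ x ∈ closure Ω, F x = f x) ∧
        eLpNorm F 2 volume ≤ C * sobolevNorm Ω f ∧ eLpNorm G 2 volume ≤ C * sobolevNorm Ω f := by
  have hfold : ∀ x ∈ closure Ω, ∃ ρ K Φ, IsFold Ω x ρ K Φ := fun x hx => by
    rcases (closure_eq_self_union_frontier Ω ▸ hx : x ∈ Ω ∪ frontier Ω) with h1 | h1
    · obtain ⟨ρ, hρ⟩ := isFold_id hΩ h1
      exact ⟨ρ, _, _, hρ⟩
    · obtain ⟨R, γ, L, r, hch⟩ := h.exists_lipChart h1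
      exact ⟨_, _, _, hch.isFold hΩ h1⟩
  choose! ρ K Φ hF using hfold
  obtain ⟨N, c, χ, hcK, hχ, hχc, hχs, hχ1⟩ := exists_partition hb.isCompact_closure ρ
    fun x hx => (hF x hx).pos
  choose M hM hMf using fun k => exists_cutoff_bound Ω (hχ k) (hχc k)
  have hFk := fun k => hF (c k) (hcK k)
  refine ⟨∑ k, (1 + (K (c k) : ℝ≥0∞)) * (2 * M k), ?_, fun f hf => ?_⟩
  · exact sum_ne_top.2 fun k _ => mul_ne_top (by simp)
      (mul_ne_top (by norm_num) (hM k))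
  set g : Fin N → E (m + 1) → ℝ := fun k x => χ k x * f x with hg
  have hgs : ∀ k, ContDiff ℝ (⊤ : ℕ∞) (g k) := fun k => (hχ k).mul hf
  have hgc : ∀ k, HasCompactSupport (g k) := fun k => (hχc k).mul_right
  have hgt : ∀ k, tsupport (g k) ⊆ ball (c k) (ρ (c k)) := fun k =>
    tsupport_mul_subset_left.trans (hχs k)
  have hg0 : ∀ k, ∀ x ∉ ball (c k) (ρ (c k)), g k x = 0 := fun k x hx =>
    image_eq_zero_of_notMem_tsupport fun hx' => hx (hgt k hx')
  have hd0 : ∀ k, ∀ x ∉ ball (c k) (ρ (c k)), ‖fderiv ℝ (g k) x‖ = 0 := fun k x hx => by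
    rw [norm_eq_zero]
    by_contra hne
    exact hx (hgt k (support_fderiv_subset ℝ hne))
  have hdm : ∀ k, Continuous fun x => ‖fderiv ℝ (g k) x‖ := fun k =>
    ((hgs k).continuous_fderiv (by simp)).norm
  have hup : ∀ k, HasUpperGrad (g k ∘ Φ (c k)) fun p => K (c k) * ‖fderiv ℝ (g k) (Φ (c k) p)‖ :=
    fun k => (HasUpperGrad.of_contDiff (hgs k) (hgc k)).comp (hFk k).lip
  refine ⟨_, _, HasUpperGrad.sum Finset.univ hup, fun x hx => ?_, ?_, ?_⟩
  · have e : ∀ k, g k (Φ (c k) x) = g k x := fun k => by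
      by_cases hb : x ∈ ball (c k) (ρ (c k)) ∨ Φ (c k) x ∈ ball (c k) (ρ (c k))
      · rw [(hFk k).eq x hx hb]
      · rw [not_or] at hb
        rw [hg0 k _ hb.1, hg0 k _ hb.2]
    simp only [Finset.sum_apply, Function.comp_apply, e]
    simp only [hg]
    rw [← sum_mul, hχ1 x hx, one_mul]
  · refine (eLpNorm_sum_le (fun k _ => (hup k).continuous.aestronglyMeasurable)
      (by norm_num)).trans ?_
    rw [sum_mul]
    refine sum_le_sum fun k _ => ?_
    calc _ ≤ 2 * eLpNorm (g k) 2 (vol Ω) :=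
          (hFk k).eLpNorm_comp_le (hgs k).continuous.measurable (hg0 k)
      _ ≤ 2 * (M k * sobolevNorm Ω f) := mul_le_mul_right (hMf k f hf).1 _
      _ ≤ (1 + (K (c k) : ℝ≥0∞)) * (2 * (M k * sobolevNorm Ω f)) := le_mul_of_one_le_left' le_self_add
      _ = _ := by ring
  · refine (eLpNorm_sum_le (fun k _ => (hup k).cont.aestronglyMeasurable)
      (by norm_num)).trans ?_
    rw [sum_mul]
    refine sum_le_sum fun k _ => ?_
    have e : eLpNorm (fun p => (K (c k) : ℝ) * ‖fderiv ℝ (g k) (Φ (c k) p)‖) 2 volume =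
        (K (c k) : ℝ≥0∞) * eLpNorm (fun p => ‖fderiv ℝ (g k) (Φ (c k) p)‖) 2 volume := by
      have := eLpNorm_const_smul (K (c k) : ℝ) (fun p => ‖fderiv ℝ (g k) (Φ (c k) p)‖) 2 volume
      rwa [enorm_eq_ofReal (NNReal.coe_nonneg _), ENNReal.ofReal_coe_nnreal] at this
    calc _ ≤ (K (c k) : ℝ≥0∞) * (2 * eLpNorm (fun p => ‖fderiv ℝ (g k) p‖) 2 (vol Ω)) := by
          rw [e]
          exact mul_le_mul_right ((hFk k).eLpNorm_comp_le (hdm k).measurable (hd0 k)) _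
      _ ≤ (1 + (K (c k) : ℝ≥0∞)) * (2 * (M k * sobolevNorm Ω f)) := by
          gcongr
          · exact le_add_self
          · exact (hMf k f hf).2
      _ = _ := by ring

end

/-! ### Trace estimates for smooth functions -/

section

theorem ENNReal_le_of_sq_le {a b : ℝ≥0∞} (h : a ^ 2 ≤ b ^ 2) : a ≤ b :=
  (ENNReal.pow_right_strictMono two_ne_zero).le_iff_le.1 h

theorem ENNReal_le_sq (K : ℝ≥0∞) : K ≤ (K + 1) ^ 2 := by
  rw [sq]
  exact le_self_add.trans (le_mul_of_one_le_left' le_add_self)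

theorem exists_surf_bound (h : HasC11Boundary Ω) (hΩ : IsOpen Ω)
    (hb : IsBounded Ω) : ∃ C : ℝ≥0∞, C ≠ ∞ ∧ ∀ f : E (m + 1) → ℝ, ContDiff ℝ (⊤ : ℕ∞) f →
      eLpNorm f 2 (surf Ω) ≤ C * sobolevNorm Ω f := by
  obtain ⟨C, hC, hext⟩ := exists_extension h hΩ hb
  have hK : IsCompact (frontier Ω) := hb.isCompact_closure.of_isClosed_subset isClosed_frontier
    frontier_subset_closure
  have hch : ∀ x ∈ frontier Ω, ∃ R γ L r, IsLipChart Ω x R γ L r := fun x hx => h.exists_lipChart hx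
  choose! R γ L r hch using hch
  obtain ⟨t, ht, hcov⟩ := hK.elim_nhds_subcover (fun x => ball x (r x))
    fun x hx => Metric.ball_mem_nhds x (hch x hx).pos
  set D : ℝ≥0∞ := ∑ x : t, ((1 + L x : NNReal) : ℝ≥0∞) ^ m with hD
  have hDt : D ≠ ∞ := sum_ne_top.2 fun x _ => ENNReal.pow_ne_top ENNReal.coe_ne_top
  refine ⟨(D * 4 + 1) * C, mul_ne_top
    (add_ne_top.2 ⟨mul_ne_top hDt (by norm_num), by norm_num⟩) hC, fun f hf => ?_⟩
  obtain ⟨F, G, hFG, hFf, hF, hG⟩ := hext f hf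
  refine ENNReal_le_of_sq_le ?_
  have hsurf : surf Ω ≤ Measure.sum fun x : t => (surf Ω).restrict (ball (x : E (m + 1)) (r x)) := by
    have e : surf Ω = (surf Ω).restrict (⋃ x : t, ball (x : E (m + 1)) (r x)) := by
      rw [surf, Measure.restrict_restrict (MeasurableSet.iUnion fun _ => measurableSet_ball),
        inter_eq_right.2]
      intro x hx
      obtain ⟨y, hy, hxy⟩ := mem_iUnion₂.1 (hcov hx)
      exact mem_iUnion.2 ⟨⟨y, hy⟩, hxy⟩
    rw [e]
    refine Measure.restrict_iUnion_le.trans (le_of_eq ?_)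
    rw [← e]
  have hFm : Measurable fun x => ‖F x‖ₑ ^ 2 := hFG.continuous.enorm.measurable.pow_const 2
  have hn := fun f => eLpNorm_two_sq (volume : Measure (E (m + 1))) (f : E (m + 1) → ℝ)
  calc eLpNorm f 2 (surf Ω) ^ 2 = eLpNorm F 2 (surf Ω) ^ 2 := by
        congr 1
        refine eLpNorm_congr_ae ?_
        filter_upwards [ae_restrict_mem isClosed_frontier.measurableSet] with x hx
        exact (hFf x (frontier_subset_closure hx)).symm
    _ = ∫⁻ x, ‖F x‖ₑ ^ 2 ∂surf Ω := eLpNorm_two_sq _ _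
    _ ≤ ∑ x : t, ∫⁻ p in ball (x : E (m + 1)) (r x), ‖F p‖ₑ ^ 2 ∂surf Ω := by
        refine (lintegral_mono' hsurf le_rfl).trans_eq ?_
        rw [lintegral_sum_measure, tsum_fintype]
    _ ≤ ∑ x : t, ((1 + L x : NNReal) : ℝ≥0∞) ^ m * (4 * (C * sobolevNorm Ω f) ^ 2) := by
        refine sum_le_sum fun x _ => ?_
        have hx := hch x (ht x x.2)
        refine (lintegral_mono' (hx.surf_restrict_le hΩ) le_rfl).trans ?_
        rw [lintegral_smul_measure, lintegral_map hFm (lipschitz_overGraph _ hx.lip).continuous.measurable,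
          smul_eq_mul]
        gcongr
        refine (hFG.lintegral_graph_le (R x) hx.lip.continuous).trans ?_
        rw [← hn F, ← hn G]
        calc _ ≤ 2 * (C * sobolevNorm Ω f) ^ 2 + 2 * (C * sobolevNorm Ω f) ^ 2 := by gcongr
          _ = _ := by ring
    _ = (D * 4) * (C * sobolevNorm Ω f) ^ 2 := by rw [← sum_mul, ← hD]; ring
    _ ≤ (D * 4 + 1) ^ 2 * (C * sobolevNorm Ω f) ^ 2 := by gcongr; exact ENNReal_le_sq _
    _ = _ := by ring

/-- The square of the Gagliardo seminorm of order `1/2` in the direction `v`. -/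
def gagliardo (v : E m) (u : E m → ℝ) : ℝ≥0∞ :=
  ∫⁻ s in Ioi (0 : ℝ), ofReal ((s ^ 2)⁻¹) * ∫⁻ y, ‖u (y + s • v) - u y‖ₑ ^ 2

theorem exists_graph_bound (h : HasC11Boundary Ω) (hΩ : IsOpen Ω)
    (hb : IsBounded Ω) {l : E m → ℝ} {L : NNReal} (hl : LipschitzWith L l) :
    ∃ C : ℝ≥0∞, C ≠ ∞ ∧ ∀ f : E (m + 1) → ℝ, ContDiff ℝ (⊤ : ℕ∞) f →
      ∃ u : E m → ℝ, Continuous u ∧ (∀ y, graphMap l y ∈ closure Ω → u y = f (graphMap l y)) ∧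
        eLpNorm u 2 volume ≤ C * sobolevNorm Ω f ∧
        ∀ v, ‖v‖ ≤ 1 → gagliardo v u ≤ (C * sobolevNorm Ω f) ^ 2 := by
  obtain ⟨C, hC, hext⟩ := exists_extension h hΩ hb
  set R := LinearIsometryEquiv.refl ℝ (E (m + 1))
  set sh : E (m + 1) → E (m + 1) := fun p => overGraph R l (hor p, ver p) with hsh
  have hshL : LipschitzWith (2 + L) sh := by
    refine LipschitzWith.of_dist_le_mul fun p q => ?_
    simp only [hsh]
    rw [overGraph, overGraph, R.symm.dist_map, dist_eq_norm, pt_sub]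
    refine (norm_pt_le _ _).trans ?_
    have h1 := hl.dist_le_mul (hor p) (hor q)
    have h2 : ‖hor p - hor q‖ ≤ dist p q := by rw [← hor_sub, dist_eq_norm]; exact norm_hor_le _
    have h3 : |ver p - ver q| ≤ dist p q := by rw [← ver_sub, dist_eq_norm]; exact abs_ver_le _
    rw [dist_eq, dist_eq_norm] at h1
    have h4 : (L : ℝ) * ‖hor p - hor q‖ ≤ L * dist p q := by gcongr
    have h5 : |l (hor p) + ver p - (l (hor q) + ver q)| ≤ |l (hor p) - l (hor q)| + |ver p - ver q| := by
      rw [add_sub_add_comm]; exact abs_add_le _ _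
    push_cast
    linarith
  have hsh0 : ∀ y, sh (pt y 0) = graphMap l y := fun y => by
    simp only [hsh, hor_pt, ver_pt, overGraph, add_zero]
    rfl
  have hshi : ∀ f : E (m + 1) → ℝ≥0∞, Measurable f → ∫⁻ p, f (sh p) = ∫⁻ p, f p := fun f hf => by
    rw [← lintegral_pt (f := fun p => f (sh p)) (hf.comp hshL.continuous.measurable),
      ← lintegral_overGraph R hl.continuous hf]
    simp only [hsh, hor_pt, ver_pt]
  have hT : ((2 + L : NNReal) : ℝ≥0∞) ≠ ∞ := ENNReal.coe_ne_top
  refine ⟨(34 * (2 + L : NNReal) ^ 2 + 1) * C, mul_ne_top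
    (add_ne_top.2 ⟨mul_ne_top (by norm_num) (ENNReal.pow_ne_top hT), by norm_num⟩) hC,
    fun f hf => ?_⟩
  obtain ⟨F, G, hFG, hFf, hF, hG⟩ := hext f hf
  have hup := hFG.comp hshL
  have hn := fun f => eLpNorm_two_sq (volume : Measure (E (m + 1))) (f : E (m + 1) → ℝ)
  have hFm : Measurable fun x => ‖F x‖ₑ ^ 2 := hFG.continuous.enorm.measurable.pow_const 2
  have hGm : Measurable fun x => ‖G x‖ₑ ^ 2 := hFG.cont.enorm.measurable.pow_const 2
  have iG : ∫⁻ p, ‖((2 + L : NNReal) : ℝ) * G (sh p)‖ₑ ^ 2 ≤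
      ((2 + L : NNReal) : ℝ≥0∞) ^ 2 * (C * sobolevNorm Ω f) ^ 2 := by
    have e : ∀ p, ‖((2 + L : NNReal) : ℝ) * G (sh p)‖ₑ ^ 2 =
        ((2 + L : NNReal) : ℝ≥0∞) ^ 2 * ‖G (sh p)‖ₑ ^ 2 := fun p => by
      rw [enorm_mul, mul_pow, enorm_eq_ofReal (NNReal.coe_nonneg _), ENNReal.ofReal_coe_nnreal]
    simp only [e]
    have hGs : Measurable fun p => ‖G (sh p)‖ₑ ^ 2 := hGm.comp hshL.continuous.measurable
    rw [lintegral_const_mul _ hGs, hshi _ hGm, ← hn G]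
    gcongr
  set A : ℝ≥0∞ := ((2 + L : NNReal) : ℝ≥0∞) ^ 2
  have hA1 : 1 ≤ A := by
    refine one_le_pow_of_one_le' ?_ 2
    rw [← ENNReal.coe_one, ENNReal.coe_le_coe]
    exact le_add_right one_le_two
  refine ⟨fun y => F (sh (pt y 0)), hup.continuous.comp (continuous_pt.comp₂ continuous_id continuous_const),
    fun y hy => ?_, ?_, fun v hv => ?_⟩
  · simp only [hsh0]
    exact hFf _ hy
  · refine ENNReal_le_of_sq_le ?_
    have e : ∀ y, F (sh (pt y 0)) = F (overGraph R l (y, 0)) := fun y => by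
      simp only [hsh, hor_pt, ver_pt]
    simp only [e]
    rw [eLpNorm_two_sq]
    refine (hFG.lintegral_graph_le R hl.continuous).trans ?_
    rw [← hn F, ← hn G]
    calc _ ≤ 2 * (C * sobolevNorm Ω f) ^ 2 + 2 * (C * sobolevNorm Ω f) ^ 2 := by gcongr
      _ = 4 * (C * sobolevNorm Ω f) ^ 2 := by ring
      _ ≤ (34 * A) * (C * sobolevNorm Ω f) ^ 2 := by
          gcongr
          calc (4 : ℝ≥0∞) ≤ 34 * 1 := by norm_num
            _ ≤ _ := by gcongr
      _ ≤ (34 * A + 1) ^ 2 * (C * sobolevNorm Ω f) ^ 2 := by gcongr; exact ENNReal_le_sq _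
      _ = _ := by ring
  · refine (hup.lintegral_gagliardo_le hv).trans ?_
    calc _ ≤ 34 * (A * (C * sobolevNorm Ω f) ^ 2) := by gcongr
      _ = (34 * A) * (C * sobolevNorm Ω f) ^ 2 := by ring
      _ ≤ (34 * A + 1) ^ 2 * (C * sobolevNorm Ω f) ^ 2 := by gcongr; exact ENNReal_le_sq _
      _ = _ := by ring

end

section

open FourierTransform TemperedDistribution

/-- Complex valued `L²(ℝᵐ)`. -/
abbrev L2C (m : ℕ) : Type := Lp ℂ 2 (volume : Measure (E m))

theorem toTemperedDistribution_injective {f g : L2C m}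
    (h : Lp.toTemperedDistribution f = Lp.toTemperedDistribution g) : f = g := by
  have hk := Lp.ker_toTemperedDistributionCLM_eq_bot (F := ℂ) (μ := (volume : Measure (E m)))
    (p := 2)
  have : f - g ∈ (Lp.toTemperedDistributionCLM ℂ (volume : Measure (E m)) 2).ker := by
    rw [LinearMap.mem_ker]
    simp only [ContinuousLinearMap.coe_coe, map_sub, Lp.toTemperedDistributionCLM_apply, h, sub_self]
  rw [hk, Submodule.mem_bot] at this
  exact sub_eq_zero.1 this

/-- The symbol `(1 + |ξ|²)^{-s/2}`. -/
def symb (m : ℕ) (s : ℝ) (ξ : E m) : ℝ := (1 + ‖ξ‖ ^ 2) ^ (-s / 2)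

theorem symb_pos (s : ℝ) (ξ : E m) : 0 < symb m s ξ := by unfold symb; positivity

theorem symb_le_one (hs : 0 ≤ s) (ξ : E m) : symb m s ξ ≤ 1 :=
  Real.rpow_le_one_of_one_le_of_nonpos (by simp) (by linarith)

theorem symb_add (s t : ℝ) (ξ : E m) : symb m (s + t) ξ = symb m s ξ * symb m t ξ := by
  unfold symb
  rw [← rpow_add (by positivity)]
  congr 1; ring

theorem continuous_symb (m : ℕ) (s : ℝ) : Continuous (symb m s) := by
  have : (symb m s).HasTemperateGrowth := by unfold symb; fun_prop
  exact this.1.continuous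

theorem memLp_symb (hs : 0 ≤ s) :
    MemLp (fun ξ : E m => ((symb m s ξ : ℝ) : ℂ)) ∞ volume := by
  refine memLp_top_of_bound
    (Complex.continuous_ofReal.comp (continuous_symb m s)).aestronglyMeasurable 1
    (.of_forall fun ξ => ?_)
  rw [Complex.norm_real, norm_eq_abs, abs_of_pos (symb_pos s ξ)]
  exact symb_le_one hs ξ

theorem isClosed_HsR (m : ℕ) (s : ℝ) : IsClosed ((HsR m s : Submodule ℝ _) : Set (Lp ℝ 2 (volume : Measure (E m)) × L2C m)) := by
  have h1 : Continuous fun q : Lp ℝ 2 (volume : Measure (E m)) × L2C m =>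
      besselPotential (E m) ℂ s (Lp.toTemperedDistributionCLM ℂ volume 2 (toComplex m q.1)) :=
    (besselPotential (E m) ℂ s).continuous.comp
      ((Lp.toTemperedDistributionCLM ℂ volume 2).continuous.comp
        ((toComplex m).continuous.comp continuous_fst))
  have h2 : Continuous fun q : Lp ℝ 2 (volume : Measure (E m)) × L2C m =>
      Lp.toTemperedDistributionCLM ℂ volume 2 q.2 :=
    (Lp.toTemperedDistributionCLM ℂ volume 2).continuous.comp continuous_snd
  exact isClosed_eq h1 h2

instance (m : ℕ) (s : ℝ) : CompleteSpace (HsR m s) := (isClosed_HsR m s).completeSpace_coe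

instance (m : ℕ) (s : ℝ) (B : Set (E m)) : CompleteSpace (Hs m s B) :=
  inferInstanceAs (CompleteSpace (HsR m s ⧸ HsR.null m s B))

theorem mem_HsR_iff (hs : 0 ≤ s) (q : Lp ℝ 2 (volume : Measure (E m)) × L2C m) :
    q ∈ HsR m s ↔ (𝓕 (toComplex m q.1) : L2C m) =ᵐ[volume]
      fun ξ => ((symb m s ξ : ℝ) : ℂ) * (𝓕 q.2 : L2C m) ξ := by
  have hg : (fun ξ : E m => ((symb m s ξ : ℝ) : ℂ)).HasTemperateGrowth := by unfold symb; fun_prop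
  have hsm := Lp.toTemperedDistribution_smul_eq (p := ∞) (q := 2) (r := 2) hg (memLp_symb hs)
    (𝓕 q.2 : L2C m)
  have e1 : q ∈ HsR m s ↔ (𝓕 (toComplex m q.1) : L2C m) = (memLp_symb (m := m) hs).toLp _ • (𝓕 q.2 : L2C m) := by
    have : q ∈ HsR m s ↔ besselPotential (E m) ℂ (-s) (Lp.toTemperedDistribution q.2) =
        Lp.toTemperedDistribution (toComplex m q.1) := (besselPotential_neg_apply_eq_iff s _ _).symm
    rw [this]
    have h3 : 𝓕 (besselPotential (E m) ℂ (-s) (Lp.toTemperedDistribution q.2)) =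
        Lp.toTemperedDistribution ((memLp_symb (m := m) hs).toLp _ • (𝓕 q.2 : L2C m)) := by
      rw [hsm, fourier_besselPotential_eq_smulLeftCLM_fourier_apply,
        Lp.fourier_toTemperedDistribution_eq]
      rfl
    constructor
    · intro h
      refine toTemperedDistribution_injective ?_
      rw [← h3, h, Lp.fourier_toTemperedDistribution_eq]
    · intro h
      have h4 : 𝓕 (besselPotential (E m) ℂ (-s) (Lp.toTemperedDistribution q.2)) =
          𝓕 (Lp.toTemperedDistribution (toComplex m q.1)) := by
        rw [h3, ← h, Lp.fourier_toTemperedDistribution_eq]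
      have h5 := congrArg (fun f : TemperedDistribution (E m) ℂ =>
        (𝓕⁻ f : TemperedDistribution (E m) ℂ)) h4
      simpa only [fourierInv_fourier_eq] using h5
  have e2 := Lp.coeFn_lpSMul (r := 2) ((memLp_symb (m := m) hs).toLp _) (𝓕 q.2 : L2C m)
  rw [e1]
  constructor
  · intro h
    rw [h]
    filter_upwards [e2, (memLp_symb (m := m) hs).coeFn_toLp] with ξ h1 h2
    rw [h1, Pi.smul_apply', h2, smul_eq_mul]
  · intro h
    refine Lp.ext ?_
    filter_upwards [h, e2, (memLp_symb (m := m) hs).coeFn_toLp] with ξ h0 h1 h2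
    rw [h0, h1, Pi.smul_apply', h2, smul_eq_mul]

theorem toComplex_ae (u : Lp ℝ 2 (volume : Measure (E m))) :
    toComplex m u =ᵐ[volume] fun x => ((u x : ℝ) : ℂ) := Complex.ofRealCLM.coeFn_compLp u

theorem norm_toComplex (u : Lp ℝ 2 (volume : Measure (E m))) : ‖toComplex m u‖ = ‖u‖ := by
  rw [Lp.norm_def, Lp.norm_def]
  congr 1
  refine eLpNorm_congr_norm_ae ?_
  filter_upwards [toComplex_ae u] with x hx
  rw [hx, Complex.norm_real]

theorem HsR_norm_le (hs : 0 ≤ s) (q : HsR m s) : ‖q.1.1‖ ≤ ‖q.1.2‖ := by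
  have h := (mem_HsR_iff hs q.1).1 q.2
  rw [← norm_toComplex, ← Lp.norm_fourier_eq (toComplex m q.1.1), ← Lp.norm_fourier_eq q.1.2]
  refine Lp.norm_le_norm_of_ae_le ?_
  filter_upwards [h] with ξ hξ
  rw [hξ, norm_mul, Complex.norm_real, norm_eq_abs, abs_of_pos (symb_pos s ξ)]
  exact mul_le_of_le_one_left (norm_nonneg _) (symb_le_one hs ξ)

/-- To lie in `Hˢ` it is enough that the weighted Fourier transform is square integrable. -/
theorem exists_mem_HsR (hs : 0 ≤ s) (u : Lp ℝ 2 (volume : Measure (E m))) {C : ℝ≥0∞} (hC : C ≠ ∞)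
    (h : eLpNorm (fun ξ => (((symb m s ξ)⁻¹ : ℝ) : ℂ) * (𝓕 (toComplex m u) : L2C m) ξ) 2 volume ≤ C) :
    ∃ g : L2C m, (u, g) ∈ HsR m s ∧ ‖g‖ₑ ≤ C := by
  have hm : MemLp (fun ξ => (((symb m s ξ)⁻¹ : ℝ) : ℂ) * (𝓕 (toComplex m u) : L2C m) ξ) 2 volume := by
    refine ⟨?_, h.trans_lt hC.lt_top⟩
    refine AEStronglyMeasurable.mul ?_ (Lp.aestronglyMeasurable _)
    exact (Complex.continuous_ofReal.comp ((continuous_symb m s).inv₀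
      fun ξ => (symb_pos s ξ).ne')).aestronglyMeasurable
  have hn : ‖(𝓕⁻ (hm.toLp _) : L2C m)‖ = ‖hm.toLp _‖ := by
    rw [← Lp.norm_fourier_eq, fourier_fourierInv_eq]
  refine ⟨𝓕⁻ (hm.toLp _), (mem_HsR_iff hs _).2 ?_, ?_⟩
  · rw [fourier_fourierInv_eq]
    filter_upwards [hm.coeFn_toLp] with ξ hξ
    rw [hξ, ← mul_assoc, ← Complex.ofReal_mul, mul_inv_cancel₀ (symb_pos s ξ).ne',
      Complex.ofReal_one, one_mul]
  · rw [← ofReal_norm, hn, ofReal_norm, Lp.enorm_toLp]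
    exact h

theorem HsR_norm_eq (hs : 0 ≤ s) (q : HsR m s) : ‖q‖ = ‖q.1.2‖ :=
  max_eq_right (HsR_norm_le hs q)

/-! ### `Hˢ(B)` as a space of functions -/

/-- The injection `Hˢ(B) → L²(B)`. -/
def Hs.toL2 (m : ℕ) (s : ℝ) (B : Set (E m)) : Hs m s B →L[ℝ] L2 (vol B) :=
  (HsR.null m s B).liftQL (HsR.restrict m s B) le_rfl

theorem Hs.toL2_mk (q : HsR m s) :
    Hs.toL2 m s B (Hs.mk q) = HsR.restrict m s B q := rfl

theorem Hs.mk_surjective (v : Hs m s B) : ∃ q : HsR m s, Hs.mk q = v :=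
  Submodule.mkQ_surjective (HsR.null m s B) v

theorem Hs.exists_mk_norm_lt (v : Hs m s B) {ε : ℝ} (hε : 0 < ε) :
    ∃ q : HsR m s, Hs.mk q = v ∧ ‖q‖ < ‖v‖ + ε :=
  Submodule.Quotient.norm_mk_lt (S := HsR.null m s B) v hε

theorem Hs.norm_mk_le (q : HsR m s) : ‖(Hs.mk q : Hs m s B)‖ ≤ ‖q‖ :=
  Submodule.Quotient.norm_mk_le (S := HsR.null m s B) q

theorem Hs.toL2_injective (m : ℕ) (s : ℝ) (B : Set (E m)) : Function.Injective (Hs.toL2 m s B) := by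
  intro v w h
  obtain ⟨q, rfl⟩ := Hs.mk_surjective v
  obtain ⟨r, rfl⟩ := Hs.mk_surjective w
  rw [Hs.toL2_mk, Hs.toL2_mk] at h
  refine (Submodule.Quotient.eq (HsR.null m s B)).2 ?_
  change HsR.restrict m s B (q - r) = 0
  rw [map_sub, h, sub_self]

theorem restrict_ae (q : HsR m s) : HsR.restrict m s B q =ᵐ[vol B] q.1.1 :=
  LpToLpRestrictCLM_coeFn ℝ B q.1.1

theorem represents_iff {v : Hs m s B} {f : E m → ℝ} :
    Represents v f ↔ f =ᵐ[vol B] Hs.toL2 m s B v := by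
  constructor
  · rintro ⟨u, rfl, h⟩
    rw [Hs.toL2_mk]
    exact h.trans (restrict_ae u).symm
  · intro h
    obtain ⟨q, rfl⟩ := Hs.mk_surjective v
    exact ⟨q, rfl, h.trans (restrict_ae q)⟩

/-- A bounded linear map into `Hˢ(B)` is determined by its values in `L²(B)`. -/
theorem exists_clm_Hs (Λ : X →ₗ[ℝ] L2 (vol B)) (C : ℝ)
    (h : ∀ x, ∃ w : Hs m s B, Hs.toL2 m s B w = Λ x ∧ ‖w‖ ≤ C * ‖x‖) :
    ∃ T : X →L[ℝ] Hs m s B, (∀ x, Hs.toL2 m s B (T x) = Λ x) ∧ ∀ x, ‖T x‖ ≤ C * ‖x‖ := by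
  choose w hw hn using h
  let L : X →ₗ[ℝ] Hs m s B :=
    { toFun := w
      map_add' := fun x y => Hs.toL2_injective m s B (by rw [map_add, hw, hw, hw, map_add])
      map_smul' := fun c x => Hs.toL2_injective m s B (by
        rw [map_smul, hw, hw, map_smul, RingHom.id_apply]) }
  exact ⟨L.mkContinuous C hn, hw, hn⟩

theorem exists_clm_Hs_of_rep {s t : ℝ} (Λ : L2 (vol B) →L[ℝ] L2 (vol B)) {C : ℝ} (hC : 0 ≤ C)
    (h : ∀ q : HsR m s, ∃ r : HsR m t, HsR.restrict m t B r = Λ (HsR.restrict m s B q) ∧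
      ‖r‖ ≤ C * ‖q‖) :
    ∃ T : Hs m s B →L[ℝ] Hs m t B, (∀ v, Hs.toL2 m t B (T v) = Λ (Hs.toL2 m s B v)) ∧
      ∀ v, ‖T v‖ ≤ C * ‖v‖ := by
  refine exists_clm_Hs (Λ.comp (Hs.toL2 m s B)).toLinearMap C fun v => ?_
  have key : ∀ ε > 0, ∃ w : Hs m t B, Hs.toL2 m t B w = Λ (Hs.toL2 m s B v) ∧
      ‖w‖ ≤ C * (‖v‖ + ε) := by
    intro ε hε
    obtain ⟨q, rfl, hq⟩ := Hs.exists_mk_norm_lt v hε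
    obtain ⟨r, hr, hn⟩ := h q
    exact ⟨Hs.mk r, by rw [Hs.toL2_mk, Hs.toL2_mk, hr],
      (Hs.norm_mk_le r).trans (hn.trans (mul_le_mul_of_nonneg_left hq.le hC))⟩
  obtain ⟨w, hw, -⟩ := key 1 one_pos
  refine ⟨w, hw, ?_⟩
  have h1 : ∀ ε > 0, ‖w‖ ≤ C * (‖v‖ + ε) := by
    intro ε hε
    obtain ⟨w', hw', hn⟩ := key ε hε
    rwa [Hs.toL2_injective m t B (hw.trans hw'.symm)]
  have h2 : Tendsto (fun ε => C * (‖v‖ + ε)) (𝓝[>] 0) (𝓝 (C * (‖v‖ + 0))) :=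
    ((continuous_const.mul (continuous_const.add continuous_id)).tendsto 0).mono_left
      nhdsWithin_le_nhds
  rw [add_zero] at h2
  exact ge_of_tendsto h2 (by filter_upwards [self_mem_nhdsWithin] with ε hε using h1 ε hε)

/-- The inclusion `Hˢ(B) → Hᵗ(B)`, `t ≤ s`. -/
theorem exists_Hs_inclusion (m : ℕ) {s t : ℝ} (B : Set (E m)) (ht : 0 ≤ t) (hts : t ≤ s) :
    ∃ J : Hs m s B →L[ℝ] Hs m t B, ∀ v, Hs.toL2 m t B (J v) = Hs.toL2 m s B v := by
  obtain ⟨T, hT, -⟩ := exists_clm_Hs_of_rep (m := m) (s := s) (t := t) (B := B)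
    (ContinuousLinearMap.id ℝ _) zero_le_one (by
    intro q
    have h := (mem_HsR_iff (ht.trans hts) q.1).1 q.2
    obtain ⟨g, hg, hn⟩ := exists_mem_HsR ht q.1.1 (C := ‖q.1.2‖ₑ) enorm_ne_top (by
      rw [← ofReal_norm, ← Lp.norm_fourier_eq q.1.2, ofReal_norm, Lp.enorm_def]
      refine eLpNorm_mono_ae ?_
      filter_upwards [h] with ξ hξ
      have hst : symb m s ξ = symb m t ξ * symb m (s - t) ξ := by rw [← symb_add]; congr 1; ring
      have hp := symb_pos t ξ
      rw [hξ, ← mul_assoc, ← Complex.ofReal_mul, hst, ← mul_assoc, inv_mul_cancel₀ hp.ne', one_mul,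
        norm_mul, Complex.norm_real, norm_eq_abs, abs_of_pos (symb_pos _ ξ)]
      exact mul_le_of_le_one_left (norm_nonneg _) (symb_le_one (by linarith) ξ))
    refine ⟨⟨(q.1.1, g), hg⟩, rfl, ?_⟩
    rw [HsR_norm_eq ht, HsR_norm_eq (ht.trans hts), one_mul]
    rw [← ofReal_norm, ← ofReal_norm] at hn
    exact (ofReal_le_ofReal_iff (norm_nonneg _)).1 hn)
  exact ⟨T, hT⟩

end

section

open FourierTransform TemperedDistribution

/-- The phase factor `e^{2πi⟨h,ξ⟩}`. -/
def phase (h ξ : E m) : ℂ := ((Real.fourierChar (inner ℝ h ξ) : Circle) : ℂ)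

theorem norm_phase (h ξ : E m) : ‖phase h ξ‖ = 1 := Circle.norm_coe _

theorem continuous_phase (h : E m) : Continuous (phase h) :=
  continuous_subtype_val.comp (Real.continuous_fourierChar.comp (continuous_const.inner continuous_id))

theorem memLp_phase (h : E m) : MemLp (phase h) ∞ volume :=
  memLp_top_of_bound (continuous_phase h).aestronglyMeasurable 1
    (.of_forall fun ξ => (norm_phase h ξ).le)

theorem fourier_translate (h : E m) (v : L2C m) :
    (𝓕 (Lp.compMeasurePreserving (fun y => y + h) (measurePreserving_add_right volume h) v) : L2C m)
      =ᵐ[volume] fun ξ => phase h ξ * (𝓕 v : L2C m) ξ := by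
  have hM := fun f : L2C m => (ContinuousLinearMap.mul ℂ ℂ).coeFn_holder
    (r := 2) ((memLp_phase h).toLp _) f
  suffices h1 : (𝓕 (Lp.compMeasurePreserving (fun y => y + h)
      (measurePreserving_add_right volume h) v) : L2C m) =
      (ContinuousLinearMap.mul ℂ ℂ).holderL volume ∞ 2 2 ((memLp_phase h).toLp _) (𝓕 v : L2C m) by
    rw [h1]
    filter_upwards [hM (𝓕 v), (memLp_phase h).coeFn_toLp] with ξ h2 h3
    rw [ContinuousLinearMap.holderL_apply_apply, h2, h3, ContinuousLinearMap.mul_apply']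
  refine DenseRange.induction_on (SchwartzMap.denseRange_toLpCLM (E := E m) (F := ℂ)
    (μ := (volume : Measure (E m))) (p := 2) ENNReal.ofNat_ne_top) v ?_ fun φ => ?_
  · refine isClosed_eq ?_ ?_
    · exact (Lp.fourierTransformₗᵢ (E m) ℂ).continuous.comp
        (Lp.isometry_compMeasurePreserving (measurePreserving_add_right volume h)).continuous
    · exact (ContinuousLinearMap.continuous _).comp (Lp.fourierTransformₗᵢ (E m) ℂ).continuous
  · have e1 : Lp.compMeasurePreserving (fun y => y + h) (measurePreserving_add_right volume h)
        (φ.toLp 2 volume) = (SchwartzMap.compSubConstCLM ℂ (-h) φ).toLp 2 volume := by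
      refine Lp.ext ?_
      filter_upwards [Lp.coeFn_compMeasurePreserving (φ.toLp 2 volume)
        (measurePreserving_add_right volume h), (SchwartzMap.compSubConstCLM ℂ (-h) φ).coeFn_toLp 2 volume,
        (measurePreserving_add_right volume h).quasiMeasurePreserving.ae_eq_comp
          (φ.coeFn_toLp 2 volume)] with x a b c
      rw [a, b, c]
      simp
    rw [SchwartzMap.toLpCLM_apply, e1, SchwartzMap.toLp_fourier_eq, SchwartzMap.toLp_fourier_eq,
      ContinuousLinearMap.holderL_apply_apply]
    refine Lp.ext ?_
    filter_upwards [hM ((𝓕 φ).toLp 2 volume), (memLp_phase h).coeFn_toLp,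
      (𝓕 φ).coeFn_toLp 2 volume, (𝓕 (SchwartzMap.compSubConstCLM ℂ (-h) φ)).coeFn_toLp 2 volume]
      with ξ a b c d
    rw [a, b, c, d, ContinuousLinearMap.mul_apply', SchwartzMap.fourier_coe, SchwartzMap.fourier_coe]
    have := congrFun (VectorFourier.fourierIntegral_comp_add_right Real.fourierChar volume
      (innerₗ (E m)) (φ : E m → ℂ) h) ξ
    have e : (⇑(SchwartzMap.compSubConstCLM ℂ (-h) φ) : E m → ℂ) = (φ : E m → ℂ) ∘ fun v => v + h := by
      ext x; simp
    rw [e]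
    exact this

theorem lintegral_translate_sub (u : Lp ℝ 2 (volume : Measure (E m))) (h : E m) :
    ∫⁻ y, ‖u (y + h) - u y‖ₑ ^ 2 =
      ∫⁻ ξ, ‖phase h ξ - 1‖ₑ ^ 2 * ‖(𝓕 (toComplex m u) : L2C m) ξ‖ₑ ^ 2 := by
  have h1 := fourier_translate h (toComplex m u)
  set τ := Lp.compMeasurePreserving (fun y => y + h) (measurePreserving_add_right volume h)
    (toComplex m u) with hτ
  have h2 : ‖τ - toComplex m u‖ₑ = ‖(𝓕 τ - 𝓕 (toComplex m u) : L2C m)‖ₑ := by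
    rw [← ofReal_norm, ← ofReal_norm, ← Lp.norm_fourier_eq]
    congr 2
    exact map_sub (Lp.fourierTransformₗᵢ (E m) ℂ) _ _
  have h3 := congrArg (fun a => a ^ 2) h2
  simp only [Lp.enorm_def, eLpNorm_two_sq] at h3
  have hτe : τ =ᵐ[volume] fun y => ((u (y + h) : ℝ) : ℂ) := by
    filter_upwards [Lp.coeFn_compMeasurePreserving (toComplex m u)
        (measurePreserving_add_right volume h),
      (measurePreserving_add_right volume h).quasiMeasurePreserving.ae_eq_comp
          (toComplex_ae u)] with x a b
    rw [hτ, a, b]; rfl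
  refine Eq.trans ?_ (h3.trans ?_)
  · refine lintegral_congr_ae ?_
    filter_upwards [Lp.coeFn_sub τ (toComplex m u), hτe, toComplex_ae u] with y a b c
    rw [a, Pi.sub_apply, b, c, ← Complex.ofReal_sub, ← ofReal_norm, ← ofReal_norm, Complex.norm_real]
  · refine lintegral_congr_ae ?_
    filter_upwards [Lp.coeFn_sub (𝓕 τ : L2C m) (𝓕 (toComplex m u)), h1] with ξ a b
    rw [a, Pi.sub_apply, b, ← mul_pow, ← enorm_mul, sub_mul, one_mul]

/-- `s ↦ |e^{2πisσ} - 1|²` -/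
theorem norm_phase_sub_one_sq (h ξ : E m) :
    ‖phase h ξ - 1‖ ^ 2 = 2 - 2 * cos (2 * Real.pi * inner ℝ h ξ) := by
  have : phase h ξ = Complex.exp ((2 * Real.pi * inner ℝ h ξ : ℝ) * Complex.I) := by
    rw [phase, Real.fourierChar_apply]
  have e : phase h ξ - 1 = ⟨cos (2 * Real.pi * inner ℝ h ξ) - 1,
      Real.sin (2 * Real.pi * inner ℝ h ξ)⟩ := by
    rw [this]
    refine Complex.ext ?_ ?_
    · rw [Complex.sub_re, Complex.exp_ofReal_mul_I_re, Complex.one_re]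
    · rw [Complex.sub_im, Complex.exp_ofReal_mul_I_im, Complex.one_im, sub_zero]
  rw [e, ← Complex.normSq_eq_norm_sq, Complex.normSq_mk]
  nlinarith [Real.sin_sq_add_cos_sq (2 * Real.pi * inner ℝ h ξ)]

theorem lintegral_phase_le (σ : ℝ) : ∫⁻ s in Ioi (0 : ℝ), ofReal ((s ^ 2)⁻¹) *
      ofReal (2 - 2 * cos (2 * Real.pi * (s * σ))) ≤ ofReal (44 * |σ|) := by
  rcases eq_or_ne σ 0 with rfl | hσ
  · simp
  have hσ' : 0 < |σ| := abs_pos.2 hσ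
  have ha : 0 < |σ|⁻¹ := inv_pos.2 hσ'
  rw [← Ioc_union_Ioi_eq_Ioi ha.le]
  refine (lintegral_union_le _ _ _).trans ?_
  have b1 : ∫⁻ s in Ioc (0 : ℝ) |σ|⁻¹, ofReal ((s ^ 2)⁻¹) *
      ofReal (2 - 2 * cos (2 * Real.pi * (s * σ))) ≤ ofReal (40 * |σ|) := by
    calc _ ≤ ∫⁻ s in Ioc (0 : ℝ) |σ|⁻¹, ofReal (40 * σ ^ 2) := by
          refine setLIntegral_mono measurable_const fun s hs => ?_
          rw [← ofReal_mul (by positivity)]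
          refine ofReal_le_ofReal ?_
          have h1 := Real.one_sub_sq_div_two_le_cos (x := 2 * Real.pi * (s * σ))
          have hs0 : 0 < s ^ 2 := pow_pos hs.1 2
          rw [inv_mul_le_iff₀ hs0]
          have h2 : Real.pi ^ 2 ≤ 10 := by nlinarith [Real.pi_lt_d2, Real.pi_pos]
          have h3 : (2 * Real.pi * (s * σ)) ^ 2 = 4 * Real.pi ^ 2 * (s ^ 2 * σ ^ 2) := by ring
          have h4 : Real.pi ^ 2 * (s ^ 2 * σ ^ 2) ≤ 10 * (s ^ 2 * σ ^ 2) :=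
            mul_le_mul_of_nonneg_right h2 (by positivity)
          nlinarith
      _ = _ := by
          rw [setLIntegral_const, Real.volume_Ioc, sub_zero, ← ofReal_mul (by positivity)]
          congr 1
          rw [← sq_abs σ]
          field_simp
  have b2 : ∫⁻ s in Ioi |σ|⁻¹, ofReal ((s ^ 2)⁻¹) *
      ofReal (2 - 2 * cos (2 * Real.pi * (s * σ))) ≤ ofReal (4 * |σ|) := by
    have hi := integrableOn_Ioi_rpow_of_lt (a := -2) (by norm_num) ha
    calc _ ≤ ∫⁻ s in Ioi |σ|⁻¹, ofReal (4 * s ^ (-2 : ℝ)) := by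
          refine setLIntegral_mono' measurableSet_Ioi fun s hs => ?_
          have hs0 : 0 < s := ha.trans hs
          rw [← ofReal_mul (by positivity)]
          refine ofReal_le_ofReal ?_
          have h1 := Real.neg_one_le_cos (2 * Real.pi * (s * σ))
          rw [rpow_neg hs0.le, Real.rpow_two, mul_comm]
          exact mul_le_mul_of_nonneg_right (by linarith) (by positivity)
      _ = ofReal (∫ s in Ioi |σ|⁻¹, 4 * s ^ (-2 : ℝ)) := by
          rw [ofReal_integral_eq_lintegral_ofReal (hi.const_mul 4)]
          filter_upwards [self_mem_ae_restrict measurableSet_Ioi] with s hs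
          have hs0 : 0 < s := ha.trans hs
          positivity
      _ = _ := by
          rw [integral_const_mul, integral_Ioi_rpow_of_lt (by norm_num) ha]
          congr 2
          norm_num
          rw [Real.rpow_neg_one, inv_inv]
  refine (add_le_add b1 b2).trans ?_
  rw [← ofReal_add (by positivity) (by positivity)]
  refine ofReal_le_ofReal ?_
  linarith

theorem le_lintegral_phase (σ : ℝ) : ofReal (2 * |σ|) ≤ ∫⁻ s in Ioi (0 : ℝ), ofReal ((s ^ 2)⁻¹) *
      ofReal (2 - 2 * cos (2 * Real.pi * (s * σ))) := by
  rcases eq_or_ne σ 0 with rfl | hσ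
  · simp
  have hσ' : 0 < |σ| := abs_pos.2 hσ
  have hsub : Ioc (1 / (4 * |σ|)) (1 / (2 * |σ|)) ⊆ Ioi (0 : ℝ) := fun s hs =>
    lt_trans (by positivity) hs.1
  refine le_trans ?_ (lintegral_mono_set hsub)
  calc ofReal (2 * |σ|)
      = ∫⁻ s in Ioc (1 / (4 * |σ|)) (1 / (2 * |σ|)), ofReal (8 * |σ| ^ 2) := by
        rw [setLIntegral_const, Real.volume_Ioc, ← ofReal_mul (by positivity)]
        congr 1
        field_simp
        norm_num
    _ ≤ _ := by
        refine setLIntegral_mono' measurableSet_Ioc fun s hs => ?_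
        have hs0 : 0 < s := hsub hs
        rw [← ofReal_mul (by positivity)]
        refine ofReal_le_ofReal ?_
        have hx1 : s * |σ| ≤ 1 / 2 := by
          have := (le_div_iff₀ (by positivity)).1 hs.2; linarith
        have hx2 : 1 / 4 ≤ s * |σ| := by
          have := (div_lt_iff₀ (by positivity)).1 hs.1; linarith
        have hc : cos (2 * Real.pi * (s * σ)) ≤ 0 := by
          rw [← Real.cos_abs]
          have : |2 * Real.pi * (s * σ)| = 2 * Real.pi * (s * |σ|) := by
            rw [abs_mul, abs_mul, abs_mul, abs_of_pos hs0, abs_of_pos Real.pi_pos, abs_of_pos two_pos]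
          rw [this]
          refine Real.cos_nonpos_of_pi_div_two_le_of_le ?_ ?_ <;> nlinarith [Real.pi_pos]
        rw [inv_mul_eq_div, le_div_iff₀ (by positivity)]
        have : 0 ≤ s * |σ| := by positivity
        nlinarith

end

section

open FourierTransform TemperedDistribution

/-- `∫_0^∞ s⁻² |e^{2πisσ} - 1|² ds` -/
def halfKernel (σ : ℝ) : ℝ≥0∞ := ∫⁻ s in Ioi (0 : ℝ), ofReal ((s ^ 2)⁻¹) * ofReal (2 - 2 * cos (2 * Real.pi * (s * σ)))

theorem gagliardo_eq (u : Lp ℝ 2 (volume : Measure (E m))) (i : Fin m) :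
    gagliardo (EuclideanSpace.single i 1) u =
      ∫⁻ ξ, halfKernel (ξ i) * ‖(𝓕 (toComplex m u) : L2C m) ξ‖ₑ ^ 2 := by
  have hu : AEMeasurable (fun ξ => ‖(𝓕 (toComplex m u) : L2C m) ξ‖ₑ ^ 2) volume :=
    (Lp.aestronglyMeasurable _).enorm.pow_const 2
  have hk : Measurable fun q : ℝ × E m => ofReal ((q.1 ^ 2)⁻¹) *
      ofReal (2 - 2 * cos (2 * Real.pi * (q.1 * q.2 i))) := by
    have h1 : Measurable fun q : ℝ × E m => ofReal ((q.1 ^ 2)⁻¹) :=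
      ((measurable_fst.pow_const 2).inv).ennreal_ofReal
    have h2 : Measurable fun q : ℝ × E m => ofReal (2 - 2 * cos (2 * Real.pi * (q.1 * q.2 i))) :=
      Measurable.ennreal_ofReal (Continuous.measurable (by fun_prop))
    exact h1.mul h2
  have e1 : ∀ s : ℝ, ∫⁻ y, ‖u (y + s • EuclideanSpace.single i 1) - u y‖ₑ ^ 2 =
      ∫⁻ ξ, ofReal (2 - 2 * cos (2 * Real.pi * (s * ξ i))) *
        ‖(𝓕 (toComplex m u) : L2C m) ξ‖ₑ ^ 2 := by
    intro s
    rw [lintegral_translate_sub]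
    refine lintegral_congr fun ξ => ?_
    rw [← ofReal_norm, ← ofReal_pow (norm_nonneg _), norm_phase_sub_one_sq]
    congr 5
    rw [inner_smul_left, EuclideanSpace.inner_single_left]
    simp
  unfold gagliardo halfKernel
  simp only [e1]
  have e2 : ∀ s : ℝ, ofReal ((s ^ 2)⁻¹) * ∫⁻ ξ, ofReal
      (2 - 2 * cos (2 * Real.pi * (s * ξ i))) * ‖(𝓕 (toComplex m u) : L2C m) ξ‖ₑ ^ 2 =
      ∫⁻ ξ, (ofReal ((s ^ 2)⁻¹) * ofReal
      (2 - 2 * cos (2 * Real.pi * (s * ξ i)))) * ‖(𝓕 (toComplex m u) : L2C m) ξ‖ₑ ^ 2 := by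
    intro s
    rw [← lintegral_const_mul' _ _ ofReal_ne_top]
    simp only [mul_assoc]
  simp only [e2]
  rw [lintegral_lintegral_swap (f := fun (s : ℝ) (ξ : E m) => (ofReal ((s ^ 2)⁻¹) * ofReal (2 - 2 * cos (2 * Real.pi * (s * ξ i)))) * ‖(𝓕 (toComplex m u) : L2C m) ξ‖ₑ ^ 2)]
  · refine lintegral_congr_ae ?_
    filter_upwards with ξ
    have hm : Measurable fun s : ℝ => ofReal ((s ^ 2)⁻¹) * ofReal (2 - 2 * cos (2 * Real.pi * (s * ξ i))) :=
      hk.comp (measurable_id.prodMk measurable_const)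
    rw [lintegral_mul_const _ hm]
  · exact hk.aemeasurable.mul (hu.comp_snd)

theorem measurable_halfKernel (i : Fin m) : Measurable fun ξ : E m => halfKernel (ξ i) := by
  have h1 : Measurable fun q : E m × ℝ => ofReal ((q.2 ^ 2)⁻¹) :=
    ((measurable_snd.pow_const 2).inv).ennreal_ofReal
  have h2 : Measurable fun q : E m × ℝ => ofReal (2 - 2 * cos (2 * Real.pi * (q.2 * q.1 i))) :=
    Measurable.ennreal_ofReal (Continuous.measurable (by fun_prop))
  exact (h1.mul h2).lintegral_prod_right'

theorem halfKernel_le (σ : ℝ) : halfKernel σ ≤ ofReal (44 * |σ|) := lintegral_phase_le σ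

theorem le_halfKernel (σ : ℝ) : ofReal (2 * |σ|) ≤ halfKernel σ := le_lintegral_phase σ

theorem symb_half_inv_sq (ξ : E m) : ((symb m (1 / 2) ξ)⁻¹) ^ 2 = √(1 + ‖ξ‖ ^ 2) := by
  unfold symb
  rw [← rpow_neg (by positivity), ← Real.rpow_natCast, ← Real.rpow_mul (by positivity),
    Real.sqrt_eq_rpow]
  norm_num

theorem gagliardo_le (q : HsR m (1 / 2)) (i : Fin m) :
    gagliardo (EuclideanSpace.single i 1) q.1.1 ≤ 44 * ‖q‖ₑ ^ 2 := by
  have h := (mem_HsR_iff (by norm_num) q.1).1 q.2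
  have e : ‖q‖ₑ ^ 2 = ∫⁻ ξ, ‖(𝓕 q.1.2 : L2C m) ξ‖ₑ ^ 2 := by
    rw [← eLpNorm_two_sq, ← Lp.enorm_def, ← ofReal_norm, ← ofReal_norm, Lp.norm_fourier_eq,
      HsR_norm_eq (by norm_num)]
  rw [gagliardo_eq, e, ← lintegral_const_mul' _ _ (by norm_num)]
  refine lintegral_mono_ae ?_
  filter_upwards [h] with ξ hξ
  rw [hξ, enorm_mul, mul_pow, ← mul_assoc]
  refine mul_le_mul_left (le_trans (mul_le_mul_left (halfKernel_le _) _) ?_) _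
  have hp := symb_pos (1 / 2) ξ
  rw [← ofReal_norm, Complex.norm_real, norm_eq_abs, abs_of_pos hp,
    ← ofReal_pow hp.le, ← ofReal_mul (by positivity)]
  refine ENNReal.ofReal_le_of_le_toReal ?_
  have h1 : |ξ i| ≤ √(1 + ‖ξ‖ ^ 2) := by
    refine Real.le_sqrt_of_sq_le ?_
    have := PiLp.norm_apply_le ξ i
    rw [norm_eq_abs] at this
    nlinarith [abs_nonneg (ξ i)]
  rw [← symb_half_inv_sq] at h1
  have h2 : ((symb m (1 / 2) ξ)⁻¹) ^ 2 * symb m (1 / 2) ξ ^ 2 = 1 := by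
    rw [← mul_pow, inv_mul_cancel₀ hp.ne', one_pow]
  have h3 := mul_le_mul_of_nonneg_right h1 (sq_nonneg (symb m (1 / 2) ξ))
  rw [h2] at h3
  norm_num
  linarith

theorem exists_HsR_half (u : Lp ℝ 2 (volume : Measure (E m))) {M : ℝ≥0∞} (hM : M ≠ ∞)
    (h : ∀ i, gagliardo (EuclideanSpace.single i 1) u ≤ M ^ 2) :
    ∃ q : HsR m (1 / 2), q.1.1 = u ∧ ‖q‖ₑ ≤ ‖u‖ₑ + m * M := by
  have hp := fun ξ : E m => symb_pos (1 / 2) ξ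
  have key : eLpNorm (fun ξ => (((symb m (1 / 2) ξ)⁻¹ : ℝ) : ℂ) * (𝓕 (toComplex m u) : L2C m) ξ) 2
      volume ≤ ‖u‖ₑ + m * M := by
    refine ENNReal_le_of_sq_le ?_
    rw [eLpNorm_two_sq]
    have hu : AEMeasurable (fun ξ => ‖(𝓕 (toComplex m u) : L2C m) ξ‖ₑ ^ 2) volume :=
      (Lp.aestronglyMeasurable _).enorm.pow_const 2
    have e : ‖u‖ₑ ^ 2 = ∫⁻ ξ, ‖(𝓕 (toComplex m u) : L2C m) ξ‖ₑ ^ 2 := by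
      rw [← eLpNorm_two_sq, ← Lp.enorm_def, ← ofReal_norm, ← ofReal_norm, Lp.norm_fourier_eq,
        norm_toComplex]
    have hpt : ∀ ξ : E m, ‖(((symb m (1 / 2) ξ)⁻¹ : ℝ) : ℂ) * (𝓕 (toComplex m u) : L2C m) ξ‖ₑ ^ 2 ≤
        ‖(𝓕 (toComplex m u) : L2C m) ξ‖ₑ ^ 2 + ∑ i, halfKernel (ξ i) *
          ‖(𝓕 (toComplex m u) : L2C m) ξ‖ₑ ^ 2 := by
      intro ξ
      rw [enorm_mul, mul_pow, ← sum_mul, ← one_add_mul]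
      refine mul_le_mul_left ?_ _
      rw [← ofReal_norm, Complex.norm_real, norm_eq_abs, abs_of_pos (inv_pos.2 (hp ξ)),
        ← ofReal_pow (inv_pos.2 (hp ξ)).le, symb_half_inv_sq]
      refine le_trans ?_ (add_le_add_right (sum_le_sum fun i _ => le_halfKernel (ξ i)) 1)
      rw [← ofReal_one, ← ENNReal.ofReal_sum_of_nonneg fun i _ => by positivity,
        ← ofReal_add zero_le_one (sum_nonneg fun i _ => by positivity)]
      refine ofReal_le_ofReal ?_
      have h0 : ‖ξ‖ ≤ ∑ i, |ξ i| := by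
        rw [EuclideanSpace.norm_eq]
        refine Real.sqrt_le_iff.2 ⟨sum_nonneg fun i _ => abs_nonneg _, ?_⟩
        exact Finset.sum_sq_le_sq_sum_of_nonneg fun i _ => abs_nonneg _
      have h1 : √(1 + ‖ξ‖ ^ 2) ≤ 1 + ‖ξ‖ := by
        refine Real.sqrt_le_iff.2 ⟨by positivity, ?_⟩
        nlinarith [norm_nonneg ξ]
      rw [← mul_sum]
      nlinarith [sum_nonneg fun (i : Fin m) (_ : i ∈ Finset.univ) => abs_nonneg (ξ i)]
    refine (lintegral_mono hpt).trans ?_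
    rw [lintegral_add_left' hu, ← e]
    have h3 : ∫⁻ ξ, ∑ i, halfKernel (ξ i) * ‖(𝓕 (toComplex m u) : L2C m) ξ‖ₑ ^ 2 ≤ m * M ^ 2 := by
      rw [lintegral_finsetSum']
      · refine (sum_le_sum fun i _ => (gagliardo_eq u i).symm.le.trans (h i)).trans ?_
        simp
      · intro i _
        refine AEMeasurable.mul ?_ hu
        exact (measurable_halfKernel i).aemeasurable
    refine (add_le_add le_rfl h3).trans ?_
    have h4 : (m : ℝ≥0∞) * M ^ 2 ≤ (m * M) ^ 2 := by
      rw [mul_pow]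
      refine mul_le_mul_left ?_ _
      exact_mod_cast Nat.le_self_pow two_ne_zero m
    refine (add_le_add le_rfl h4).trans ?_
    rw [add_sq]
    exact add_le_add_left le_self_add _
  obtain ⟨g, hg, hn⟩ := exists_mem_HsR (by norm_num) u
    (add_ne_top.2 ⟨enorm_ne_top, mul_ne_top (ENNReal.natCast_ne_top m) hM⟩) key
  refine ⟨⟨(u, g), hg⟩, rfl, ?_⟩
  rw [← ofReal_norm, HsR_norm_eq (by norm_num), ofReal_norm]
  exact hn

theorem gagliardo_congr {u v : E m → ℝ} (h : u =ᵐ[volume] v) (e : E m) :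
    gagliardo e u = gagliardo e v := by
  unfold gagliardo
  refine lintegral_congr fun s => ?_
  congr 1
  refine lintegral_congr_ae ?_
  filter_upwards [h, (measurePreserving_add_right volume (s • e)).quasiMeasurePreserving.ae_eq_comp h]
    with y a b
  simp only [Function.comp] at b
  rw [a, b]

/-- Multiplication by a bounded Lipschitz function. -/
theorem gagliardo_mul_le {a u : E m → ℝ} (e : E m) (he : ‖e‖ ≤ 1) {A : ℝ}
    (ha : ∀ y, |a y| ≤ A) (hl : ∀ y z, |a y - a z| ≤ A * ‖y - z‖)
    (hu : AEStronglyMeasurable u volume) : gagliardo e (fun y => a y * u y) ≤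
      ofReal A ^ 2 * (2 * gagliardo e u + 10 * eLpNorm u 2 volume ^ 2) := by
  have hA : 0 ≤ A := (abs_nonneg _).trans (ha 0)
  have hk : Measurable fun s : ℝ => ofReal ((s ^ 2)⁻¹) :=
    ((measurable_id.pow_const 2).inv).ennreal_ofReal
  have hpt : ∀ s : ℝ, 0 < s → ∫⁻ y, ‖a (y + s • e) * u (y + s • e) - a y * u y‖ₑ ^ 2 ≤
      ofReal A ^ 2 * (2 * ∫⁻ y, ‖u (y + s • e) - u y‖ₑ ^ 2) +
      ofReal A ^ 2 * (ofReal (2 * min (s ^ 2) 4) * eLpNorm u 2 volume ^ 2) := by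
    intro s hs
    have h1 : ∀ y, ‖a (y + s • e) * u (y + s • e) - a y * u y‖ₑ ^ 2 ≤
        ofReal A ^ 2 * (2 * ‖u (y + s • e) - u y‖ₑ ^ 2) +
        ofReal A ^ 2 * (ofReal (2 * min (s ^ 2) 4) * ‖u y‖ₑ ^ 2) := by
      intro y
      have t2 : ∀ x : ℝ≥0∞, 2 * x = ofReal 2 * x := fun x => by norm_num
      have hd : |a (y + s • e) - a y| ^ 2 ≤ A ^ 2 * min (s ^ 2) 4 := by
        rw [mul_min_of_nonneg _ _ (sq_nonneg A)]
        refine le_min ?_ ?_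
        · rw [← mul_pow]
          refine pow_le_pow_left₀ (abs_nonneg _) ((hl _ _).trans ?_) 2
          rw [add_sub_cancel_left, norm_smul, norm_eq_abs, abs_of_pos hs]
          exact mul_le_mul_of_nonneg_left (mul_le_of_le_one_right hs.le he) hA
        · have : |a (y + s • e) - a y| ≤ 2 * A :=
            (abs_sub _ _).trans (by linarith [ha (y + s • e), ha y])
          nlinarith [abs_nonneg (a (y + s • e) - a y)]
      rw [← ofReal_norm, ← ofReal_norm, ← ofReal_norm, ← ofReal_pow (norm_nonneg _),
        ← ofReal_pow (norm_nonneg _), ← ofReal_pow (norm_nonneg _), ← ofReal_pow hA, t2,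
        ← ofReal_mul (by positivity), ← ofReal_mul (by positivity),
        ← ofReal_mul (by positivity), ← ofReal_mul (by positivity),
        ← ofReal_add (by positivity) (by positivity)]
      refine ofReal_le_ofReal ?_
      simp only [norm_eq_abs, sq_abs] at hd ⊢
      have e1 : a (y + s • e) * u (y + s • e) - a y * u y =
        a (y + s • e) * (u (y + s • e) - u y) + (a (y + s • e) - a y) * u y := by ring
      have e2 : a (y + s • e) ^ 2 ≤ A ^ 2 := by
        rw [← sq_abs]; exact pow_le_pow_left₀ (abs_nonneg _) (ha _) 2
      have e3 := mul_le_mul_of_nonneg_right e2 (sq_nonneg (u (y + s • e) - u y))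
      have e4 := mul_le_mul_of_nonneg_right hd (sq_nonneg (u y))
      rw [e1]
      nlinarith [sq_nonneg (a (y + s • e) * (u (y + s • e) - u y) - (a (y + s • e) - a y) * u y)]
    refine (lintegral_mono h1).trans ?_
    have hu2 : AEMeasurable (fun y => ‖u y‖ₑ ^ 2) volume := hu.enorm.pow_const 2
    have hu3 : AEMeasurable (fun y => ofReal A ^ 2 * (ofReal (2 * min (s ^ 2) 4) *
      ‖u y‖ₑ ^ 2)) volume := (hu2.const_mul _).const_mul _
    rw [lintegral_add_right' _ hu3, lintegral_const_mul' _ _ (by finiteness),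
      lintegral_const_mul' _ _ (by finiteness), lintegral_const_mul' _ _ (by finiteness),
      lintegral_const_mul' _ _ (by finiteness), eLpNorm_two_sq]
  have hker : ∫⁻ s in Ioi (0 : ℝ), ofReal ((s ^ 2)⁻¹) * ofReal (2 * min (s ^ 2) 4) ≤ 10 := by
    rw [← Ioc_union_Ioi_eq_Ioi zero_le_one]
    refine (lintegral_union_le _ _ _).trans ?_
    have b1 : ∫⁻ s in Ioc (0 : ℝ) 1, ofReal ((s ^ 2)⁻¹) * ofReal (2 * min (s ^ 2) 4) ≤ 2 := by
      calc _ ≤ ∫⁻ s in Ioc (0 : ℝ) 1, 2 := by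
            refine setLIntegral_mono measurable_const fun s hs => ?_
            have hs0 : 0 < s ^ 2 := pow_pos hs.1 2
            rw [← ofReal_mul (by positivity)]
            refine ENNReal.ofReal_le_of_le_toReal ?_
            rw [inv_mul_le_iff₀ hs0]
            norm_num
            nlinarith [min_le_left (s ^ 2) 4]
        _ = 2 := by simp
    have b2 : ∫⁻ s in Ioi (1 : ℝ), ofReal ((s ^ 2)⁻¹) * ofReal (2 * min (s ^ 2) 4) ≤ 8 := by
      have hi := integrableOn_Ioi_rpow_of_lt (a := -2) (by norm_num) zero_lt_one
      calc _ ≤ ∫⁻ s in Ioi (1 : ℝ), ofReal (8 * s ^ (-2 : ℝ)) := by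
            refine setLIntegral_mono' measurableSet_Ioi fun s hs => ?_
            have hs0 : (0 : ℝ) < s := zero_lt_one.trans hs
            rw [← ofReal_mul (by positivity)]
            refine ofReal_le_ofReal ?_
            rw [rpow_neg hs0.le, Real.rpow_two, mul_comm]
            exact mul_le_mul_of_nonneg_right (by linarith [min_le_right (s ^ 2) 4]) (by positivity)
        _ = ofReal (∫ s in Ioi (1 : ℝ), 8 * s ^ (-2 : ℝ)) := by
            rw [ofReal_integral_eq_lintegral_ofReal (hi.const_mul 8)]
            filter_upwards [self_mem_ae_restrict measurableSet_Ioi] with s hs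
            have hs0 : (0 : ℝ) < s := zero_lt_one.trans hs
            positivity
        _ = 8 := by
            rw [integral_const_mul, integral_Ioi_rpow_of_lt (by norm_num) zero_lt_one]
            norm_num
    refine (add_le_add b1 b2).trans ?_
    norm_num
  have hkm : Measurable fun s : ℝ => ofReal ((s ^ 2)⁻¹) * ofReal (2 * min (s ^ 2) 4) :=
    hk.mul (Continuous.measurable (by fun_prop)).ennreal_ofReal
  calc gagliardo e (fun y => a y * u y)
      ≤ ∫⁻ s in Ioi (0 : ℝ), (ofReal A ^ 2 * 2) * (ofReal ((s ^ 2)⁻¹) *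
          ∫⁻ y, ‖u (y + s • e) - u y‖ₑ ^ 2) +
          (ofReal A ^ 2 * eLpNorm u 2 volume ^ 2) * (ofReal ((s ^ 2)⁻¹) * ofReal (2 * min (s ^ 2) 4)) := by
        unfold gagliardo
        refine setLIntegral_mono' measurableSet_Ioi fun s hs => ?_
        refine (mul_le_mul_right (hpt s hs) _).trans (le_of_eq ?_)
        ring
    _ = (ofReal A ^ 2 * 2) * gagliardo e u + (ofReal A ^ 2 * eLpNorm u 2 volume ^ 2) *
          ∫⁻ s in Ioi (0 : ℝ), ofReal ((s ^ 2)⁻¹) * ofReal (2 * min (s ^ 2) 4) := by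
        have hm2 : Measurable fun s : ℝ => (ofReal A ^ 2 * eLpNorm u 2 volume ^ 2) *
          (ofReal ((s ^ 2)⁻¹) * ofReal (2 * min (s ^ 2) 4)) := hkm.const_mul _
        rw [lintegral_add_right _ hm2, lintegral_const_mul' _ _ (by finiteness),
          lintegral_const_mul _ hkm]
        rfl
    _ ≤ (ofReal A ^ 2 * 2) * gagliardo e u +
        (ofReal A ^ 2 * eLpNorm u 2 volume ^ 2) * 10 := by gcongr
    _ = _ := by ring

theorem half_constant {A x : ℝ} (hA : 0 ≤ A) (hx : 0 ≤ x) (m : ℕ) :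
    ofReal A * ofReal x + m * (10 * (ofReal A * ofReal x)) = ofReal (((1 + 10 * m) * A) * x) := by
  have t : ∀ x : ℝ≥0∞, 10 * x = ofReal 10 * x := fun x => by norm_num
  rw [t, ← ENNReal.ofReal_natCast, ← ofReal_mul hA, ← ofReal_mul (by norm_num),
    ← ofReal_mul (by positivity), ← ofReal_add (by positivity) (by positivity)]
  congr 1; ring

/-- The product of an `L^∞` and an `L²` function. -/
def mulL (μ : Measure (E n)) : Lp ℝ ∞ μ →L[ℝ] L2 μ →L[ℝ] L2 μ :=
  (ContinuousLinearMap.mul ℝ ℝ).holderL μ ∞ 2 2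

theorem mulL_ae {μ : Measure (E n)} (a : Lp ℝ ∞ μ) (f : L2 μ) :
    mulL μ a f =ᵐ[μ] fun x => a x * f x := (ContinuousLinearMap.mul ℝ ℝ).coeFn_holder (r := 2) a f

theorem HsR_eLpNorm_le (hs : 0 ≤ s) (q : HsR m s) : eLpNorm q.1.1 2 volume ≤ ‖q‖ₑ := by
  rw [← Lp.enorm_def, ← ofReal_norm, ← ofReal_norm]
  refine ofReal_le_ofReal ?_
  rw [HsR_norm_eq hs]
  exact HsR_norm_le hs q

theorem exists_mul_HsR_half {b : E m → ℝ} {A : ℝ} (hb : Continuous b)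
    (ha : ∀ y, |b y| ≤ A) (hl : ∀ y z, |b y - b z| ≤ A * ‖y - z‖) (q : HsR m (1 / 2)) :
    ∃ r : HsR m (1 / 2), r.1.1 =ᵐ[volume] (fun y => b y * q.1.1 y) ∧
      ‖r‖ ≤ ((1 + 10 * m) * A) * ‖q‖ := by
  have hA : 0 ≤ A := (abs_nonneg _).trans (ha 0)
  have hbL : MemLp b ∞ (volume : Measure (E m)) :=
    memLp_top_of_bound hb.aestronglyMeasurable A (.of_forall ha)
  have hm : MemLp (fun y => b y * q.1.1 y) 2 volume := (Lp.memLp q.1.1).mul (p := ∞) hbL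
  have hq := HsR_eLpNorm_le (by norm_num) q
  have hn : ‖hm.toLp‖ₑ ≤ ofReal A * ‖q‖ₑ := by
    rw [Lp.enorm_toLp]
    have : eLpNorm (fun y => b y * q.1.1 y) 2 volume ≤ ofReal A * eLpNorm q.1.1 2 volume := by
      refine eLpNorm_le_mul_eLpNorm_of_ae_le_mul (.of_forall fun y => ?_) 2
      rw [norm_mul]
      exact mul_le_mul_of_nonneg_right (ha y) (norm_nonneg _)
    exact this.trans (mul_le_mul_right hq _)
  have hg : ∀ i, gagliardo (EuclideanSpace.single i 1) (hm.toLp) ≤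
      (10 * (ofReal A * ‖q‖ₑ)) ^ 2 := by
    intro i
    rw [gagliardo_congr hm.coeFn_toLp]
    refine (gagliardo_mul_le (EuclideanSpace.single i 1) (by simp) ha hl
      (Lp.aestronglyMeasurable _)).trans ?_
    rw [mul_pow, mul_pow, ← mul_assoc, mul_comm (10 ^ 2 : ℝ≥0∞), mul_assoc]
    refine mul_le_mul_right ?_ _
    calc _ ≤ 2 * (44 * ‖q‖ₑ ^ 2) + 10 * ‖q‖ₑ ^ 2 := by
          gcongr; exact gagliardo_le q i
      _ = 98 * ‖q‖ₑ ^ 2 := by ring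
      _ ≤ 10 ^ 2 * ‖q‖ₑ ^ 2 := by gcongr; norm_num
  obtain ⟨r, hr, hrn⟩ := exists_HsR_half (hm.toLp) (by finiteness) hg
  refine ⟨r, ?_, ?_⟩
  · rw [hr]
    exact hm.coeFn_toLp
  · have h4 : ‖r‖ₑ ≤ ofReal (((1 + 10 * m) * A) * ‖q‖) := by
      rw [← half_constant hA (norm_nonneg q) m, ofReal_norm q]
      exact hrn.trans (add_le_add_left hn _)
    rw [← ofReal_norm] at h4
    exact (ofReal_le_ofReal_iff (by positivity)).1 h4

/-- Multiplication by the restriction of a bounded Lipschitz function, as a linear map on `H^½`. -/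
theorem exists_mul_half (B : Set (E m)) (a : Lp ℝ ∞ (vol B)) {b : E m → ℝ} {A : ℝ}
    (hab : a =ᵐ[vol B] b) (ha : ∀ y, |b y| ≤ A) (hl : ∀ y z, |b y - b z| ≤ A * ‖y - z‖) :
    ∃ T : Hs m (1 / 2) B →L[ℝ] Hs m (1 / 2) B,
      (∀ v, Hs.toL2 m (1 / 2) B (T v) = mulL (vol B) a (Hs.toL2 m (1 / 2) B v)) ∧
      ∀ v, ‖T v‖ ≤ ((1 + 10 * m) * A) * ‖v‖ := by
  have hA : 0 ≤ A := (abs_nonneg _).trans (ha 0)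
  have hb : Continuous b := by
    refine (LipschitzWith.of_dist_le_mul (K := ⟨A, hA⟩) fun y z => ?_).continuous
    rw [dist_eq, dist_eq_norm]; exact hl y z
  refine exists_clm_Hs_of_rep _ (by positivity) fun q => ?_
  obtain ⟨r, hr, hn⟩ := exists_mul_HsR_half hb ha hl q
  refine ⟨r, Lp.ext ?_, hn⟩
  refine ((restrict_ae r).trans (ae_restrict_of_ae hr)).trans ((mulL_ae a _).trans ?_).symm
  filter_upwards [restrict_ae (B := B) q, hab] with y h3 h4
  rw [h3, h4]

end

section

open FourierTransform TemperedDistribution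

/-- On `L¹ ∩ L²` the inverse Fourier transform is given by the integral. -/
theorem fourierInv_ae_eq (v : L2C m) (hv : Integrable v volume) :
    (𝓕⁻ v : L2C m) =ᵐ[volume] 𝓕 (fun ξ => v (-ξ)) := by
  have hv' : Integrable (fun ξ => v (-ξ)) volume := hv.comp_neg
  have hc : Continuous (𝓕 (fun ξ => v (-ξ))) :=
    VectorFourier.fourierIntegral_continuous Real.continuous_fourierChar continuous_inner hv'
  refine ae_eq_of_integral_contDiff_smul_eq
    ((Lp.memLp _).locallyIntegrable one_le_two) hc.locallyIntegrable fun g hg hgc => ?_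
  have hg₁ : HasCompactSupport (Complex.ofRealCLM ∘ g) := hgc.comp_left rfl
  have hg₂ : ContDiff ℝ (⊤ : ℕ∞) (Complex.ofRealCLM ∘ g) := Complex.ofRealCLM.contDiff.comp hg
  set φ : SchwartzMap (E m) ℂ := hg₁.toSchwartzMap hg₂ with hφ
  have hφe : ∀ x, φ x = ((g x : ℝ) : ℂ) := fun x => rfl
  have h1 := congrArg (fun S : TemperedDistribution (E m) ℂ => S φ)
    (Lp.fourierInv_toTemperedDistribution_eq v)
  simp only [fourierInv_apply, Lp.toTemperedDistribution_apply] at h1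
  have h2 : ∀ f : E m → ℂ, ∫ x, g x • f x = ∫ x, φ x • f x := fun f => by
    refine integral_congr_ae (.of_forall fun x => ?_)
    simp only [hφe]
    exact (Complex.coe_smul _ _).symm
  rw [h2, h2, ← h1]
  have h3 : ∀ x, (𝓕⁻ φ : SchwartzMap (E m) ℂ) x = 𝓕 (φ : E m → ℂ) (-x) := fun x => by
    rw [SchwartzMap.fourierInv_coe, Real.fourierInv_eq_fourier_neg]
  simp only [h3]
  rw [← integral_neg_eq_self]
  simp only [neg_neg]
  have := VectorFourier.integral_fourierIntegral_smul_eq_flip (L := innerₗ (E m))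
      Real.continuous_fourierChar continuous_inner (φ.integrable (μ := volume)) hv'
  simp only [flip_innerₗ] at this
  exact this

theorem memLp_symb_two (hs : (m : ℝ) < 2 * s) : MemLp (symb m s) 2 volume := by
  refine (memLp_two_iff_integrable_sq (continuous_symb m s).aestronglyMeasurable).2 ?_
  have h := integrable_rpow_neg_one_add_norm_sq (μ := (volume : Measure (E m))) (r := 2 * s)
    (by simpa using hs)
  refine h.congr (.of_forall fun ξ => ?_)
  simp only [symb]
  rw [← Real.rpow_natCast ((1 + ‖ξ‖ ^ 2) ^ (-s / 2)) 2, ← Real.rpow_mul (by positivity)]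
  congr 1
  push_cast
  ring

theorem symb_neg_two (ξ : E m) : symb m (-2) ξ = 1 + ‖ξ‖ ^ 2 := by unfold symb; norm_num

/-- The weighted Fourier transform of an element of `Hˢ`, `s > m/2 + 2`, is integrable. -/
theorem exists_integrable_fourier (m : ℕ) (hs : (m : ℝ) + 4 < 2 * s) :
    ∃ K : ℝ, 0 ≤ K ∧ ∀ q : HsR m s,
      Integrable (fun ξ => (1 + ‖ξ‖ ^ 2) * ‖(𝓕 (toComplex m q.1.1) : L2C m) ξ‖) volume ∧
      ∫ ξ, (1 + ‖ξ‖ ^ 2) * ‖(𝓕 (toComplex m q.1.1) : L2C m) ξ‖ ≤ K * ‖q‖ := by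
  have hs0 : 0 ≤ s := by have : (0 : ℝ) ≤ m := Nat.cast_nonneg m; linarith
  have hsy := memLp_symb_two (m := m) (s := s - 2) (by linarith)
  refine ⟨‖hsy.toLp‖, norm_nonneg _, fun q => ?_⟩
  have h := (mem_HsR_iff hs0 q.1).1 q.2
  have hg : MemLp (fun ξ => ‖(𝓕 q.1.2 : L2C m) ξ‖) 2 volume := (Lp.memLp _).norm
  have e : (fun ξ => (1 + ‖ξ‖ ^ 2) * ‖(𝓕 (toComplex m q.1.1) : L2C m) ξ‖) =ᵐ[volume]
      fun ξ => symb m (s - 2) ξ * ‖(𝓕 q.1.2 : L2C m) ξ‖ := by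
    filter_upwards [h] with ξ hξ
    rw [hξ, norm_mul, Complex.norm_real, norm_eq_abs, abs_of_pos (symb_pos s ξ), ← mul_assoc,
      ← symb_neg_two, ← symb_add]
    congr 2; ring
  refine ⟨((hsy.integrable_mul hg)).congr e.symm, ?_⟩
  rw [integral_congr_ae e]
  have h1 : ∫ ξ, symb m (s - 2) ξ * ‖(𝓕 q.1.2 : L2C m) ξ‖ = inner ℝ (hg.toLp) (hsy.toLp) := by
    rw [L2.inner_def]
    refine integral_congr_ae ?_
    filter_upwards [hg.coeFn_toLp, hsy.coeFn_toLp] with ξ a b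
    rw [a, b]; rfl
  rw [h1, HsR_norm_eq hs0]
  refine (real_inner_le_norm _ _).trans (le_of_eq ?_)
  rw [mul_comm, ← Lp.norm_fourier_eq q.1.2]
  congr 1
  rw [Lp.norm_toLp, Lp.norm_def, eLpNorm_norm]

theorem contDiff_fourier_of_weight {v : E m → ℂ} (hvm : AEStronglyMeasurable v volume)
    (hi' : Integrable (fun ξ => (1 + ‖ξ‖ ^ 2) * ‖v ξ‖) volume) :
    Integrable v volume ∧ ContDiff ℝ (2 : ℕ∞) (𝓕 v) ∧ ∀ k ≤ 2, ∀ y,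
      ‖iteratedFDeriv ℝ k (𝓕 v) y‖ ≤ (2 * Real.pi + 1) ^ 2 * ∫ ξ, (1 + ‖ξ‖ ^ 2) * ‖v ξ‖ := by
  have hpow : ∀ k ≤ 2, ∀ ξ : E m, ‖ξ‖ ^ k ≤ 1 + ‖ξ‖ ^ 2 := by
    intro k hk ξ
    interval_cases k
    · simp
    · nlinarith [sq_nonneg (‖ξ‖ - 1), norm_nonneg ξ]
    · simp
  have hik : ∀ k : ℕ, k ≤ 2 → Integrable (fun ξ => ‖ξ‖ ^ k * ‖v ξ‖) volume := by
    intro k hk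
    refine hi'.mono ((continuous_norm.pow k).aestronglyMeasurable.mul hvm.norm)
      (.of_forall fun ξ => ?_)
    rw [norm_of_nonneg (by positivity), norm_of_nonneg (by positivity)]
    exact mul_le_mul_of_nonneg_right (hpow k hk ξ) (norm_nonneg _)
  have hik' : ∀ k : ℕ, (k : ℕ∞) ≤ (2 : ℕ∞) → Integrable (fun ξ => ‖ξ‖ ^ k * ‖v ξ‖) volume :=
    fun k hk => hik k (by exact_mod_cast hk)
  have hvi : Integrable v volume := by
    have := hik 0 (by norm_num)
    simp only [pow_zero, one_mul] at this
    exact (integrable_norm_iff hvm).1 this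
  have hF : ContDiff ℝ (2 : ℕ∞) (𝓕 v) := Real.contDiff_fourier hik'
  refine ⟨hvi, hF, fun k hk y => ?_⟩
  rw [Real.iteratedFDeriv_fourier hik' hvm (by exact_mod_cast hk)]
  refine (VectorFourier.norm_fourierIntegral_le_integral_norm _ _ _ _ _).trans ?_
  calc ∫ ξ, ‖VectorFourier.fourierPowSMulRight (innerSL ℝ) v ξ k‖
      ≤ ∫ ξ, (2 * Real.pi + 1) ^ 2 * ((1 + ‖ξ‖ ^ 2) * ‖v ξ‖) := by
        refine integral_mono_of_nonneg (.of_forall fun ξ => norm_nonneg _)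
          (hi'.const_mul _) (.of_forall fun ξ => ?_)
        refine (VectorFourier.norm_fourierPowSMulRight_le _ _ _ _).trans ?_
        have h1 : 2 * Real.pi * ‖innerSL ℝ (E := E m)‖ ≤ 2 * Real.pi + 1 := by
          nlinarith [norm_innerSL_le ℝ (E := E m), Real.pi_pos]
        have h2 : (2 * Real.pi * ‖innerSL ℝ (E := E m)‖) ^ k ≤ (2 * Real.pi + 1) ^ 2 :=
          (pow_le_pow_left₀ (by positivity) h1 k).trans
            (pow_le_pow_right₀ (by linarith [Real.pi_pos]) hk)
        rw [mul_assoc]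
        exact mul_le_mul h2 (mul_le_mul_of_nonneg_right (hpow k hk ξ) (norm_nonneg _))
          (by positivity) (by positivity)
    _ = (2 * Real.pi + 1) ^ 2 * ∫ ξ, (1 + ‖ξ‖ ^ 2) * ‖v ξ‖ := integral_const_mul _ _

/-- The Sobolev embedding of `Hˢ(ℝᵐ)`, `s > m/2 + 2`, into `C²` functions with bounded
derivatives. -/
theorem exists_contDiff_rep (m : ℕ) (hs : (m : ℝ) + 4 < 2 * s) :
    ∃ K : ℝ, 0 ≤ K ∧ ∀ q : HsR m s, ∃ f : E m → ℝ, ContDiff ℝ 2 f ∧ f =ᵐ[volume] q.1.1 ∧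
      ∀ k ≤ 2, ∀ y, ‖iteratedFDeriv ℝ k f y‖ ≤ K * ‖q‖ := by
  obtain ⟨K, hK0, hK⟩ := exists_integrable_fourier m hs
  refine ⟨(2 * Real.pi + 1) ^ 2 * K, by positivity, fun q => ?_⟩
  obtain ⟨hi, hb⟩ := hK q
  have hw1 : (𝓕⁻ (𝓕 (toComplex m q.1.1) : L2C m) : L2C m) = toComplex m q.1.1 :=
    fourierInv_fourier_eq _
  generalize (𝓕 (toComplex m q.1.1) : L2C m) = w at hi hb hw1
  have hvm : AEStronglyMeasurable (fun ξ => w (-ξ)) volume :=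
    (Lp.aestronglyMeasurable w).comp_quasiMeasurePreserving
      (Measure.measurePreserving_neg volume).quasiMeasurePreserving
  have hi' : Integrable (fun ξ => (1 + ‖ξ‖ ^ 2) * ‖w (-ξ)‖) volume := by
    have := hi.comp_neg
    simpa only [norm_neg] using this
  have hb' : ∫ ξ, (1 + ‖ξ‖ ^ 2) * ‖w (-ξ)‖ ≤ K * ‖q‖ := by
    rw [← integral_neg_eq_self] at hb
    simpa only [norm_neg] using hb
  obtain ⟨hvi, hF, hbound⟩ := contDiff_fourier_of_weight hvm hi'
  have hwi : Integrable w volume := by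
    have := hvi.comp_neg
    simpa only [neg_neg] using this
  have h1 := fourierInv_ae_eq w hwi
  rw [hw1] at h1
  generalize (𝓕 (fun ξ => w (-ξ))) = F at hF hbound h1
  refine ⟨fun y => (F y).re, Complex.reCLM.contDiff.comp hF, ?_, fun k hk y => ?_⟩
  · filter_upwards [h1, toComplex_ae q.1.1] with y a b
    have c : F y = ((q.1.1 y : ℝ) : ℂ) := a.symm.trans b
    rw [c, Complex.ofReal_re]
  · have hre : ‖Complex.reCLM‖ ≤ 1 := Complex.reCLM_norm.le
    have := Complex.reCLM.norm_iteratedFDeriv_comp_left (x := y) (hF.contDiffAt) (n := k)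
      (by exact_mod_cast hk)
    refine this.trans ((mul_le_mul_of_nonneg_right hre (norm_nonneg _)).trans ?_)
    rw [one_mul, mul_assoc]
    exact (hbound k hk y).trans (mul_le_mul_of_nonneg_left hb' (by positivity))

end

theorem abs_pd_le (f : E n → ℝ) (i : Fin n) (y : E n) : |pd f i y| ≤ ‖fderiv ℝ f y‖ := by
  have := (fderiv ℝ f y).le_opNorm (EuclideanSpace.single i 1)
  simpa [pd] using this

theorem pd_congr {f g : E n → ℝ} {y : E n} (h : f =ᶠ[𝓝 y] g) (i : Fin n) : pd f i y = pd g i y := by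
  unfold pd; rw [h.fderiv_eq]

theorem pd_eventuallyEq {f g : E n → ℝ} {y : E n} (h : f =ᶠ[𝓝 y] g) (i : Fin n) :
    pd f i =ᶠ[𝓝 y] pd g i := by
  filter_upwards [h.eventuallyEq_nhds] with z hz using pd_congr hz i

theorem contDiffAt_pd {f : E n → ℝ} {y : E n} (hf : ContDiffAt ℝ 2 f y) (i : Fin n) :
    ContDiffAt ℝ 1 (pd f i) y := (hf.fderiv_right (m := 1) (by norm_num)).clm_apply contDiffAt_const

theorem fderiv_pd {f : E n → ℝ} {y : E n} (hf : ContDiffAt ℝ 2 f y) (i : Fin n) (v : E n) :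
    fderiv ℝ (pd f i) y v = fderiv ℝ (fderiv ℝ f) y v (EuclideanSpace.single i 1) := by
  have h : HasFDerivAt (fderiv ℝ f) (fderiv ℝ (fderiv ℝ f) y) y :=
    ((hf.fderiv_right (m := 1) (by norm_num)).differentiableAt (by norm_num)).hasFDerivAt
  have h2 := h.clm_apply (hasFDerivAt_const (EuclideanSpace.single i (1 : ℝ)) y)
  have h3 : HasFDerivAt (pd f i) _ y := h2
  rw [h3.fderiv]
  simp

theorem norm_fderiv_pd_le {f : E n → ℝ} {y : E n} (hf : ContDiffAt ℝ 2 f y) (i : Fin n) :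
    ‖fderiv ℝ (pd f i) y‖ ≤ ‖fderiv ℝ (fderiv ℝ f) y‖ := by
  refine opNorm_le_bound _ (norm_nonneg (fderiv ℝ (fderiv ℝ f) y)) fun v => ?_
  rw [fderiv_pd hf]
  refine ((fderiv ℝ (fderiv ℝ f) y v).le_opNorm _).trans ?_
  simpa using (fderiv ℝ (fderiv ℝ f) y).le_opNorm v

theorem abs_sub_le_of_fderiv {f : E n → ℝ} {C : ℝ} (hf : Differentiable ℝ f)
    (h : ∀ y, ‖fderiv ℝ f y‖ ≤ C) (y z : E n) : |f y - f z| ≤ C * ‖y - z‖ :=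
  (convex_univ).norm_image_sub_le_of_norm_fderiv_le (𝕜 := ℝ) (fun x _ => hf x) (fun x _ => h x)
    (mem_univ z) (mem_univ y)

/-- A `C²` function with bounded derivatives. -/
structure BddC2 (f : E m → ℝ) (C : ℝ) : Prop where
  contDiff : ContDiff ℝ 2 f
  le : ∀ y, |f y| ≤ C
  fderiv_le : ∀ y, ‖fderiv ℝ f y‖ ≤ C
  fderiv_fderiv_le : ∀ y, ‖fderiv ℝ (fderiv ℝ f) y‖ ≤ C

theorem BddC2.lip {f : E m → ℝ} {C : ℝ} (h : BddC2 f C) (y z : E m) : |f y - f z| ≤ C * ‖y - z‖ :=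
  abs_sub_le_of_fderiv (h.contDiff.differentiable (by norm_num)) h.fderiv_le y z

theorem BddC2.pd_le {f : E m → ℝ} {C : ℝ} (h : BddC2 f C) (i : Fin m) (y : E m) :
    |pd f i y| ≤ C := (abs_pd_le f i y).trans (h.fderiv_le y)

theorem BddC2.pd_pd_le {f : E m → ℝ} {C : ℝ} (h : BddC2 f C) (i j : Fin m) (y : E m) :
    |pd (pd f i) j y| ≤ C :=
  ((abs_pd_le _ j y).trans (norm_fderiv_pd_le h.contDiff.contDiffAt i)).trans
    (h.fderiv_fderiv_le y)

theorem BddC2.lip_pd {f : E m → ℝ} {C : ℝ} (h : BddC2 f C) (i : Fin m) (y z : E m) :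
    |pd f i y - pd f i z| ≤ C * ‖y - z‖ :=
  abs_sub_le_of_fderiv (fun x => (contDiffAt_pd h.contDiff.contDiffAt i).differentiableAt
    (by norm_num)) (fun x => (norm_fderiv_pd_le h.contDiff.contDiffAt i).trans
      (h.fderiv_fderiv_le x)) y z

theorem Hs.exists_mk_norm_le (v : Hs m s B) :
    ∃ q : HsR m s, Hs.mk q = v ∧ ‖q‖ ≤ 2 * ‖v‖ := by
  rcases eq_or_ne v 0 with rfl | hv
  · exact ⟨0, map_zero _, by simp⟩
  · obtain ⟨q, hq, hn⟩ := Hs.exists_mk_norm_lt v (norm_pos_iff.2 hv)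
    exact ⟨q, hq, by linarith⟩

theorem Hs.exists_bddC2 (m : ℕ) (hs : (m : ℝ) + 4 < 2 * s) (B : Set (E m)) :
    ∃ K : ℝ, 0 ≤ K ∧ ∀ v : Hs m s B, ∃ f : E m → ℝ, BddC2 f (K * ‖v‖) ∧ Represents v f := by
  obtain ⟨K, hK0, hK⟩ := exists_contDiff_rep m hs
  refine ⟨K * 2, by positivity, fun v => ?_⟩
  obtain ⟨q, rfl, hq⟩ := Hs.exists_mk_norm_le v
  obtain ⟨f, hf, hfq, hb⟩ := hK q
  have hle : K * ‖q‖ ≤ K * 2 * ‖(Hs.mk q : Hs m s B)‖ := by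
    rw [mul_assoc]; exact mul_le_mul_of_nonneg_left hq hK0
  refine ⟨f, ⟨hf, fun y => ?_, fun y => ?_, fun y => ?_⟩, q, rfl, ae_restrict_of_ae hfq⟩
  · have := hb 0 (by norm_num) y
    rw [norm_iteratedFDeriv_zero] at this
    exact this.trans hle
  · have := hb 1 (by norm_num) y
    rw [norm_iteratedFDeriv_one] at this
    exact this.trans hle
  · have := hb 2 le_rfl y
    rw [← norm_iteratedFDeriv_fderiv, norm_iteratedFDeriv_one] at this
    exact this.trans hle

section fn
variable {B : Set (E m)}

theorem Hs.fn_spec (hs : (m : ℝ) + 4 < 2 * s) (v : Hs m s B) :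
    ContDiff ℝ 2 v.fn ∧ Represents v v.fn := by
  have h : ∃ f, ContDiff ℝ 2 f ∧ Represents v f := by
    obtain ⟨K, -, hK⟩ := Hs.exists_bddC2 m hs B
    obtain ⟨f, hf, hr⟩ := hK v
    exact ⟨f, hf.contDiff, hr⟩
  unfold Hs.fn
  rw [dif_pos h]
  exact h.choose_spec

theorem Hs.fn_eventuallyEq (hs : (m : ℝ) + 4 < 2 * s) (hB : IsOpen B) {v : Hs m s B}
    {f : E m → ℝ} (hf : Continuous f) (hr : Represents v f) {y : E m} (hy : y ∈ B) :
    v.fn =ᶠ[𝓝 y] f := by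
  obtain ⟨h1, h2⟩ := Hs.fn_spec hs v
  have h3 : v.fn =ᵐ[vol B] f := (represents_iff.1 h2).trans (represents_iff.1 hr).symm
  have h4 : EqOn v.fn f B :=
    Measure.eqOn_open_of_ae_eq h3 hB h1.continuous.continuousOn hf.continuousOn
  filter_upwards [hB.mem_nhds hy] with z hz using h4 hz

theorem Hs.fn_add (hs : (m : ℝ) + 4 < 2 * s) (hB : IsOpen B) (v w : Hs m s B) {y : E m}
    (hy : y ∈ B) : (v + w).fn =ᶠ[𝓝 y] v.fn + w.fn := by
  obtain ⟨h1, h2⟩ := Hs.fn_spec hs v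
  obtain ⟨h3, h4⟩ := Hs.fn_spec hs w
  refine Hs.fn_eventuallyEq hs hB (h1.continuous.add h3.continuous) ?_ hy
  rw [represents_iff] at *
  rw [map_add]
  exact (h2.add h4).trans (Lp.coeFn_add _ _).symm

theorem Hs.fn_smul (hs : (m : ℝ) + 4 < 2 * s) (hB : IsOpen B) (c : ℝ) (v : Hs m s B) {y : E m}
    (hy : y ∈ B) : (c • v).fn =ᶠ[𝓝 y] c • v.fn := by
  obtain ⟨h1, h2⟩ := Hs.fn_spec hs v
  refine Hs.fn_eventuallyEq hs hB (continuous_const.smul h1.continuous) ?_ hy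
  rw [represents_iff] at *
  rw [map_smul]
  exact (h2.const_smul c).trans (Lp.coeFn_smul _ _).symm

end fn

theorem pd_mul {f g : E n → ℝ} {y : E n} (hf : DifferentiableAt ℝ f y)
    (hg : DifferentiableAt ℝ g y) (i : Fin n) :
    pd (fun z => f z * g z) i y = pd f i y * g y + f y * pd g i y := by
  unfold pd
  rw [fderiv_fun_mul hf hg]
  simp
  ring

theorem pd_pd_mul {f g : E n → ℝ} {y : E n} (hf : ContDiffAt ℝ 2 f y)
    (hg : ContDiffAt ℝ 2 g y) (i j : Fin n) :
    pd (pd (fun z => f z * g z) i) j y = pd (pd f i) j y * g y + pd f i y * pd g j y +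
      (pd f j y * pd g i y + f y * pd (pd g i) j y) := by
  have hf1 : ∀ᶠ z in 𝓝 y, DifferentiableAt ℝ f z :=
    (hf.eventually (by norm_num)).mono fun z h => h.differentiableAt (by norm_num)
  have hg1 : ∀ᶠ z in 𝓝 y, DifferentiableAt ℝ g z :=
    (hg.eventually (by norm_num)).mono fun z h => h.differentiableAt (by norm_num)
  have h1 : pd (fun z => f z * g z) i =ᶠ[𝓝 y] fun z => pd f i z * g z + f z * pd g i z := by
    filter_upwards [hf1, hg1] with z a b using pd_mul a b i
  rw [pd_congr h1]
  have df := (contDiffAt_pd hf i).differentiableAt (by norm_num)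
  have dg := (contDiffAt_pd hg i).differentiableAt (by norm_num)
  have df0 := hf1.self_of_nhds
  have dg0 := hg1.self_of_nhds
  rw [← pd_mul df dg0, ← pd_mul df0 dg]
  have h2 := fderiv_fun_add (df.fun_mul dg0) (df0.fun_mul dg)
  exact congrArg (fun L : E n →L[ℝ] ℝ => L (EuclideanSpace.single j 1)) h2

/-- `C²` functions on `B` whose derivatives are bounded there. -/
structure BddJet (B : Set (E m)) (f : E m → ℝ) (K : ℝ) : Prop where
  smooth : ∀ y ∈ B, ContDiffAt ℝ 2 f y
  le : ∀ y ∈ B, |f y| ≤ K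
  pd_le : ∀ y ∈ B, ∀ i, |pd f i y| ≤ K
  pd_pd_le : ∀ y ∈ B, ∀ i j, |pd (pd f i) j y| ≤ K

theorem BddC2.bddJet {f : E m → ℝ} {C : ℝ} (h : BddC2 f C) (B : Set (E m)) : BddJet B f C :=
  ⟨fun _ _ => h.contDiff.contDiffAt, fun y _ => h.le y, fun y _ i => h.pd_le i y,
    fun y _ i j => h.pd_pd_le i j y⟩

theorem BddJet.congr {f g : E m → ℝ} {K : ℝ} (h : BddJet B f K)
    (hg : ∀ y ∈ B, g =ᶠ[𝓝 y] f) : BddJet B g K := by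
  refine ⟨fun y hy => (h.smooth y hy).congr_of_eventuallyEq (hg y hy), fun y hy => ?_,
    fun y hy i => ?_, fun y hy i j => ?_⟩
  · rw [(hg y hy).self_of_nhds]; exact h.le y hy
  · rw [pd_congr (hg y hy)]; exact h.pd_le y hy i
  · rw [pd_congr (pd_eventuallyEq (hg y hy) i)]; exact h.pd_pd_le y hy i j

theorem BddJet.mul {f g : E m → ℝ} {K L : ℝ} (hf : BddJet B f K)
    (hg : BddJet B g L) : BddJet B (fun y => f y * g y) (4 * (K * L)) := by
  have key : ∀ {a b : ℝ}, |a| ≤ K → |b| ≤ L → |a * b| ≤ K * L := by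
    intro a b ha hb
    rw [abs_mul]
    exact mul_le_mul ha hb (abs_nonneg _) ((abs_nonneg _).trans ha)
  refine ⟨fun y hy => (hf.smooth y hy).mul (hg.smooth y hy), fun y hy => ?_, fun y hy i => ?_,
    fun y hy i j => ?_⟩
  · have h1 := key (hf.le y hy) (hg.le y hy)
    linarith [(abs_nonneg _).trans h1]
  · rw [pd_mul ((hf.smooth y hy).differentiableAt (by norm_num))
      ((hg.smooth y hy).differentiableAt (by norm_num))]
    have h1 := key (hf.pd_le y hy i) (hg.le y hy)
    have h2 := key (hf.le y hy) (hg.pd_le y hy i)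
    refine (abs_add_le _ _).trans ?_
    linarith [(abs_nonneg _).trans h1]
  · rw [pd_pd_mul (hf.smooth y hy) (hg.smooth y hy)]
    have h1 := key (hf.pd_pd_le y hy i j) (hg.le y hy)
    have h2 := key (hf.pd_le y hy i) (hg.pd_le y hy j)
    have h3 := key (hf.pd_le y hy j) (hg.pd_le y hy i)
    have h4 := key (hf.le y hy) (hg.pd_pd_le y hy i j)
    refine (abs_add_le _ _).trans ?_
    have h5 := abs_add_le (pd (pd f i) j y * g y) (pd f i y * pd g j y)
    have h6 := abs_add_le (pd f j y * pd g i y) (f y * pd (pd g i) j y)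
    linarith

theorem pd_inv {f : E n → ℝ} {y : E n} (hf : DifferentiableAt ℝ f y) (h0 : f y ≠ 0)
    (i : Fin n) : pd (fun z => (f z)⁻¹) i y = -(pd f i y * ((f y)⁻¹ * (f y)⁻¹)) := by
  have h := (hasDerivAt_inv h0).comp_hasFDerivAt y hf.hasFDerivAt
  have h2 : HasFDerivAt (fun z => (f z)⁻¹) _ y := h
  unfold pd
  rw [h2.fderiv]
  simp
  ring

theorem BddJet.inv {f : E m → ℝ} {K c : ℝ} (hf : BddJet B f K)
    (hc : 0 < c) (hfc : ∀ y ∈ B, c ≤ f y) : ∃ L, BddJet B (fun y => (f y)⁻¹) L := by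
  rcases B.eq_empty_or_nonempty with rfl | ⟨y0, hy0⟩
  · exact ⟨0, by constructor <;> simp⟩
  have hK : 0 ≤ K := (abs_nonneg _).trans (hf.le y0 hy0)
  have h0 : ∀ y ∈ B, f y ≠ 0 := fun y hy => (hc.trans_le (hfc y hy)).ne'
  have hi : ∀ y ∈ B, |(f y)⁻¹| ≤ c⁻¹ := fun y hy => by
    rw [abs_inv, abs_of_pos (hc.trans_le (hfc y hy))]
    exact inv_anti₀ hc (hfc y hy)
  have hd : ∀ y ∈ B, ∀ i, |pd (fun z => (f z)⁻¹) i y| ≤ K * (c⁻¹ * c⁻¹) := fun y hy i => by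
    rw [pd_inv ((hf.smooth y hy).differentiableAt (by norm_num)) (h0 y hy), abs_neg, abs_mul, abs_mul]
    exact mul_le_mul (hf.pd_le y hy i) (mul_le_mul (hi y hy) (hi y hy) (abs_nonneg _)
      (by positivity)) (by positivity) hK
  have hs : ∀ y ∈ B, ContDiffAt ℝ 2 (fun z => (f z)⁻¹) y := fun y hy => (hf.smooth y hy).inv (h0 y hy)
  have hdd : ∀ y ∈ B, ∀ i j, |pd (pd (fun z => (f z)⁻¹) i) j y| ≤
      K * (c⁻¹ * c⁻¹) + 2 * (K * (K * (c⁻¹ * c⁻¹) * c⁻¹)) := fun y hy i j => by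
    have e1 : pd (fun z => (f z)⁻¹) i =ᶠ[𝓝 y]
        fun z => (-1) * (pd f i z * ((f z)⁻¹ * (f z)⁻¹)) := by
      filter_upwards [((hf.smooth y hy).eventually (by norm_num)).mono fun z h =>
        h.differentiableAt (by norm_num), (hf.smooth y hy).continuousAt.eventually_ne (h0 y hy)]
        with z a b
      rw [pd_inv a b]; ring
    have d1 := (contDiffAt_pd (hf.smooth y hy) i).differentiableAt (by norm_num)
    have d2 := (hs y hy).differentiableAt (by norm_num)
    rw [pd_congr e1, pd_mul (differentiableAt_const _) (d1.fun_mul (d2.fun_mul d2)), pd_mul d1 (d2.fun_mul d2),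
      pd_mul d2 d2]
    have e2 : pd (fun _ : E m => (-1 : ℝ)) j y = 0 := by simp [pd]
    rw [e2]
    have b1 : |pd (pd f i) j y * ((f y)⁻¹ * (f y)⁻¹)| ≤ K * (c⁻¹ * c⁻¹) := by
      rw [abs_mul, abs_mul]
      exact mul_le_mul (hf.pd_pd_le y hy i j) (mul_le_mul (hi y hy) (hi y hy) (abs_nonneg _)
        (by positivity)) (by positivity) hK
    have b2 : |pd f i y * (pd (fun z => (f z)⁻¹) j y * (f y)⁻¹)| ≤ K * (K * (c⁻¹ * c⁻¹) * c⁻¹) := by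
      rw [abs_mul, abs_mul]
      exact mul_le_mul (hf.pd_le y hy i) (mul_le_mul (hd y hy j) (hi y hy) (abs_nonneg _)
        (by positivity)) (by positivity) hK
    rw [abs_le] at b1 b2 ⊢
    constructor <;> nlinarith [b1.1, b1.2, b2.1, b2.2]
  refine ⟨c⁻¹ + K * (c⁻¹ * c⁻¹) + 2 * (K * (K * (c⁻¹ * c⁻¹) * c⁻¹)), hs, fun y hy => ?_,
    fun y hy i => ?_, fun y hy i j => ?_⟩
  · have := hi y hy
    have : 0 ≤ K * (c⁻¹ * c⁻¹) := by positivity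
    have : 0 ≤ K * (K * (c⁻¹ * c⁻¹) * c⁻¹) := by positivity
    linarith [hi y hy]
  · have : 0 ≤ c⁻¹ := by positivity
    have : 0 ≤ K * (K * (c⁻¹ * c⁻¹) * c⁻¹) := by positivity
    linarith [hd y hy i]
  · have : 0 ≤ c⁻¹ := by positivity
    linarith [hdd y hy i j]

theorem memLp_of_continuous_surf {μ : Measure (E (m + 1))} [IsFiniteMeasure μ]
    {φ : E (m + 1) → ℝ} (h : Continuous φ) (hc : HasCompactSupport φ) : MemLp φ 2 μ :=
  h.memLp_of_hasCompactSupport hc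

/-- Extension by density of a bounded linear relation to a bounded linear map. -/
theorem exists_clm_of_closure [CompleteSpace Y] (S : Submodule ℝ (X × Y)) {C : ℝ}
    (hC : 0 ≤ C) (hS : ∀ q ∈ S, ‖q.2‖ ≤ C * ‖q.1‖) (H : Submodule ℝ X)
    (hd : ∀ x ∈ H, ∃ q : ℕ → X × Y, (∀ n, q n ∈ S) ∧ Tendsto (fun n => (q n).1) atTop (𝓝 x)) :
    ∃ T : H →L[ℝ] Y, ∀ x : H, ((x : X), T x) ∈ S.topologicalClosure := by
  have hb : ∀ q ∈ S.topologicalClosure, ‖q.2‖ ≤ C * ‖q.1‖ := by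
    have hcl : IsClosed {q : X × Y | ‖q.2‖ ≤ C * ‖q.1‖} :=
      isClosed_le continuous_snd.norm (continuous_const.mul continuous_fst.norm)
    have hsub : (S : Set (X × Y)) ⊆ {q : X × Y | ‖q.2‖ ≤ C * ‖q.1‖} := fun q hq => hS q hq
    intro q hq
    exact closure_minimal hsub hcl hq
  have huniq : ∀ x y y', (x, y) ∈ S.topologicalClosure → (x, y') ∈ S.topologicalClosure → y = y' := by
    intro x y y' h h'
    have := hb _ (S.topologicalClosure.sub_mem h h')
    simp only [Prod.mk_sub_mk, sub_self, norm_zero, mul_zero] at this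
    exact sub_eq_zero.1 (norm_le_zero_iff.1 this)
  have hex : ∀ x : H, ∃ y, ((x : X), y) ∈ S.topologicalClosure := by
    intro x
    obtain ⟨q, hq, hlim⟩ := hd x x.2
    have hcau : CauchySeq fun n => (q n).2 := by
      rw [Metric.cauchySeq_iff]
      intro ε hε
      obtain ⟨N, hN⟩ := Metric.cauchySeq_iff.1 hlim.cauchySeq (ε / (C + 1)) (by positivity)
      refine ⟨N, fun j hj k hk => ?_⟩
      have h1 := hS _ (S.sub_mem (hq j) (hq k))
      have h2 := hN j hj k hk
      rw [dist_eq_norm] at h2 ⊢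
      rw [lt_div_iff₀ (by positivity)] at h2
      simp only [Prod.fst_sub, Prod.snd_sub] at h1
      nlinarith [norm_nonneg ((q j).1 - (q k).1)]
    obtain ⟨y, hy⟩ := cauchySeq_tendsto_of_complete hcau
    exact ⟨y, mem_closure_of_tendsto (hlim.prodMk_nhds hy) (.of_forall hq)⟩
  choose y hy using hex
  let L : H →ₗ[ℝ] Y :=
    { toFun := y
      map_add' := fun a b => huniq _ _ _ (hy (a + b)) (S.topologicalClosure.add_mem (hy a) (hy b))
      map_smul' := fun c a => huniq _ _ _ (hy (c • a)) (S.topologicalClosure.smul_mem c (hy a)) }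
  exact ⟨L.mkContinuous C fun x => hb _ (hy x), hy⟩

/-- `H¹(Ω)`, as the space of pairs `(u, ∇u)`. -/
def H1sub (Ω : Set (E n)) : Submodule ℝ (L2 (vol Ω) × (Fin n → L2 (vol Ω))) where
  carrier := {q | ∀ i, (q.1, q.2 i) ∈ weakPartial Ω i}
  zero_mem' := fun i => (weakPartial Ω i).zero_mem
  add_mem' := fun {_ _} h h' i => (weakPartial Ω i).add_mem (h i) (h' i)
  smul_mem' := fun c _ h i => (weakPartial Ω i).smul_mem c (h i)

/-- Composition with the graph map. -/
theorem exists_pullback {f : E m → ℝ} (hf : Continuous f) (hB : graphOver B f ⊆ frontier Ω) :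
    ∃ P : L2 (surf Ω) →L[ℝ] L2 (vol B), ∀ v, P v =ᵐ[vol B] fun y => v (graphMap f y) := by
  have hle := map_graphMap_le_surf hf hB
  have hm := (continuous_graphMap hf).measurable
  have hae : ∀ {p : E (m + 1) → Prop}, (∀ᵐ x ∂surf Ω, p x) → ∀ᵐ y ∂vol B, p (graphMap f y) :=
    fun h => ae_of_ae_map hm.aemeasurable (h.filter_mono (ae_mono hle))
  have hmem : ∀ v : L2 (surf Ω), MemLp (fun y => v (graphMap f y)) 2 (vol B) := fun v =>
    ((Lp.memLp v).mono_measure hle).comp_of_map hm.aemeasurable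
  let L : L2 (surf Ω) →ₗ[ℝ] L2 (vol B) :=
    { toFun := fun v => (hmem v).toLp
      map_add' := fun v w => Lp.ext (by
        filter_upwards [(hmem (v + w)).coeFn_toLp, (hmem v).coeFn_toLp, (hmem w).coeFn_toLp,
          Lp.coeFn_add ((hmem v).toLp _) ((hmem w).toLp _), hae (Lp.coeFn_add v w)] with y a b c d e
        rw [a, d, Pi.add_apply, b, c, e, Pi.add_apply])
      map_smul' := fun t v => Lp.ext (by
        filter_upwards [(hmem (t • v)).coeFn_toLp, (hmem v).coeFn_toLp,
          Lp.coeFn_smul t ((hmem v).toLp _), hae (Lp.coeFn_smul t v)] with y a b d e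
        rw [a, RingHom.id_apply, d, Pi.smul_apply, b, e, Pi.smul_apply]) }
  refine ⟨L.mkContinuous 1 fun v => ?_, fun v => (hmem v).coeFn_toLp⟩
  rw [one_mul]
  change ‖(hmem v).toLp _‖ ≤ _
  rw [Lp.norm_toLp, Lp.norm_def]
  refine toReal_mono (Lp.eLpNorm_ne_top v) ?_
  have h1 : eLpNorm (fun y => v (graphMap f y)) 2 (vol B) =
      eLpNorm v 2 ((vol B).map (graphMap f)) :=
    (eLpNorm_map_measure ((Lp.aestronglyMeasurable v).mono_measure hle) hm.aemeasurable).symm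
  rw [h1]
  exact eLpNorm_mono_measure _ hle

theorem sobolevNorm_le {x : L2 (vol Ω) × (Fin (m + 1) → L2 (vol Ω))}
    {φ : E (m + 1) → ℝ} (h : x.1 =ᵐ[vol Ω] φ) (h' : ∀ i, x.2 i =ᵐ[vol Ω] pd φ i) :
    sobolevNorm Ω φ ≤ (m + 2 : ℕ) * ‖x‖ₑ := by
  have h1 : eLpNorm φ 2 (vol Ω) ≤ ‖x‖ₑ := by
    rw [← eLpNorm_congr_ae h, ← Lp.enorm_def, ← ofReal_norm, ← ofReal_norm]
    exact ofReal_le_ofReal (norm_fst_le x)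
  have h2 : ∀ i, eLpNorm (pd φ i) 2 (vol Ω) ≤ ‖x‖ₑ := fun i => by
    rw [← eLpNorm_congr_ae (h' i), ← Lp.enorm_def, ← ofReal_norm, ← ofReal_norm]
    exact ofReal_le_ofReal ((norm_le_pi_norm x.2 i).trans (norm_snd_le x))
  unfold sobolevNorm
  refine (add_le_add h1 (sum_le_sum fun i _ => h2 i)).trans (le_of_eq ?_)
  simp
  ring

theorem exists_smooth_approx (h : HasC11Boundary Ω) (hΩ : IsOpen Ω)
    (hb : IsBounded Ω) {x : L2 (vol Ω) × (Fin (m + 1) → L2 (vol Ω))}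
    (hx : x ∈ H1sub Ω) :
    ∃ (φ : ℕ → E (m + 1) → ℝ) (z : ℕ → L2 (vol Ω) × (Fin (m + 1) → L2 (vol Ω))),
      (∀ j, ContDiff ℝ (⊤ : ℕ∞) (φ j) ∧ HasCompactSupport (φ j) ∧ (z j).1 =ᵐ[vol Ω] φ j ∧
        ∀ i, (z j).2 i =ᵐ[vol Ω] pd (φ j) i) ∧ Tendsto z atTop (𝓝 x) := by
  obtain ⟨M⟩ := (h.hasCones hΩ).nonempty_mollifiers hΩ hb
  have hs := fun j => Mollifiers.contDiff_J hΩ.measurableSet j M.adapted_χ x.1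
  have hc := fun j => Mollifiers.hasCompactSupport_J j M.adapted_χ x.1
  have m1 : ∀ j, MemLp (M.J j M.χ x.1) 2 (vol Ω) := fun j =>
    (hs j).continuous.memLp_of_hasCompactSupport (hc j)
  have m2 : ∀ j i, MemLp (pd (M.J j M.χ x.1) i) 2 (vol Ω) := fun j i =>
    (pd_continuous (hs j) i).memLp_of_hasCompactSupport (pd_hasCompactSupport (hc j) i)
  refine ⟨fun j => M.J j M.χ x.1, fun j => ((m1 j).toLp _, fun i => (m2 j i).toLp _),
    fun j => ⟨hs j, hc j, (m1 j).coeFn_toLp, fun i => (m2 j i).coeFn_toLp⟩, ?_⟩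
  have tl : ∀ (F : ℕ → E (m + 1) → ℝ) (hF : ∀ j, MemLp (F j) 2 (vol Ω)) (u : L2 (vol Ω)),
      Tendsto (fun j => eLpNorm (F j - (u : E (m + 1) → ℝ)) 2 (vol Ω)) atTop (𝓝 0) →
      Tendsto (fun j => (hF j).toLp (F j)) atTop (𝓝 u) := by
    intro F hF u hu
    have := (Lp.tendsto_Lp_iff_tendsto_eLpNorm'' F hF u (Lp.memLp u)).2 hu
    rwa [Lp.toLp_coeFn] at this
  have t1 := tl _ m1 x.1 (Mollifiers.tendsto_J_one (M := M) hΩ x.1)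
  have t2 := fun i => tl _ (fun j => m2 j i) (x.2 i) (Mollifiers.tendsto_pd_J (M := M) hΩ (hx i))
  exact t1.prodMk_nhds (tendsto_pi_nhds.2 t2)

/-- The trace on `∂Ω` and its restriction to a graph in `∂Ω`, as an element of `H^½`. -/
theorem exists_traces (h : HasC11Boundary Ω) (hΩ : IsOpen Ω)
    (hb : IsBounded Ω) (hBm : MeasurableSet B) {l : E m → ℝ}
    (hB : graphOver B l ⊆ frontier Ω) {L : NNReal} (hl : LipschitzWith L l) :
    ∃ (tr : H1sub Ω →L[ℝ] L2 (surf Ω)) (trN : H1sub Ω →L[ℝ] Hs m (1 / 2) B),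
      (∀ x, (x.1.1, x.1.2, tr x) ∈ traceRel Ω) ∧
      ∀ x, Hs.toL2 m (1 / 2) B (trN x) =ᵐ[vol B] fun y => tr x (graphMap l y) := by
  have := isFiniteMeasure_surf h hΩ hb
  obtain ⟨P, hP⟩ := exists_pullback hl.continuous hB
  obtain ⟨C₁, hC₁, hs⟩ := exists_surf_bound h hΩ hb
  obtain ⟨C₂, hC₂, hg⟩ := exists_graph_bound h hΩ hb hl
  let X := L2 (vol Ω) × (Fin (m + 1) → L2 (vol Ω))
  let Y := L2 (surf Ω) × Hs m (1 / 2) B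
  let toTriple : X × Y →L[ℝ] L2 (vol Ω) × (Fin (m + 1) → L2 (vol Ω)) × L2 (surf Ω) :=
    ((fst ℝ _ _).comp (fst ℝ X Y)).prod
      (((snd ℝ _ _).comp (fst ℝ X Y)).prod
        ((fst ℝ _ _).comp (snd ℝ X Y)))
  let diff : X × Y →L[ℝ] L2 (vol B) := (Hs.toL2 m (1 / 2) B).comp ((snd ℝ _ _).comp (snd ℝ X Y))
      - P.comp ((fst ℝ _ _).comp (snd ℝ X Y))
  let S : Submodule ℝ (X × Y) :=
    (smoothTrace Ω).comap toTriple.toLinearMap ⊓ LinearMap.ker diff.toLinearMap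
  have hgraph : ∀ y ∈ B, graphMap l y ∈ frontier Ω := fun y hy => hB ⟨y, hy, rfl⟩
  have hPφ : ∀ {v : L2 (surf Ω)} {φ : E (m + 1) → ℝ}, v =ᵐ[surf Ω] φ →
      P v =ᵐ[vol B] fun y => φ (graphMap l y) := by
    intro v φ hv
    have hm := (continuous_graphMap hl.continuous).measurable
    have h2 : ∀ᵐ y ∂vol B, v (graphMap l y) = φ (graphMap l y) := ae_of_ae_map hm.aemeasurable
        (hv.filter_mono (ae_mono (map_graphMap_le_surf hl.continuous hB)))
    exact (hP v).trans h2
  -- the half order norm of the trace of a smooth function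
  have key : ∀ (x : X) (v : L2 (surf Ω)) (φ : E (m + 1) → ℝ), ContDiff ℝ (⊤ : ℕ∞) φ →
      x.1 =ᵐ[vol Ω] φ → (∀ i, x.2 i =ᵐ[vol Ω] pd φ i) → v =ᵐ[surf Ω] φ →
      ∃ w : Hs m (1 / 2) B, Hs.toL2 m (1 / 2) B w = P v ∧
        ‖w‖ₑ ≤ (1 + m) * (C₂ * ((m + 2 : ℕ) * ‖x‖ₑ)) := by
    intro x v φ hφ h1 h2 h3
    obtain ⟨u, huc, hu, hun, hug⟩ := hg φ hφ
    have hle := sobolevNorm_le h1 h2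
    have hfin : C₂ * sobolevNorm Ω φ ≠ ∞ := mul_ne_top hC₂ (ne_top_of_le_ne_top
        (mul_ne_top (ENNReal.natCast_ne_top _) enorm_ne_top) hle)
    have hum : MemLp u 2 volume := ⟨huc.aestronglyMeasurable, hun.trans_lt hfin.lt_top⟩
    obtain ⟨q, hq, hqn⟩ := exists_HsR_half (hum.toLp u) hfin (fun i => by
      rw [gagliardo_congr hum.coeFn_toLp]
      exact hug _ (by simp))
    refine ⟨Hs.mk q, ?_, ?_⟩
    · rw [Hs.toL2_mk]
      refine Lp.ext ?_
      have e1 : q.1.1 =ᵐ[vol B] u := by rw [hq]; exact ae_restrict_of_ae hum.coeFn_toLp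
      filter_upwards [restrict_ae (B := B) q, e1, hPφ h3, ae_restrict_mem hBm] with y a b c hy
      rw [a, b, c, hu y (frontier_subset_closure (hgraph y hy))]
    · have e2 : ‖(Hs.mk q : Hs m (1 / 2) B)‖ₑ ≤ ‖q‖ₑ := by
        rw [← ofReal_norm, ← ofReal_norm]
        exact ofReal_le_ofReal (Hs.norm_mk_le q)
      refine e2.trans (hqn.trans ?_)
      rw [Lp.enorm_toLp]
      refine (add_le_add hun le_rfl).trans ?_
      rw [← one_add_mul]
      gcongr
  have hbound : ∀ q ∈ S, ‖q.2‖ ≤ ((C₁ + (1 + m) * C₂) * (m + 2 : ℕ)).toReal * ‖q.1‖ := by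
    rintro ⟨x, v, w⟩ ⟨⟨φ, hφ, -, h1, h2, h3⟩, hd⟩
    have hd' : Hs.toL2 m (1 / 2) B w = P v := sub_eq_zero.1 hd
    change x.1 =ᵐ[vol Ω] φ at h1
    change ∀ i, x.2 i =ᵐ[vol Ω] pd φ i at h2
    change v =ᵐ[surf Ω] φ at h3
    obtain ⟨w', hw', hn⟩ := key x v φ hφ h1 h2 h3
    have : w = w' := Hs.toL2_injective _ _ _ (hd'.trans hw'.symm)
    subst this
    have hv : ‖v‖ₑ ≤ C₁ * ((m + 2 : ℕ) * ‖x‖ₑ) := by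
      rw [Lp.enorm_def, eLpNorm_congr_ae h3]
      exact (hs φ hφ).trans (mul_le_mul_right (sobolevNorm_le h1 h2) _)
    have hfin : (C₁ + (1 + m) * C₂) * (m + 2 : ℕ) ≠ ∞ := by finiteness
    have e : ‖((v, w) : Y)‖ₑ ≤ (C₁ + (1 + m) * C₂) * (m + 2 : ℕ) * ‖x‖ₑ := by
      have e1 : ‖((v, w) : Y)‖ₑ = max ‖v‖ₑ ‖w‖ₑ := by
        rw [← ofReal_norm, ← ofReal_norm, ← ofReal_norm, Prod.norm_mk, ENNReal.ofReal_max]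
      rw [e1]
      refine max_le (hv.trans ?_) (hn.trans ?_)
      · rw [mul_assoc]; exact mul_le_mul_left le_self_add _
      · rw [mul_assoc, ← mul_assoc (1 + (m : ℝ≥0∞))]; exact mul_le_mul_left le_add_self _
    have := toReal_mono (mul_ne_top hfin enorm_ne_top) e
    rwa [toReal_mul, toReal_enorm, toReal_enorm] at this
  obtain ⟨T, hT⟩ := exists_clm_of_closure S ENNReal.toReal_nonneg hbound (H1sub Ω) (by
    intro x hx
    obtain ⟨φ, z, hφ, hz⟩ := exists_smooth_approx h hΩ hb hx
    have hv : ∀ j, MemLp (φ j) 2 (surf Ω) := fun j =>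
      memLp_of_continuous_surf (hφ j).1.continuous (hφ j).2.1
    have hw := fun j => key (z j) ((hv j).toLp _) (φ j) (hφ j).1 (hφ j).2.2.1 (hφ j).2.2.2
      (hv j).coeFn_toLp
    choose w hw hwn using hw
    refine ⟨fun j => (z j, (hv j).toLp _, w j), fun j => ⟨⟨φ j, (hφ j).1, (hφ j).2.1,
      (hφ j).2.2.1, (hφ j).2.2.2, (hv j).coeFn_toLp⟩, ?_⟩, hz⟩
    exact sub_eq_zero.2 (hw j))
  refine ⟨(fst ℝ _ _).comp T, (snd ℝ _ _).comp T, fun x => ?_, fun x => ?_⟩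
  · have h1 : toTriple ((x : X), T x) ∈ traceRel Ω := by
      have h2 : MapsTo toTriple (S : Set (X × Y)) (smoothTrace Ω) := fun q hq => hq.1
      exact map_mem_closure toTriple.continuous (hT x) h2
    exact h1
  · have h1 : diff ((x : X), T x) = 0 := by
      have hcl : IsClosed {q : X × Y | diff q = 0} := isClosed_eq diff.continuous continuous_const
      have hsub : (S : Set (X × Y)) ⊆ {q : X × Y | diff q = 0} := fun q hq => hq.2
      exact closure_minimal hsub hcl (hT x)
    have h2 : Hs.toL2 m (1 / 2) B (T x).2 = P (T x).1 := sub_eq_zero.1 h1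
    change Hs.toL2 m (1 / 2) B (T x).2 =ᵐ[vol B] _
    rw [h2]
    exact hP _

/-! ### Completeness and bounded maps on `H²(Ω)` -/

theorem exists_clm_integral_mul (Ω : Set (E n)) {f : E n → ℝ} (hf : Continuous f)
    (hc : HasCompactSupport f) : ∃ Λ : L2 (vol Ω) →L[ℝ] ℝ, ∀ u, Λ u = ∫ x in Ω, u x * f x := by
  have hm : MemLp f 2 (vol Ω) := hf.memLp_of_hasCompactSupport hc
  refine ⟨innerSL ℝ (hm.toLp f), fun u => ?_⟩
  rw [innerSL_apply_apply, L2.inner_def]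
  refine integral_congr_ae ?_
  filter_upwards [hm.coeFn_toLp] with x hx
  rw [hx]
  simp

theorem isClosed_weakPartial (Ω : Set (E n)) (i : Fin n) :
    IsClosed (weakPartial Ω i : Set (L2 (vol Ω) × L2 (vol Ω))) := by
  change IsClosed {q : L2 (vol Ω) × L2 (vol Ω) | ∀ φ : E n → ℝ, ContDiff ℝ (⊤ : ℕ∞) φ →
    HasCompactSupport φ → tsupport φ ⊆ Ω → ∫ x in Ω, q.1 x * pd φ i x = - ∫ x in Ω, q.2 x * φ x}
  simp only [ofPred_forall]
  refine isClosed_iInter fun φ => isClosed_iInter fun h1 => isClosed_iInter fun h2 =>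
    isClosed_iInter fun _ => ?_
  obtain ⟨Λ, hΛ⟩ := exists_clm_integral_mul Ω (pd_continuous h1 i) (pd_hasCompactSupport h2 i)
  obtain ⟨Ψ, hΨ⟩ := exists_clm_integral_mul Ω h1.continuous h2
  simp only [← hΛ, ← hΨ]
  exact isClosed_eq (Λ.continuous.comp continuous_fst) (Ψ.continuous.comp continuous_snd).neg

instance (Ω : Set (E n)) : CompleteSpace (H2 Ω) := by
  have h : IsClosed (H2sub Ω).carrier := by
    have e : (H2sub Ω).carrier = (⋂ i, (fun u => (u.1, u.2.1 i)) ⁻¹' (weakPartial Ω i : Set _)) ∩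
        ⋂ i, ⋂ j, (fun u => (u.2.1 i, u.2.2 i j)) ⁻¹' (weakPartial Ω j : Set _) := by
      ext u
      simp only [mem_inter_iff, mem_iInter]
      exact Iff.rfl
    rw [e]
    refine (isClosed_iInter fun i => (isClosed_weakPartial Ω i).preimage (by fun_prop)).inter
      (isClosed_iInter fun i => isClosed_iInter fun j =>
        (isClosed_weakPartial Ω j).preimage (by fun_prop))
  exact IsClosed.completeSpace_coe (s := (H2sub Ω).carrier) (hs := h)

instance (Ω Γ : Set (E (m + 1))) : CompleteSpace (Hd Ω Γ) := by
  have h : IsClosed (H2s Ω Γ).carrier := by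
    have e : (H2s Ω Γ).carrier = (fun u => (u.1, u.2.1)) ⁻¹' (H1s Ω Γ).carrier ∩
        ⋂ i, (fun u => (u.2.1 i, u.2.2 i)) ⁻¹' (H1s Ω Γ).carrier := by
      ext u
      simp only [mem_inter_iff, mem_iInter]
      exact Iff.rfl
    have hc := (smoothSurf Ω Γ univ).isClosed_topologicalClosure
    rw [e]
    exact (hc.preimage (by fun_prop)).inter
      (isClosed_iInter fun i => hc.preimage (by fun_prop))
  have h1 : CompleteSpace (H2s Ω Γ) := IsClosed.completeSpace_coe (s := (H2s Ω Γ).carrier) (hs := h)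
  have h2 := (hingedCore Ω Γ).isClosed_topologicalClosure
  exact h2.completeSpace_coe

theorem weakPartial_zero_left {Ω : Set (E n)} (hΩ : IsOpen Ω) {i : Fin n}
    {g : L2 (vol Ω)} (h : ((0 : L2 (vol Ω)), g) ∈ weakPartial Ω i) : g = 0 := by
  refine Lp.ext (EventuallyEq.trans ?_ (Lp.coeFn_zero ℝ 2 (vol Ω)).symm)
  refine (ae_restrict_iff' hΩ.measurableSet).2 ?_
  refine hΩ.ae_eq_zero_of_integral_contDiff_smul_eq_zero ?_ fun φ h1 h2 h3 => ?_
  · have : LocallyIntegrable g (vol Ω) := (Lp.memLp g).locallyIntegrable one_le_two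
    exact (locallyIntegrableOn_of_locallyIntegrable_restrict this)
  · have e := h φ h1 h2 h3
    have e0 : ∫ x in Ω, (0 : L2 (vol Ω)) x * pd φ i x = 0 := integral_eq_zero_of_ae (by
        filter_upwards [Lp.coeFn_zero ℝ 2 (vol Ω)] with x hx; rw [hx]; simp)
    change ∫ x in Ω, (0 : L2 (vol Ω)) x * pd φ i x = -∫ x in Ω, g x * φ x at e
    rw [e0, eq_comm, neg_eq_zero] at e
    rw [← e, ← setIntegral_eq_integral_of_forall_compl_eq_zero (s := Ω)]
    · exact integral_congr_ae (.of_forall fun x => by simp [mul_comm])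
    · intro x hx
      rw [image_eq_zero_of_notMem_tsupport fun h => hx (h3 h), zero_smul]

theorem H2.toL2_injective {Ω : Set (E n)} (hΩ : IsOpen Ω) : Function.Injective (H2.toL2 Ω) := by
  refine (injective_iff_map_eq_zero _).2 fun u hu => ?_
  have h0 : u.1.1 = 0 := hu
  have h1 : ∀ i, u.1.2.1 i = 0 := fun i => weakPartial_zero_left hΩ (h0 ▸ u.2.1 i)
  have h2 : ∀ i j, u.1.2.2 i j = 0 := fun i j => weakPartial_zero_left hΩ (h1 i ▸ u.2.2 i j)
  exact Subtype.ext (Prod.ext h0 (Prod.ext (funext h1) (funext fun i => funext (h2 i))))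

/-- `∂ᵢ : H²(Ω) → L²(Ω)`. -/
def H2.gradL (Ω : Set (E n)) (i : Fin n) : H2 Ω →L[ℝ] L2 (vol Ω) :=
  (ContinuousLinearMap.proj i).comp ((fst ℝ _ _).comp
    ((snd ℝ _ _).comp (H2sub Ω).subtypeL))

/-- `∂ⱼ ∂ᵢ : H²(Ω) → L²(Ω)`. -/
def H2.hessL (Ω : Set (E n)) (i j : Fin n) : H2 Ω →L[ℝ] L2 (vol Ω) :=
  (ContinuousLinearMap.proj (R := ℝ) (φ := fun _ : Fin n => L2 (vol Ω)) j).comp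
    ((ContinuousLinearMap.proj (R := ℝ) (φ := fun _ : Fin n => Fin n → L2 (vol Ω)) i).comp
      ((snd ℝ _ _).comp
        ((snd ℝ _ _).comp (H2sub Ω).subtypeL)))

/-- `u ↦ (u, ∇u)`, from `H²(Ω)` to `H¹(Ω)`. -/
def H2.toH1 (Ω : Set (E n)) : H2 Ω →L[ℝ] H1sub Ω := ContinuousLinearMap.codRestrict
    (((fst ℝ _ _).comp (H2sub Ω).subtypeL).prod
      ((fst ℝ _ _).comp ((snd ℝ _ _).comp
        (H2sub Ω).subtypeL))) (H1sub Ω) fun u => u.2.1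

/-- `u ↦ (∂ᵢ u, ∇∂ᵢ u)`, from `H²(Ω)` to `H¹(Ω)`. -/
def H2.gradH1 (Ω : Set (E n)) (i : Fin n) : H2 Ω →L[ℝ] H1sub Ω := ContinuousLinearMap.codRestrict
    ((H2.gradL Ω i).prod
      ((ContinuousLinearMap.proj (R := ℝ) (φ := fun _ : Fin n => Fin n → L2 (vol Ω)) i).comp
        ((snd ℝ _ _).comp
          ((snd ℝ _ _).comp (H2sub Ω).subtypeL)))) (H1sub Ω)
    fun u => u.2.2 i

/-- Traces of `u` and `∂_ν u` on `Γ ⊆ ∂Ω`, and of `∇u` on a graph in `∂Ω`, for `u ∈ H²(Ω)`. -/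
theorem exists_traces_H2 (h : HasC11Boundary Ω) (hΩ : IsOpen Ω)
    (hb : IsBounded Ω) (Γ : Set (E (m + 1))) (hBm : MeasurableSet B)
    {l : E m → ℝ} (hB : graphOver B l ⊆ frontier Ω) {L : NNReal} (hl : LipschitzWith L l) :
    ∃ (trp dn : H2 Ω →L[ℝ] L2s Ω Γ) (trN : Fin (m + 1) → H2 Ω →L[ℝ] Hs m (1 / 2) B),
      (∀ u, ∃ v, HasTrace u v ∧ trp u =ᵐ[(surf Ω).restrict Γ] v) ∧
      (∀ u, ∃ v, HasNormalDeriv u v ∧ dn u =ᵐ[(surf Ω).restrict Γ] v) ∧ ∀ u, ∃ τ, HasGradTrace u τ ∧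
        ∀ i, Hs.toL2 m (1 / 2) B (trN i u) =ᵐ[vol B] fun y => τ i (pt y (l y)) := by
  obtain ⟨tr, trN, h1, h2⟩ := exists_traces h hΩ hb hBm hB hl
  let R := LpToLpRestrictCLM (E (m + 1)) ℝ ℝ (surf Ω) 2 Γ
  have hν : ∀ i, MemLp (fun x => normal Ω x i) ∞ (surf Ω) := fun i =>
    memLp_top_of_bound (aestronglyMeasurable_normal h hΩ i) 1 (.of_forall fun x =>
      (PiLp.norm_apply_le (normal Ω x) i).trans (norm_normal_le Ω x))
  let D : H2 Ω →L[ℝ] L2 (surf Ω) :=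
    ∑ i, (mulL (surf Ω) ((hν i).toLp _)).comp (tr.comp (H2.gradH1 Ω i))
  refine ⟨R.comp (tr.comp (H2.toH1 Ω)), R.comp D, fun i => trN.comp (H2.gradH1 Ω i),
    fun u => ⟨tr (H2.toH1 Ω u), h1 (H2.toH1 Ω u), ?_⟩, fun u => ⟨D u, ⟨fun i => tr (H2.gradH1 Ω i u),
      fun i => h1 (H2.gradH1 Ω i u), ?_⟩, ?_⟩, fun u => ⟨fun i => tr (H2.gradH1 Ω i u), fun i => h1 (H2.gradH1 Ω i u),
      fun i => h2 (H2.gradH1 Ω i u)⟩⟩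
  · exact LpToLpRestrictCLM_coeFn ℝ Γ _
  · have e : D u = ∑ i, mulL (surf Ω) ((hν i).toLp _) (tr (H2.gradH1 Ω i u)) := by
      simp [D]
    rw [e]
    have e1 : ∀ᵐ x ∂surf Ω, ∀ i, mulL (surf Ω) ((hν i).toLp _) (tr (H2.gradH1 Ω i u)) x =
        normal Ω x i * tr (H2.gradH1 Ω i u) x := ae_all_iff.2 fun i => by
      filter_upwards [mulL_ae ((hν i).toLp _) (tr (H2.gradH1 Ω i u)), (hν i).coeFn_toLp]
        with x a b
      rw [a, b]
    filter_upwards [Lp.coeFn_finsetSum (Finset.univ) fun i =>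
      mulL (surf Ω) ((hν i).toLp _) (tr (H2.gradH1 Ω i u)), e1] with x a b
    rw [a]
    simp only [Finset.sum_apply, b]
  · exact LpToLpRestrictCLM_coeFn ℝ Γ _

/-! ### Wave functions -/

theorem mem_weakTime_of_comp [CompleteSpace X] [CompleteSpace Y]
    {ι : X →L[ℝ] Y} (hι : Function.Injective ι) {u v : Lp X 2 (tim T)}
    (h : (ι.compLpL 2 (tim T) u, ι.compLpL 2 (tim T) v) ∈ weakTime Y T 2) :
    (u, v) ∈ weakTime X T 2 := by
  have key : ∀ (w : Lp X 2 (tim T)) (f : ℝ → ℝ), Continuous f → HasCompactSupport f →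
      ∫ t in Ioo 0 T, f t • ι.compLpL 2 (tim T) w t = ι (∫ t in Ioo 0 T, f t • w t) := by
    intro w f hf hc
    rw [← ι.integral_comp_comm (integrable_smul_time w hf hc)]
    refine integral_congr_ae ?_
    filter_upwards [ι.coeFn_compLpL w] with t ht
    rw [ht, map_smul]
  intro φ h1 h2 h3
  have e := h φ h1 h2 h3
  rw [key u _ (h1.continuous_deriv (by simp)) h2.deriv, key v _ h1.continuous h2, ← map_neg] at e
  exact hι e

/-- A wave function is bounded in time with values in `H²(Ω)`, and its time derivative with values
in `L²(Ω)`. -/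
theorem exists_waveSpace_top (hΩ : IsOpen Ω) (hT : 0 < T) :
    ∃ (L : waveSpace Ω T →L[ℝ] Lp (H2 Ω) ∞ (tim T))
      (L' : waveSpace Ω T →L[ℝ] Lp (L2 (vol Ω)) ∞ (tim T)),
      (∀ q, L q =ᵐ[tim T] q.1.1) ∧ ∀ q, L' q =ᵐ[tim T] fun t => H2.toL2 Ω (q.1.2.1 t) := by
  obtain ⟨F, hF⟩ := exists_embedding_top (X := H2 Ω) hT
  obtain ⟨F', hF'⟩ := exists_embedding_top (X := L2 (vol Ω)) hT
  let S := (waveSpace Ω T).subtypeL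
  let p := (fst ℝ _ _).comp S
  let p' := (fst ℝ _ _).comp ((snd ℝ _ _).comp S)
  let p'' := (snd ℝ _ _).comp ((snd ℝ _ _).comp S)
  let A : waveSpace Ω T →L[ℝ] weakTime (H2 Ω) T 2 :=
    ContinuousLinearMap.codRestrict (p.prod p') _ fun q =>
      mem_weakTime_of_comp (H2.toL2_injective hΩ) q.2.1
  let A' : waveSpace Ω T →L[ℝ] weakTime (L2 (vol Ω)) T 2 :=
    ContinuousLinearMap.codRestrict ((((H2.toL2 Ω).compLpL 2 (tim T)).comp p').prod p'') _ fun q =>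
      q.2.2
  exact ⟨F.comp A, F'.comp A', fun q => hF (A q), fun q =>
    (hF' (A' q)).trans ((H2.toL2 Ω).coeFn_compLpL _)⟩

/-! ### Multiplication operators -/

section Mul

variable {μ : Measure (E n)}
  {ι : V →L[ℝ] L2 μ}

/-- The operator `T` is multiplication by the function `a`. -/
def IsMul (ι : V →L[ℝ] L2 μ) (a : E n → ℝ) (T : V →L[ℝ] V) : Prop :=
  ∀ v, ι (T v) =ᵐ[μ] fun x => a x * ι v x

theorem IsMul.congr {a b : E n → ℝ} {T : V →L[ℝ] V} (h : IsMul ι a T) (hab : a =ᵐ[μ] b) :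
    IsMul ι b T := fun v => by
  filter_upwards [h v, hab] with x h1 h2
  rw [h1, h2]

theorem IsMul.unique (hι : Function.Injective ι) {a b : E n → ℝ} {T S : V →L[ℝ] V}
    (h : IsMul ι a T) (h' : IsMul ι b S) (hab : a =ᵐ[μ] b) : T = S := by
  ext v
  refine hι (Lp.ext ?_)
  filter_upwards [h v, h' v, hab] with x h1 h2 h3
  rw [h1, h2, h3]

theorem IsMul.one : IsMul ι (fun _ => 1) 1 := fun v => Eventually.of_forall fun x => by simp

theorem IsMul.add {a b : E n → ℝ} {T S : V →L[ℝ] V} (h : IsMul ι a T) (h' : IsMul ι b S) :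
    IsMul ι (fun x => a x + b x) (T + S) := fun v => by
  have e : ι ((T + S) v) = ι (T v) + ι (S v) := map_add ι _ _
  rw [e]
  filter_upwards [h v, h' v, Lp.coeFn_add (ι (T v)) (ι (S v))] with x h1 h2 h3
  rw [h3, Pi.add_apply, h1, h2, add_mul]

theorem IsMul.smul (c : ℝ) {a : E n → ℝ} {T : V →L[ℝ] V} (h : IsMul ι a T) :
    IsMul ι (fun x => c * a x) (c • T) := fun v => by
  have e : ι ((c • T) v) = c • ι (T v) := map_smul ι _ _
  rw [e]
  filter_upwards [h v, Lp.coeFn_smul c (ι (T v))] with x h1 h3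
  rw [h3, Pi.smul_apply, h1, smul_eq_mul, mul_assoc]

theorem IsMul.neg {a : E n → ℝ} {T : V →L[ℝ] V} (h : IsMul ι a T) :
    IsMul ι (fun x => -a x) (-T) := by
  have := h.smul (-1)
  simpa using this

theorem IsMul.sub {a b : E n → ℝ} {T S : V →L[ℝ] V} (h : IsMul ι a T) (h' : IsMul ι b S) :
    IsMul ι (fun x => a x - b x) (T - S) := by
  simpa only [sub_eq_add_neg] using h.add h'.neg

theorem IsMul.mul {a b : E n → ℝ} {T S : V →L[ℝ] V} (h : IsMul ι a T) (h' : IsMul ι b S) :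
    IsMul ι (fun x => a x * b x) (T * S) := fun v => by
  filter_upwards [h (S v), h' v] with x h1 h2
  rw [mul_apply_eq_comp, h1, h2, mul_assoc]

theorem IsMul.sum {κ : Type*} (s : Finset κ) {a : κ → E n → ℝ} {T : κ → V →L[ℝ] V}
    (h : ∀ i, IsMul ι (a i) (T i)) : IsMul ι (fun x => ∑ i ∈ s, a i x) (∑ i ∈ s, T i) := by
  classical
  induction s using Finset.induction_on with
  | empty =>
    intro v
    simp only [Finset.sum_empty, zero_mul]
    have : ι ((0 : V →L[ℝ] V) v) = 0 := by simp
    rw [this]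
    exact Lp.coeFn_zero _ _ _
  | insert i s hi ih =>
    simp only [Finset.sum_insert hi]
    exact (h i).add ih

theorem IsMul.isUnit (hι : Function.Injective ι) {a b : E n → ℝ} {T S : V →L[ℝ] V}
    (h : IsMul ι a T) (h' : IsMul ι b S) (hab : ∀ᵐ x ∂μ, a x * b x = 1) :
    IsUnit T ∧ Ring.inverse T = S := by
  have h1 : T * S = 1 := (h.mul h').unique hι IsMul.one hab
  have h2 : S * T = 1 := (h'.mul h).unique hι IsMul.one
    (hab.mono fun x hx => (mul_comm _ _).trans hx)
  exact ⟨⟨⟨T, S, h1, h2⟩, rfl⟩, Ring.inverse_unit ⟨T, S, h1, h2⟩⟩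

/-- A bounded linear family of multiplication operators. -/
theorem exists_clm_isMul (hι : Function.Injective ι) (φ : X → E n → ℝ) (C : ℝ)
    (hadd : ∀ x x', φ (x + x') =ᵐ[μ] fun y => φ x y + φ x' y)
    (hsmul : ∀ (c : ℝ) x, φ (c • x) =ᵐ[μ] fun y => c * φ x y)
    (h : ∀ x, ∃ T : V →L[ℝ] V, IsMul ι (φ x) T ∧ ‖T‖ ≤ C * ‖x‖) :
    ∃ M : X →L[ℝ] V →L[ℝ] V, ∀ x, IsMul ι (φ x) (M x) := by
  choose T hT hn using h
  let L : X →ₗ[ℝ] V →L[ℝ] V :=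
    { toFun := T
      map_add' := fun x x' => (hT _).unique hι ((hT x).add (hT x')) (hadd x x')
      map_smul' := fun c x => (hT _).unique hι ((hT x).smul c) (hsmul c x) }
  exact ⟨L.mkContinuous C hn, hT⟩

theorem exists_isMul_L2 {a : E n → ℝ} (ha : AEStronglyMeasurable a μ) {C : ℝ} (hC : 0 ≤ C)
    (h : ∀ᵐ x ∂μ, |a x| ≤ C) :
    ∃ T : L2 μ →L[ℝ] L2 μ, IsMul (ContinuousLinearMap.id ℝ (L2 μ)) a T ∧ ‖T‖ ≤ C := by
  have hm : MemLp a ∞ μ := memLp_top_of_bound ha C h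
  have hT : IsMul (ContinuousLinearMap.id ℝ (L2 μ)) a (mulL μ (hm.toLp a)) := fun v => by
    filter_upwards [mulL_ae (hm.toLp a) v, hm.coeFn_toLp] with x h1 h2
    rw [ContinuousLinearMap.id_apply, h1, h2, ContinuousLinearMap.id_apply]
  refine ⟨_, hT, opNorm_le_bound _ hC fun v => ?_⟩
  refine Lp.norm_le_mul_norm_of_ae_le_mul ?_
  filter_upwards [hT v, h] with x h1 h2
  change mulL μ (hm.toLp a) v x = a x * v x at h1
  rw [h1, norm_mul]
  exact mul_le_mul_of_nonneg_right h2 (norm_nonneg _)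

end Mul

/-! ### The ratio of two shapes -/

section Ratio

variable {B : Set (E m)}

theorem forall_le_of_ae_le (hB : IsOpen B) {f : E m → ℝ} (hf : Continuous f) {c : ℝ}
    (h : ∀ᵐ y ∂vol B, c ≤ f y) : ∀ y ∈ B, c ≤ f y := by
  intro y hy
  by_contra! hlt
  have hO : IsOpen (B ∩ {z | f z < c}) := hB.inter (isOpen_lt hf continuous_const)
  have h1 := (ae_restrict_iff' hB.measurableSet).1 h
  have h2 : volume (B ∩ {z | f z < c}) = 0 := by
    rw [← nonpos_iff_eq_zero, ← (ae_iff.1 h1)]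
    refine measure_mono fun z hz => ?_
    simp only [mem_ofPred_eq, Classical.not_imp, not_le]
    exact hz
  exact (hO.measure_pos volume ⟨y, hy, hlt⟩).ne' h2

theorem exists_le_of_nondegenerate (hB : IsOpen B) {f : E m → ℝ} (hf : Continuous f)
    (h0 : ∀ y ∈ B, 0 < f y) (h : eLpNorm (fun y => 1 / f y) ∞ (vol B) < ∞) :
    ∃ c > 0, ∀ y ∈ B, c ≤ f y := by
  obtain ⟨C, hC⟩ : ∃ C : ℝ, ∀ᵐ y ∂vol B, 1 / f y ≤ C := by
    refine ⟨(eLpNorm (fun y => 1 / f y) ∞ (vol B)).toReal, ?_⟩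
    have := enorm_ae_le_eLpNormEssSup (fun y => 1 / f y) (vol B)
    filter_upwards [this] with y hy
    rw [← eLpNorm_exponent_top] at hy
    have h2 := toReal_mono h.ne hy
    rw [toReal_enorm] at h2
    exact (le_abs_self _).trans h2
  have hle : ∀ᵐ y ∂vol B, (max C 1)⁻¹ ≤ f y := by
    filter_upwards [hC, ae_restrict_mem hB.measurableSet] with y hy hyB
    have h1 := h0 y hyB
    rw [inv_le_comm₀ (by positivity) h1, ← one_div]
    exact hy.trans (le_max_left _ _)
  exact ⟨(max C 1)⁻¹, by positivity, forall_le_of_ae_le hB hf hle⟩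

theorem Hs.exists_bddJet_fn (hs : (m : ℝ) + 4 < 2 * s) (hB : IsOpen B) :
    ∃ K, 0 ≤ K ∧ ∀ v : Hs m s B, BddJet B v.fn (K * ‖v‖) := by
  obtain ⟨K, hK, h⟩ := Hs.exists_bddC2 m hs B
  refine ⟨K, hK, fun v => ?_⟩
  obtain ⟨f, hf, hr⟩ := h v
  exact (hf.bddJet B).congr fun y hy => Hs.fn_eventuallyEq hs hB hf.contDiff.continuous hr hy

theorem exists_bddJet_ratio (hs : (m : ℝ) + 4 < 2 * s) (hB : IsOpen B) (l0 : Hs m s B) {c : ℝ}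
    (hc : 0 < c) (h0 : ∀ y ∈ B, c ≤ l0.fn y) :
    ∃ K, 0 ≤ K ∧ ∀ l : Hs m s B, BddJet B (fun y => l.fn y / l0.fn y) (K * ‖l‖) := by
  obtain ⟨K, hK, h⟩ := Hs.exists_bddJet_fn hs hB
  obtain ⟨L, hL⟩ := (h l0).inv hc h0
  refine ⟨4 * (K * |L|), by positivity, fun l => ?_⟩
  have h1 := (h l).mul hL
  have e : (fun y => l.fn y / l0.fn y) = fun y => l.fn y * (l0.fn y)⁻¹ :=
    funext fun y => div_eq_mul_inv _ _
  rw [e]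
  have hle : 4 * (K * ‖l‖ * L) ≤ 4 * (K * |L|) * ‖l‖ := by
    have : K * ‖l‖ * L ≤ K * ‖l‖ * |L| := mul_le_mul_of_nonneg_left (le_abs_self L) (by positivity)
    linarith
  exact ⟨h1.smooth, fun y hy => (h1.le y hy).trans hle, fun y hy i => (h1.pd_le y hy i).trans hle,
    fun y hy i j => (h1.pd_pd_le y hy i j).trans hle⟩

theorem pd_add_at {f g : E n → ℝ} {y : E n} (hf : DifferentiableAt ℝ f y)
    (hg : DifferentiableAt ℝ g y) (i : Fin n) : pd (f + g) i y = pd f i y + pd g i y := by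
  unfold pd
  rw [fderiv_add hf hg]
  rfl

theorem pd_smul_at {f : E n → ℝ} {y : E n} (hf : DifferentiableAt ℝ f y) (c : ℝ)
    (i : Fin n) : pd (c • f) i y = c * pd f i y := by
  unfold pd
  rw [fderiv_const_smul hf]
  rfl

theorem pd_pd_add_at {f g : E n → ℝ} {y : E n} (hf : ContDiffAt ℝ 2 f y)
    (hg : ContDiffAt ℝ 2 g y) (i j : Fin n) :
    pd (pd (f + g) i) j y = pd (pd f i) j y + pd (pd g i) j y := by
  have h : pd (f + g) i =ᶠ[𝓝 y] pd f i + pd g i := by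
    filter_upwards [hf.eventually (by norm_num), hg.eventually (by norm_num)] with z h1 h2
    exact pd_add_at (h1.differentiableAt (by norm_num)) (h2.differentiableAt (by norm_num)) i
  rw [pd_congr h]
  exact pd_add_at ((contDiffAt_pd hf i).differentiableAt (by norm_num))
    ((contDiffAt_pd hg i).differentiableAt (by norm_num)) j

theorem pd_pd_smul_at {f : E n → ℝ} {y : E n} (hf : ContDiffAt ℝ 2 f y) (c : ℝ)
    (i j : Fin n) : pd (pd (c • f) i) j y = c * pd (pd f i) j y := by
  have h : pd (c • f) i =ᶠ[𝓝 y] c • pd f i := by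
    filter_upwards [hf.eventually (by norm_num)] with z h1
    exact pd_smul_at (h1.differentiableAt (by norm_num)) c i
  rw [pd_congr h]
  exact pd_smul_at ((contDiffAt_pd hf i).differentiableAt (by norm_num)) c j

end Ratio

/-! ### The transformed Laplacian as an operator depending on the shape -/

theorem exists_clm_isMul_hor {Ω D : Set (E (m + 1))} (hD : IsOpen D) (hDB : ∀ x ∈ D, hor x ∈ B)
    (φ : X → E m → ℝ) {K : ℝ} (hK : 0 ≤ K) (hc : ∀ x, ContinuousOn (φ x) B)
    (hadd : ∀ x x', ∀ y ∈ B, φ (x + x') y = φ x y + φ x' y)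
    (hsmul : ∀ (c : ℝ) x, ∀ y ∈ B, φ (c • x) y = c * φ x y)
    (hb : ∀ x, ∀ y ∈ B, |φ x y| ≤ K * ‖x‖) : ∃ M : X →L[ℝ] L2 (vol Ω) →L[ℝ] L2 (vol Ω), ∀ x,
      IsMul (ContinuousLinearMap.id ℝ (L2 (vol Ω))) (D.indicator fun z => φ x (hor z)) (M x) := by
  refine exists_clm_isMul Function.injective_id (fun x => D.indicator fun z => φ x (hor z)) K
    (fun x x' => Eventually.of_forall fun z => ?_) (fun c x => Eventually.of_forall fun z => ?_)
    fun x => ?_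
  · by_cases hz : z ∈ D
    · simp [hz, hadd x x' _ (hDB z hz)]
    · simp [hz]
  · by_cases hz : z ∈ D
    · simp [hz, hsmul c x _ (hDB z hz)]
    · simp [hz]
  · refine exists_isMul_L2 ?_ (by positivity) (.of_forall fun z => ?_)
    · rw [aestronglyMeasurable_indicator_iff hD.measurableSet]
      exact (((hc x).comp continuous_hor.continuousOn hDB).aestronglyMeasurable hD.measurableSet).mono_measure
        (Measure.restrict_mono_measure Measure.restrict_le_self _)
    · by_cases hz : z ∈ D
      · simp [hz, hb x _ (hDB z hz)]
      · simp only [hz, not_false_eq_true, indicator_of_notMem, abs_zero]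
        positivity

theorem isOpen_underGraph (hB : IsOpen B) {l : E m → ℝ} (hl : Continuous l) :
    IsOpen (underGraph B l) := by
  have h : underGraph B l = hor ⁻¹' B ∩ ({x | 0 < ver x} ∩ {x | ver x < l (hor x)}) := rfl
  rw [h]
  exact (hB.preimage continuous_hor).inter ((isOpen_lt continuous_const continuous_ver).inter
    (isOpen_lt continuous_ver (hl.comp continuous_hor)))

theorem ae_add_rep {α : Type*} [MeasurableSpace α] {μ : Measure α} {f g : Lp ℝ 2 μ} {φ ψ : α → ℝ}
    (hf : f =ᵐ[μ] φ) (hg : g =ᵐ[μ] ψ) : ⇑(f + g) =ᵐ[μ] fun x => φ x + ψ x := by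
  filter_upwards [Lp.coeFn_add f g, hf, hg] with x a b c
  rw [a, Pi.add_apply, b, c]

theorem ae_sub_rep {α : Type*} [MeasurableSpace α] {μ : Measure α} {f g : Lp ℝ 2 μ} {φ ψ : α → ℝ}
    (hf : f =ᵐ[μ] φ) (hg : g =ᵐ[μ] ψ) : ⇑(f - g) =ᵐ[μ] fun x => φ x - ψ x := by
  filter_upwards [Lp.coeFn_sub f g, hf, hg] with x a b c
  rw [a, Pi.sub_apply, b, c]

theorem ae_smul_rep {α : Type*} [MeasurableSpace α] {μ : Measure α} {f : Lp ℝ 2 μ} {φ : α → ℝ}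
    (c : ℝ) (hf : f =ᵐ[μ] φ) : ⇑(c • f) =ᵐ[μ] fun x => c * φ x := by
  filter_upwards [Lp.coeFn_smul c f, hf] with x a b
  rw [a, Pi.smul_apply, b, smul_eq_mul]

theorem ae_sum_rep {α κ : Type*} [Fintype κ] [MeasurableSpace α] {μ : Measure α}
    {f : κ → Lp ℝ 2 μ} {φ : κ → α → ℝ} (hf : ∀ i, f i =ᵐ[μ] φ i) :
    ⇑(∑ i, f i) =ᵐ[μ] fun x => ∑ i, φ i x := by
  filter_upwards [Lp.coeFn_finsetSum Finset.univ f, ae_all_iff.2 hf] with x a b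
  rw [a, Finset.sum_apply]
  exact sum_congr rfl fun i _ => b i

section Abstract

variable [NormedSpace ℝ W]

/-- A second order operator assembled from its coefficients (`S` for the ratio, `R` for its inverse,
`S1` and `S2` for its derivatives, `Z` for the height, `χ` for the part under the graph) and the
second and first derivatives. -/
def lapOperator (S R Z χ : W →L[ℝ] W) (S1 S2 : Fin m → W →L[ℝ] W) (H H' : Fin m → V →L[ℝ] W)
    (h g t : V →L[ℝ] W) : V →L[ℝ] W := (∑ i, S.comp (H i)) - (2 : ℝ) • (∑ i, (Z * S1 i).comp (H' i))
    + (R * (Z * Z * (∑ i, S1 i * S1 i) + χ)).comp h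
    + ((2 : ℝ) • (R * (Z * (∑ i, S1 i * S1 i))) - Z * (∑ i, S2 i)).comp g
    + (1 - χ).comp t

theorem lapOperator_apply (S R Z χ : W →L[ℝ] W) (S1 S2 : Fin m → W →L[ℝ] W)
    (H H' : Fin m → V →L[ℝ] W) (h g t : V →L[ℝ] W) (u : V) :
    lapOperator S R Z χ S1 S2 H H' h g t u = (∑ i, S (H i u)) - (2 : ℝ) • (∑ i, (Z * S1 i) (H' i u))
      + (R * (Z * Z * (∑ i, S1 i * S1 i) + χ)) (h u)
      + ((2 : ℝ) • (R * (Z * (∑ i, S1 i * S1 i))) - Z * (∑ i, S2 i)) (g u)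
      + (1 - χ) (t u) := by
  simp only [lapOperator, add_apply, sub_apply, smul_apply, ContinuousLinearMap.coe_comp,
    Function.comp_apply, sum_apply]

theorem differentiableAt_lapOperator {S R : X → W →L[ℝ] W} {S1 S2 : Fin m → X → W →L[ℝ] W} {x : X}
    (hS : DifferentiableAt ℝ S x) (hR : DifferentiableAt ℝ R x)
    (hS1 : ∀ i, DifferentiableAt ℝ (S1 i) x) (hS2 : ∀ i, DifferentiableAt ℝ (S2 i) x)
    (Z χ : W →L[ℝ] W) (H H' : Fin m → V →L[ℝ] W) (h g t : V →L[ℝ] W) :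
    DifferentiableAt ℝ (fun l => lapOperator (S l) (R l) Z χ (fun i => S1 i l) (fun i => S2 i l)
      H H' h g t) x := by
  have d1 : DifferentiableAt ℝ (fun l => ∑ i, S1 i l * S1 i l) x :=
    DifferentiableAt.fun_sum fun i _ => (hS1 i).fun_mul (hS1 i)
  have d2 : DifferentiableAt ℝ (fun l => ∑ i, S2 i l) x := DifferentiableAt.fun_sum fun i _ => hS2 i
  unfold lapOperator
  have t1 : DifferentiableAt ℝ (fun l => ∑ i, (S l).comp (H i)) x :=
    DifferentiableAt.fun_sum fun i _ => hS.clm_comp (differentiableAt_const _)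
  have t2 : DifferentiableAt ℝ (fun l => (2 : ℝ) • ∑ i, (Z * S1 i l).comp (H' i)) x :=
    (DifferentiableAt.fun_sum fun i _ =>
      (((differentiableAt_const _).fun_mul (hS1 i)).clm_comp (differentiableAt_const _))).fun_const_smul _
  have t3 : DifferentiableAt ℝ (fun l => (R l * (Z * Z * (∑ i, S1 i l * S1 i l) + χ)).comp h) x :=
    (hR.fun_mul (((differentiableAt_const _).fun_mul d1).add_const χ)).clm_comp (differentiableAt_const _)
  have t4 : DifferentiableAt ℝ (fun l => ((2 : ℝ) • (R l * (Z * (∑ i, S1 i l * S1 i l)))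
      - Z * (∑ i, S2 i l)).comp g) x :=
    (((hR.fun_mul ((differentiableAt_const _).fun_mul d1)).fun_const_smul _).fun_sub
      ((differentiableAt_const _).fun_mul d2)).clm_comp (differentiableAt_const _)
  exact (((t1.fun_sub t2).fun_add t3).fun_add t4).fun_add (differentiableAt_const _)

end Abstract

namespace Problem

variable {P : Problem m}

theorem Assumptions.lt_two_mul_sl (hP : P.Assumptions) : (m : ℝ) + 4 < 2 * P.sl := by
  have := hP.sl_gt
  push_cast at this
  linarith

theorem Assumptions.exists_le (hP : P.Assumptions) {l : Hs m P.sl P.B} (h : P.Nondegenerate l) :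
    ∃ c > 0, ∀ y ∈ P.B, c ≤ l.fn y :=
  exists_le_of_nondegenerate hP.isOpen_B (Hs.fn_spec hP.lt_two_mul_sl l).1.continuous h.1 h.2

/-- The ratio `ℓ/ℓ₀` and its derivatives on the part under the graph of `ℓ₀`, as multiplication
operators that depend linearly on `ℓ`. -/
theorem exists_ratio_operators (hP : P.Assumptions) :
    ∃ (S : Hs m P.sl P.B →L[ℝ] L2 (vol P.Ω) →L[ℝ] L2 (vol P.Ω))
      (S1 S2 : Fin m → Hs m P.sl P.B →L[ℝ] L2 (vol P.Ω) →L[ℝ] L2 (vol P.Ω)),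
      (∀ l, IsMul (ContinuousLinearMap.id ℝ (L2 (vol P.Ω)))
        ((underGraph P.B P.l0.fn).indicator fun z => P.ratio l (hor z)) (S l)) ∧
      (∀ i l, IsMul (ContinuousLinearMap.id ℝ (L2 (vol P.Ω)))
        ((underGraph P.B P.l0.fn).indicator fun z => pd (P.ratio l) i (hor z)) (S1 i l)) ∧
      ∀ i l, IsMul (ContinuousLinearMap.id ℝ (L2 (vol P.Ω)))
        ((underGraph P.B P.l0.fn).indicator fun z => pd (pd (P.ratio l) i) i (hor z)) (S2 i l) := by
  have hs := hP.lt_two_mul_sl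
  have hD := isOpen_underGraph hP.isOpen_B (Hs.fn_spec hs P.l0).1.continuous
  have hDB : ∀ x ∈ underGraph P.B P.l0.fn, hor x ∈ P.B := fun x hx => hx.1
  obtain ⟨c, hc, h0⟩ := hP.exists_le hP.nondegenerate
  obtain ⟨K, hK, hj⟩ := exists_bddJet_ratio hs hP.isOpen_B P.l0 hc h0
  have hj' : ∀ l, BddJet P.B (P.ratio l) (K * ‖l‖) := hj
  have hadd : ∀ l l' : Hs m P.sl P.B, ∀ y ∈ P.B,
      P.ratio (l + l') =ᶠ[𝓝 y] P.ratio l + P.ratio l' := fun l l' y hy => by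
    filter_upwards [Hs.fn_add hs hP.isOpen_B l l' hy] with z hz
    simp only [ratio, hz, Pi.add_apply, add_div]
  have hsmul : ∀ (t : ℝ) (l : Hs m P.sl P.B), ∀ y ∈ P.B,
      P.ratio (t • l) =ᶠ[𝓝 y] t • P.ratio l := fun t l y hy => by
    filter_upwards [Hs.fn_smul hs hP.isOpen_B t l hy] with z hz
    simp only [ratio, hz, Pi.smul_apply, smul_eq_mul, mul_div_assoc]
  have hdiff : ∀ l, ∀ y ∈ P.B, DifferentiableAt ℝ (P.ratio l) y := fun l y hy =>
    ((hj' l).smooth y hy).differentiableAt (by norm_num)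
  obtain ⟨S, hS⟩ := exists_clm_isMul_hor (Ω := P.Ω) hD hDB P.ratio hK
    (fun l y hy => ((hj' l).smooth y hy).continuousAt.continuousWithinAt)
    (fun l l' y hy => (hadd l l' y hy).self_of_nhds)
    (fun t l y hy => (hsmul t l y hy).self_of_nhds) (fun l y hy => (hj' l).le y hy)
  have h1 := fun i => exists_clm_isMul_hor (Ω := P.Ω) hD hDB (fun l => pd (P.ratio l) i) hK
    (fun l y hy => (contDiffAt_pd ((hj' l).smooth y hy) i).continuousAt.continuousWithinAt)
    (fun l l' y hy => (pd_congr (hadd l l' y hy) i).trans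
      (pd_add_at (hdiff l y hy) (hdiff l' y hy) i))
    (fun t l y hy => (pd_congr (hsmul t l y hy) i).trans (pd_smul_at (hdiff l y hy) t i))
    (fun l y hy => (hj' l).pd_le y hy i)
  have h2 := fun i => exists_clm_isMul_hor (Ω := P.Ω) hD hDB
    (fun l => pd (pd (P.ratio l) i) i) hK
    (fun l y hy => (((contDiffAt_pd ((hj' l).smooth y hy) i).fderiv_right (m := 0)
      (by norm_num)).clm_apply contDiffAt_const).continuousAt.continuousWithinAt)
    (fun l l' y hy => (pd_congr (pd_eventuallyEq (hadd l l' y hy) i) i).trans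
      (pd_pd_add_at ((hj' l).smooth y hy) ((hj' l').smooth y hy) i i))
    (fun t l y hy => (pd_congr (pd_eventuallyEq (hsmul t l y hy) i) i).trans
      (pd_pd_smul_at ((hj' l).smooth y hy) t i i))
    (fun l y hy => (hj' l).pd_pd_le y hy i i)
  choose S1 hS1 using h1
  choose S2 hS2 using h2
  exact ⟨S, S1, S2, hS, hS1, hS2⟩

/-- Multiplication by the inverse of the ratio on the part under the graph, by `1` elsewhere. -/
theorem exists_inverse_ratio (hP : P.Assumptions) {l : Hs m P.sl P.B} (h : P.Nondegenerate l) :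
    ∃ R : L2 (vol P.Ω) →L[ℝ] L2 (vol P.Ω), IsMul (ContinuousLinearMap.id ℝ (L2 (vol P.Ω)))
      (fun x => (P.invω0 l x)⁻¹) R := by
  classical
  have hs := hP.lt_two_mul_sl
  obtain ⟨c, hc, hl⟩ := hP.exists_le h
  obtain ⟨c0, hc0, hl0⟩ := hP.exists_le hP.nondegenerate
  obtain ⟨K, hK, hj⟩ := Hs.exists_bddJet_fn (B := P.B) hs hP.isOpen_B
  have hD := isOpen_underGraph hP.isOpen_B (Hs.fn_spec hs P.l0).1.continuous
  have hcl := (Hs.fn_spec hs l).1.continuous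
  have hcl0 := (Hs.fn_spec hs P.l0).1.continuous
  have hm : Measurable fun x => (P.invω0 l x)⁻¹ := by
    refine Measurable.inv (Measurable.ite hD.measurableSet ?_ measurable_const)
    exact ((hcl.measurable.div hcl0.measurable).comp continuous_hor.measurable)
  obtain ⟨R, hR, -⟩ := exists_isMul_L2 (μ := vol P.Ω) hm.aestronglyMeasurable
    (C := max 1 (K * ‖P.l0‖ / c)) (by positivity) (.of_forall fun x => by
      by_cases hx : x ∈ underGraph P.B P.l0.fn
      · have h1 := hl _ hx.1
        have h2 := hl0 _ hx.1
        have h3 := (hj P.l0).le _ hx.1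
        have h4 : (P.invω0 l x)⁻¹ = P.l0.fn (hor x) / l.fn (hor x) := by simp [invω0, hx, ratio]
        rw [h4, abs_div, abs_of_pos (hc.trans_le h1)]
        exact (div_le_div₀ (by positivity) h3 hc h1).trans (le_max_right _ _)
      · simp [invω0, hx])
  exact ⟨R, hR⟩

theorem invω0_mul_lap {l : Hs m P.sl P.B} {u : H2 P.Ω} {x : E (m + 1)}
    (hr : x ∈ underGraph P.B P.l0.fn → P.ratio l (hor x) ≠ 0) : P.invω0 l x * P.lap l u x =
      (∑ i : Fin m, (underGraph P.B P.l0.fn).indicator (fun z => P.ratio l (hor z)) x *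
          u.hess i.castSucc i.castSucc x)
      - 2 * (∑ i : Fin m, ver x *
          (underGraph P.B P.l0.fn).indicator (fun z => pd (P.ratio l) i (hor z)) x *
          u.hess i.castSucc (Fin.last m) x)
      + ((P.invω0 l x)⁻¹ * (ver x * ver x * (∑ i : Fin m,
          (underGraph P.B P.l0.fn).indicator (fun z => pd (P.ratio l) i (hor z)) x *
          (underGraph P.B P.l0.fn).indicator (fun z => pd (P.ratio l) i (hor z)) x)
          + (underGraph P.B P.l0.fn).indicator (fun _ => 1) x) * u.hess (Fin.last m) (Fin.last m) x)
      + ((2 * ((P.invω0 l x)⁻¹ * (ver x * (∑ i : Fin m,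
          (underGraph P.B P.l0.fn).indicator (fun z => pd (P.ratio l) i (hor z)) x *
          (underGraph P.B P.l0.fn).indicator (fun z => pd (P.ratio l) i (hor z)) x)))
          - ver x * (∑ i : Fin m,
          (underGraph P.B P.l0.fn).indicator (fun z => pd (pd (P.ratio l) i) i (hor z)) x)) *
          u.grad (Fin.last m) x)
      + (1 - (underGraph P.B P.l0.fn).indicator (fun _ => 1) x) * ∑ i, u.hess i i x := by
  by_cases hx : x ∈ underGraph P.B P.l0.fn
  · have h := hr hx
    simp only [invω0, lap, hx, if_true, indicator_of_mem, mul_assoc (ver x), ← mul_sum]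
    simp only [← sq]
    field_simp
    ring
  · simp only [invω0, lap, hx, if_false, indicator_of_notMem, not_false_eq_true]
    simp

/-- The weight `1/ω⁰_ℓ` and the weighted transformed Laplacian are differentiable as functions of
`ℓ` with values in the bounded operators. -/
theorem exists_interior_operators (hP : P.Assumptions) :
    ∃ (S : Hs m P.sl P.B → L2 (vol P.Ω) →L[ℝ] L2 (vol P.Ω))
      (K : Hs m P.sl P.B → H2 P.Ω →L[ℝ] L2 (vol P.Ω)), ∀ l, P.Nondegenerate l →
      DifferentiableAt ℝ S l ∧ DifferentiableAt ℝ K l ∧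
      (∀ f, S l f =ᵐ[vol P.Ω] fun x => P.invω0 l x * f x) ∧
      ∀ u, K l u =ᵐ[vol P.Ω] fun x => P.invω0 l x * P.lap l u x := by
  classical
  have hs := hP.lt_two_mul_sl
  have hD := isOpen_underGraph hP.isOpen_B (Hs.fn_spec hs P.l0).1.continuous
  obtain ⟨S, S1, S2, hS, hS1, hS2⟩ := exists_ratio_operators hP
  obtain ⟨χ, hχ, -⟩ := exists_isMul_L2 (μ := vol P.Ω)
    (a := (underGraph P.B P.l0.fn).indicator fun _ => (1 : ℝ))
    (aestronglyMeasurable_const.indicator hD.measurableSet) (C := 1) zero_le_one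
    (.of_forall fun x => by by_cases hx : x ∈ underGraph P.B P.l0.fn <;> simp [hx])
  obtain ⟨C, hC⟩ := hP.isBounded_Ω.exists_norm_le
  obtain ⟨Z, hZ, -⟩ := exists_isMul_L2 (μ := vol P.Ω) (a := ver) (C := |C|)
    continuous_ver.aestronglyMeasurable (abs_nonneg C) (by
      filter_upwards [ae_restrict_mem hP.isOpen_Ω.measurableSet] with x hx
      exact (abs_ver_le x).trans ((hC x hx).trans (le_abs_self C)))
  let S' : Hs m P.sl P.B → L2 (vol P.Ω) →L[ℝ] L2 (vol P.Ω) := fun l => S l + (1 - χ)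
  let R : Hs m P.sl P.B → L2 (vol P.Ω) →L[ℝ] L2 (vol P.Ω) := fun l => Ring.inverse (S' l)
  let e := Fin.last m
  let K : Hs m P.sl P.B → H2 P.Ω →L[ℝ] L2 (vol P.Ω) := fun l =>
    lapOperator (S l) (R l) Z χ (fun i => S1 i l) (fun i => S2 i l)
      (fun i => H2.hessL P.Ω i.castSucc i.castSucc) (fun i => H2.hessL P.Ω i.castSucc e)
      (H2.hessL P.Ω e e) (H2.gradL P.Ω e) (∑ i, H2.hessL P.Ω i i)
  have hS' : ∀ l, IsMul (ContinuousLinearMap.id ℝ (L2 (vol P.Ω))) (P.invω0 l) (S' l) := fun l =>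
    ((hS l).add (IsMul.one.sub hχ)).congr (.of_forall fun x => by
      by_cases hx : x ∈ underGraph P.B P.l0.fn <;> simp [hx, invω0])
  refine ⟨S', K, fun l hl => ?_⟩
  have hr : ∀ x, x ∈ underGraph P.B P.l0.fn → P.ratio l (hor x) ≠ 0 := fun x hx =>
    (div_pos (hl.1 _ hx.1) (hP.nondegenerate.1 _ hx.1)).ne'
  have hω : ∀ x, P.invω0 l x ≠ 0 := fun x => by
    by_cases hx : x ∈ underGraph P.B P.l0.fn <;> simp [hx, invω0, hr]
  obtain ⟨R0, hR0⟩ := exists_inverse_ratio hP hl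
  obtain ⟨hu, hR⟩ := (hS' l).isUnit Function.injective_id hR0
    (.of_forall fun x => mul_inv_cancel₀ (hω x))
  have hRl : IsMul (ContinuousLinearMap.id ℝ (L2 (vol P.Ω))) (fun x => (P.invω0 l x)⁻¹) (R l) := by
    change IsMul _ _ (Ring.inverse (S' l))
    rw [hR]; exact hR0
  have dS' : DifferentiableAt ℝ S' l := S.differentiableAt.add_const (1 - χ)
  have dR : DifferentiableAt ℝ R l := by
    have h1 : DifferentiableAt ℝ Ring.inverse (S' l) := differentiableAt_inverse hu
    exact h1.comp l dS'
  refine ⟨dS', differentiableAt_lapOperator S.differentiableAt dR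
    (fun i => (S1 i).differentiableAt) (fun i => (S2 i).differentiableAt) Z χ _ _ _ _ _,
    fun f => hS' l f, fun u => ?_⟩
  · have hq : IsMul (ContinuousLinearMap.id ℝ (L2 (vol P.Ω))) _ (∑ i, S1 i l * S1 i l) :=
      IsMul.sum _ fun i => (hS1 i l).mul (hS1 i l)
    have hd : IsMul (ContinuousLinearMap.id ℝ (L2 (vol P.Ω))) _ (∑ i, S2 i l) :=
      IsMul.sum _ fun i => hS2 i l
    have a1 := ae_sum_rep fun i : Fin m => hS l (H2.hessL P.Ω i.castSucc i.castSucc u)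
    have a2 := ae_sum_rep fun i : Fin m => (hZ.mul (hS1 i l)) (H2.hessL P.Ω i.castSucc e u)
    have a3 := (hRl.mul (((hZ.mul hZ).mul hq).add hχ)) (H2.hessL P.Ω e e u)
    have a4 := (((hRl.mul (hZ.mul hq)).smul 2).sub (hZ.mul hd)) (H2.gradL P.Ω e u)
    have a5 := (IsMul.one.sub hχ) (∑ i, H2.hessL P.Ω i i u)
    have a6 := ae_sum_rep fun i => (EventuallyEq.refl (ae (vol P.Ω)) (H2.hessL P.Ω i i u))
    have a7 := ae_add_rep (ae_add_rep (ae_add_rep (ae_sub_rep a1 (ae_smul_rep 2 a2)) a3) a4) a5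
    have eK := lapOperator_apply (S l) (R l) Z χ (fun i => S1 i l) (fun i => S2 i l)
      (fun i => H2.hessL P.Ω i.castSucc i.castSucc) (fun i => H2.hessL P.Ω i.castSucc e)
      (H2.hessL P.Ω e e) (H2.gradL P.Ω e) (∑ i, H2.hessL P.Ω i i) u
    rw [sum_apply] at eK
    change K l u = _ at eK
    rw [eK]
    filter_upwards [a7, a6] with x h7 h6
    rw [invω0_mul_lap (hr x)]
    refine h7.trans ?_
    simp only [ContinuousLinearMap.id_apply]
    rw [h6]
    rfl

end Problem

/-! ### Multipliers of `H^½(B)` -/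

/-- Bounded Lipschitz functions. -/
structure LipBdd (f : E m → ℝ) (A : ℝ) : Prop where
  le : ∀ y, |f y| ≤ A
  lip : ∀ y z, |f y - f z| ≤ A * ‖y - z‖

theorem LipBdd.nonneg {f : E m → ℝ} {A : ℝ} (h : LipBdd f A) : 0 ≤ A :=
  (abs_nonneg _).trans (h.le 0)

theorem LipBdd.mono {f : E m → ℝ} {A A' : ℝ} (h : LipBdd f A) (hA : A ≤ A') : LipBdd f A' :=
  ⟨fun y => (h.le y).trans hA, fun y z => (h.lip y z).trans (by gcongr)⟩

theorem LipBdd.continuous {f : E m → ℝ} {A : ℝ} (h : LipBdd f A) : Continuous f := by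
  refine (LipschitzWith.of_dist_le_mul (K := A.toNNReal) fun y z => ?_).continuous
  rw [Real.coe_toNNReal _ h.nonneg, dist_eq, dist_eq_norm]
  exact h.lip y z

theorem LipBdd.exists_isMul {f : E m → ℝ} {A : ℝ} (h : LipBdd f A) (B : Set (E m)) :
    ∃ T : Hs m (1 / 2) B →L[ℝ] Hs m (1 / 2) B, IsMul (Hs.toL2 m (1 / 2) B) f T ∧
      ‖T‖ ≤ (1 + 10 * m) * A := by
  have hm : MemLp f ∞ (vol B) := memLp_top_of_bound h.continuous.aestronglyMeasurable A
    (.of_forall h.le)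
  obtain ⟨T, hT, hn⟩ := exists_mul_half B (hm.toLp f) hm.coeFn_toLp h.le h.lip
  have := h.nonneg
  refine ⟨T, fun v => ?_, opNorm_le_bound _ (by positivity) hn⟩
  rw [hT]
  filter_upwards [mulL_ae (hm.toLp f) (Hs.toL2 m (1 / 2) B v), hm.coeFn_toLp] with y h1 h2
  rw [h1, h2]

theorem LipBdd.inv {f : E m → ℝ} {A c : ℝ} (h : LipBdd f A) (hc : 0 < c) (hf : ∀ y, c ≤ f y) :
    LipBdd (fun y => (f y)⁻¹) (c⁻¹ + A * (c⁻¹ * c⁻¹)) := by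
  have hA := h.nonneg
  have h0 : ∀ y, 0 < f y := fun y => hc.trans_le (hf y)
  have hi : ∀ y, |(f y)⁻¹| ≤ c⁻¹ := fun y => by
    rw [abs_inv, abs_of_pos (h0 y)]
    exact inv_anti₀ hc (hf y)
  refine ⟨fun y => (hi y).trans (le_add_of_nonneg_right (by positivity)), fun y z => ?_⟩
  have e : (f y)⁻¹ - (f z)⁻¹ = (f z - f y) * ((f y)⁻¹ * (f z)⁻¹) := by
    have := (h0 y).ne'
    have := (h0 z).ne'
    field_simp
  rw [e, abs_mul, abs_mul]
  have h1 : |f z - f y| * (|(f y)⁻¹| * |(f z)⁻¹|) ≤ A * ‖y - z‖ * (c⁻¹ * c⁻¹) := by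
    have h2 := h.lip y z
    rw [abs_sub_comm] at h2
    exact mul_le_mul h2 (mul_le_mul (hi y) (hi z) (abs_nonneg _) (by positivity))
      (by positivity) (by positivity)
  have : 0 ≤ c⁻¹ * ‖y - z‖ := by positivity
  linarith

theorem LipBdd.add {f g : E m → ℝ} {A A' : ℝ} (h : LipBdd f A) (h' : LipBdd g A') :
    LipBdd (fun y => f y + g y) (A + A') := by
  refine ⟨fun y => (abs_add_le _ _).trans (add_le_add (h.le y) (h'.le y)), fun y z => ?_⟩
  have e : f y + g y - (f z + g z) = (f y - f z) + (g y - g z) := by ring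
  rw [e, add_mul]
  exact (abs_add_le _ _).trans (add_le_add (h.lip y z) (h'.lip y z))

theorem LipBdd.max {f : E m → ℝ} {A : ℝ} (h : LipBdd f A) (c : ℝ) :
    LipBdd (fun y => max (f y) c) (A + |c|) := by
  refine ⟨fun y => ?_, fun y z => ?_⟩
  · exact abs_max_le_max_abs_abs.trans (max_le ((h.le y).trans (by linarith [abs_nonneg c]))
      (by linarith [h.nonneg]))
  · refine (abs_max_sub_max_le_abs _ _ _).trans ((h.lip y z).trans ?_)
    gcongr
    linarith [abs_nonneg c]

theorem BddC2.lipBdd {f : E m → ℝ} {C : ℝ} (h : BddC2 f C) : LipBdd f C := ⟨h.le, h.lip⟩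

theorem BddC2.lipBdd_pd {f : E m → ℝ} {C : ℝ} (h : BddC2 f C) (i : Fin m) : LipBdd (pd f i) C :=
  ⟨h.pd_le i, h.lip_pd i⟩

/-- The area density `√(|∇f|² + 1)` of the graph of `f`. -/
def area (f : E m → ℝ) (y : E m) : ℝ := √((∑ i, pd f i y ^ 2) + 1)

theorem one_le_area (f : E m → ℝ) (y : E m) : 1 ≤ area f y := by
  refine Real.one_le_sqrt.2 ?_
  linarith [sum_nonneg fun i (_ : i ∈ Finset.univ) => sq_nonneg (pd f i y)]

theorem area_mul_self (f : E m → ℝ) (y : E m) :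
    area f y * area f y = 1 + ∑ i, pd f i y * pd f i y := by
  unfold area
  rw [Real.mul_self_sqrt (by positivity), add_comm]
  simp only [sq]

theorem area_congr {f g : E m → ℝ} {y : E m} (h : f =ᶠ[𝓝 y] g) : area f y = area g y := by
  unfold area
  simp only [pd_congr h]

theorem BddC2.lipBdd_area {f : E m → ℝ} {C : ℝ} (h : BddC2 f C) :
    LipBdd (area f) (1 + 2 * m * C ^ 2) := by
  have hC : 0 ≤ C := h.lipBdd.nonneg
  refine ⟨fun y => ?_, fun y z => ?_⟩
  · have h1 := one_le_area f y
    have h2 := area_mul_self f y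
    have h3 : ∑ i, pd f i y * pd f i y ≤ ∑ _i : Fin m, C ^ 2 := sum_le_sum fun i _ => by
      have := h.pd_le i y
      rw [← sq, ← sq_abs]
      gcongr
    simp only [sum_const, card_univ, Fintype.card_fin, nsmul_eq_mul] at h3
    rw [abs_of_pos (by linarith)]
    have : 0 ≤ (m : ℝ) * C ^ 2 := by positivity
    nlinarith
  · have h1 := one_le_area f y
    have h2 := one_le_area f z
    have e : (area f y - area f z) * (area f y + area f z) =
        ∑ i, (pd f i y - pd f i z) * (pd f i y + pd f i z) := by
      have h3 := area_mul_self f y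
      have h4 := area_mul_self f z
      have h5 : ∑ i, (pd f i y - pd f i z) * (pd f i y + pd f i z) =
          (∑ i, pd f i y * pd f i y) - ∑ i, pd f i z * pd f i z := by
        rw [← Finset.sum_sub_distrib]
        exact sum_congr rfl fun i _ => by ring
      rw [h5]
      linarith
    have h6 : |area f y - area f z| ≤ |(area f y - area f z) * (area f y + area f z)| := by
      rw [abs_mul]
      refine le_mul_of_one_le_right (abs_nonneg _) ?_
      rw [abs_of_pos (by linarith)]
      linarith
    refine h6.trans ?_
    rw [e]
    refine (abs_sum_le_sum_abs _ _).trans ?_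
    have h7 : ∀ i ∈ Finset.univ, |(pd f i y - pd f i z) * (pd f i y + pd f i z)| ≤
        C * ‖y - z‖ * (C + C) := fun i _ => by
      rw [abs_mul]
      exact mul_le_mul (h.lip_pd i y z) ((abs_add_le _ _).trans (add_le_add (h.pd_le i y)
        (h.pd_le i z))) (abs_nonneg _) (by positivity)
    refine (sum_le_sum h7).trans ?_
    simp only [sum_const, card_univ, Fintype.card_fin, nsmul_eq_mul]
    have := norm_nonneg (y - z)
    linarith

/-- Differentiability from a first order expansion in terms of a differentiable function. -/
theorem differentiableAt_of_expansion {𝔸 : Type*}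
    [NormedRing 𝔸] [NormedAlgebra ℝ 𝔸] {A Q : X → 𝔸} {x : X} (hA : DifferentiableAt ℝ A x) (p : 𝔸)
    (C : ℝ) (h : ∀ᶠ y in 𝓝 x, ‖Q y - Q x - p * (A y - A x)‖ ≤ C * ‖A y - A x‖ ^ 2) :
    DifferentiableAt ℝ Q x := by
  have h1 : (fun y => Q y - Q x - p * (A y - A x)) =O[𝓝 x] fun y => ‖y - x‖ ^ 2 := by
    have h2 : (fun y => Q y - Q x - p * (A y - A x)) =O[𝓝 x] fun y => ‖A y - A x‖ ^ 2 :=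
      Asymptotics.IsBigO.of_bound C (h.mono fun y hy => by simpa using hy)
    exact h2.trans ((hA.hasFDerivAt.isBigO_sub.norm_norm).pow 2)
  have h3 := (h1.hasFDerivAt (𝕜 := ℝ) (by norm_num)).differentiableAt
  have h4 : DifferentiableAt ℝ (fun y => p * (A y - A x)) x :=
    (differentiableAt_const _).fun_mul (hA.sub_const _)
  have h5 := (h3.fun_add h4).add_const (Q x)
  exact h5.congr_of_eventuallyEq (.of_forall fun y => by simp)

section Operators

variable {B : Set (E m)}

/-- Multiplication by a shape and by its derivatives, and the inverse. -/
theorem exists_shape_operators (hs : (m : ℝ) + 4 < 2 * s) (hB : IsOpen B) :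
    ∃ (M : Hs m s B →L[ℝ] Hs m (1 / 2) B →L[ℝ] Hs m (1 / 2) B)
      (M1 : Fin m → Hs m s B →L[ℝ] Hs m (1 / 2) B →L[ℝ] Hs m (1 / 2) B),
      (∀ l, IsMul (Hs.toL2 m (1 / 2) B) l.fn (M l)) ∧
      ∀ i l, IsMul (Hs.toL2 m (1 / 2) B) (pd l.fn i) (M1 i l) := by
  obtain ⟨K, hK, h⟩ := Hs.exists_bddC2 m hs B
  have hae : ∀ {p : E m → Prop}, (∀ y ∈ B, p y) → ∀ᵐ y ∂vol B, p y := fun hp => by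
    filter_upwards [ae_restrict_mem hB.measurableSet] with y hy using hp y hy
  have hd : ∀ l : Hs m s B, Differentiable ℝ l.fn := fun l =>
    (Hs.fn_spec hs l).1.differentiable (by norm_num)
  have hι := Hs.toL2_injective m (1 / 2) B
  obtain ⟨M, hM⟩ := exists_clm_isMul hι (fun l : Hs m s B => l.fn) ((1 + 10 * m) * K)
    (fun l l' => hae fun y hy => (Hs.fn_add hs hB l l' hy).self_of_nhds)
    (fun c l => hae fun y hy => (Hs.fn_smul hs hB c l hy).self_of_nhds) (fun l => by
      obtain ⟨f, hf, hr⟩ := h l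
      obtain ⟨T, hT, hn⟩ := hf.lipBdd.exists_isMul B
      exact ⟨T, hT.congr (hae fun y hy =>
        (Hs.fn_eventuallyEq hs hB hf.contDiff.continuous hr hy).self_of_nhds.symm),
        hn.trans_eq (by ring)⟩)
  have h1 := fun i => exists_clm_isMul hι (fun l : Hs m s B => pd l.fn i) ((1 + 10 * m) * K)
    (fun l l' => hae fun y hy => (pd_congr (Hs.fn_add hs hB l l' hy) i).trans
      (pd_add_at (hd l y) (hd l' y) i))
    (fun c l => hae fun y hy => (pd_congr (Hs.fn_smul hs hB c l hy) i).trans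
      (pd_smul_at (hd l y) c i)) (fun l => by
      obtain ⟨f, hf, hr⟩ := h l
      obtain ⟨T, hT, hn⟩ := (hf.lipBdd_pd i).exists_isMul B
      exact ⟨T, hT.congr (hae fun y hy =>
        (pd_congr (Hs.fn_eventuallyEq hs hB hf.contDiff.continuous hr hy) i).symm),
        hn.trans_eq (by ring)⟩)
  choose M1 hM1 using h1
  exact ⟨M, M1, hM, hM1⟩

theorem exists_isMul_inv_shape (hs : (m : ℝ) + 4 < 2 * s) (hB : IsOpen B) (l : Hs m s B) {c : ℝ}
    (hc : 0 < c) (hl : ∀ y ∈ B, c ≤ l.fn y) :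
    ∃ T, IsMul (Hs.toL2 m (1 / 2) B) (fun y => (l.fn y)⁻¹) T := by
  obtain ⟨K, hK, h⟩ := Hs.exists_bddC2 m hs B
  obtain ⟨f, hf, hr⟩ := h l
  obtain ⟨T, hT, -⟩ := ((hf.lipBdd.max c).inv hc fun y => le_max_right _ _).exists_isMul B
  refine ⟨T, hT.congr ?_⟩
  filter_upwards [ae_restrict_mem hB.measurableSet] with y hy
  have h1 := (Hs.fn_eventuallyEq hs hB hf.contDiff.continuous hr hy).self_of_nhds
  rw [← h1, max_eq_left (hl y hy)]

theorem exists_isMul_inv_area (hs : (m : ℝ) + 4 < 2 * s) (hB : IsOpen B) (l : Hs m s B) :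
    ∃ T, IsMul (Hs.toL2 m (1 / 2) B) (fun y => (area l.fn y)⁻¹) T := by
  obtain ⟨K, hK, h⟩ := Hs.exists_bddC2 m hs B
  obtain ⟨f, hf, hr⟩ := h l
  obtain ⟨T, hT, -⟩ := (hf.lipBdd_area.inv one_pos (one_le_area f)).exists_isMul B
  refine ⟨T, hT.congr ?_⟩
  filter_upwards [ae_restrict_mem hB.measurableSet] with y hy
  rw [area_congr (Hs.fn_eventuallyEq hs hB hf.contDiff.continuous hr hy)]

/-- Multiplication by the area density is differentiable in the shape. -/
theorem exists_area_operator (hs : (m : ℝ) + 4 < 2 * s) (hB : IsOpen B) :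
    ∃ Q : Hs m s B → Hs m (1 / 2) B →L[ℝ] Hs m (1 / 2) B,
      (∀ l, IsMul (Hs.toL2 m (1 / 2) B) (area l.fn) (Q l)) ∧ ∀ l, DifferentiableAt ℝ Q l := by
  obtain ⟨K, hK, h⟩ := Hs.exists_bddC2 m hs B
  obtain ⟨-, M1, -, hM1⟩ := exists_shape_operators hs hB
  have hι := Hs.toL2_injective m (1 / 2) B
  choose f hf hr using h
  have hfa : ∀ l : Hs m s B, area l.fn =ᵐ[vol B] area (f l) := fun l => by
    filter_upwards [ae_restrict_mem hB.measurableSet] with y hy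
    exact area_congr (Hs.fn_eventuallyEq hs hB (hf l).contDiff.continuous (hr l) hy)
  have hQ := fun l => (hf l).lipBdd_area.exists_isMul B
  choose Q hQ _ using hQ
  let A : Hs m s B → Hs m (1 / 2) B →L[ℝ] Hs m (1 / 2) B := fun l => 1 + ∑ i, M1 i l * M1 i l
  have hA : ∀ l, IsMul (Hs.toL2 m (1 / 2) B) (fun y => area (f l) y * area (f l) y) (A l) :=
    fun l => (IsMul.one.add (IsMul.sum _ fun i => (hM1 i l).mul (hM1 i l))).congr (by
      filter_upwards [hfa l] with y hy
      rw [← area_mul_self, hy])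
  have dA : ∀ l, DifferentiableAt ℝ A l := fun l =>
    (differentiableAt_const _).fun_add (DifferentiableAt.fun_sum fun i _ =>
      ((M1 i).differentiableAt.fun_mul (M1 i).differentiableAt))
  refine ⟨Q, fun l => (hQ l).congr (hfa l).symm, fun l => ?_⟩
  obtain ⟨R, hR, -⟩ := ((hf l).lipBdd_area.inv one_pos (one_le_area (f l))).exists_isMul B
  have hC : ∃ C, ∀ l' ∈ ball l 1, ∃ G, ‖G‖ ≤ C ∧ IsMul (Hs.toL2 m (1 / 2) B)
      (fun y => (area (f l') y + area (f l) y)⁻¹) G := by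
    let K' := K * (‖l‖ + 1)
    refine ⟨(1 + 10 * m) * ((2 : ℝ)⁻¹ + (1 + 2 * m * K' ^ 2 + (1 + 2 * m * (K * ‖l‖) ^ 2)) *
      ((2 : ℝ)⁻¹ * (2 : ℝ)⁻¹)), fun l' hl' => ?_⟩
    have hn : ‖l'‖ ≤ ‖l‖ + 1 := by
      have h1 := norm_le_norm_add_norm_sub l l'
      have h2 := mem_ball_iff_norm.1 hl'
      linarith [norm_sub_rev l l']
    have h2 : LipBdd (area (f l')) (1 + 2 * m * K' ^ 2) := by
      refine (hf l').lipBdd_area.mono ?_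
      have : K * ‖l'‖ ≤ K' := mul_le_mul_of_nonneg_left hn hK
      gcongr
    obtain ⟨G, hG, hGn⟩ := ((h2.add (hf l).lipBdd_area).inv two_pos fun y => by
      linarith [one_le_area (f l') y, one_le_area (f l) y]).exists_isMul B
    exact ⟨G, hGn, hG⟩
  obtain ⟨C, hC⟩ := hC
  refine differentiableAt_of_expansion (dA l) ((2 : ℝ)⁻¹ • R) (2⁻¹ * ‖R‖ * C ^ 2) ?_
  filter_upwards [Metric.ball_mem_nhds l one_pos] with l' hl'
  obtain ⟨G, hGC, hG⟩ := hC l' hl'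
  have e : Q l' - Q l - ((2 : ℝ)⁻¹ • R) * (A l' - A l) =
      (-2⁻¹ : ℝ) • (R * (G * G) * ((A l' - A l) * (A l' - A l))) := by
    refine (((hQ l').sub (hQ l)).sub ((hR.smul 2⁻¹).mul ((hA l').sub (hA l)))).unique hι
      (((hR.mul (hG.mul hG)).mul (((hA l').sub (hA l)).mul ((hA l').sub (hA l)))).smul (-2⁻¹))
      (.of_forall fun y => ?_)
    have h1 := one_le_area (f l') y
    have h2 := one_le_area (f l) y
    have h3 : area (f l) y ≠ 0 := by positivity
    have h4 : area (f l') y + area (f l) y ≠ 0 := by positivity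
    simp only
    field_simp
    ring
  rw [e, norm_smul, norm_neg, norm_inv, Real.norm_ofNat]
  have n1 : ‖R * (G * G) * ((A l' - A l) * (A l' - A l))‖ ≤
      ‖R‖ * (‖G‖ * ‖G‖) * (‖A l' - A l‖ * ‖A l' - A l‖) := by
    refine (norm_mul_le _ _).trans (mul_le_mul ((norm_mul_le _ _).trans ?_) (norm_mul_le _ _)
      (norm_nonneg _) (by positivity))
    exact mul_le_mul_of_nonneg_left (norm_mul_le _ _) (norm_nonneg _)
  calc _ ≤ 2⁻¹ * (‖R‖ * (‖G‖ * ‖G‖) * (‖A l' - A l‖ * ‖A l' - A l‖)) := by gcongr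
    _ ≤ 2⁻¹ * (‖R‖ * (C * C) * (‖A l' - A l‖ * ‖A l' - A l‖)) := by
      have := (norm_nonneg G).trans hGC
      gcongr
    _ = _ := by ring

end Operators

/-! ### The Neumann residual as an operator depending on the shape -/

namespace Problem

variable {P : Problem m}

theorem graphNormal_castSucc (f : E m → ℝ) (y : E m) (i : Fin m) :
    graphNormal f y i.castSucc = -pd f i y / area f y := by
  simp [graphNormal, area]

theorem graphNormal_last (f : E m → ℝ) (y : E m) : graphNormal f y (Fin.last m) = 1 / area f y := by
  simp [graphNormal, area]

theorem ω1_eq (l : Hs m P.sl P.B) (y : E m) : P.ω1 l y = area l.fn y * (area P.l0.fn y)⁻¹ := rfl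

/-- The weighted normal `ω¹_ℓ n` as a vector of multipliers. -/
theorem exists_normal_operators (hP : P.Assumptions) (nc : NormalChoice) :
    ∃ (W : Fin m → Hs m P.sl P.B → Hs m (1 / 2) P.B →L[ℝ] Hs m (1 / 2) P.B)
      (We D : Hs m P.sl P.B → Hs m (1 / 2) P.B →L[ℝ] Hs m (1 / 2) P.B), ∀ l,
      (∀ i, DifferentiableAt ℝ (W i) l) ∧ DifferentiableAt ℝ We l ∧ DifferentiableAt ℝ D l ∧
      (∀ i, IsMul (Hs.toL2 m (1 / 2) P.B)
        (fun y => P.ω1 l y * P.neumannNormal nc l y i.castSucc) (W i l)) ∧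
      IsMul (Hs.toL2 m (1 / 2) P.B)
        (fun y => P.ω1 l y * P.neumannNormal nc l y (Fin.last m)) (We l) ∧
      IsMul (Hs.toL2 m (1 / 2) P.B) (P.ω1 l) (D l) := by
  have hs := hP.lt_two_mul_sl
  obtain ⟨M, M1, hM, hM1⟩ := exists_shape_operators hs hP.isOpen_B
  obtain ⟨Q, hQ, dQ⟩ := exists_area_operator hs hP.isOpen_B
  obtain ⟨R, hR⟩ := exists_isMul_inv_area hs hP.isOpen_B P.l0
  have c : ∀ A : Hs m (1 / 2) P.B →L[ℝ] Hs m (1 / 2) P.B, ∀ l : Hs m P.sl P.B,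
    DifferentiableAt ℝ (fun _ : Hs m P.sl P.B => A) l := fun A l => differentiableAt_const A
  have hD : ∀ l, IsMul (Hs.toL2 m (1 / 2) P.B) (P.ω1 l) (Q l * R) := fun l => (hQ l).mul hR
  have dD : ∀ l, DifferentiableAt ℝ (fun l => Q l * R) l := fun l => (dQ l).fun_mul (c R l)
  cases nc with
  | reference =>
    refine ⟨fun i l => Q l * R * -(M1 i P.l0 * R), fun l => Q l * R * R, fun l => Q l * R,
      fun l => ⟨fun i => (dD l).fun_mul (c _ l), (dD l).fun_mul (c _ l), dD l, fun i => ?_, ?_,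
      hD l⟩⟩
    · refine ((hD l).mul ((hM1 i P.l0).mul hR).neg).congr (.of_forall fun y => ?_)
      simp only [neumannNormal, graphNormal_castSucc, div_eq_mul_inv, neg_mul]
    · refine ((hD l).mul hR).congr (.of_forall fun y => ?_)
      simp only [neumannNormal, graphNormal_last, one_div]
  | deformed =>
    refine ⟨fun i l => -(M1 i l * R), fun l => R, fun l => Q l * R,
      fun l => ⟨fun i => ((M1 i).differentiableAt.fun_mul (c _ l)).fun_neg, c _ l, dD l,
      fun i => ?_, ?_, hD l⟩⟩
    · refine ((hM1 i l).mul hR).neg.congr (.of_forall fun y => ?_)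
      have h1 := one_le_area l.fn y
      have h2 : area l.fn y ≠ 0 := by positivity
      simp only [neumannNormal, graphNormal_castSucc, ω1_eq]
      field_simp
    · refine hR.congr (.of_forall fun y => ?_)
      have h1 := one_le_area l.fn y
      have h2 : area l.fn y ≠ 0 := by positivity
      simp only [neumannNormal, graphNormal_last, ω1_eq]
      field_simp

/-- The entries of the last column of `M_ℓ` as multipliers. -/
theorem exists_column_operators (hP : P.Assumptions) :
    ∃ (b : Fin m → Hs m P.sl P.B → Hs m (1 / 2) P.B →L[ℝ] Hs m (1 / 2) P.B)
      (be : Hs m P.sl P.B → Hs m (1 / 2) P.B →L[ℝ] Hs m (1 / 2) P.B), ∀ l, P.Nondegenerate l →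
      (∀ i, DifferentiableAt ℝ (b i) l) ∧ DifferentiableAt ℝ be l ∧
      (∀ i, IsMul (Hs.toL2 m (1 / 2) P.B)
        (fun y => 1 / P.ratio l y * P.l0.fn y * pd (P.ratio l) i y) (b i l)) ∧
      IsMul (Hs.toL2 m (1 / 2) P.B) (fun y => 1 / P.ratio l y) (be l) := by
  have hs := hP.lt_two_mul_sl
  obtain ⟨M, M1, hM, hM1⟩ := exists_shape_operators hs hP.isOpen_B
  have c : ∀ A : Hs m (1 / 2) P.B →L[ℝ] Hs m (1 / 2) P.B, ∀ l : Hs m P.sl P.B,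
    DifferentiableAt ℝ (fun _ : Hs m P.sl P.B => A) l := fun A l => differentiableAt_const A
  refine ⟨fun i l => M P.l0 * Ring.inverse (M l) * M1 i l - M1 i P.l0,
    fun l => M P.l0 * Ring.inverse (M l), fun l hl => ?_⟩
  obtain ⟨δ, hδ, hle⟩ := hP.exists_le hl
  obtain ⟨T, hT⟩ := exists_isMul_inv_shape hs hP.isOpen_B l hδ hle
  have hpos : ∀ᵐ y ∂vol P.B, l.fn y * (l.fn y)⁻¹ = 1 := by
    filter_upwards [ae_restrict_mem hP.isOpen_B.measurableSet] with y hy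
    exact mul_inv_cancel₀ (hl.1 y hy).ne'
  obtain ⟨hu, hinv⟩ := (hM l).isUnit (Hs.toL2_injective m (1 / 2) P.B) hT hpos
  have dI : DifferentiableAt ℝ (fun l => Ring.inverse (M l)) l :=
    (differentiableAt_inverse hu).comp l M.differentiableAt
  have d1 : DifferentiableAt ℝ (fun l => M P.l0 * Ring.inverse (M l)) l := (c _ l).fun_mul dI
  refine ⟨fun i => (d1.fun_mul (M1 i).differentiableAt).sub_const _, d1, fun i => ?_, ?_⟩
  · beta_reduce; rw [hinv]
    refine ((((hM P.l0).mul hT).mul (hM1 i l)).sub (hM1 i P.l0)).congr ?_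
    filter_upwards [ae_restrict_mem hP.isOpen_B.measurableSet] with y hy
    have h1 := (hl.1 y hy).ne'
    have h2 := (hP.nondegenerate.1 y hy).ne'
    have d : ∀ l : Hs m P.sl P.B, DifferentiableAt ℝ l.fn y := fun l =>
      (Hs.fn_spec hs l).1.differentiable (by norm_num) y
    have e : P.ratio l = fun y => l.fn y * (P.l0.fn y)⁻¹ := funext fun y => div_eq_mul_inv _ _
    rw [e, pd_mul (d l) ((d P.l0).fun_inv h2), pd_inv (d P.l0) h2]
    field_simp
    ring
  · beta_reduce; rw [hinv]
    refine ((hM P.l0).mul hT).congr (.of_forall fun y => ?_)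
    change P.l0.fn y * (l.fn y)⁻¹ = 1 / (l.fn y / P.l0.fn y)
    rw [one_div, inv_div, div_eq_mul_inv]

theorem sum_normal_mul_Mmul (n τ : Fin (m + 1) → ℝ) (l : Hs m P.sl P.B) (y : E m) (w f : ℝ) :
    w * ((∑ i, n i * P.Mmul l y τ i) - f) = (∑ i : Fin m, w * n i.castSucc * τ i.castSucc)
        + (w * n (Fin.last m) * (1 / P.ratio l y) - ∑ i : Fin m, w * n i.castSucc *
          (1 / P.ratio l y * P.l0.fn y * pd (P.ratio l) i y)) * τ (Fin.last m) - w * f := by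
  rw [Fin.sum_univ_castSucc]
  simp only [Mmul, Fin.snoc_castSucc, Fin.snoc_last]
  rw [mul_sub, mul_add, mul_sum, sub_mul, sum_mul]
  have e : ∑ i : Fin m, w * (n i.castSucc * (τ i.castSucc
      - 1 / P.ratio l y * P.l0.fn y * pd (P.ratio l) i y * τ (Fin.last m))) =
      (∑ i : Fin m, w * n i.castSucc * τ i.castSucc) - ∑ i : Fin m, w * n i.castSucc *
          (1 / P.ratio l y * P.l0.fn y * pd (P.ratio l) i y) * τ (Fin.last m) := by
    rw [← Finset.sum_sub_distrib]
    exact sum_congr rfl fun i _ => by ring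
  rw [e]
  ring

/-- The Neumann residual `ω¹_ℓ (n · M_ℓ τ - g)` as a function of `ℓ` with values in the bounded
operators acting on `(τ, g)`. -/
theorem exists_neumann_operators (hP : P.Assumptions) (nc : NormalChoice) :
    ∃ (C : Fin m → Hs m P.sl P.B → Hs m (1 / 2) P.B →L[ℝ] Hs m (1 / 2) P.B)
      (Ce D : Hs m P.sl P.B → Hs m (1 / 2) P.B →L[ℝ] Hs m (1 / 2) P.B), ∀ l, P.Nondegenerate l →
      (∀ i, DifferentiableAt ℝ (C i) l) ∧ DifferentiableAt ℝ Ce l ∧ DifferentiableAt ℝ D l ∧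
      ∀ (t : Fin (m + 1) → Hs m (1 / 2) P.B) (τ : Fin (m + 1) → E m → ℝ)
        (g : Hs m (1 / 2) P.B) (f : E m → ℝ), (∀ i, Hs.toL2 m (1 / 2) P.B (t i) =ᵐ[vol P.B] τ i) →
        Hs.toL2 m (1 / 2) P.B g =ᵐ[vol P.B] f →
        Hs.toL2 m (1 / 2) P.B ((∑ i, C i l (t i.castSucc)) + Ce l (t (Fin.last m)) - D l g)
          =ᵐ[vol P.B] fun y => P.ω1 l y *
            ((∑ i, P.neumannNormal nc l y i * P.Mmul l y (fun j => τ j y) i) - f y) := by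
  obtain ⟨W, We, D, hW⟩ := exists_normal_operators hP nc
  obtain ⟨b, be, hb⟩ := exists_column_operators hP
  refine ⟨W, fun l => We l * be l - ∑ i, W i l * b i l, D, fun l hl => ?_⟩
  obtain ⟨d1, d2, d3, h1, h2, h3⟩ := hW l
  obtain ⟨d4, d5, h4, h5⟩ := hb l hl
  refine ⟨d1, (d2.fun_mul d5).fun_sub (DifferentiableAt.fun_sum fun i _ =>
    (d1 i).fun_mul (d4 i)), d3, fun t τ g f ht hg => ?_⟩
  have a1 := ae_sum_rep fun i : Fin m => h1 i (t i.castSucc)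
  have a2 := ((h2.mul h5).sub (IsMul.sum Finset.univ fun i => (h1 i).mul (h4 i))) (t (Fin.last m))
  have a3 := h3 g
  have e : Hs.toL2 m (1 / 2) P.B ((∑ i, W i l (t i.castSucc)) +
      (We l * be l - ∑ i, W i l * b i l) (t (Fin.last m)) - D l g) =
      (∑ i, Hs.toL2 m (1 / 2) P.B (W i l (t i.castSucc))) +
      Hs.toL2 m (1 / 2) P.B ((We l * be l - ∑ i, W i l * b i l) (t (Fin.last m))) -
      Hs.toL2 m (1 / 2) P.B (D l g) := by
    rw [map_sub, map_add, map_sum]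
  rw [e]
  filter_upwards [ae_sub_rep (ae_add_rep a1 a2) a3, ae_all_iff.2 ht, hg] with y k1 k2 k3
  rw [k1, sum_normal_mul_Mmul, k3]
  simp only [k2]

end Problem

/-! ### Operators and pairings in time -/

section Time

variable [NormedSpace ℝ W]

theorem differentiableAt_compLpL {μ : Measure ℝ} {K : Y → V →L[ℝ] W} {l : X → Y}
    {f : X → Lp V 2 μ} {x : X} (hK : DifferentiableAt ℝ K (l x)) (hl : DifferentiableAt ℝ l x)
    (hf : DifferentiableAt ℝ f x) :
    DifferentiableAt ℝ (fun x => (K (l x)).compLpL 2 μ (f x)) x := by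
  have h1 : DifferentiableAt ℝ (fun x => K (l x)) x := hK.comp x hl
  have h2 := ((ContinuousLinearMap.compLpL₂ (p := 2) (μ := μ)
    (ContinuousLinearMap.id ℝ (V →L[ℝ] W))).differentiableAt.comp x h1).clm_apply hf
  exact h2

/-- The functional `z ↦ ∫ B (f(t)) ((π z)(t)) dt`. -/
def pairL {μ : Measure ℝ} (B : V →L[ℝ] W →L[ℝ] ℝ) (π : Z →L[ℝ] Lp W 2 μ) :
    Lp V 2 μ →L[ℝ] Z →L[ℝ] ℝ :=
  ((ContinuousLinearMap.compL ℝ Z (Lp W 2 μ) ℝ).flip π).comp (B.lpPairing μ 2 2)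

theorem pairL_apply {μ : Measure ℝ} (B : V →L[ℝ] W →L[ℝ] ℝ) (π : Z →L[ℝ] Lp W 2 μ) (f : Lp V 2 μ)
    (z : Z) : pairL B π f z = ∫ t, B (f t) (π z t) ∂μ := B.lpPairing_eq_integral f (π z)

theorem integrable_pair {μ : Measure ℝ} (B : V →L[ℝ] W →L[ℝ] ℝ) (f : Lp V 2 μ) (g : Lp W 2 μ) :
    Integrable (fun t => B (f t) (g t)) μ :=
  memLp_one_iff_integrable.1 (B.memLp_of_bilin 1 (Lp.memLp f) (Lp.memLp g))

/-- The inclusion `L^∞ → L²` on a finite measure space. -/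
theorem exists_top_to_two (X : Type*) [NormedAddCommGroup X] [NormedSpace ℝ X] (μ : Measure ℝ)
    [IsFiniteMeasure μ] : ∃ J : Lp X ∞ μ →L[ℝ] Lp X 2 μ, ∀ f, J f =ᵐ[μ] f := by
  have h1 : MemLp (fun _ : ℝ => (1 : ℝ)) 2 μ := memLp_const 1
  let B : X →L[ℝ] ℝ →L[ℝ] X := (lsmul ℝ ℝ).flip
  refine ⟨(B.holderL μ ∞ 2 2).flip h1.toLp, fun f => ?_⟩
  have h2 : (B.holderL μ ∞ 2 2).flip (h1.toLp _) f =ᵐ[μ] fun t => B (f t) (h1.toLp _ t) :=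
    B.coeFn_holder (r := 2) f (h1.toLp _)
  filter_upwards [h2, h1.coeFn_toLp] with t a b
  rw [a, b]
  simp [B]

end Time

/-- The products `p_t²` and `p p_tt`, for wave functions `p`. -/
theorem exists_products :
    ∃ (M : Lp (Lp ℝ ∞ (vol Ω)) 2 (tim T) →L[ℝ] Lp (L2 (vol Ω)) ∞ (tim T) →L[ℝ]
        Lp (L2 (vol Ω)) 2 (tim T))
      (N : Lp (Lp ℝ ∞ (vol Ω)) ∞ (tim T) →L[ℝ] Lp (L2 (vol Ω)) 2 (tim T) →L[ℝ]
        Lp (L2 (vol Ω)) 2 (tim T)), (∀ a f, ∀ᵐ t ∂tim T, M a f t =ᵐ[vol Ω] fun x => a t x * f t x) ∧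
      ∀ a f, ∀ᵐ t ∂tim T, N a f t =ᵐ[vol Ω] fun x => a t x * f t x := by
  refine ⟨(mulL (vol Ω)).holderL (tim T) 2 ∞ 2, (mulL (vol Ω)).holderL (tim T) ∞ 2 2,
    fun a f => ?_, fun a f => ?_⟩
  · filter_upwards [(mulL (vol Ω)).coeFn_holder (r := 2) a f] with t ht
    have h : (mulL (vol Ω)).holderL (tim T) 2 ∞ 2 a f t = mulL (vol Ω) (a t) (f t) := ht
    rw [h]
    exact mulL_ae _ _
  · filter_upwards [(mulL (vol Ω)).coeFn_holder (r := 2) a f] with t ht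
    have h : (mulL (vol Ω)).holderL (tim T) ∞ 2 2 a f t = mulL (vol Ω) (a t) (f t) := ht
    rw [h]
    exact mulL_ae _ _

theorem exists_lapBeltrami (Ω Γ : Set (E (m + 1))) :
    ∃ D : Hd Ω Γ →L[ℝ] L2s Ω Γ, ∀ w, D w = lapBeltrami w.1 := by
  let F := Fin (m + 1) → L2s Ω Γ
  let S : Hd Ω Γ →L[ℝ] Fin (m + 1) → F := (snd ℝ _ _).comp ((snd ℝ _ _).comp
      ((H2s Ω Γ).subtypeL.comp (H2hinged Ω Γ).subtypeL))
  refine ⟨∑ i, (ContinuousLinearMap.proj (R := ℝ) (φ := fun _ : Fin (m + 1) => L2s Ω Γ) i).comp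
    ((ContinuousLinearMap.proj (R := ℝ) (φ := fun _ : Fin (m + 1) => F) i).comp S), fun w => ?_⟩
  rw [sum_apply]
  rfl

namespace Problem

variable {P : Problem m}

theorem nondegenerate_of_le (hP : P.Assumptions) {l : Hs m P.sl P.B} {c : ℝ} (hc : 0 < c)
    (h : ∀ y ∈ P.B, c ≤ l.fn y) : P.Nondegenerate l := by
  refine ⟨fun y hy => hc.trans_le (h y hy), ?_⟩
  have hm : AEStronglyMeasurable (fun y => 1 / l.fn y) (vol P.B) := (measurable_const.div
      (Hs.fn_spec hP.lt_two_mul_sl l).1.continuous.measurable).aestronglyMeasurable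
  refine (memLp_top_of_bound hm c⁻¹ ?_).2
  filter_upwards [ae_restrict_mem hP.isOpen_B.measurableSet] with y hy
  rw [one_div, norm_inv, norm_of_nonneg (hc.trans_le (h y hy)).le]
  exact inv_anti₀ hc (h y hy)

theorem Close.nondegenerate (hP : P.Assumptions) {l : Hs m P.sl P.B} (h : P.Close l) :
    P.Nondegenerate l := by
  have hs := hP.lt_two_mul_sl
  have hfin := hP.nondegenerate.2
  unfold Close at h
  set N := eLpNorm (fun y => 1 / P.l0.fn y) ∞ (vol P.B) with hN
  have h1 : ∀ᵐ y ∂vol P.B, ‖1 / P.l0.fn y‖ₑ ≤ N := by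
    rw [hN, eLpNorm_exponent_top]
    exact enorm_ae_le_eLpNormEssSup _ _
  have h2 : ∀ᵐ y ∂vol P.B, ‖l.fn y - P.l0.fn y‖ₑ ≤ 2⁻¹ * N⁻¹ := by
    have h3 := enorm_ae_le_eLpNormEssSup (fun y => l.fn y - P.l0.fn y) (vol P.B)
    rw [← eLpNorm_exponent_top] at h3
    exact h3.mono fun y hy => hy.trans h
  have key : ∀ᵐ y ∂vol P.B, 0 < N.toReal ∧ (2 * N.toReal)⁻¹ ≤ l.fn y := by
    filter_upwards [h1, h2, ae_restrict_mem hP.isOpen_B.measurableSet] with y a b hy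
    have hpos := hP.nondegenerate.1 y hy
    have a' := toReal_mono hfin.ne a
    rw [toReal_enorm, norm_of_nonneg (by positivity)] at a'
    have hn : 0 < N.toReal := (by positivity : 0 < 1 / P.l0.fn y).trans_le a'
    have hN0 : N ≠ 0 := fun h => by simp [h] at hn
    have b' := toReal_mono (by finiteness) b
    rw [toReal_enorm, toReal_mul, ENNReal.toReal_inv, ENNReal.toReal_inv,
      ENNReal.toReal_ofNat, ← mul_inv] at b'
    refine ⟨hn, ?_⟩
    have c1 : N.toReal⁻¹ ≤ P.l0.fn y := by rw [inv_le_comm₀ hn hpos, ← one_div]; exact a'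
    have c2 : N.toReal⁻¹ = 2 * (2 * N.toReal)⁻¹ := by field_simp
    have c3 := (abs_le.1 b').1
    linarith
  by_cases hn : 0 < N.toReal
  · exact nondegenerate_of_le hP (by positivity : 0 < (2 * N.toReal)⁻¹)
      (forall_le_of_ae_le hP.isOpen_B (Hs.fn_spec hs l).1.continuous (key.mono fun y hy => hy.2))
  · exact nondegenerate_of_le hP one_pos
      (forall_le_of_ae_le hP.isOpen_B (Hs.fn_spec hs l).1.continuous
        (key.mono fun y hy => absurd hy.1 hn))

end Problem

/-! ### The interior residuals -/

section Time

variable {μ : Measure ℝ}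

section Coord

variable (S : Submodule ℝ (X × Y × Z))

/-- The first coordinate on a subspace of a product of three spaces. -/
def coordOne : S →L[ℝ] X := (fst ℝ _ _).comp S.subtypeL

/-- The second coordinate on a subspace of a product of three spaces. -/
def coordTwo : S →L[ℝ] Y := (fst ℝ _ _).comp ((snd ℝ _ _).comp S.subtypeL)

/-- The third coordinate on a subspace of a product of three spaces. -/
def coordThree : S →L[ℝ] Z := (snd ℝ _ _).comp ((snd ℝ _ _).comp S.subtypeL)

end Coord

theorem differentiable_add_bilinear {D : Type*} [NormedAddCommGroup D] [NormedSpace ℝ D]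
    (M : X →L[ℝ] Z →L[ℝ] V) (N : W →L[ℝ] D →L[ℝ] V) (a : Y →L[ℝ] X) (b : Y →L[ℝ] Z) (c : Y →L[ℝ] W)
    (d : Y →L[ℝ] D) : Differentiable ℝ fun y => M (a y) (b y) + N (c y) (d y) := fun y => by
  have h1 : DifferentiableAt ℝ (fun s => M (a s)) y := (M.comp a).differentiableAt
  have h2 : DifferentiableAt ℝ (fun s => N (c s)) y := (N.comp c).differentiableAt
  exact (h1.clm_apply b.differentiableAt).fun_add (h2.clm_apply d.differentiableAt)

/-- `S f - c p - b p'` in `L²` in time, with the operators acting on the values. -/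
def timeResidual (c b : ℝ) (S : W →L[ℝ] W) (K : V →L[ℝ] W) (p p' : Lp V 2 μ)
    (f : Lp W 2 μ) : Lp W 2 μ := S.compLpL 2 μ f - c • K.compLpL 2 μ p - b • K.compLpL 2 μ p'

theorem ae_timeResidual (c b : ℝ) (S : W →L[ℝ] W) (K : V →L[ℝ] W) (p p' : Lp V 2 μ) (f : Lp W 2 μ) :
    ∀ᵐ t ∂μ, timeResidual c b S K p p' f t = S (f t) - c • K (p t) - b • K (p' t) := by
  filter_upwards [Lp.coeFn_sub (S.compLpL 2 μ f - c • K.compLpL 2 μ p) (b • K.compLpL 2 μ p'),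
    Lp.coeFn_sub (S.compLpL 2 μ f) (c • K.compLpL 2 μ p), Lp.coeFn_smul c (K.compLpL 2 μ p),
    Lp.coeFn_smul b (K.compLpL 2 μ p'), S.coeFn_compLpL f, K.coeFn_compLpL p, K.coeFn_compLpL p']
    with t e1 e2 e3 e4 e5 e6 e7
  rw [timeResidual, e1, Pi.sub_apply, e2, Pi.sub_apply, e3, Pi.smul_apply, e4, Pi.smul_apply, e5,
    e6, e7]

theorem differentiableAt_timeResidual (c b : ℝ) {S : Y → W →L[ℝ] W}
    {K : Y → V →L[ℝ] W} {l : X → Y} {p p' : X → Lp V 2 μ} {f : X → Lp W 2 μ} {x : X}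
    (hS : DifferentiableAt ℝ S (l x)) (hK : DifferentiableAt ℝ K (l x))
    (hl : DifferentiableAt ℝ l x) (hp : DifferentiableAt ℝ p x) (hp' : DifferentiableAt ℝ p' x)
    (hf : DifferentiableAt ℝ f x) :
    DifferentiableAt ℝ (fun x => timeResidual c b (S (l x)) (K (l x)) (p x) (p' x) (f x)) x :=
  ((differentiableAt_compLpL hS hl hf).fun_sub
    ((differentiableAt_compLpL hK hl hp).fun_const_smul c)).fun_sub
    ((differentiableAt_compLpL hK hl hp').fun_const_smul b)

theorem ae_coeFn_sub {p : ℝ≥0∞} (f g : Lp X p μ) :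
    ∀ᵐ t ∂μ, (f - g) t = f t - g t := Lp.coeFn_sub f g

theorem ae_coeFn_add {p : ℝ≥0∞} (f g : Lp X p μ) :
    ∀ᵐ t ∂μ, (f + g) t = f t + g t := Lp.coeFn_add f g

theorem ae_coeFn_smul {p : ℝ≥0∞} (c : ℝ) (f : Lp X p μ) : ∀ᵐ t ∂μ, (c • f) t = c • f t := Lp.coeFn_smul c f

theorem ae_compLpL {p : ℝ≥0∞} [Fact (1 ≤ p)] (L : X →L[ℝ] Y) (f : Lp X p μ) :
    ∀ᵐ t ∂μ, L.compLpL p μ f t = L (f t) := L.coeFn_compLpL f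

theorem ae_quadratic {μ : Measure (E n)} (j : V →L[ℝ] Lp ℝ ∞ μ) (ι : V →L[ℝ] L2 μ) (hj : ∀ u, j u =ᵐ[μ] ι u)
    {F F₁ F₂ v w w' : L2 μ} {A A' : Lp ℝ ∞ μ} {p p' : V} (e1 : F = F₁ + F₂)
    (e2 : F₁ =ᵐ[μ] fun x => A x * v x) (e3 : F₂ =ᵐ[μ] fun x => A' x * w x) (e4 : A = j p')
    (e5 : A' = j p) (e7 : v = ι p') (e8 : w = w') : F =ᵐ[μ] fun x => ι p' x ^ 2 + ι p x * w' x := by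
  subst e1 e4 e5 e7 e8
  filter_upwards [ae_add_rep e2 e3, hj p', hj p] with x k1 k2 k3
  rw [k1, k2, k3, sq]

end Time

theorem exists_wave_maps (hΩ : IsOpen Ω) (hT : 0 < T)
    (j : H2 Ω →L[ℝ] Lp ℝ ∞ (vol Ω)) : ∃ (a : waveSpace Ω T →L[ℝ] Lp (Lp ℝ ∞ (vol Ω)) 2 (tim T))
      (a' : waveSpace Ω T →L[ℝ] Lp (Lp ℝ ∞ (vol Ω)) ∞ (tim T))
      (b : waveSpace Ω T →L[ℝ] Lp (L2 (vol Ω)) ∞ (tim T))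
      (c : waveSpace Ω T →L[ℝ] Lp (L2 (vol Ω)) 2 (tim T)),
      (∀ s, ∀ᵐ t ∂tim T, a s t = j (s.1.2.1 t)) ∧ (∀ s, ∀ᵐ t ∂tim T, a' s t = j (s.1.1 t)) ∧
      (∀ s, ∀ᵐ t ∂tim T, b s t = H2.toL2 Ω (s.1.2.1 t)) ∧ ∀ s, c s = s.1.2.2 := by
  obtain ⟨L, L', hL, hL'⟩ := exists_waveSpace_top hΩ hT
  refine ⟨(j.compLpL 2 (tim T)).comp (coordTwo (waveSpace Ω T)), (j.compLpL ∞ (tim T)).comp L, L',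
    coordThree (waveSpace Ω T), ?_, ?_, hL', fun s => rfl⟩
  · exact fun s => ae_compLpL j (coordTwo (waveSpace Ω T) s)
  · intro s
    filter_upwards [ae_compLpL j (L s), hL s] with t h1 h2
    rw [← h2]
    exact h1

/-- The quadratic term `p_t² + p p_tt`. -/
theorem exists_quadratic (hm : m + 1 ≤ 3) (h : HasC11Boundary Ω)
    (hΩ : IsOpen Ω) (hb : IsBounded Ω) (hT : 0 < T) :
    ∃ F : waveSpace Ω T → Lp (L2 (vol Ω)) 2 (tim T), Differentiable ℝ F ∧
      ∀ s, ∀ᵐ t ∂tim T, F s t =ᵐ[vol Ω] fun x =>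
        H2.toL2 Ω (s.1.2.1 t) x ^ 2 + H2.toL2 Ω (s.1.1 t) x * s.1.2.2 t x := by
  obtain ⟨j, hj⟩ := H2.exists_toLinfty hm (h.hasCones hΩ) hΩ hb
  obtain ⟨a, a', b, c, ha, ha', hb, hc⟩ := exists_wave_maps hΩ hT j
  obtain ⟨M, N, hM, hN⟩ := exists_products (Ω := Ω) (T := T)
  refine ⟨fun s => M (a s) (b s) + N (a' s) (c s), ?_, ?_⟩
  · exact differentiable_add_bilinear M N a b a' c
  intro s
  filter_upwards [ae_coeFn_add (M (a s) (b s)) (N (a' s) (c s)), hM (a s) (b s),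
    hN (a' s) (c s), ha s, ha' s, hb s] with t e1 e2 e3 e4 e5 e7
  have e8 : c s t = s.1.2.2 t := congrArg (fun f : Lp (L2 (vol Ω)) 2 (tim T) => f t) (hc s)
  exact ae_quadratic j (H2.toL2 Ω) hj e1 e2 e3 e4 e5 e7 e8

namespace Problem

variable {P : Problem m}

/-- The wave residual with a source term `f`. -/
theorem exists_wave_residual (hP : P.Assumptions) :
    ∃ r : Hs m P.sl P.B → Lp (H2 P.Ω) 2 (tim P.T) → Lp (H2 P.Ω) 2 (tim P.T) →
        Lp (L2 (vol P.Ω)) 2 (tim P.T) → Lp (L2 (vol P.Ω)) 2 (tim P.T),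
      (∀ (X : Type) [NormedAddCommGroup X] [NormedSpace ℝ X] (l : X → Hs m P.sl P.B)
        (p p' : X → Lp (H2 P.Ω) 2 (tim P.T)) (f : X → Lp (L2 (vol P.Ω)) 2 (tim P.T)) (x : X),
        P.Nondegenerate (l x) → DifferentiableAt ℝ l x → DifferentiableAt ℝ p x →
        DifferentiableAt ℝ p' x → DifferentiableAt ℝ f x →
        DifferentiableAt ℝ (fun x => r (l x) (p x) (p' x) (f x)) x) ∧
      ∀ l p p' f, P.Nondegenerate l → ∀ᵐ t ∂tim P.T, ∀ᵐ x ∂vol P.Ω, r l p p' f t x =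
        P.invω0 l x * (f t x - P.c ^ 2 * P.lap l (p t) x - P.b * P.lap l (p' t) x) := by
  obtain ⟨S, K, h⟩ := exists_interior_operators hP
  refine ⟨fun l p p' f => timeResidual (P.c ^ 2) P.b (S l) (K l) p p' f, ?_, ?_⟩
  · intro X _ _ l p p' f x hl dl dp dp' df
    obtain ⟨dS, dK, -, -⟩ := h _ hl
    exact differentiableAt_timeResidual _ _ dS dK dl dp dp' df
  intro l p p' f hl
  obtain ⟨-, -, hS, hK⟩ := h l hl
  have e : ∀ w F A B : ℝ, w * F - P.c ^ 2 * (w * A) - P.b * (w * B) =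
    w * (F - P.c ^ 2 * A - P.b * B) := fun w F A B => by ring
  filter_upwards [ae_timeResidual (P.c ^ 2) P.b (S l) (K l) p p' f] with t ht
  rw [ht]
  exact (ae_sub_rep (ae_sub_rep (hS (f t)) (ae_smul_rep (P.c ^ 2) (hK (p t))))
    (ae_smul_rep P.b (hK (p' t)))).mono fun x hx => hx.trans (e _ _ _ _)

end Problem

section

/-! ### The source term of the second wave equation -/

variable {G : Type*} [NormedAddCommGroup G] [NormedSpace ℝ G]

theorem ae_source_slice {μ : Measure (E n)} (ι : V →L[ℝ] L2 μ) {F f p'' q'' r'' : L2 μ} {p q p' q' r r' : V} (c : ℝ)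
    (h : F =ᵐ[μ] fun x => ι r' x ^ 2 + ι r x * r'' x) (hr : r = p + q) (hr' : r' = p' + q')
    (hr'' : r'' = p'' + q'') (hf : f = q'' - c • F) :
    f =ᵐ[μ] fun x => q'' x - c * ((ι p' x + ι q' x) ^ 2 + (ι p x + ι q x) * (p'' x + q'' x)) := by
  subst hr hr' hr'' hf
  rw [map_add, map_add] at h
  filter_upwards [ae_sub_rep (EventuallyEq.refl _ q'') (ae_smul_rep c h),
    Lp.coeFn_add (ι p) (ι q), Lp.coeFn_add (ι p') (ι q'), Lp.coeFn_add p'' q''] with x k a1 a2 a3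
  rw [k, a1, a2, a3]
  rfl

theorem exists_source_of_quadratic {μ : Measure (E n)}
    (ι : V →L[ℝ] L2 μ) (a a' : W →L[ℝ] Lp V 2 (tim T)) (a'' : W →L[ℝ] Lp (L2 μ) 2 (tim T))
    (hF : ∃ F : W → Lp (L2 μ) 2 (tim T), Differentiable ℝ F ∧
      ∀ s, ∀ᵐ t ∂tim T, F s t =ᵐ[μ] fun x => ι (a' s t) x ^ 2 + ι (a s t) x * a'' s t x)
    (c : ℝ) (p q : X →L[ℝ] W) : ∃ f : X → Lp (L2 μ) 2 (tim T), Differentiable ℝ f ∧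
      ∀ s, ∀ᵐ t ∂tim T, f s t =ᵐ[μ] fun x => a'' (q s) t x
        - c * ((ι (a' (p s) t) x + ι (a' (q s) t) x) ^ 2
        + (ι (a (p s) t) x + ι (a (q s) t) x) * (a'' (p s) t x + a'' (q s) t x)) := by
  obtain ⟨F, dF, hF⟩ := hF
  refine ⟨fun s => a'' (q s) - c • F (p s + q s), ?_, fun s => ?_⟩
  · have h1 : Differentiable ℝ fun s => F (p s + q s) := dF.comp (p + q).differentiable
    exact (a''.comp q).differentiable.fun_sub (h1.fun_const_smul c)
  have h := hF (p s + q s)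
  rw [map_add, map_add, map_add] at h
  filter_upwards [h, ae_coeFn_add (a (p s)) (a (q s)), ae_coeFn_add (a' (p s)) (a' (q s)),
    ae_coeFn_add (a'' (p s)) (a'' (q s)), ae_coeFn_sub (a'' (q s)) (c • F (p s + q s)),
    ae_coeFn_smul c (F (p s + q s))] with t h1 e1 e2 e3 e4 e5
  exact ae_source_slice ι c h1 e1 e2 e3 (e4.trans (by rw [e5]))

theorem exists_source (hm : m + 1 ≤ 3) (h : HasC11Boundary Ω)
    (hΩ : IsOpen Ω) (hb : IsBounded Ω) (hT : 0 < T) (c : ℝ) (p q : X →L[ℝ] waveSpace Ω T) :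
    ∃ f : X → Lp (L2 (vol Ω)) 2 (tim T), Differentiable ℝ f ∧
      ∀ s, ∀ᵐ t ∂tim T, f s t =ᵐ[vol Ω] fun x => (q s).1.2.2 t x
        - c * ((H2.toL2 Ω ((p s).1.2.1 t) x + H2.toL2 Ω ((q s).1.2.1 t) x) ^ 2
        + (H2.toL2 Ω ((p s).1.1 t) x + H2.toL2 Ω ((q s).1.1 t) x) *
          ((p s).1.2.2 t x + (q s).1.2.2 t x)) :=
  exists_source_of_quadratic (H2.toL2 Ω) (coordOne (waveSpace Ω T)) (coordTwo (waveSpace Ω T))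
    (coordThree (waveSpace Ω T)) (exists_quadratic hm h hΩ hb hT) c p q

/-! ### The boundary residuals -/

theorem exists_boundary_residuals (hP : P.Assumptions) :
    ∃ (trp dn : H2 P.Ω →L[ℝ] L2s P.Ω P.Γpl) (trN : Fin (m + 1) → H2 P.Ω →L[ℝ] Hs m (1 / 2) P.B),
      (∀ u, ∃ v, HasTrace u v ∧ trp u =ᵐ[(surf P.Ω).restrict P.Γpl] v) ∧
      (∀ u, ∃ v, HasNormalDeriv u v ∧ dn u =ᵐ[(surf P.Ω).restrict P.Γpl] v) ∧
      ∀ u, ∃ τ, HasGradTrace u τ ∧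
        ∀ i, Hs.toL2 m (1 / 2) P.B (trN i u) =ᵐ[vol P.B] fun y => τ i (pt y (P.l0.fn y)) := by
  have hs := hP.lt_two_mul_sl
  obtain ⟨K, hK, h⟩ := Hs.exists_bddC2 m hs P.B
  obtain ⟨f, hf, hr⟩ := h P.l0
  have e : ∀ y ∈ P.B, P.l0.fn y = f y := fun y hy =>
    (Hs.fn_eventuallyEq hs hP.isOpen_B hf.contDiff.continuous hr hy).self_of_nhds
  have hg : graphOver P.B f ⊆ frontier P.Ω := by
    rintro _ ⟨y, hy, rfl⟩
    rw [hP.frontier_eq]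
    exact Or.inl (Or.inr ⟨y, hy, by simp only [e y hy]⟩)
  have hl : LipschitzWith (K * ‖P.l0‖).toNNReal f := LipschitzWith.of_dist_le_mul fun y z => by
      rw [Real.coe_toNNReal _ (by positivity), dist_eq, dist_eq_norm]
      exact hf.lip y z
  obtain ⟨trp, dn, trN, h1, h2, h3⟩ := exists_traces_H2 hP.c11 hP.isOpen_Ω hP.isBounded_Ω P.Γpl
    hP.isOpen_B.measurableSet hg hl
  refine ⟨trp, dn, trN, h1, h2, fun u => ?_⟩
  obtain ⟨τ, hτ, hi⟩ := h3 u
  refine ⟨τ, hτ, fun i => ?_⟩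
  filter_upwards [hi i, ae_restrict_mem hP.isOpen_B.measurableSet] with y a hy
  rw [a, e y hy]

/-- `∑ᵢ Cᵢ tᵢ p + Cₑ tₑ p - D g` in `L²` in time, with the operators acting on the values. -/
def timeBoundary {μ : Measure ℝ}
    (t : Fin (m + 1) → V →L[ℝ] W) (J : G →L[ℝ] W) (C : Fin m → W →L[ℝ] W) (Ce D : W →L[ℝ] W)
    (p : Lp V 2 μ) (g : Lp G 2 μ) : Lp W 2 μ :=
  ((∑ i, (C i).comp (t i.castSucc)) + Ce.comp (t (Fin.last m))).compLpL 2 μ p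
    - (D.comp J).compLpL 2 μ g

theorem ae_timeBoundary {μ : Measure ℝ} (t : Fin (m + 1) → V →L[ℝ] W) (J : G →L[ℝ] W) (C : Fin m → W →L[ℝ] W)
    (Ce D : W →L[ℝ] W) (p : Lp V 2 μ) (g : Lp G 2 μ) : ∀ᵐ s ∂μ, timeBoundary t J C Ce D p g s =
      (∑ i, C i (t i.castSucc (p s))) + Ce (t (Fin.last m) (p s)) - D (J (g s)) := by
  filter_upwards [ae_coeFn_sub (((∑ i, (C i).comp (t i.castSucc))
    + Ce.comp (t (Fin.last m))).compLpL 2 μ p) ((D.comp J).compLpL 2 μ g),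
    ae_compLpL ((∑ i, (C i).comp (t i.castSucc)) + Ce.comp (t (Fin.last m))) p,
    ae_compLpL (D.comp J) g] with s e1 e2 e3
  rw [timeBoundary, e1, e2, e3]
  simp only [add_apply, sum_apply, ContinuousLinearMap.coe_comp, Function.comp_apply]

theorem differentiableAt_timeBoundary {μ : Measure ℝ} (t : Fin (m + 1) → V →L[ℝ] W) (J : G →L[ℝ] W) {C : Fin m → Y → W →L[ℝ] W}
    {Ce D : Y → W →L[ℝ] W} {l : X → Y} {p : X → Lp V 2 μ} {g : X → Lp G 2 μ} {x : X}
    (hC : ∀ i, DifferentiableAt ℝ (C i) (l x)) (hCe : DifferentiableAt ℝ Ce (l x))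
    (hD : DifferentiableAt ℝ D (l x)) (hl : DifferentiableAt ℝ l x) (hp : DifferentiableAt ℝ p x)
    (hg : DifferentiableAt ℝ g x) :
    DifferentiableAt ℝ (fun x => timeBoundary t J (fun i => C i (l x)) (Ce (l x)) (D (l x))
      (p x) (g x)) x := by
  have h1 : DifferentiableAt ℝ (fun y => (∑ i, (C i y).comp (t i.castSucc))
      + (Ce y).comp (t (Fin.last m))) (l x) :=
    (DifferentiableAt.fun_sum fun i _ => (hC i).clm_comp (differentiableAt_const _)).fun_add
      (hCe.clm_comp (differentiableAt_const _))
  have h2 : DifferentiableAt ℝ (fun y => (D y).comp J) (l x) :=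
    hD.clm_comp (differentiableAt_const _)
  exact (differentiableAt_compLpL h1 hl hp).fun_sub (differentiableAt_compLpL h2 hl hg)

namespace Problem

variable {P : Problem m}

/-- The factor of `μ_N`. -/
theorem exists_neumann_residual (hP : P.Assumptions) (nc : NormalChoice)
    (trN : Fin (m + 1) → H2 P.Ω →L[ℝ] Hs m (1 / 2) P.B) :
    ∃ r : Hs m P.sl P.B → Lp (H2 P.Ω) 2 (tim P.T) → Lp (Hs m P.sg P.B) ∞ (tim P.T) →
        Lp (Hs m (1 / 2) P.B) 2 (tim P.T),
      (∀ (X : Type) [NormedAddCommGroup X] [NormedSpace ℝ X] (l : X → Hs m P.sl P.B)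
        (p : X → Lp (H2 P.Ω) 2 (tim P.T)) (g : X → Lp (Hs m P.sg P.B) ∞ (tim P.T)) (x : X),
        P.Nondegenerate (l x) → DifferentiableAt ℝ l x → DifferentiableAt ℝ p x →
        DifferentiableAt ℝ g x → DifferentiableAt ℝ (fun x => r (l x) (p x) (g x)) x) ∧
      ∀ l p g, P.Nondegenerate l → ∀ᵐ t ∂tim P.T, ∀ τ : Fin (m + 1) → E m → ℝ,
        (∀ i, Hs.toL2 m (1 / 2) P.B (trN i (p t)) =ᵐ[vol P.B] τ i) →
        Represents (r l p g t) fun y => P.ω1 l y *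
          ((∑ i, P.neumannNormal nc l y i * P.Mmul l y (fun j => τ j y) i)
            - Hs.toL2 m P.sg P.B (g t) y) := by
  obtain ⟨C, Ce, D, h⟩ := exists_neumann_operators hP nc
  obtain ⟨J, hJ⟩ := exists_Hs_inclusion m P.B (by norm_num : (0 : ℝ) ≤ 1 / 2) hP.sg_ge
  obtain ⟨I, hI⟩ := exists_top_to_two (Hs m P.sg P.B) (tim P.T)
  refine ⟨fun l p g => timeBoundary trN J (fun i => C i l) (Ce l) (D l) p (I g), ?_, ?_⟩
  · intro X _ _ l p g x hl dl dp dg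
    obtain ⟨d1, d2, d3, -⟩ := h _ hl
    have dI : DifferentiableAt ℝ (fun x => I (g x)) x := I.differentiableAt.comp x dg
    exact differentiableAt_timeBoundary trN J d1 d2 d3 dl dp dI
  · intro l p g hl
    obtain ⟨-, -, -, h4⟩ := h l hl
    filter_upwards [ae_timeBoundary trN J (fun i => C i l) (Ce l) (D l) p (I g), hI g]
      with t h1 h2 τ hτ
    rw [represents_iff, h1, h2]
    exact (h4 (fun i => trN i (p t)) τ (J (g t)) _ hτ (by rw [hJ])).symm

end Problem

end

/-! ### The functional -/

theorem integral_residual {α : Type*} [MeasurableSpace α] {μ : Measure α}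
    {f₁ f₂ f₃ f₄ f₅ f₆ f₇ : α → ℝ} (a b d : ℝ) (h₁ : Integrable f₁ μ) (h₂ : Integrable f₂ μ)
    (h₃ : Integrable f₃ μ) (h₄ : Integrable f₄ μ) (h₅ : Integrable f₅ μ) (h₆ : Integrable f₆ μ)
    (h₇ : Integrable f₇ μ) :
    ∫ t, (f₁ t + f₂ t + a * (b * f₃ t - f₄ t + d * f₅ t) + f₆ t + f₇ t) ∂μ =
      ∫ t, f₁ t ∂μ + ∫ t, f₂ t ∂μ + a * (b * ∫ t, f₃ t ∂μ - ∫ t, f₄ t ∂μ + d * ∫ t, f₅ t ∂μ)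
        + ∫ t, f₆ t ∂μ + ∫ t, f₇ t ∂μ := by
  have k₃ := h₃.const_mul b
  have k₅ := h₅.const_mul d
  have k : Integrable (fun t => b * f₃ t - f₄ t + d * f₅ t) μ := (k₃.sub h₄).add k₅
  have k' := k.const_mul a
  have l₁ : Integrable (fun t => f₁ t + f₂ t) μ := h₁.add h₂
  have l₂ : Integrable (fun t => f₁ t + f₂ t + a * (b * f₃ t - f₄ t + d * f₅ t)) μ := l₁.add k'
  have l₃ : Integrable (fun t => f₁ t + f₂ t + a * (b * f₃ t - f₄ t + d * f₅ t) + f₆ t) μ :=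
    l₂.add h₆
  have l₄ : Integrable (fun t => b * f₃ t - f₄ t) μ := k₃.sub h₄
  rw [integral_add l₃ h₇, integral_add l₂ h₆, integral_add l₁ k', integral_add h₁ h₂,
    integral_const_mul a, integral_add l₄ k₅, integral_sub k₃ h₄, integral_const_mul b,
    integral_const_mul d]

section Functional

variable {H S N : Type*} [NormedAddCommGroup H]
  [InnerProductSpace ℝ H] [NormedAddCommGroup S] [InnerProductSpace ℝ S] [NormedAddCommGroup N] [NormedSpace ℝ N] {μ : Measure ℝ}
  (π₁ π₂ : Z →L[ℝ] Lp H 2 μ) (π₃ : Z →L[ℝ] Lp V 2 μ) (π₄ : Z →L[ℝ] Lp (N →L[ℝ] ℝ) 2 μ)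
  (π₅ : Z →L[ℝ] Lp S 2 μ) (a b d : ℝ) (ι Λ : V →L[ℝ] S)

/-- The form `(w, v) ↦ ⟨Λ w, Λ v⟩`. -/
def energyForm : V →L[ℝ] V →L[ℝ] ℝ := (dualMap Λ).comp Λ

/-- The evaluation `(r, f) ↦ f r`. -/
def evalForm (N : Type*) [NormedAddCommGroup N] [NormedSpace ℝ N] : N →L[ℝ] (N →L[ℝ] ℝ) →L[ℝ] ℝ :=
  ContinuousLinearMap.apply ℝ ℝ

/-- `z ↦ ∫ ⟨r₁, z₁⟩ + ⟨r₂, z₂⟩ + a (b w'' z₃ - ⟨g, ι z₃⟩ + d ⟨Λ w, Λ z₃⟩) + z₄ r + ⟨s, z₅⟩ dt`,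
where `zᵢ = πᵢ z`. -/
def residualFunctional (r₁ r₂ : Lp H 2 μ) (g : Lp S 2 μ) (w : Lp V 2 μ)
    (w'' : Lp (V →L[ℝ] ℝ) 2 μ) (r : Lp N 2 μ) (s : Lp S 2 μ) : Z →L[ℝ] ℝ :=
  pairL (innerSL ℝ) π₁ r₁ + pairL (innerSL ℝ) π₂ r₂
    + a • (b • pairL (ContinuousLinearMap.id ℝ _) π₃ w'' - pairL (dualMap ι) π₃ g
      + d • pairL (energyForm Λ) π₃ w)
    + pairL (evalForm N) π₄ r + pairL (innerSL ℝ) π₅ s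

theorem residualFunctional_apply (r₁ r₂ : Lp H 2 μ) (g : Lp S 2 μ) (w : Lp V 2 μ)
    (w'' : Lp (V →L[ℝ] ℝ) 2 μ) (r : Lp N 2 μ) (s : Lp S 2 μ) (z : Z) :
    residualFunctional π₁ π₂ π₃ π₄ π₅ a b d ι Λ r₁ r₂ g w w'' r s z =
      ∫ t, (inner ℝ (r₁ t) (π₁ z t) + inner ℝ (r₂ t) (π₂ z t)
        + a * (b * w'' t (π₃ z t) - inner ℝ (g t) (ι (π₃ z t))
          + d * inner ℝ (Λ (w t)) (Λ (π₃ z t)))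
        + π₄ z t (r t) + inner ℝ (s t) (π₅ z t)) ∂μ := by
  have e := integral_residual a b d (integrable_pair (innerSL ℝ) r₁ (π₁ z))
    (integrable_pair (innerSL ℝ) r₂ (π₂ z))
    (integrable_pair (ContinuousLinearMap.id ℝ (V →L[ℝ] ℝ)) w'' (π₃ z))
    (integrable_pair (dualMap ι) g (π₃ z)) (integrable_pair (energyForm Λ) w (π₃ z))
    (integrable_pair (evalForm N) r (π₄ z)) (integrable_pair (innerSL ℝ) s (π₅ z))
  rw [← pairL_apply, ← pairL_apply, ← pairL_apply, ← pairL_apply, ← pairL_apply, ← pairL_apply,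
    ← pairL_apply] at e
  exact e.symm

theorem differentiableAt_residualFunctional
    {r₁ r₂ : X → Lp H 2 μ} {g : X → Lp S 2 μ} {w : X → Lp V 2 μ}
    {w'' : X → Lp (V →L[ℝ] ℝ) 2 μ} {r : X → Lp N 2 μ} {s : X → Lp S 2 μ} {x : X}
    (d₁ : DifferentiableAt ℝ r₁ x) (d₂ : DifferentiableAt ℝ r₂ x) (dg : DifferentiableAt ℝ g x)
    (dw : DifferentiableAt ℝ w x) (dw' : DifferentiableAt ℝ w'' x) (dr : DifferentiableAt ℝ r x)
    (ds : DifferentiableAt ℝ s x) :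
    DifferentiableAt ℝ (fun x => residualFunctional π₁ π₂ π₃ π₄ π₅ a b d ι Λ (r₁ x) (r₂ x) (g x)
      (w x) (w'' x) (r x) (s x)) x := by
  have e₁ := (pairL (innerSL ℝ) π₁).differentiableAt.comp x d₁
  have e₂ := (pairL (innerSL ℝ) π₂).differentiableAt.comp x d₂
  have e₃ := (pairL (ContinuousLinearMap.id ℝ _) π₃).differentiableAt.comp x dw'
  have e₄ := (pairL (dualMap ι) π₃).differentiableAt.comp x dg
  have e₅ := (pairL (energyForm Λ) π₃).differentiableAt.comp x dw
  have e₆ := (pairL (evalForm N) π₄).differentiableAt.comp x dr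
  have e₇ := (pairL (innerSL ℝ) π₅).differentiableAt.comp x ds
  exact (((e₁.add e₂).add ((((e₃.const_smul b).sub e₄).add (e₅.const_smul d)).const_smul a)).add
    e₆).add e₇

end Functional

/-! ### The operator -/

theorem integral_mul_add_mul {μ : Measure (E n)} (f g f' g' : L2 μ) :
    ∫ x, (f x * g x + f' x * g' x) ∂μ = inner ℝ f g + inner ℝ f' g' := by
  have h (f g : L2 μ) : Integrable (fun x => f x * g x) μ :=
    (Lp.memLp f).integrable_mul (q := 2) (Lp.memLp g)
  rw [integral_add (h f g) (h f' g'), L2.inner_def, L2.inner_def]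
  simp only [RCLike.inner_apply, conj_trivial, mul_comm]

theorem differentiableAt_add_smul {f : X → Y} {x : X} (hf : DifferentiableAt ℝ f x)
    (c : ℝ) (L : X →L[ℝ] Y) : DifferentiableAt ℝ (fun x => f x + c • L x) x :=
  hf.fun_add (L.differentiableAt.fun_const_smul c)

theorem ae_coeFn_add_smul {p : ℝ≥0∞}
    {μ : Measure ℝ} (f g : Lp X p μ) (c : ℝ) : ∀ᵐ t ∂μ, (f + c • g) t = f t + c • g t := by
  filter_upwards [ae_coeFn_add f (c • g), ae_coeFn_smul c g] with t h1 h2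
  rw [h1, h2]

theorem residualFunctional_apply_add {ν : Measure (E n)} {S N : Type*} [NormedAddCommGroup S] [InnerProductSpace ℝ S] [NormedAddCommGroup N] [NormedSpace ℝ N]
    {μ : Measure ℝ} (π₁ π₂ : Z →L[ℝ] Lp (L2 ν) 2 μ) (π₃ : Z →L[ℝ] Lp V 2 μ)
    (π₄ : Z →L[ℝ] Lp (N →L[ℝ] ℝ) 2 μ) (π₅ : Z →L[ℝ] Lp S 2 μ) (a b d κ ρ : ℝ) (ι Λ : V →L[ℝ] S)
    (r₁ r₂ : Lp (L2 ν) 2 μ) (h k e f : Lp S 2 μ) (w : Lp V 2 μ) (w'' : Lp (V →L[ℝ] ℝ) 2 μ)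
    (r : Lp N 2 μ) (z : Z) :
    residualFunctional π₁ π₂ π₃ π₄ π₅ a b d ι Λ r₁ r₂ (h + κ • k) w w'' r (e + ρ • f) z =
      ∫ t, ((∫ x, (r₁ t x * π₁ z t x + r₂ t x * π₂ z t x) ∂ν)
        + a * (b * w'' t (π₃ z t) - inner ℝ (h t + κ • k t) (ι (π₃ z t))
          + d * inner ℝ (Λ (w t)) (Λ (π₃ z t)))
        + π₄ z t (r t) + inner ℝ (e t + ρ • f t) (π₅ z t)) ∂μ := by
  rw [residualFunctional_apply]
  refine integral_congr_ae ?_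
  filter_upwards [ae_coeFn_add_smul h k κ, ae_coeFn_add_smul e f ρ] with t h1 h2
  rw [h1, h2, integral_mul_add_mul]

namespace Problem

variable (P : Problem m)

/-- The content of `IsAPDE`, with separate arguments for the components of control and state. -/
def IsResidualFunctional (nc : NormalChoice) (l : Hs m P.sl P.B)
    (gN : Lp (Hs m P.sg P.B) ∞ (tim P.T)) (h : Lp (L2s P.Ω P.Γpl) 2 (tim P.T))
    (p p' : Lp (H2 P.Ω) 2 (tim P.T)) (p'' : Lp (L2 (vol P.Ω)) 2 (tim P.T))
    (q q' : Lp (H2 P.Ω) 2 (tim P.T)) (q'' : Lp (L2 (vol P.Ω)) 2 (tim P.T))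
    (w : Lp (Hd P.Ω P.Γpl) 2 (tim P.T)) (w' w'' : Lp (HdDual P.Ω P.Γpl) 2 (tim P.T))
    (L : P.Z →L[ℝ] ℝ) : Prop :=
  ∃ (r₁ r₂ : Lp (L2 (vol P.Ω)) 2 (tim P.T)) (trp wt dn : Lp (L2s P.Ω P.Γpl) 2 (tim P.T))
    (rN : Lp (Hs m (1 / 2) P.B) 2 (tim P.T)), (∀ᵐ t ∂tim P.T, ∀ᵐ x ∂vol P.Ω, r₁ t x =
      P.invω0 l x * (p'' t x - P.c ^ 2 * P.lap l (p t) x - P.b * P.lap l (p' t) x)) ∧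
    (∀ᵐ t ∂tim P.T, ∀ᵐ x ∂vol P.Ω, r₂ t x =
      P.invω0 l x * (q'' t x - P.c ^ 2 * P.lap l (q t) x - P.b * P.lap l (q' t) x
        - 2 * P.k * (H2.toL2 P.Ω (p' t) x + H2.toL2 P.Ω (q' t) x) ^ 2
        - 2 * P.k * (H2.toL2 P.Ω (p t) x + H2.toL2 P.Ω (q t) x) * (p'' t x + q'' t x))) ∧
    (∀ᵐ t ∂tim P.T, ∃ v, HasTrace (p' t + q' t) v ∧ trp t =ᵐ[(surf P.Ω).restrict P.Γpl] v) ∧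
    (∀ᵐ t ∂tim P.T, w' t = L2s.toDual P.Ω P.Γpl (wt t)) ∧
    (∀ᵐ t ∂tim P.T, ∃ v, HasNormalDeriv (q t) v ∧ dn t =ᵐ[(surf P.Ω).restrict P.Γpl] v) ∧
    (∀ᵐ t ∂tim P.T, ∃ (τ : Fin (m + 1) → L2 (surf P.Ω)) (f : E m → ℝ),
      HasGradTrace (p t) τ ∧ Represents (gN t) f ∧ Represents (rN t) (fun y => P.ω1 l y *
        ((∑ i, P.neumannNormal nc l y i * P.Mmul l y (fun j => τ j (pt y (P.l0.fn y))) i)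
          - f y))) ∧ ∀ z : P.Z, L z = ∫ t in Ioo 0 P.T,
      ((∫ x in P.Ω, (r₁ t x * z.1 t x + r₂ t x * z.2.1 t x))
        + P.ρ / P.κ * (P.ρ * w'' t (z.2.2.1 t)
            - inner ℝ (h t + P.κ • trp t) (Hd.toL2 P.Ω P.Γpl (z.2.2.1 t))
            + P.δ * inner ℝ (lapBeltrami (w t).1) (lapBeltrami (z.2.2.1 t).1))
        + z.2.2.2.1 t (rN t)
        + inner ℝ (dn t + P.ρ • wt t) (z.2.2.2.2 t))

variable {P}

theorem exists_test_projections (P : Problem m) :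
    ∃ (π₁ π₂ : P.Z →L[ℝ] Lp (L2 (vol P.Ω)) 2 (tim P.T))
      (π₃ : P.Z →L[ℝ] Lp (Hd P.Ω P.Γpl) 2 (tim P.T))
      (π₄ : P.Z →L[ℝ] Lp (Hs m (1 / 2) P.B →L[ℝ] ℝ) 2 (tim P.T))
      (π₅ : P.Z →L[ℝ] Lp (L2s P.Ω P.Γpl) 2 (tim P.T)),
      (∀ z, π₁ z = z.1) ∧ (∀ z, π₂ z = z.2.1) ∧ (∀ z, π₃ z = z.2.2.1) ∧ (∀ z, π₄ z = z.2.2.2.1) ∧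
      ∀ z, π₅ z = z.2.2.2.2 := by
  let s₂ := snd ℝ (Lp (L2 (vol P.Ω)) 2 (tim P.T))
    (Lp (L2 (vol P.Ω)) 2 (tim P.T) × Lp (Hd P.Ω P.Γpl) 2 (tim P.T) ×
      Lp (Hs m (1 / 2) P.B →L[ℝ] ℝ) 2 (tim P.T) × Lp (L2s P.Ω P.Γpl) 2 (tim P.T))
  let s₃ := (snd ℝ _ _).comp s₂
  let s₄ := (snd ℝ _ _).comp s₃
  exact ⟨.fst ℝ _ _, (fst ℝ _ _).comp s₂, (fst ℝ _ _).comp s₃, (fst ℝ _ _).comp s₄,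
    (snd ℝ _ _).comp s₄, fun _ => rfl, fun _ => rfl, fun _ => rfl, fun _ => rfl, fun _ => rfl⟩

/-- The functional as a differentiable function of the factors. -/
theorem exists_functional (P : Problem m) :
    ∃ Φ : Lp (L2 (vol P.Ω)) 2 (tim P.T) → Lp (L2 (vol P.Ω)) 2 (tim P.T) →
        Lp (L2s P.Ω P.Γpl) 2 (tim P.T) → Lp (Hd P.Ω P.Γpl) 2 (tim P.T) →
        Lp (HdDual P.Ω P.Γpl) 2 (tim P.T) → Lp (Hs m (1 / 2) P.B) 2 (tim P.T) →
        Lp (L2s P.Ω P.Γpl) 2 (tim P.T) → P.Z →L[ℝ] ℝ,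
      (∀ (X : Type) [NormedAddCommGroup X] [NormedSpace ℝ X]
        (r₁ r₂ : X → Lp (L2 (vol P.Ω)) 2 (tim P.T)) (g : X → Lp (L2s P.Ω P.Γpl) 2 (tim P.T))
        (w : X → Lp (Hd P.Ω P.Γpl) 2 (tim P.T)) (w'' : X → Lp (HdDual P.Ω P.Γpl) 2 (tim P.T))
        (r : X → Lp (Hs m (1 / 2) P.B) 2 (tim P.T)) (s : X → Lp (L2s P.Ω P.Γpl) 2 (tim P.T))
        (x : X), DifferentiableAt ℝ r₁ x → DifferentiableAt ℝ r₂ x → DifferentiableAt ℝ g x →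
        DifferentiableAt ℝ w x → DifferentiableAt ℝ w'' x → DifferentiableAt ℝ r x →
        DifferentiableAt ℝ s x →
        DifferentiableAt ℝ (fun x => Φ (r₁ x) (r₂ x) (g x) (w x) (w'' x) (r x) (s x)) x) ∧
      ∀ r₁ r₂ h trp wt dn w w'' r z,
        Φ r₁ r₂ (h + P.κ • trp) w w'' r (dn + P.ρ • wt) z = ∫ t in Ioo 0 P.T,
          ((∫ x in P.Ω, (r₁ t x * z.1 t x + r₂ t x * z.2.1 t x))
          + P.ρ / P.κ * (P.ρ * w'' t (z.2.2.1 t)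
              - inner ℝ (h t + P.κ • trp t) (Hd.toL2 P.Ω P.Γpl (z.2.2.1 t))
              + P.δ * inner ℝ (lapBeltrami (w t).1) (lapBeltrami (z.2.2.1 t).1))
          + z.2.2.2.1 t (r t) + inner ℝ (dn t + P.ρ • wt t) (z.2.2.2.2 t)) := by
  obtain ⟨Λ, hΛ⟩ := exists_lapBeltrami P.Ω P.Γpl
  obtain ⟨π₁, π₂, π₃, π₄, π₅, e₁, e₂, e₃, e₄, e₅⟩ := exists_test_projections P
  refine ⟨fun r₁ r₂ g w w'' r s => residualFunctional π₁ π₂ π₃ π₄ π₅ (P.ρ / P.κ) P.ρ P.δ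
    (Hd.toL2 P.Ω P.Γpl) Λ r₁ r₂ g w w'' r s, ?_, ?_⟩
  · intro X _ _ r₁ r₂ g w w'' r s x d₁ d₂ dg dw dw' dr ds
    exact differentiableAt_residualFunctional _ _ _ _ _ _ _ _ _ _ d₁ d₂ dg dw dw' dr ds
  · intro r₁ r₂ h trp wt dn w w'' r z
    have h := residualFunctional_apply_add π₁ π₂ π₃ π₄ π₅ (P.ρ / P.κ) P.ρ P.δ P.κ P.ρ
      (Hd.toL2 P.Ω P.Γpl) Λ r₁ r₂ h trp dn wt w w'' r z
    simp only [hΛ, e₁, e₂, e₃, e₄, e₅] at h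
    exact h

theorem exists_velocity (hP : P.Assumptions) :
    ∃ D : plateSpace P.Ω P.Γpl P.T →L[ℝ] Lp (L2s P.Ω P.Γpl) 2 (tim P.T),
      ∀ q, ∀ᵐ t ∂tim P.T, q.1.2.1 t = L2s.toDual P.Ω P.Γpl (D q t) :=
  exists_intermediate hP.T_pos (Hd.toL2 P.Ω P.Γpl)

theorem source_identity (w a A B k f u v : ℝ) : w * (a - 2 * k * (f ^ 2 + u * v) - A - B) =
      w * (a - A - B - 2 * k * f ^ 2 - 2 * k * u * v) := by ring

end Problem

namespace Problem

variable {P : Problem m}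

/-- The traces and the plate velocity, as linear functions of the state. -/
theorem exists_boundary_fields (hP : P.Assumptions) {X : Type} [NormedAddCommGroup X]
    [NormedSpace ℝ X] (p' q q' : X →L[ℝ] Lp (H2 P.Ω) 2 (tim P.T)) :
    ∃ (trp dn : X →L[ℝ] Lp (L2s P.Ω P.Γpl) 2 (tim P.T))
      (trN : Fin (m + 1) → H2 P.Ω →L[ℝ] Hs m (1 / 2) P.B),
      (∀ s, ∀ᵐ t ∂tim P.T, ∃ v, HasTrace (p' s t + q' s t) v ∧
        trp s t =ᵐ[(surf P.Ω).restrict P.Γpl] v) ∧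
      (∀ s, ∀ᵐ t ∂tim P.T, ∃ v, HasNormalDeriv (q s t) v ∧ dn s t =ᵐ[(surf P.Ω).restrict P.Γpl] v) ∧
      ∀ u, ∃ τ, HasGradTrace u τ ∧
        ∀ i, Hs.toL2 m (1 / 2) P.B (trN i u) =ᵐ[vol P.B] fun y => τ i (pt y (P.l0.fn y)) := by
  obtain ⟨tr, dn, trN, h1, h2, h3⟩ := exists_boundary_residuals hP
  refine ⟨(tr.compLpL 2 (tim P.T)).comp (p' + q'), (dn.compLpL 2 (tim P.T)).comp q, trN,
    fun s => ?_, fun s => ?_, h3⟩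
  · filter_upwards [ae_compLpL tr (p' s + q' s), ae_coeFn_add (p' s) (q' s)] with t e1 e2
    rw [← e2]
    obtain ⟨v, hv, hv'⟩ := h1 ((p' s + q' s : Lp (H2 P.Ω) 2 (tim P.T)) t)
    exact ⟨v, hv, by rw [← e1] at hv'; exact hv'⟩
  · filter_upwards [ae_compLpL dn (q s)] with t e1
    obtain ⟨v, hv, hv'⟩ := h2 (q s t)
    exact ⟨v, hv, by rw [← e1] at hv'; exact hv'⟩

theorem exists_residualFunctional_of_source (hP : P.Assumptions) (nc : NormalChoice)
    {X : Type} [NormedAddCommGroup X] [NormedSpace ℝ X] {l : X → Hs m P.sl P.B}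
    {g : X → Lp (Hs m P.sg P.B) ∞ (tim P.T)} {h : X → Lp (L2s P.Ω P.Γpl) 2 (tim P.T)}
    (dl : Differentiable ℝ l) (dg : Differentiable ℝ g) (dh : Differentiable ℝ h)
    (p p' q q' : X →L[ℝ] Lp (H2 P.Ω) 2 (tim P.T)) (p'' : X →L[ℝ] Lp (L2 (vol P.Ω)) 2 (tim P.T))
    (q'' : X → Lp (L2 (vol P.Ω)) 2 (tim P.T))
    (w : X →L[ℝ] Lp (Hd P.Ω P.Γpl) 2 (tim P.T)) (w'' : X →L[ℝ] Lp (HdDual P.Ω P.Γpl) 2 (tim P.T))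
    (w' : X → Lp (HdDual P.Ω P.Γpl) 2 (tim P.T)) (v : X →L[ℝ] Lp (L2s P.Ω P.Γpl) 2 (tim P.T))
    (hv : ∀ s, ∀ᵐ t ∂tim P.T, w' s t = L2s.toDual P.Ω P.Γpl (v s t))
    (f : X → Lp (L2 (vol P.Ω)) 2 (tim P.T)) (df : Differentiable ℝ f)
    (hf : ∀ s, ∀ᵐ t ∂tim P.T, f s t =ᵐ[vol P.Ω] fun x => q'' s t x
        - 2 * P.k * ((H2.toL2 P.Ω (p' s t) x + H2.toL2 P.Ω (q' s t) x) ^ 2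
        + (H2.toL2 P.Ω (p s t) x + H2.toL2 P.Ω (q s t) x) * (p'' s t x + q'' s t x))) :
    ∃ A : X → (P.Z →L[ℝ] ℝ), ∀ s, P.Nondegenerate (l s) → DifferentiableAt ℝ A s ∧
      P.IsResidualFunctional nc (l s) (g s) (h s) (p s) (p' s) (p'' s) (q s) (q' s) (q'' s)
        (w s) (w' s) (w'' s) (A s) := by
  obtain ⟨r, dr, hr⟩ := exists_wave_residual hP
  obtain ⟨trp, dn, trN, htrp, hdn, htrN⟩ := exists_boundary_fields hP p' q q'
  obtain ⟨rN, drN, hrN⟩ := exists_neumann_residual hP nc trN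
  obtain ⟨Φ, dΦ, hΦ⟩ := exists_functional P
  refine ⟨fun s => Φ (r (l s) (p s) (p' s) (p'' s)) (r (l s) (q s) (q' s) (f s))
    (h s + P.κ • trp s) (w s) (w'' s) (rN (l s) (p s) (g s)) (dn s + P.ρ • v s),
    fun s hs => ⟨?_, ?_⟩⟩
  · have d1 := dr X l p p' p'' s hs (dl s) p.differentiableAt p'.differentiableAt
      p''.differentiableAt
    have d2 := dr X l q q' f s hs (dl s) q.differentiableAt q'.differentiableAt (df s)
    have d3 := drN X l p g s hs (dl s) p.differentiableAt (dg s)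
    exact dΦ X _ _ _ _ _ _ _ s d1 d2 (differentiableAt_add_smul (dh s) P.κ trp)
      w.differentiableAt w''.differentiableAt d3
      (differentiableAt_add_smul dn.differentiableAt P.ρ v)
  · refine ⟨r (l s) (p s) (p' s) (p'' s), r (l s) (q s) (q' s) (f s), trp s, v s, dn s,
      rN (l s) (p s) (g s), hr _ _ _ _ hs, ?_, htrp s, hv s, hdn s, ?_, hΦ _ _ _ _ _ _ _ _ _⟩
    · filter_upwards [hr (l s) (q s) (q' s) (f s) hs, hf s] with t h1 h2
      filter_upwards [h1, h2] with x k1 k2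
      rw [k1, k2]
      exact source_identity _ _ _ _ _ _ _ _
    · filter_upwards [hrN (l s) (p s) (g s) hs] with t ht
      obtain ⟨τ, hτ, e⟩ := htrN (p s t)
      exact ⟨τ, _, hτ, represents_iff.2 (EventuallyEq.refl _ _), ht _ e⟩

end Problem

namespace Problem

variable {P : Problem m}

set_option maxHeartbeats 2000000 in
theorem exists_residualFunctional (hP : P.Assumptions) (hm : m + 1 ≤ 3) (nc : NormalChoice)
    {X : Type} [NormedAddCommGroup X] [NormedSpace ℝ X] {l : X → Hs m P.sl P.B}
    {g : X → Lp (Hs m P.sg P.B) ∞ (tim P.T)} {h : X → Lp (L2s P.Ω P.Γpl) 2 (tim P.T)}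
    (dl : Differentiable ℝ l) (dg : Differentiable ℝ g) (dh : Differentiable ℝ h)
    (p q : X →L[ℝ] waveSpace P.Ω P.T) (w : X →L[ℝ] plateSpace P.Ω P.Γpl P.T) :
    ∃ A : X → (P.Z →L[ℝ] ℝ), ∀ s, P.Nondegenerate (l s) → DifferentiableAt ℝ A s ∧
      P.IsResidualFunctional nc (l s) (g s) (h s) (p s).1.1 (p s).1.2.1 (p s).1.2.2
        (q s).1.1 (q s).1.2.1 (q s).1.2.2 (w s).1.1 (w s).1.2.1 (w s).1.2.2 (A s) := by
  obtain ⟨f, df, hf⟩ := exists_source hm hP.c11 hP.isOpen_Ω hP.isBounded_Ω hP.T_pos (2 * P.k) p q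
  obtain ⟨v, hv⟩ := exists_velocity hP
  exact exists_residualFunctional_of_source hP nc dl dg dh
    ((coordOne _).comp p) ((coordTwo _).comp p) ((coordOne _).comp q) ((coordTwo _).comp q)
    ((coordThree _).comp p) (fun s => (q s).1.2.2) ((coordOne _).comp w) ((coordThree _).comp w)
    (fun s => (w s).1.2.1) (v.comp w) (fun s => hv (w s)) f df hf

theorem exists_residualFunctional_prod (hP : P.Assumptions) (hm : m + 1 ≤ 3) (nc : NormalChoice)
    {X Y₁ Y₂ Y₃ : Type} [NormedAddCommGroup X] [NormedSpace ℝ X] [NormedAddCommGroup Y₁]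
    [NormedSpace ℝ Y₁] [NormedAddCommGroup Y₂] [NormedSpace ℝ Y₂] [NormedAddCommGroup Y₃]
    [NormedSpace ℝ Y₃] {l : X → Hs m P.sl P.B} {g : X → Lp (Hs m P.sg P.B) ∞ (tim P.T)}
    {h : X → Lp (L2s P.Ω P.Γpl) 2 (tim P.T)} (dl : Differentiable ℝ l) (dg : Differentiable ℝ g)
    (dh : Differentiable ℝ h) (p : Y₁ →L[ℝ] waveSpace P.Ω P.T) (q : Y₂ →L[ℝ] waveSpace P.Ω P.T)
    (w : Y₃ →L[ℝ] plateSpace P.Ω P.Γpl P.T) :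
    ∃ A : X × Y₁ × Y₂ × Y₃ → (P.Z →L[ℝ] ℝ), ∀ x, P.Nondegenerate (l x.1) → DifferentiableAt ℝ A x ∧
      P.IsResidualFunctional nc (l x.1) (g x.1) (h x.1) (p x.2.1).1.1 (p x.2.1).1.2.1
        (p x.2.1).1.2.2 (q x.2.2.1).1.1 (q x.2.2.1).1.2.1 (q x.2.2.1).1.2.2
        (w x.2.2.2).1.1 (w x.2.2.2).1.2.1 (w x.2.2.2).1.2.2 (A x) := by
  let s₂ := snd ℝ X (Y₁ × Y₂ × Y₃)
  let s₃ := (snd ℝ Y₁ (Y₂ × Y₃)).comp s₂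
  exact exists_residualFunctional hP hm nc (dl.comp differentiable_fst)
    (dg.comp differentiable_fst) (dh.comp differentiable_fst)
    (p.comp ((fst ℝ Y₁ (Y₂ × Y₃)).comp s₂))
    (q.comp ((fst ℝ Y₂ Y₃).comp s₃))
    (w.comp ((snd ℝ Y₂ Y₃).comp s₃))

/-- The inclusion of the pressure space into the wave functions. -/
def pressureIncl (Ω Γa Γ : Set (E (m + 1))) (β γ : E (m + 1) → ℝ) (T : ℝ) :
    pressureSpace Ω Γa Γ β γ T →L[ℝ] waveSpace Ω T :=
  (pressureSpace Ω Γa Γ β γ T).subtypeL.codRestrict _ fun q => q.2.1.1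

theorem differentiable_const_add_subtype {G : Type*} [NormedAddCommGroup G] [NormedSpace ℝ G] (S : Submodule ℝ G) (b : G) (L : G →L[ℝ] Y) :
    Differentiable ℝ fun x : S => L (b + x) :=
  L.differentiable.comp (S.subtypeL.differentiable.const_add b)

/-- The Neumann control. -/
def neumannControl (P : Problem m) : P.G →L[ℝ] Lp (Hs m P.sg P.B) ∞ (tim P.T) := ((fst ℝ _ _).comp
    (weakTime (Hs m P.sg P.B) P.T ∞).subtypeL).comp (fst ℝ _ _)

/-- The plate control. -/
def plateControl (P : Problem m) : P.G →L[ℝ] Lp (L2s P.Ω P.Γpl) 2 (tim P.T) :=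
  ((fst ℝ _ _).comp (weakTime (L2s P.Ω P.Γpl) P.T 2).subtypeL).comp
    ((fst ℝ _ _).comp (snd ℝ _ _))

/-- The shape control. -/
def shapeControl (P : Problem m) : P.G →L[ℝ] Hs m P.sl P.B := (snd ℝ _ _).comp (snd ℝ _ _)

end Problem

namespace Problem
variable {P : Problem m}

theorem shapeControl_control (x : P.G0) : P.shapeControl (P.base + x) = (P.control x).2.2 := rfl

theorem neumannControl_control (x : P.G0) :
    P.neumannControl (P.base + x) = (P.control x).1.1.1 := rfl

theorem plateControl_control (x : P.G0) : P.plateControl (P.base + x) = (P.control x).2.1.1.1 := rfl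

theorem coe_pressureIncl {Ω Γa Γ : Set (E (m + 1))} {β γ : E (m + 1) → ℝ}
    (p : pressureSpace Ω Γa Γ β γ T) : (pressureIncl Ω Γa Γ β γ T p).1 = p.1 := rfl

theorem isAPDE_of_eq {nc : NormalChoice} {g : P.G} {u : P.U} {L : P.Z →L[ℝ] ℝ}
    {l : Hs m P.sl P.B} {gN : Lp (Hs m P.sg P.B) ∞ (tim P.T)}
    {h : Lp (L2s P.Ω P.Γpl) 2 (tim P.T)}
    {p q : Lp (H2 P.Ω) 2 (tim P.T) × Lp (H2 P.Ω) 2 (tim P.T) × Lp (L2 (vol P.Ω)) 2 (tim P.T)}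
    {w : Lp (Hd P.Ω P.Γpl) 2 (tim P.T) × Lp (HdDual P.Ω P.Γpl) 2 (tim P.T) ×
      Lp (HdDual P.Ω P.Γpl) 2 (tim P.T)} (el : l = g.2.2) (eg : gN = g.1.1.1)
    (eh : h = g.2.1.1.1) (ep : p = u.1.1) (eq : q = u.2.1.1) (ew : w = u.2.2.1)
    (H : P.IsResidualFunctional nc l gN h p.1 p.2.1 p.2.2 q.1 q.2.1 q.2.2 w.1 w.2.1 w.2.2 L) :
    P.IsAPDE nc g u L := by
  subst el eg eh ep eq ew
  exact H

set_option maxHeartbeats 1000000 in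
theorem exists_operator (hP : P.Assumptions) (hm : m + 1 ≤ 3) (nc : NormalChoice) :
    ∃ A : P.G0 × P.U → (P.Z →L[ℝ] ℝ), (∀ x : P.G0 × P.U, P.Nondegenerate (P.control x.1).2.2 →
        P.IsAPDE nc (P.control x.1) x.2 (A x)) ∧
      ∀ x : P.G0 × P.U, P.Nondegenerate (P.control x.1).2.2 → DifferentiableAt ℝ A x := by
  obtain ⟨A, hA⟩ := exists_residualFunctional_prod hP hm nc
    (differentiable_const_add_subtype P.G0 P.base P.shapeControl)
    (differentiable_const_add_subtype P.G0 P.base P.neumannControl)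
    (differentiable_const_add_subtype P.G0 P.base P.plateControl)
    (pressureIncl P.Ω P.Γa P.Γpl P.βa P.γa P.T) (pressureIncl P.Ω P.Γa P.ΓN P.βa P.γa P.T)
    (ContinuousLinearMap.id ℝ (plateSpace P.Ω P.Γpl P.T))
  refine ⟨A, fun x hx => ?_, fun x hx => ?_⟩
  · obtain ⟨-, h⟩ := hA x hx
    exact isAPDE_of_eq (shapeControl_control x.1) (neumannControl_control x.1)
      (plateControl_control x.1) (coe_pressureIncl x.2.1) (coe_pressureIncl x.2.2.1) rfl h
  · obtain ⟨h, -⟩ := hA x hx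
    exact h

end Problem

end AcousticStructure

end

open AcousticStructure in
theorem proposition4p2 (m : ℕ) (hm : m = 1 ∨ m = 2) (P : Problem m) (hP : P.Assumptions)
    (nc : Problem.NormalChoice) :
    ∃ A : P.G0 × P.U → (P.Z →L[ℝ] ℝ),
      (∀ x : P.G0 × P.U, P.Nondegenerate (P.control x.1).2.2 →
        P.IsAPDE nc (P.control x.1) x.2 (A x)) ∧
      (∀ x : P.G0 × P.U, P.Close (P.control x.1).2.2 →
        P.Nondegenerate (P.control x.1).2.2) ∧
      (∀ x : P.G0 × P.U, P.Nondegenerate (P.control x.1).2.2 → DifferentiableAt ℝ A x) := by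
  have h : m + 1 ≤ 3 := by omega
  exact (Problem.exists_operator hP h nc).imp fun A hA =>
    ⟨hA.1, fun x hx => hx.nondegenerate hP, hA.2⟩
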